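/- For $n\ge 2$ let $\mathfrak{sl}_n$ be the complex Lie algebra of traceless $n\times n$ matrices, $\mathfrak h^{(n)}$ its subalgebra of traceless diagonal matrices and $\mathfrak n_+^{(n)}$ its subalgebra of strictly upper triangular matrices. Let $\mathcal O^{(n)}$ be the BGG category of finitely generated, $\mathfrak h^{(n)}$-semisimple, $U(\mathfrak n^{(n)}_+)$-locally finite $\mathfrak{sl}_n$-modules, and let $\mathcal O_0^{(n)}$ be its principal block, i.e. the smallest direct summand of the category $\mathcal O^{(n)}$ that contains the trivial module. For $n\ge 3$ embed $\mathfrak{sl}_{n-1}\subset\mathfrak{sl}_n$ as the left upper corner, and let $\mathbb Z\mathbf Q^{(n-1)}\subset(\mathfrak h^{(n)})^*$ be the subgroup generated by the roots of $\mathfrak{sl}_n$ that belong to $\mathfrak{sl}_{n-1}$. The truncation functor $\mathbf F^n_{n-1}:\mathcal O_0^{(n)}\to\mathcal O_0^{(n-1)}$ sends $M$ to the $\mathfrak{sl}_{n-1}$-module $\bigoplus_{\lambda\in\mathbb Z\mathbf Q^{(n-1)}}M_\lambda$, where $M_\lambda$ is the weight space of weight $\lambda$, and acts on morphisms by restriction.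 Let $\mathcal C$ be the limit of $\mathcal O_0^{(2)}\leftarrow\mathcal O_0^{(3)}\leftarrow\mathcal O_0^{(4)}\leftarrow\cdots$ along these functors: its objects are the pairs $(\{C_i\}_{i\ge2},\{\phi_i\}_{i\ge3})$ with $C_i\in\mathcal O_0^{(i)}$ and isomorphisms $\phi_i:\mathbf F^i_{i-1}C_i\to C_{i-1}$, and a morphism from $(\{C_i\},\{\phi_i\})$ to $(\{C'_i\},\{\phi'_i\})$ is a family of morphisms $f_i:C_i\to C'_i$ such that $f_{i-1}\circ\phi_i=\phi'_i\circ\mathbf F^i_{i-1}(f_i)$ for all $i\ge3$. The restricted inverse limit $\mathcal C^{\mathrm{res}}$ is the full subcategory of $\mathcal C$ of all objects for which the sequence of lengths of the modules $C_i$ is eventually constant, with a finite value. Let $\mathfrak{sl}_\infty$ be the direct limit of $\mathfrak{sl}_2\subset\mathfrak{sl}_3\subset\cdots$ along the left upper corner embeddings, with the induced subalgebras $\mathfrak h^{(\infty)}$ of diagonal and $\mathfrak n_+^{(\infty)}$ of strictly upper triangular matrices. Let $\mathcal O^{(\infty,\mathrm{fl})}$ be the full subcategory of the category of $\mathfrak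 h^{(\infty)}$-weight $\mathfrak{sl}_\infty$-modules that consists of the modules having a finite composition series all of whose subquotients are simple highest weight modules, and let $\mathcal O^{(\infty,\mathrm{fl})}_0$ be the smallest direct summand of the category $\mathcal O^{(\infty,\mathrm{fl})}$ that contains the trivial module. Then the categories $\mathcal C^{\mathrm{res}}$ and $\mathcal O^{(\infty,\mathrm{fl})}_0$ are equivalent. -/

import Mathlib

open CategoryTheory CategoryTheory.Limits

attribute [local instance 100] LieRing.ofAssociativeRing

universe u v w

noncomputable section

namespace SlInfty

/-! ### Direct summands and blocks of a full subcategory -/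

section Blocks

variable {C : Type w} [Category.{v} C] [HasZeroMorphisms C] [HasBinaryBiproducts C]

/-- The full subcategory `P` is the direct sum `A ⊕ B` of two strictly full subcategories:
there are no nonzero morphisms between `A` and `B` in either direction, and every object of `P`
is a direct sum of an object of `A` and an object of `B`. -/
structure IsDirectSumDecomposition (P A B : ObjectProperty C) : Prop where
  left_le : A ≤ P
  right_le : B ≤ P
  left_iso : A.IsClosedUnderIsomorphisms
  right_iso : B.IsClosedUnderIsomorphisms
  hom_left_right : ∀ ⦃X Y : C⦄, A X → B Y → ∀ f : X ⟶ Y, f = 0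
  hom_right_left : ∀ ⦃X Y : C⦄, A X → B Y → ∀ f : Y ⟶ X, f = 0
  exists_iso : ∀ ⦃M : C⦄, P M → ∃ X Y : C, A X ∧ B Y ∧ Nonempty (M ≅ X ⊞ Y)

/-- The block of `P` containing the objects `T`: the smallest direct summand of the category `P`
which contains `T`, i.e. the intersection of all of them. -/
def blockContaining (P T : ObjectProperty C) : ObjectProperty C := fun M =>
  P M ∧ ∀ A B : ObjectProperty C, IsDirectSumDecomposition P A B → T ≤ A → A M

end Blocks

/-! ### Limits of inverse sequences of categories -/

section InverseLimit

variable {D : ℕ → Type w} [∀ k, Category.{v} (D k)]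

/-- Objects of the inverse limit of `D 0 ← D 1 ← D 2 ← ⋯`. -/
structure InverseLimit (F : ∀ k, D (k + 1) ⥤ D k) where
  obj : ∀ k, D k
  iso : ∀ k, (F k).obj (obj (k + 1)) ≅ obj k

/-- Morphisms of the inverse limit: families of morphisms compatible with the isomorphisms. -/
@[ext]
structure InverseLimit.Hom {F : ∀ k, D (k + 1) ⥤ D k} (X Y : InverseLimit F) where
  app : ∀ k, X.obj k ⟶ Y.obj k
  comm : ∀ k, (F k).map (app (k + 1)) ≫ (Y.iso k).hom = (X.iso k).hom ≫ app k

instance InverseLimit.category (F : ∀ k, D (k + 1) ⥤ D k) : Category (InverseLimit F) where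
  Hom X Y := InverseLimit.Hom X Y
  id X := ⟨fun k => 𝟙 (X.obj k), fun k => by simp⟩
  comp f g := ⟨fun k => f.app k ≫ g.app k, fun k => by
    rw [Functor.map_comp, Category.assoc, g.comm, ← Category.assoc, f.comm, Category.assoc]⟩
  id_comp f := by apply InverseLimit.Hom.ext; funext k; simp
  comp_id f := by apply InverseLimit.Hom.ext; funext k; simp
  assoc f g h := by apply InverseLimit.Hom.ext; funext k; simp

end InverseLimit

/-! ### Modules over a complex Lie algebra `L` with a "Cartan" subspace `H` and a
"positive" subspace `N`

Modules over `L` are the same as modules over its universal enveloping algebra. -/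

section Modules

/-- The universal enveloping algebra of a complex Lie algebra. -/
abbrev U (L : Type v) [LieRing L] [LieAlgebra ℂ L] := UniversalEnvelopingAlgebra ℂ L

/-- The category of all modules over a complex Lie algebra. -/
abbrev Rep (L : Type v) [LieRing L] [LieAlgebra ℂ L] := ModuleCat.{u} (U L)

open scoped ModuleCat

variable {L : Type v} [LieRing L] [LieAlgebra ℂ L]

/-- The canonical map from a Lie algebra to its enveloping algebra. -/
abbrev toU (x : L) : U L := UniversalEnvelopingAlgebra.ι ℂ x

/-- One-dimensional modules with zero action, i.e. modules isomorphic to the trivial module. -/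
def IsTrivialRep : ObjectProperty (Rep.{u} L) := fun M =>
  Module.finrank ℂ M = 1 ∧ ∀ (x : L) (v : M), toU x • v = 0

/-- The weight space `M_χ = {v | h v = χ(h) v for all h ∈ H}`. -/
def weightSpace (H : Submodule ℂ L) (M : Rep.{u} L) (χ : Module.Dual ℂ H) : Submodule ℂ M where
  carrier := {v | ∀ h : H, toU (h : L) • v = χ h • v}
  add_mem' {a b} ha hb h := by rw [smul_add, smul_add, ha h, hb h]
  zero_mem' h := by rw [smul_zero, smul_zero]
  smul_mem' c v hv h := by rw [smul_comm, hv h, smul_comm]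

/-- Weight modules (`H`-semisimple modules): `M` is the sum of its weight spaces (the sum is
automatically direct). -/
def IsWeightModule (H : Submodule ℂ L) (M : Rep.{u} L) : Prop :=
  ⨆ χ, weightSpace H M χ = ⊤

/-- `N` acts locally finitely: every vector lies in a finite-dimensional `N`-stable subspace. -/
def IsLocallyFinite (N : Submodule ℂ L) (M : Rep.{u} L) : Prop :=
  ∀ v : M, ∃ V : Submodule ℂ M, FiniteDimensional ℂ V ∧ v ∈ V ∧
    ∀ x ∈ N, ∀ w ∈ V, toU x • w ∈ V

/-- Simple highest weight modules: simple modules with a nonzero weight vector that is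
annihilated by `N`. -/
def IsSimpleHighestWeight (H N : Submodule ℂ L) (M : Rep.{u} L) : Prop :=
  IsSimpleModule (U L) M ∧ ∃ (χ : Module.Dual ℂ H) (v : M),
    v ≠ 0 ∧ v ∈ weightSpace H M χ ∧ ∀ x ∈ N, toU x • v = 0

/-- The category `𝒪`: finitely generated, `H`-semisimple, `N`-locally finite modules. -/
def categoryO (H N : Submodule ℂ L) : ObjectProperty (Rep.{u} L) := fun M =>
  Module.Finite (U L) M ∧ IsWeightModule H M ∧ IsLocallyFinite N M

/-- The category `𝒪^fl`: weight modules which have a finite composition series all of whose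
subquotients are simple highest weight modules. -/
def categoryOfl (H N : Submodule ℂ L) : ObjectProperty (Rep.{u} L) := fun M =>
  IsWeightModule H M ∧
    ∃ s : CompositionSeries (Submodule (U L) M), s.head = ⊥ ∧ s.last = ⊤ ∧
      ∀ i : Fin s.length, IsSimpleHighestWeight H N
        (ModuleCat.of (U L) (s i.succ ⧸ (s i.castSucc).submoduleOf (s i.succ)))

variable {L' : Type w} [LieRing L'] [LieAlgebra ℂ L']

/-- The map of enveloping algebras induced by a map of Lie algebras. -/
def mapU (f : L' →ₗ⁅ℂ⁆ L) : U L' →ₐ[ℂ] U L :=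
  UniversalEnvelopingAlgebra.lift ℂ ((UniversalEnvelopingAlgebra.ι ℂ).comp f)

lemma mapU_toU (f : L' →ₗ⁅ℂ⁆ L) (x : L') : mapU f (toU x) = toU (f x) :=
  UniversalEnvelopingAlgebra.lift_ι_apply ℂ _ x

/-- A subspace stable under a Lie algebra is stable under its enveloping algebra. -/
lemma mapU_smul_mem (f : L' →ₗ⁅ℂ⁆ L) {M : Rep.{u} L} (S : Submodule ℂ M)
    (hS : ∀ x : L', ∀ v ∈ S, toU (f x) • v ∈ S) (a : U L') {v : M} (hv : v ∈ S) :
    mapU f a • v ∈ S := by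
  let T : Subalgebra ℂ (U L') :=
    { carrier := {a | ∀ v ∈ S, mapU f a • v ∈ S}
      mul_mem' := fun {a b} ha hb v hv => by
        rw [map_mul, mul_smul]; exact ha _ (hb _ hv)
      add_mem' := fun {a b} ha hb v hv => by
        rw [map_add, add_smul]; exact S.add_mem (ha _ hv) (hb _ hv)
      algebraMap_mem' := fun c v hv => by
        rw [AlgHom.commutes, algebraMap_smul]; exact S.smul_mem c hv }
  let j : L' →ₗ⁅ℂ⁆ T :=
    { toFun := fun x => ⟨toU x, fun v hv => by rw [mapU_toU]; exact hS x v hv⟩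
      map_add' := fun x y => Subtype.ext (by simp [toU])
      map_smul' := fun c x => Subtype.ext (by simp [toU])
      map_lie' := fun {x y} => Subtype.ext (LieHom.map_lie (UniversalEnvelopingAlgebra.ι ℂ) x y) }
  have key : T.val.comp (UniversalEnvelopingAlgebra.lift ℂ j) = AlgHom.id ℂ (U L') := by
    apply UniversalEnvelopingAlgebra.hom_ext
    ext x
    exact congrArg Subtype.val (UniversalEnvelopingAlgebra.lift_ι_apply ℂ j x)
  have h2 : ((UniversalEnvelopingAlgebra.lift ℂ j a : T) : U L') = a := DFunLike.congr_fun key a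
  have h3 := (UniversalEnvelopingAlgebra.lift ℂ j a).2
  rw [h2] at h3
  exact h3 v hv

/-- A weight vector of weight `α` in `L` shifts weight spaces by `α`. -/
lemma toU_smul_mem_weightSpace (H : Submodule ℂ L) {M : Rep.{u} L} {x : L}
    {α χ : Module.Dual ℂ H} (hx : ∀ h : H, ⁅(h : L), x⁆ = α h • x) {v : M}
    (hv : v ∈ weightSpace H M χ) : toU x • v ∈ weightSpace H M (α + χ) := by
  intro h
  have h1 : toU (h : L) * toU x = toU x * toU (h : L) + α h • toU x := by
    have h2 := LieHom.map_lie (UniversalEnvelopingAlgebra.ι ℂ) (h : L) x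
    rw [hx h, map_smul, LieRing.of_associative_ring_bracket] at h2
    change _ = _ at h2
    rw [toU, h2]
    abel
  rw [← mul_smul, h1, add_smul, mul_smul, hv h, smul_comm, smul_assoc, LinearMap.add_apply,
    add_smul, add_comm]

end Modules

/-! ### The Lie algebras `sl_n` and the truncation functors -/

section Finite

open LieAlgebra.SpecialLinear
open scoped ModuleCat

/-- `sl_n` over the complex numbers. -/
abbrev slFin (n : ℕ) : LieSubalgebra ℂ (Matrix (Fin n) (Fin n) ℂ) := sl (Fin n) ℂ

/-- Traceless diagonal matrices. -/
def cartan (n : ℕ) : Submodule ℂ (slFin n) where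
  carrier := {x | ∀ i j, i ≠ j → x.1 i j = 0}
  add_mem' {a b} ha hb i j h := by simp [ha i j h, hb i j h]
  zero_mem' i j h := rfl
  smul_mem' c x hx i j h := by simp [hx i j h]

/-- Strictly upper triangular matrices. -/
def nilPlus (n : ℕ) : Submodule ℂ (slFin n) where
  carrier := {x | ∀ i j, j ≤ i → x.1 i j = 0}
  add_mem' {a b} ha hb i j h := by simp [ha i j h, hb i j h]
  zero_mem' i j h := rfl
  smul_mem' c x hx i j h := by simp [hx i j h]

/-- The Bernstein-Gelfand-Gelfand category `𝒪` for `sl_n`. -/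
def catO (n : ℕ) : ObjectProperty (Rep.{u} (slFin n)) := categoryO (cartan n) (nilPlus n)

/-- The principal block `𝒪_0^{(n)}`: the direct summand of `𝒪` containing the trivial module. -/
def catO₀ (n : ℕ) : ObjectProperty (Rep.{u} (slFin n)) := blockContaining (catO n) IsTrivialRep

/-- A matrix as the left upper corner of a matrix with one more row and column. -/
def corner {n : ℕ} (A : Matrix (Fin n) (Fin n) ℂ) : Matrix (Fin (n + 1)) (Fin (n + 1)) ℂ :=
  Matrix.reindex finSumFinEquiv finSumFinEquiv (Matrix.fromBlocks A 0 0 (0 : Matrix (Fin 1) (Fin 1) ℂ))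

lemma corner_castSucc {n : ℕ} (A : Matrix (Fin n) (Fin n) ℂ) (i j : Fin n) :
    corner A i.castSucc j.castSucc = A i j := by
  have h (k : Fin n) : k.castSucc = finSumFinEquiv (Sum.inl k : Fin n ⊕ Fin 1) := rfl
  simp [corner, h]

lemma corner_last_left {n : ℕ} (A : Matrix (Fin n) (Fin n) ℂ) (j : Fin (n + 1)) :
    corner A (Fin.last n) j = 0 := by
  have h : Fin.last n = finSumFinEquiv (Sum.inr 0 : Fin n ⊕ Fin 1) := rfl
  obtain ⟨j, rfl⟩ := (finSumFinEquiv (m := n) (n := 1)).surjective j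
  rcases j with j | j <;> simp [corner, h]

lemma corner_last_right {n : ℕ} (A : Matrix (Fin n) (Fin n) ℂ) (i : Fin (n + 1)) :
    corner A i (Fin.last n) = 0 := by
  have h : Fin.last n = finSumFinEquiv (Sum.inr 0 : Fin n ⊕ Fin 1) := rfl
  obtain ⟨i, rfl⟩ := (finSumFinEquiv (m := n) (n := 1)).surjective i
  rcases i with i | i <;> simp [corner, h]

lemma corner_mul {n : ℕ} (A B : Matrix (Fin n) (Fin n) ℂ) :
    corner (A * B) = corner A * corner B := by
  simp [corner, Matrix.submatrix_mul_equiv, Matrix.fromBlocks_multiply]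

lemma trace_corner {n : ℕ} (A : Matrix (Fin n) (Fin n) ℂ) :
    (corner A).trace = A.trace := by
  simp [Matrix.trace, Fin.sum_univ_castSucc, corner_castSucc, corner_last_left]

lemma corner_add {n : ℕ} (A B : Matrix (Fin n) (Fin n) ℂ) :
    corner (A + B) = corner A + corner B := by
  ext i j
  refine Fin.lastCases ?_ (fun i => ?_) i
  · simp [corner_last_left]
  · refine Fin.lastCases ?_ (fun j => ?_) j
    · simp [corner_last_right]
    · simp [corner_castSucc]

lemma corner_smul {n : ℕ} (c : ℂ) (A : Matrix (Fin n) (Fin n) ℂ) :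
    corner (c • A) = c • corner A := by
  ext i j
  refine Fin.lastCases ?_ (fun i => ?_) i
  · simp [corner_last_left]
  · refine Fin.lastCases ?_ (fun j => ?_) j
    · simp [corner_last_right]
    · simp [corner_castSucc]

lemma corner_sub {n : ℕ} (A B : Matrix (Fin n) (Fin n) ℂ) :
    corner (A - B) = corner A - corner B := by
  rw [eq_sub_iff_add_eq, ← corner_add, sub_add_cancel]

/-- The standard embedding of `sl_n` in `sl_{n+1}` as the left upper corner. -/
def slIncl (n : ℕ) : slFin n →ₗ⁅ℂ⁆ slFin (n + 1) where
  toFun x := ⟨corner x.1, by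
    have h : x.1.trace = 0 := x.2
    change (corner x.1).trace = 0
    rw [trace_corner, h]⟩
  map_add' x y := Subtype.ext (corner_add _ _)
  map_smul' c x := Subtype.ext (corner_smul _ _)
  map_lie' {x y} := Subtype.ext (by
    change corner (x.1 * y.1 - y.1 * x.1) = corner x.1 * corner y.1 - corner y.1 * corner x.1
    rw [corner_sub, corner_mul, corner_mul])

/-- The weight `ε_i`, which picks the `i`-th diagonal entry. The roots of `sl_n` are the
differences `ε_i - ε_j` with `i ≠ j`. -/
def eps {n : ℕ} (i : Fin n) : Module.Dual ℂ (cartan n) where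
  toFun h := h.1.1 i i
  map_add' _ _ := rfl
  map_smul' _ _ := rfl

/-- The subgroup of the weights of `sl_{n+1}` generated by the roots of the subalgebra `sl_n`. -/
def subRootLattice (n : ℕ) : AddSubgroup (Module.Dual ℂ (cartan (n + 1))) :=
  AddSubgroup.closure {α | ∃ i j : Fin n, i ≠ j ∧ α = eps i.castSucc - eps j.castSucc}

/-- The sum of the weight spaces of an `sl_{n+1}`-module for the weights in the root lattice of
`sl_n`. -/
def truncSpace (n : ℕ) (M : Rep.{u} (slFin (n + 1))) : Submodule ℂ M :=
  ⨆ χ ∈ subRootLattice n, weightSpace (cartan (n + 1)) M χ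

lemma weightSpace_le_truncSpace {n : ℕ} (M : Rep.{u} (slFin (n + 1)))
    {χ : Module.Dual ℂ (cartan (n + 1))} (hχ : χ ∈ subRootLattice n) :
    weightSpace (cartan (n + 1)) M χ ≤ truncSpace n M :=
  le_iSup₂_of_le χ hχ le_rfl

lemma lie_single {n : ℕ} {i j : Fin n} (hij : i ≠ j) (c : ℂ) (h : cartan n) :
    ⁅(h : slFin n), single i j hij c⁆ = (eps i - eps j) h • single i j hij c := by
  obtain ⟨h, hh⟩ := h
  have hd : h.1 = Matrix.diagonal fun k => h.1 k k := by
    ext a b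
    by_cases hab : a = b
    · subst hab; simp
    · rw [Matrix.diagonal_apply_ne _ hab]; exact hh a b hab
  apply Subtype.ext
  rw [sl_bracket, val_single]
  change h.1 * _ - _ * h.1 = (h.1 i i - h.1 j j) • Matrix.single i j c
  rw [hd]
  ext a b
  simp only [Matrix.sub_apply, Matrix.diagonal_mul, Matrix.mul_diagonal, Matrix.smul_apply,
    Matrix.single_apply, Matrix.diagonal_apply_eq, smul_eq_mul]
  split_ifs with hab
  · rw [← hab.1, ← hab.2]; ring
  · simp

lemma toU_smul_mem_truncSpace {n : ℕ} (M : Rep.{u} (slFin (n + 1))) (x : slFin n) (v : M)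
    (hv : v ∈ truncSpace n M) : toU (slIncl n x) • v ∈ truncSpace n M := by
  -- it suffices to treat weight vectors
  suffices h : ∀ χ ∈ subRootLattice n, ∀ w ∈ weightSpace (cartan (n + 1)) M χ,
      toU (slIncl n x) • w ∈ truncSpace n M by
    let E : M →ₗ[ℂ] M := Algebra.lsmul ℂ ℂ M (toU (slIncl n x))
    have : truncSpace n M ≤ (truncSpace n M).comap E :=
      iSup₂_le fun χ hχ w hw => h χ hχ w hw
    exact this hv
  intro χ hχ w hw
  let y (p : Fin n × Fin n) : slFin (n + 1) :=
    if h : p.1 = p.2 then 0 else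
      single p.1.castSucc p.2.castSucc (fun e => h (Fin.castSucc_injective n e)) (x.1 p.1 p.2)
  have hy (p : Fin n × Fin n) (a b : Fin n) : (y p).1 a.castSucc b.castSucc =
      if p = (a, b) ∧ a ≠ b then x.1 a b else 0 := by
    obtain ⟨i, j⟩ := p
    by_cases hij : i = j
    · subst hij
      have : ¬ ((i, i) = (a, b) ∧ a ≠ b) := by
        rintro ⟨h1, h2⟩
        obtain ⟨rfl, rfl⟩ := Prod.mk.inj h1
        exact h2 rfl
      rw [if_neg this]
      simp [y]
    · by_cases hab : i = a ∧ j = b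
      · obtain ⟨rfl, rfl⟩ := hab
        simp [y, hij]
      · have h2 : ¬ ((i, j) = (a, b) ∧ a ≠ b) := fun h => hab (Prod.mk.inj h.1)
        simp only [y, hij, dif_neg, not_false_eq_true, val_single, Matrix.single_apply, h2,
          if_false, Fin.castSucc_inj, hab]
  have hylast (p : Fin n × Fin n) (a b : Fin (n + 1)) (hab : a = Fin.last n ∨ b = Fin.last n) :
      (y p).1 a b = 0 := by
    obtain ⟨i, j⟩ := p
    by_cases hij : i = j
    · simp [y, hij]
    · simp only [y, hij, dif_neg, not_false_eq_true, val_single, Matrix.single_apply]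
      rw [if_neg]
      rintro ⟨rfl, rfl⟩
      rcases hab with h | h
      · exact (Fin.castSucc_lt_last i).ne h
      · exact (Fin.castSucc_lt_last j).ne h
  have hcoe (a b : Fin (n + 1)) : (∑ p, y p).1 a b = ∑ p, (y p).1 a b := by
    have h1 : (∑ p, y p).1 = ∑ p, (y p).1 :=
      map_sum (slFin (n + 1)).toSubmodule.subtype y Finset.univ
    rw [h1, Matrix.sum_apply]
  have hd : slIncl n x - ∑ p, y p ∈ cartan (n + 1) := by
    intro a b hab
    change corner x.1 a b - (∑ p, y p).1 a b = 0
    rw [hcoe]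
    induction a using Fin.lastCases with
    | last => simp [corner_last_left, hylast]
    | cast a =>
      induction b using Fin.lastCases with
      | last => simp [corner_last_right, hylast]
      | cast b =>
        have hab' : a ≠ b := fun h => hab (by rw [h])
        simp [corner_castSucc, hy, hab']
  have hx : slIncl n x = (slIncl n x - ∑ p, y p) + ∑ p, y p := by abel
  have hU : toU (slIncl n x) = toU (slIncl n x - ∑ p, y p) + ∑ p, toU (y p) := by
    conv_lhs => rw [hx]
    rw [toU, map_add, map_sum]
  rw [hU, add_smul, Finset.sum_smul]
  refine Submodule.add_mem _ ?_ (Submodule.sum_mem _ fun p _ => ?_)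
  · rw [hw ⟨_, hd⟩]
    exact Submodule.smul_mem _ _ (weightSpace_le_truncSpace M hχ hw)
  · by_cases hp : p.1 = p.2
    · simp [y, hp, toU]
    · simp only [y, hp, dif_neg, not_false_eq_true]
      refine weightSpace_le_truncSpace M ?_
        (toU_smul_mem_weightSpace _ (lie_single _ _) hw)
      exact AddSubgroup.add_mem _ (AddSubgroup.subset_closure ⟨p.1, p.2, hp, rfl⟩) hχ

/-- The `sl_n`-submodule of (the restriction of) an `sl_{n+1}`-module `M` given by the weights in
the root lattice of `sl_n`. -/
def truncSubmodule (n : ℕ) (M : Rep.{u} (slFin (n + 1))) :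
    Submodule (U (slFin n)) ((ModuleCat.restrictScalars (mapU (slIncl n)).toRingHom).obj M) where
  carrier := {v | (show M from v) ∈ truncSpace n M}
  add_mem' ha hb := (truncSpace n M).add_mem ha hb
  zero_mem' := (truncSpace n M).zero_mem
  smul_mem' a _ hv :=
    mapU_smul_mem (slIncl n) (truncSpace n M) (toU_smul_mem_truncSpace M) a hv

lemma map_mem_truncSpace (n : ℕ) {M M' : Rep.{u} (slFin (n + 1))} (f : M ⟶ M') (v : M)
    (hv : v ∈ truncSpace n M) : f.hom v ∈ truncSpace n M' := by
  let g : M →ₗ[ℂ] M' := f.hom.restrictScalars ℂ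
  have : truncSpace n M ≤ (truncSpace n M').comap g :=
    iSup₂_le fun χ hχ w hw => weightSpace_le_truncSpace M' hχ fun h => by
      change toU _ • f.hom w = _ • g w
      rw [← map_smul, hw h, ← map_smul]
      rfl
  exact this hv

/-- The truncation functor from `sl_{n+1}`-modules to `sl_n`-modules, sending `M` to the sum of
its weight spaces for the weights in the root lattice of `sl_n`; on morphisms it is restriction. -/
def trunc (n : ℕ) : Rep.{u} (slFin (n + 1)) ⥤ Rep.{u} (slFin n) where
  obj M := ModuleCat.of (U (slFin n)) (truncSubmodule n M)
  map f := ModuleCat.ofHom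
    (((ModuleCat.restrictScalars (mapU (slIncl n)).toRingHom).map f).hom.restrict
      (map_mem_truncSpace n f))
  map_id _ := rfl
  map_comp _ _ := rfl

/-- The limit of the categories of all modules over `sl_2, sl_3, …` along the truncation
functors; the index `k` stands for `sl_{k+2}`. -/
abbrev LimRep := InverseLimit (D := fun k => Rep.{u} (slFin (k + 2))) (fun k => trunc (k + 2))

/-- The limit `𝒞` of the principal blocks `𝒪_0^{(2)} ← 𝒪_0^{(3)} ← ⋯` along the truncation
functors (the principal blocks are strictly full subcategories, so the isomorphisms and morphisms
are the same as in the categories of all modules). -/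
def catC : ObjectProperty LimRep.{u} := fun X => ∀ k, catO₀ (k + 2) (X.obj k)

/-- The restricted limit `𝒞^res`: the objects of `𝒞` the lengths of whose components form an
eventually constant sequence of natural numbers. -/
def catCRes : ObjectProperty LimRep.{u} := fun X => catC X ∧
  ∃ l N : ℕ, ∀ k ≥ N, Module.length (U (slFin (k + 2))) (X.obj k) = l

end Finite

/-! ### The Lie algebra `sl_∞` -/

section Infinite

open LieAlgebra.SpecialLinear

/-- A matrix `A` of size `n` as the endomorphism of the space with basis `e_0, e_1, …` which maps
`e_j` to the sum of the `A i j • e_i` for `j < n` and to zero otherwise. This is the infinite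
matrix with left upper corner `A` and zeros elsewhere. -/
def extend (n : ℕ) (A : Matrix (Fin n) (Fin n) ℂ) : Module.End ℂ (ℕ →₀ ℂ) :=
  (∑ i : Fin n, (Finsupp.lsingle (i : ℕ)).comp (LinearMap.proj i)) ∘ₗ
    A.mulVecLin ∘ₗ LinearMap.pi fun i : Fin n => Finsupp.lapply (i : ℕ)

lemma extend_apply (n : ℕ) (A : Matrix (Fin n) (Fin n) ℂ) (v : ℕ →₀ ℂ) :
    extend n A v = ∑ i : Fin n, Finsupp.single (i : ℕ) (∑ j : Fin n, A i j * v j) := by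
  simp only [extend, LinearMap.comp_apply, LinearMap.sum_apply]
  rfl

lemma extend_apply_val (n : ℕ) (A : Matrix (Fin n) (Fin n) ℂ) (v : ℕ →₀ ℂ) (k : Fin n) :
    extend n A v k = ∑ j : Fin n, A k j * v j := by
  rw [extend_apply, Finsupp.finsetSum_apply, Finset.sum_eq_single k]
  · simp
  · intro b _ hb
    rw [Finsupp.single_eq_of_ne]
    exact fun h => hb (Fin.ext h.symm)
  · simp

lemma extend_mul (n : ℕ) (A B : Matrix (Fin n) (Fin n) ℂ) :
    extend n (A * B) = extend n A * extend n B := by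
  ext1 v
  ext1
  rw [Module.End.mul_eq_comp, LinearMap.comp_apply, LinearMap.comp_apply, LinearMap.comp_apply,
    extend_apply n (A * B), extend_apply n A]
  refine Finset.sum_congr rfl fun i _ => congrArg _ ?_
  simp_rw [extend_apply_val, Matrix.mul_apply, Finset.mul_sum, Finset.sum_mul, mul_assoc]
  exact Finset.sum_comm

lemma extend_add (n : ℕ) (A B : Matrix (Fin n) (Fin n) ℂ) :
    extend n (A + B) = extend n A + extend n B := by
  ext1 v
  ext1
  simp [extend_apply, add_mul, Finset.sum_add_distrib]

lemma extend_smul (n : ℕ) (c : ℂ) (A : Matrix (Fin n) (Fin n) ℂ) :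
    extend n (c • A) = c • extend n A := by
  ext1 v
  ext1
  simp [extend_apply, mul_assoc, Finset.mul_sum, Finset.smul_sum]

lemma extend_corner (n : ℕ) (A : Matrix (Fin n) (Fin n) ℂ) :
    extend (n + 1) (corner A) = extend n A := by
  ext1 v
  ext1
  simp [extend_apply, Fin.sum_univ_castSucc, corner_castSucc, corner_last_left, corner_last_right]

lemma exists_extend_of_le {n m : ℕ} (h : n ≤ m) (A : slFin n) :
    ∃ B : slFin m, extend m B.1 = extend n A.1 := by
  induction m, h using Nat.le_induction with
  | base => exact ⟨A, rfl⟩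
  | succ m _ ih =>
    obtain ⟨B, hB⟩ := ih
    exact ⟨slIncl m B, (extend_corner m B.1).trans hB⟩

lemma exists_extend_pair {f g : Module.End ℂ (ℕ →₀ ℂ)}
    (hf : ∃ n, ∃ A : slFin n, extend n A.1 = f) (hg : ∃ n, ∃ A : slFin n, extend n A.1 = g) :
    ∃ n, ∃ A B : slFin n, extend n A.1 = f ∧ extend n B.1 = g := by
  obtain ⟨n, A, rfl⟩ := hf
  obtain ⟨m, B, rfl⟩ := hg
  obtain ⟨A', hA⟩ := exists_extend_of_le (le_max_left n m) A
  obtain ⟨B', hB⟩ := exists_extend_of_le (le_max_right n m) B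
  exact ⟨max n m, A', B', hA, hB⟩

/-- `sl_∞`, the direct limit of `sl_2 ⊂ sl_3 ⊂ ⋯`, realized as the union of the images of the
`sl_n` in the Lie algebra of endomorphisms of the space with basis `e_0, e_1, …`. -/
def slInf : LieSubalgebra ℂ (Module.End ℂ (ℕ →₀ ℂ)) where
  carrier := {f | ∃ n, ∃ A : slFin n, extend n A.1 = f}
  add_mem' hf hg := by
    obtain ⟨n, A, B, rfl, rfl⟩ := exists_extend_pair hf hg
    exact ⟨n, A + B, extend_add n A.1 B.1⟩
  zero_mem' := ⟨0, 0, by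
    ext1 v
    ext1
    simp [extend_apply]⟩
  smul_mem' c f hf := by
    obtain ⟨n, A, rfl⟩ := hf
    exact ⟨n, c • A, extend_smul n c A.1⟩
  lie_mem' hf hg := by
    obtain ⟨n, A, B, rfl, rfl⟩ := exists_extend_pair hf hg
    refine ⟨n, ⁅A, B⁆, ?_⟩
    rw [sl_bracket, LieRing.of_associative_ring_bracket, ← extend_mul, ← extend_mul,
      eq_sub_iff_add_eq, ← extend_add, sub_add_cancel]

/-- The `(i, j)` entry of an element of `sl_∞`. -/
def entry (i j : ℕ) (x : slInf) : ℂ := x.1 (Finsupp.single j 1) i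

/-- Diagonal matrices in `sl_∞`. -/
def cartanInf : Submodule ℂ slInf where
  carrier := {x | ∀ i j, i ≠ j → entry i j x = 0}
  add_mem' {a b} ha hb i j h := by
    have h1 := ha i j h
    have h2 := hb i j h
    simp only [entry] at h1 h2 ⊢
    simp [h1, h2]
  zero_mem' i j h := rfl
  smul_mem' c x hx i j h := by
    have h1 := hx i j h
    simp only [entry] at h1 ⊢
    simp [h1]

/-- Strictly upper triangular matrices in `sl_∞`. -/
def nilPlusInf : Submodule ℂ slInf where
  carrier := {x | ∀ i j, j ≤ i → entry i j x = 0}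
  add_mem' {a b} ha hb i j h := by
    have h1 := ha i j h
    have h2 := hb i j h
    simp only [entry] at h1 h2 ⊢
    simp [h1, h2]
  zero_mem' i j h := rfl
  smul_mem' c x hx i j h := by
    have h1 := hx i j h
    simp only [entry] at h1 ⊢
    simp [h1]

/-- The category `𝒪^{(∞,fl)}`: weight modules over `sl_∞` with a finite composition series whose
subquotients are simple highest weight modules. -/
def catOInf : ObjectProperty (Rep.{u} slInf) := categoryOfl cartanInf nilPlusInf

/-- The category `𝒪^{(∞,fl)}_0`: the direct summand of `𝒪^{(∞,fl)}` containing the trivial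
module. -/
def catOInf₀ : ObjectProperty (Rep.{u} slInf) := blockContaining catOInf IsTrivialRep

end Infinite

end SlInfty

end

open CategoryTheory CategoryTheory.Limits

noncomputable section

namespace SlInfty

/-! ### Root data of `sl_n` and `sl_∞` -/

section RootData

open LieAlgebra.SpecialLinear

/-! An `sl_∞`-module is sent to the family of its truncations to `sl_2, sl_3, …`, where the
truncation to `sl_n` is the sum of the weight spaces for the weights in the root lattice of `sl_n`
(`truncationFunctor`). A module of the principal block is the union of its truncations, so
compatible morphisms between truncations glue and the functor is fully faithful
(`truncationsMap_injective`, `truncationsMap_surjective`). An object of the inverse limit is a tower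
of injections; its direct limit carries an action of `sl_∞` and has the given modules as truncations
(`limIso`), so the functor is essentially surjective. What remains is to show that block membership
and finite length pass from a module to its truncations and back (`catO₀_obj`, `length_obj`,
`catOInf₀_of_obj`).

This rests on an intrinsic description of the principal blocks, `blockContaining_iff`, proved at
once for `sl_n` and `sl_∞` in terms of `SlData`, `Levels` and `BlockData`: a module of the category
lies in the block iff every weight of a singular vector of a subquotient (`SlData.SW`) lies in the
dot orbit of zero, i.e. has coordinates `a i = i - σ i` for a permutation `σ` (`Linked`).

Every module in question has a finite filtration by highest weight subquotients (`HwFilt`), and its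
linked part splits off (`HwFilt.exists_split`). The tool is the family of Gelfand invariants, traces
of powers of the matrix of generators, whose eigenvalues determine the shifted coordinates of a
highest weight up to permutation. For `sl_∞` the invariants of the subalgebras `sl_m` replace a
center of the whole enveloping algebra: a central element of `U(sl_m)` acts by a scalar on the
weight vectors of a highest weight module as long as the highest weight and the weight both lie in
the root lattice of `sl_m` (`Level.center_smul_of_mem`), because only words in letters of `sl_m`
lead from one to the other.

Conversely, every direct summand containing the trivial module contains all highest weight modules
with linked weights (`IsHW.left_of_linked`): two weights of the orbit that differ by a simple
reflection are joined by an indecomposable extension of highest weight modules. It is generated by a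
product of powers of minors in the field of rational functions in the entries of a matrix with `k`
columns (`Emb.isLink_linkRep`). For `sl_∞` this module must also have finite length. Capelli
operators of size `k + 1` vanish on functions of `k` columns, which forces the singular weights to
vanish from index `2 * k` on (`eq_zero_of_capelli`); so there are finitely many, and their weight
spaces are finite-dimensional.

Truncation is controlled by the partial sums `hd n a` of coordinates: they are nonpositive for
linked weights and can only drop when positive roots are subtracted. A highest weight subquotient
whose highest weight `a` is supported below `n` is cut to a highest weight subquotient for `sl_n`,
simple ones to simple ones (`cut_sup_span`, `cut_covBy`). If `a` is not supported below `n`, some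
`hd j a` with `n ≤ j` is negative and the subquotient disappears (`cut_sup_span_of_hd`). For large
`n` nothing disappears, so lengths agree. -/

/-- The matrix units `E i j` and the weights `ε i` of a Lie algebra of traceless matrices whose
rows and columns are indexed by an initial segment `dom` of the natural numbers. -/
structure SlData (L : Type) [LieRing L] [LieAlgebra ℂ L] where
  dom : Set ℕ
  H : Submodule ℂ L
  N : Submodule ℂ L
  E : ℕ → ℕ → L
  ε : ℕ → Module.Dual ℂ H
  h : ℕ → ℕ → H
  dom_lt : ∀ {i j}, i ≤ j → j ∈ dom → i ∈ dom
  lie_H : ∀ a b : H, ⁅(a : L), (b : L)⁆ = 0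
  lie_H_E : ∀ (a : H) {i j}, i ∈ dom → j ∈ dom → i ≠ j → ⁅(a : L), E i j⁆ = (ε i a - ε j a) • E i j
  lie_E_swap : ∀ {i j}, i ∈ dom → j ∈ dom → i ≠ j → ⁅E i j, E j i⁆ = h i j
  ε_h : ∀ {i j k}, i ∈ dom → j ∈ dom → i ≠ j →
    ε k (h i j) = (if k = i then 1 else 0) - (if k = j then 1 else 0)
  N_eq : N = Submodule.span ℂ {x | ∃ i j, i ∈ dom ∧ j ∈ dom ∧ i < j ∧ x = E i j}
  span_eq : H ⊔ Submodule.span ℂ {x | ∃ i j, i ∈ dom ∧ j ∈ dom ∧ i ≠ j ∧ x = E i j} = ⊤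

/-- The operator which maps `e_j` to `e_i` and the other basis vectors to zero. -/
def unitOp (i j : ℕ) : Module.End ℂ (ℕ →₀ ℂ) := (Finsupp.lsingle i).comp (Finsupp.lapply j)

lemma unitOp_single (i j k : ℕ) :
    unitOp i j (Finsupp.single k 1) = if k = j then Finsupp.single i 1 else 0 := by
  simp only [unitOp, LinearMap.comp_apply, Finsupp.lapply_apply, Finsupp.lsingle_apply,
    Finsupp.single_apply]
  split_ifs <;> simp

lemma unitOp_mul (i j k l : ℕ) :
    unitOp i j * unitOp k l = if j = k then unitOp i l else 0 := by
  ext1 v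
  ext1
  by_cases h : j = k
  · subst h
    simp [unitOp]
  · simp [unitOp, h]

lemma lie_unitOp_swap (i j : ℕ) : ⁅unitOp i j, unitOp j i⁆ = unitOp i i - unitOp j j := by
  change unitOp i j * unitOp j i - unitOp j i * unitOp i j = _
  rw [unitOp_mul, unitOp_mul, if_pos rfl, if_pos rfl]

lemma extend_single (n : ℕ) (A : Matrix (Fin n) (Fin n) ℂ) (j : Fin n) :
    extend n A (Finsupp.single (j : ℕ) 1) = ∑ i : Fin n, Finsupp.single (i : ℕ) (A i j) := by
  rw [extend_apply]
  refine Finset.sum_congr rfl fun i _ => ?_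
  congr 1
  rw [Finset.sum_eq_single j]
  · simp
  · intro b _ hb
    rw [Finsupp.single_eq_of_ne, mul_zero]
    exact fun h => hb (Fin.ext h)
  · simp

lemma extend_single_of_le (n : ℕ) (A : Matrix (Fin n) (Fin n) ℂ) (j : ℕ) (hj : n ≤ j) :
    extend n A (Finsupp.single j 1) = 0 := by
  rw [extend_apply]
  refine Finset.sum_eq_zero fun i _ => ?_
  rw [Finset.sum_eq_zero, Finsupp.single_zero]
  intro k _
  rw [Finsupp.single_eq_of_ne, mul_zero]
  have := k.2
  omega

lemma extend_entry (n : ℕ) (A : Matrix (Fin n) (Fin n) ℂ) (i j : Fin n) :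
    extend n A (Finsupp.single (j : ℕ) 1) (i : ℕ) = A i j := by
  rw [extend_apply_val, Finset.sum_eq_single j]
  · simp
  · intro b _ hb
    rw [Finsupp.single_eq_of_ne, mul_zero]
    exact fun h => hb (Fin.ext h)
  · simp

lemma extend_entry_of_le (n : ℕ) (A : Matrix (Fin n) (Fin n) ℂ) (i j : ℕ) (hi : n ≤ i) :
    extend n A (Finsupp.single j 1) i = 0 := by
  rw [extend_apply, Finsupp.finsetSum_apply]
  refine Finset.sum_eq_zero fun k _ => ?_
  rw [Finsupp.single_eq_of_ne]
  have := k.2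
  omega

lemma extend_injective (n : ℕ) : Function.Injective (extend n) := by
  intro A B h
  ext i j
  rw [← extend_entry n A, h, extend_entry]

/-- The embedding of `sl_n` in `sl_∞` as the left upper corner. -/
def inclInf (n : ℕ) : slFin n →ₗ⁅ℂ⁆ slInf where
  toFun A := ⟨extend n A.1, n, A, rfl⟩
  map_add' A B := Subtype.ext (extend_add n _ _)
  map_smul' c A := Subtype.ext (extend_smul n _ _)
  map_lie' {A B} := Subtype.ext (by
    change extend n (A.1 * B.1 - B.1 * A.1) = extend n A.1 * extend n B.1 - extend n B.1 * extend n A.1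
    rw [← extend_mul, ← extend_mul]
    refine eq_sub_of_add_eq (G := Module.End ℂ (ℕ →₀ ℂ)) ?_
    rw [← extend_add, sub_add_cancel])

lemma inclInf_injective (n : ℕ) : Function.Injective (inclInf n) := fun _ _ h =>
  Subtype.ext (extend_injective n (congrArg Subtype.val h))

lemma inclInf_slIncl (n : ℕ) (x : slFin n) : inclInf (n + 1) (slIncl n x) = inclInf n x :=
  Subtype.ext (extend_corner n x.1)

/-- The matrix units of `sl_n`, indexed by natural numbers; zero outside of the range. -/
def finE (n i j : ℕ) : slFin n :=
  if h : i < n ∧ j < n ∧ i ≠ j then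
    single (⟨i, h.1⟩ : Fin n) ⟨j, h.2.1⟩ (fun e => h.2.2 (Fin.mk.inj_iff.mp e)) 1 else 0

lemma finE_coe {n : ℕ} {i j : ℕ} (hi : i < n) (hj : j < n) (hij : i ≠ j) :
    (finE n i j).1 = Matrix.single (⟨i, hi⟩ : Fin n) ⟨j, hj⟩ 1 := by
  rw [finE, dif_pos ⟨hi, hj, hij⟩, val_single]

lemma extend_single_matrix {n : ℕ} (i j : Fin n) :
    extend n (Matrix.single i j 1) = unitOp i j := by
  refine Finsupp.lhom_ext' fun k => LinearMap.ext_ring ?_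
  change extend n (Matrix.single i j 1) (Finsupp.single k 1) = unitOp i j (Finsupp.single k 1)
  rw [unitOp_single]
  by_cases hk : k < n
  · rw [extend_single n _ ⟨k, hk⟩, Finset.sum_eq_single i]
    · split_ifs with h
      · simp [h]
      · rw [Matrix.single_apply_of_col_ne, Finsupp.single_zero]
        exact fun e => h (congrArg Fin.val e).symm
    · intro b _ hb
      rw [Matrix.single_apply_of_row_ne (Ne.symm hb), Finsupp.single_zero]
    · simp
  · rw [extend_single_of_le _ _ _ (by omega), if_neg]
    have := j.2
    omega

lemma inclInf_finE {n : ℕ} {i j : ℕ} (hi : i < n) (hj : j < n) (hij : i ≠ j) :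
    (inclInf n (finE n i j)).1 = unitOp i j := by
  change extend n (finE n i j).1 = _
  rw [finE_coe hi hj hij, extend_single_matrix]

/-- The matrix units of `sl_∞`. -/
def infE (i j : ℕ) : slInf := inclInf (max i j + 1) (finE (max i j + 1) i j)

lemma infE_coe {i j : ℕ} (hij : i ≠ j) : (infE i j).1 = unitOp i j :=
  inclInf_finE (by omega) (by omega) hij

lemma inclInf_finE_eq {n : ℕ} {i j : ℕ} (hi : i < n) (hj : j < n) (hij : i ≠ j) :
    inclInf n (finE n i j) = infE i j :=
  Subtype.ext (by rw [inclInf_finE hi hj hij, infE_coe hij])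

/-- The coroot `E i i - E j j` of `sl_n`. -/
def finH (n i j : ℕ) : slFin n := ⁅finE n i j, finE n j i⁆

lemma inclInf_finH {n : ℕ} {i j : ℕ} (hi : i < n) (hj : j < n) (hij : i ≠ j) :
    (inclInf n (finH n i j)).1 = unitOp i i - unitOp j j := by
  rw [finH, LieHom.map_lie]
  change ⁅(inclInf n (finE n i j)).1, (inclInf n (finE n j i)).1⁆ = _
  rw [inclInf_finE hi hj hij, inclInf_finE hj hi hij.symm, lie_unitOp_swap]

lemma inclInf_entry (n : ℕ) (x : slFin n) (i j : Fin n) :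
    entry i j (inclInf n x) = x.1 i j := extend_entry n x.1 i j

lemma finH_mem (n i j : ℕ) : finH n i j ∈ cartan n := by
  intro a b hab
  by_cases h : i < n ∧ j < n ∧ i ≠ j
  · rw [← inclInf_entry, entry, inclInf_finH h.1 h.2.1 h.2.2, LinearMap.sub_apply, unitOp_single,
      unitOp_single]
    have hab' : (a : ℕ) ≠ b := fun e => hab (Fin.ext e)
    split_ifs <;> simp_all
  · rw [finH, finE, dif_neg h, zero_lie]; rfl

/-- An operator whose matrix is diagonal. -/
lemma apply_eq_of_diag {T : Module.End ℂ (ℕ →₀ ℂ)}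
    (hT : ∀ i j, i ≠ j → T (Finsupp.single j 1) i = 0) (j : ℕ) :
    T (Finsupp.single j 1) = Finsupp.single j (T (Finsupp.single j 1) j) := by
  ext i
  by_cases h : j = i
  · subst h; simp
  · rw [Finsupp.single_eq_of_ne (Ne.symm h), hT i j (Ne.symm h)]

lemma lie_diag_unitOp {T : Module.End ℂ (ℕ →₀ ℂ)}
    (hT : ∀ i j, i ≠ j → T (Finsupp.single j 1) i = 0) (i j : ℕ) :
    ⁅T, unitOp i j⁆ =
      (T (Finsupp.single i 1) i - T (Finsupp.single j 1) j) • unitOp i j := by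
  refine Finsupp.lhom_ext' fun k => LinearMap.ext_ring ?_
  change T (unitOp i j (Finsupp.single k 1)) - unitOp i j (T (Finsupp.single k 1)) =
    (T (Finsupp.single i 1) i - T (Finsupp.single j 1) j) • unitOp i j (Finsupp.single k 1)
  rw [apply_eq_of_diag hT k, ← mul_one (T (Finsupp.single k 1) k), ← smul_eq_mul,
    ← Finsupp.smul_single, map_smul, unitOp_single]
  split_ifs with h
  · subst h
    rw [apply_eq_of_diag hT i, Finsupp.single_eq_same, Finsupp.smul_single, Finsupp.smul_single,
      ← Finsupp.single_sub, smul_eq_mul, smul_eq_mul, mul_one, mul_one]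
  · simp

lemma lie_diag {T S : Module.End ℂ (ℕ →₀ ℂ)}
    (hT : ∀ i j, i ≠ j → T (Finsupp.single j 1) i = 0)
    (hS : ∀ i j, i ≠ j → S (Finsupp.single j 1) i = 0) : ⁅T, S⁆ = 0 := by
  refine Finsupp.lhom_ext' fun k => LinearMap.ext_ring ?_
  change T (S (Finsupp.single k 1)) - S (T (Finsupp.single k 1)) = 0
  rw [apply_eq_of_diag hT k, apply_eq_of_diag hS k, ← mul_one (T (Finsupp.single k 1) k),
    ← mul_one (S (Finsupp.single k 1) k), ← smul_eq_mul, ← smul_eq_mul, ← Finsupp.smul_single,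
    ← Finsupp.smul_single, map_smul, map_smul, apply_eq_of_diag hT k, apply_eq_of_diag hS k]
  simp [mul_comm]

lemma inclInf_diag {n : ℕ} {x : slFin n} (hx : x ∈ cartan n) (i j : ℕ) (hij : i ≠ j) :
    (inclInf n x).1 (Finsupp.single j 1) i = 0 := by
  by_cases hi : i < n
  · by_cases hj : j < n
    · exact (extend_entry n x.1 ⟨i, hi⟩ ⟨j, hj⟩).trans (hx _ _ fun e => hij (Fin.mk.inj_iff.mp e))
    · change extend n x.1 (Finsupp.single j 1) i = 0
      rw [extend_single_of_le n x.1 j (by omega)]; rfl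
  · exact extend_entry_of_le n x.1 i j (by omega)

/-- The weight `ε i` of `sl_n`, which is zero outside of the range. -/
def finEps (n i : ℕ) : Module.Dual ℂ (cartan n) := if h : i < n then eps ⟨i, h⟩ else 0

lemma finEps_apply (n i : ℕ) (x : cartan n) :
    finEps n i x = entry i i (inclInf n (x : slFin n)) := by
  by_cases hi : i < n
  · rw [finEps, dif_pos hi]
    exact (inclInf_entry n x ⟨i, hi⟩ ⟨i, hi⟩).symm
  · rw [finEps, dif_neg hi]
    exact (extend_entry_of_le n _ i i (by omega)).symm

/-- The weight `ε i` of `sl_∞`. -/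
def infEps (i : ℕ) : Module.Dual ℂ cartanInf where
  toFun x := entry i i (x : slInf)
  map_add' x y := by simp [entry]
  map_smul' c x := by simp [entry]

lemma inclInf_mem_cartanInf {n : ℕ} {x : slFin n} (hx : x ∈ cartan n) :
    inclInf n x ∈ cartanInf := fun i j hij => inclInf_diag hx i j hij

lemma sl_span (n : ℕ) (x : slFin n) : x ∈ cartan n ⊔
    Submodule.span ℂ {x | ∃ i j, i ∈ Set.Iio n ∧ j ∈ Set.Iio n ∧ i ≠ j ∧ x = finE n i j} := by
  -- Since `finE` is zero for equal indices, this sum over all pairs is the off-diagonal part of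
  -- `x`.
  let y : slFin n := ∑ p : Fin n × Fin n, x.1 p.1 p.2 • finE n p.1 p.2
  have hco (z : Fin n × Fin n → slFin n) (a b : Fin n) : (∑ p, z p).1 a b = ∑ p, (z p).1 a b := by
    have h1 : (∑ p, z p).1 = ∑ p, (z p).1 := map_sum (slFin n).toSubmodule.subtype z Finset.univ
    rw [h1, Matrix.sum_apply]
  have hy : x - y ∈ cartan n := by
    intro a b hab
    change x.1 a b - y.1 a b = 0
    rw [hco, Finset.sum_eq_single (a, b)]
    · change x.1 a b - x.1 a b * (finE n a b).1 a b = 0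
      rw [finE_coe a.2 b.2 fun e => hab (Fin.ext e)]
      simp
    · rintro ⟨i, j⟩ _ hne
      change x.1 i j * (finE n i j).1 a b = 0
      by_cases hij : i = j
      · subst hij
        simp [finE]
      · rw [finE_coe i.2 j.2 fun e => hij (Fin.ext e)]
        have : ¬ (i = a ∧ j = b) := fun h => hne (by rw [h.1, h.2])
        simp [this]
    · simp
  rw [← sub_add_cancel x y]
  refine Submodule.add_mem_sup hy (Submodule.sum_mem _ fun p _ => ?_)
  by_cases hp : (p.1 : ℕ) = p.2
  · have : finE n p.1 p.2 = 0 := by rw [finE, dif_neg]; exact fun h => h.2.2 hp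
    rw [this, smul_zero]; exact Submodule.zero_mem _
  · exact Submodule.smul_mem _ _ (Submodule.subset_span ⟨_, _, p.1.2, p.2.2, hp, rfl⟩)

lemma nilPlus_eq (n : ℕ) : nilPlus n = Submodule.span ℂ
    {x | ∃ i j, i ∈ Set.Iio n ∧ j ∈ Set.Iio n ∧ i < j ∧ x = finE n i j} := by
  apply le_antisymm
  · intro x hx
    have hco (z : Fin n × Fin n → slFin n) (a b : Fin n) :
        (∑ p, z p).1 a b = ∑ p, (z p).1 a b := by
      have h1 : (∑ p, z p).1 = ∑ p, (z p).1 := map_sum (slFin n).toSubmodule.subtype z Finset.univ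
      rw [h1, Matrix.sum_apply]
    have h : x = ∑ p : Fin n × Fin n, x.1 p.1 p.2 • finE n p.1 p.2 := by
      apply Subtype.ext
      ext a b
      rw [hco, Finset.sum_eq_single (a, b)]
      · change x.1 a b = x.1 a b * (finE n a b).1 a b
        by_cases hab : (a : ℕ) = b
        · rw [hx a b (Fin.ext hab).ge, zero_mul]
        · rw [finE_coe a.2 b.2 hab]; simp
      · rintro ⟨i, j⟩ _ hne
        change x.1 i j * (finE n i j).1 a b = 0
        by_cases hij : i = j
        · subst hij
          simp [finE]
        · rw [finE_coe i.2 j.2 fun e => hij (Fin.ext e)]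
          have : ¬ (i = a ∧ j = b) := fun h => hne (by rw [h.1, h.2])
          simp [this]
      · simp
    rw [h]
    refine Submodule.sum_mem _ fun p _ => ?_
    by_cases hp : p.1 < p.2
    · exact Submodule.smul_mem _ _ (Submodule.subset_span ⟨_, _, p.1.2, p.2.2, hp, rfl⟩)
    · rw [hx _ _ (not_lt.mp hp), zero_smul]; exact Submodule.zero_mem _
  · refine Submodule.span_le.mpr ?_
    rintro _ ⟨i, j, hi, hj, hij, rfl⟩ a b hab
    rw [finE_coe hi hj hij.ne, Matrix.single_apply, if_neg]
    rintro ⟨rfl, rfl⟩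
    exact absurd (Fin.mk_le_mk.mp hab) (by omega)

lemma inclInf_lift {n : ℕ} {x y : slFin n} (h : (inclInf n x).1 = (inclInf n y).1) : x = y :=
  inclInf_injective n (Subtype.ext h)

/-- The root data of `sl_n`. -/
def slFinData (n : ℕ) : SlData (slFin n) where
  dom := Set.Iio n
  H := cartan n
  N := nilPlus n
  E := finE n
  ε := finEps n
  h i j := ⟨finH n i j, finH_mem n i j⟩
  dom_lt h hj := lt_of_le_of_lt h hj
  lie_H a b := by
    apply inclInf_lift
    rw [LieHom.map_lie, map_zero]
    exact lie_diag (inclInf_diag a.2) (inclInf_diag b.2)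
  lie_H_E a i j hi hj hij := by
    apply inclInf_lift
    rw [LieHom.map_lie, map_smul, finEps_apply, finEps_apply]
    change ⁅(inclInf n a).1, (inclInf n (finE n i j)).1⁆ = _ • (inclInf n (finE n i j)).1
    rw [inclInf_finE hi hj hij, lie_diag_unitOp (inclInf_diag a.2)]
    rfl
  lie_E_swap hi hj hij := rfl
  ε_h {i j k} hi hj hij := by
    rw [finEps_apply, entry, inclInf_finH hi hj hij, LinearMap.sub_apply, unitOp_single,
      unitOp_single]
    split_ifs <;> simp_all
  N_eq := nilPlus_eq n
  span_eq := eq_top_iff.mpr fun x _ => sl_span n x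

lemma slInf_eq_inclInf (x : slInf) : ∃ n, ∃ y : slFin n, inclInf n y = x := by
  obtain ⟨x, n, A, rfl⟩ := x
  exact ⟨n, A, rfl⟩

/-- The root data of `sl_∞`. -/
def slInfData : SlData slInf where
  dom := Set.univ
  H := cartanInf
  N := nilPlusInf
  E := infE
  ε := infEps
  h i j := ⟨inclInf (max i j + 1) (finH (max i j + 1) i j), inclInf_mem_cartanInf (finH_mem _ i j)⟩
  dom_lt _ _ := trivial
  lie_H a b := Subtype.ext (lie_diag a.2 b.2)
  lie_H_E a i j _ _ hij := Subtype.ext (by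
    change ⁅(a : slInf).1, (infE i j).1⁆ = _ • (infE i j).1
    rw [infE_coe hij, lie_diag_unitOp a.2]
    rfl)
  lie_E_swap {i j} _ _ hij := Subtype.ext (by
    change ⁅(infE i j).1, (infE j i).1⁆ = (inclInf _ _).1
    rw [infE_coe hij, infE_coe hij.symm, lie_unitOp_swap,
      inclInf_finH (by omega) (by omega) hij])
  ε_h {i j k} _ _ hij := by
    change (inclInf _ _).1 _ _ = _
    rw [inclInf_finH (by omega) (by omega) hij, LinearMap.sub_apply, unitOp_single, unitOp_single]
    split_ifs <;> simp_all
  N_eq := by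
    apply le_antisymm
    · intro x hx
      obtain ⟨n, y, rfl⟩ := slInf_eq_inclInf x
      have hy : y ∈ nilPlus n := fun i j hij => by
        rw [← inclInf_entry]; exact hx i j hij
      rw [nilPlus_eq] at hy
      have := Submodule.mem_map_of_mem (f := (inclInf n).toLinearMap) hy
      rw [Submodule.map_span] at this
      refine Submodule.span_mono ?_ this
      rintro _ ⟨_, ⟨i, j, hi, hj, hij, rfl⟩, rfl⟩
      exact ⟨i, j, trivial, trivial, hij, inclInf_finE_eq hi hj hij.ne⟩
    · refine Submodule.span_le.mpr ?_
      rintro _ ⟨i, j, -, -, hij, rfl⟩ a b hab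
      rw [entry, infE_coe hij.ne, unitOp_single]
      split_ifs with h
      · exact Finsupp.single_eq_of_ne (by omega)
      · rfl
  span_eq := eq_top_iff.mpr fun x _ => by
    obtain ⟨n, y, rfl⟩ := slInf_eq_inclInf x
    have := Submodule.mem_map_of_mem (f := (inclInf n).toLinearMap) (sl_span n y)
    rw [Submodule.map_sup, Submodule.map_span] at this
    refine SetLike.le_def.mp (sup_le_sup ?_ (Submodule.span_mono ?_)) this
    · rintro _ ⟨z, hz, rfl⟩
      exact inclInf_mem_cartanInf hz
    · rintro _ ⟨_, ⟨i, j, hi, hj, hij, rfl⟩, rfl⟩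
      exact ⟨i, j, trivial, trivial, hij, inclInf_finE_eq hi hj hij⟩

end RootData

/-! ### Integral weights -/

section Weights

/-- The sum of the first `n` coordinates. -/
def hd (n : ℕ) : (ℕ →₀ ℤ) →+ ℤ where
  toFun a := ∑ i ∈ Finset.range n, a i
  map_zero' := by simp
  map_add' a b := by simp [Finset.sum_add_distrib]

lemma hd_apply (n : ℕ) (a : ℕ →₀ ℤ) : hd n a = ∑ i ∈ Finset.range n, a i := rfl

lemma hd_succ (n : ℕ) (a : ℕ →₀ ℤ) : hd (n + 1) a = hd n a + a n := Finset.sum_range_succ _ _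

/-- The sum of all coordinates. -/
def tot : (ℕ →₀ ℤ) →+ ℤ := (Finsupp.linearCombination ℤ (fun _ : ℕ => (1 : ℤ))).toAddMonoidHom

lemma tot_apply (a : ℕ →₀ ℤ) : tot a = a.sum fun _ c => c := by
  simp [tot, Finsupp.linearCombination_apply]

lemma tot_single (i : ℕ) (c : ℤ) : tot (Finsupp.single i c) = c := by simp [tot]

lemma hd_eq_tot {n : ℕ} {a : ℕ →₀ ℤ} (h : ∀ i, n ≤ i → a i = 0) : hd n a = tot a := by
  rw [tot_apply, Finsupp.sum, hd_apply]
  symm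
  apply Finset.sum_subset
  · intro i hi
    rw [Finset.mem_range]
    by_contra hn
    exact (Finsupp.mem_support_iff.mp hi) (h i (not_lt.mp hn))
  · intro i _ hi
    simpa using hi

lemma exists_bound (a : ℕ →₀ ℤ) : ∃ n, ∀ i, n ≤ i → a i = 0 :=
  ⟨a.support.sup id + 1, fun i hi => by
    by_contra h
    have := Finset.le_sup (f := id) (Finsupp.mem_support_iff.mpr h)
    simp only [id] at this
    omega⟩

lemma eq_zero_of_hd {k : ℕ} {a : ℕ →₀ ℤ} (h : ∀ n, k ≤ n → hd n a = 0) (i : ℕ) (hi : k ≤ i) :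
    a i = 0 := by
  have h1 := hd_succ i a
  rw [h i hi, h (i + 1) (by omega)] at h1
  omega

/-- The weight of the matrix unit `E i j`. -/
def root (i j : ℕ) : ℕ →₀ ℤ := Finsupp.single i 1 - Finsupp.single j 1

lemma tot_root (i j : ℕ) : tot (root i j) = 0 := by
  rw [root, map_sub, tot_single, tot_single, sub_self]

lemma hd_single (n i : ℕ) (c : ℤ) : hd n (Finsupp.single i c) = if i < n then c else 0 := by
  rw [hd_apply]
  split_ifs with h
  · rw [Finset.sum_eq_single_of_mem i (Finset.mem_range.mpr h)]
    · simp
    · intro b _ hb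
      exact Finsupp.single_eq_of_ne hb
  · refine Finset.sum_eq_zero fun b hb => Finsupp.single_eq_of_ne ?_
    rw [Finset.mem_range] at hb
    omega

lemma hd_root (n i j : ℕ) : hd n (root i j) =
    (if i < n then 1 else 0) - (if j < n then 1 else 0) := by
  rw [root, map_sub, hd_single, hd_single]

variable {L : Type} [LieRing L] [LieAlgebra ℂ L] (D : SlData L)

namespace SlData

/-- The weight with given integral coordinates. -/
def wt : (ℕ →₀ ℤ) →+ Module.Dual ℂ D.H := (Finsupp.linearCombination ℤ D.ε).toAddMonoidHom

lemma wt_apply (a : ℕ →₀ ℤ) : D.wt a = a.sum fun i c => c • D.ε i :=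
  Finsupp.linearCombination_apply _ _

lemma wt_root (i j : ℕ) : D.wt (root i j) = D.ε i - D.ε j := by
  simp [wt, root, map_sub]

lemma wt_h (a : ℕ →₀ ℤ) {i j : ℕ} (hi : i ∈ D.dom) (hj : j ∈ D.dom) (hij : i ≠ j) :
    D.wt a (D.h i j) = a i - a j := by
  rw [wt_apply, Finsupp.sum, LinearMap.sum_apply]
  simp only [LinearMap.smul_apply, D.ε_h hi hj hij, zsmul_eq_mul, mul_sub, mul_ite, mul_one,
    mul_zero, Finset.sum_sub_distrib, Finset.sum_ite_eq']
  split_ifs with h1 h2 h2 <;> simp_all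

/-- Vanishing on all coroots makes the coordinates on `dom` equal, and a common value with total
zero is zero. The condition on the total is what makes coordinates unique for `sl_n`, where the sum
of all `ε i` is zero. -/
lemma eq_zero_of_wt {c : ℕ →₀ ℤ} (hc : ∀ i ∉ D.dom, c i = 0) (ht : tot c = 0)
    (h : D.wt c = 0) : c = 0 := by
  have key : ∀ i ∈ D.dom, ∀ j ∈ D.dom, c i = c j := by
    intro i hi j hj
    by_cases hij : i = j
    · rw [hij]
    · have := D.wt_h c hi hj hij
      rw [h, LinearMap.zero_apply, eq_comm, sub_eq_zero] at this
      exact_mod_cast this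
  by_contra hne
  obtain ⟨i, hi⟩ := Finsupp.support_nonempty_iff.mpr hne
  have hi' := Finsupp.mem_support_iff.mp hi
  have hd : i ∈ D.dom := by_contra fun hh => hi' (hc i hh)
  rw [tot_apply, Finsupp.sum, Finset.sum_congr rfl (g := fun _ => c i), Finset.sum_const,
    smul_eq_zero] at ht
  · rcases ht with ht | ht
    · rw [Finset.card_eq_zero] at ht
      rw [ht] at hi
      simp at hi
    · exact hi' ht
  · intro j hj
    refine key j ?_ i hd
    exact by_contra fun hh => (Finsupp.mem_support_iff.mp hj) (hc j hh)

lemma wt_inj {a b : ℕ →₀ ℤ} (ha : ∀ i ∉ D.dom, a i = 0) (hb : ∀ i ∉ D.dom, b i = 0)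
    (ht : tot a = tot b) (h : D.wt a = D.wt b) : a = b := by
  rw [← sub_eq_zero]
  refine D.eq_zero_of_wt (fun i hi => ?_) ?_ ?_
  · simp [ha i hi, hb i hi]
  · rw [map_sub, ht, sub_self]
  · rw [map_sub, h, sub_self]

end SlData

end Weights

/-! ### Weight modules -/

section WeightModules

open scoped ModuleCat

variable {L : Type} [LieRing L] [LieAlgebra ℂ L]

lemma mapU_id : mapU (LieHom.id : L →ₗ⁅ℂ⁆ L) = AlgHom.id ℂ (U L) := by
  apply UniversalEnvelopingAlgebra.hom_ext
  ext x
  exact mapU_toU LieHom.id x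

lemma U_smul_mem {M : Rep.{u} L} (S : Submodule ℂ M)
    (hS : ∀ x : L, ∀ v ∈ S, toU x • v ∈ S) (a : U L) {v : M} (hv : v ∈ S) : a • v ∈ S := by
  have := mapU_smul_mem (LieHom.id : L →ₗ⁅ℂ⁆ L) S hS a hv
  rwa [mapU_id] at this

/-- A subspace stable under the Lie algebra is a submodule. -/
def toSubmoduleU {M : Rep.{u} L} (S : Submodule ℂ M)
    (hS : ∀ x : L, ∀ v ∈ S, toU x • v ∈ S) : Submodule (U L) M :=
  { S.toAddSubmonoid with smul_mem' := fun a _ hv => U_smul_mem S hS a hv }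

lemma lie_smul {M : Rep.{u} L} (x y : L) (v : M) :
    toU ⁅x, y⁆ • v = toU x • toU y • v - toU y • toU x • v := by
  have h := LieHom.map_lie (UniversalEnvelopingAlgebra.ι ℂ) x y
  rw [toU, h, ← mul_smul, ← mul_smul, ← sub_smul]
  rfl

lemma toU_add_smul {M : Rep.{u} L} (x y : L) (v : M) :
    toU (x + y) • v = toU x • v + toU y • v := by
  rw [toU, map_add, add_smul]

lemma toU_smul_smul {M : Rep.{u} L} (c : ℂ) (x : L) (v : M) :
    toU (c • x) • v = c • toU x • v := by
  rw [toU, map_smul, smul_assoc]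

/-- The elements of the Lie algebra which map a vector into a subspace. -/
def intoSub {M : Rep.{u} L} (T : Submodule ℂ M) (v : M) : Submodule ℂ L where
  carrier := {x | toU x • v ∈ T}
  add_mem' {x y} hx hy := by
    change toU (x + y) • v ∈ T
    rw [toU_add_smul]; exact T.add_mem hx hy
  zero_mem' := by
    change toU (0 : L) • v ∈ T
    rw [toU, map_zero, zero_smul]; exact T.zero_mem
  smul_mem' c x hx := by
    change toU (c • x) • v ∈ T
    rw [toU_smul_smul]; exact T.smul_mem c hx

variable {H : Submodule ℂ L}

/-- Submodules contain the weight components of their elements. -/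
lemma component_mem {M : Rep.{u} L} (S : Submodule (U L) M) (s : Finset (Module.Dual ℂ H)) :
    ∀ f : Module.Dual ℂ H → M, (∀ χ ∈ s, f χ ∈ weightSpace H M χ) → ∑ χ ∈ s, f χ ∈ S →
      ∀ χ ∈ s, f χ ∈ S := by
  classical
  induction s using Finset.induction_on with
  | empty => simp
  | insert a s ha ih =>
    intro f hf hsum
    have h1 : ∀ χ ∈ s, f χ ∈ S := by
      intro χ hχ
      have hne : χ ≠ a := fun h => ha (h ▸ hχ)
      obtain ⟨h, hh⟩ : ∃ h : H, χ h ≠ a h := by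
        by_contra! hc
        exact hne (LinearMap.ext hc)
      -- Applying `h - a h` to the sum removes the component of weight `a` and scales the one of
      -- weight `χ` by the nonzero number `χ h - a h`.
      have h2 := ih (fun ψ => (ψ h - a h) • f ψ)
        (fun ψ hψ => Submodule.smul_mem _ _ (hf ψ (Finset.mem_insert_of_mem hψ))) ?_ χ hχ
      · have h3 := Submodule.smul_of_tower_mem S (χ h - a h)⁻¹ h2
        rwa [inv_smul_smul₀ (sub_ne_zero.mpr hh)] at h3
      · have h3 := S.sub_mem (S.smul_mem (toU (h : L)) hsum)
          (Submodule.smul_of_tower_mem S (a h) hsum)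
        rw [Finset.smul_sum, Finset.smul_sum, ← Finset.sum_sub_distrib,
          Finset.sum_insert ha] at h3
        rw [hf a (Finset.mem_insert_self _ _) h, sub_self, zero_add] at h3
        convert h3 using 1
        refine Finset.sum_congr rfl fun ψ hψ => ?_
        rw [hf ψ (Finset.mem_insert_of_mem hψ) h, sub_smul]
    intro χ hχ
    rcases Finset.mem_insert.mp hχ with rfl | hχ
    · rw [Finset.sum_insert ha] at hsum
      have := S.sub_mem hsum (S.sum_mem h1)
      rwa [add_sub_cancel_right] at this
    · exact h1 χ hχ

lemma iSup_weightSpace_exists {M : Rep.{u} L} {ι : Set (Module.Dual ℂ H)} {x : M}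
    (hx : x ∈ ⨆ χ ∈ ι, weightSpace H M χ) :
    ∃ (s : Finset (Module.Dual ℂ H)) (f : Module.Dual ℂ H → M),
      (∀ χ, f χ ∈ weightSpace H M χ) ∧ (∀ χ ∈ s, χ ∈ ι) ∧ ∑ χ ∈ s, f χ = x := by
  classical
  rw [iSup_subtype', Submodule.mem_iSup_iff_exists_finsupp] at hx
  obtain ⟨f, hf, rfl⟩ := hx
  refine ⟨f.support.map (Function.Embedding.subtype _),
    fun χ => if h : χ ∈ ι then f ⟨χ, h⟩ else 0, fun χ => ?_, fun χ hχ => ?_, ?_⟩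
  · dsimp only
    split_ifs with h
    · exact hf ⟨χ, h⟩
    · exact Submodule.zero_mem _
  · obtain ⟨y, _, rfl⟩ := Finset.mem_map.mp hχ
    exact y.2
  · rw [Finset.sum_map, Finsupp.sum]
    refine Finset.sum_congr rfl fun y _ => ?_
    simp [y.2]

lemma IsWeightModule.exists_sum {M : Rep.{u} L} (hM : IsWeightModule H M) (x : M) :
    ∃ (s : Finset (Module.Dual ℂ H)) (f : Module.Dual ℂ H → M),
      (∀ χ, f χ ∈ weightSpace H M χ) ∧ ∑ χ ∈ s, f χ = x := by
  have : x ∈ ⨆ χ ∈ (Set.univ : Set (Module.Dual ℂ H)), weightSpace H M χ := by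
    have h : x ∈ ⨆ χ, weightSpace H M χ := by rw [hM]; trivial
    simpa using h
  obtain ⟨s, f, h1, -, h2⟩ := iSup_weightSpace_exists this
  exact ⟨s, f, h1, h2⟩

lemma sum_eq_zero_component {M : Rep.{u} L} {s : Finset (Module.Dual ℂ H)}
    {f : Module.Dual ℂ H → M} (hf : ∀ χ ∈ s, f χ ∈ weightSpace H M χ) (h : ∑ χ ∈ s, f χ = 0) :
    ∀ χ ∈ s, f χ = 0 :=
  component_mem (⊥ : Submodule (U L) M) s f hf (by rw [h]; exact Submodule.zero_mem _)

/-- A sum of weight vectors which is a weight vector equals its component. -/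
lemma sum_eq_component {M : Rep.{u} L} {s : Finset (Module.Dual ℂ H)}
    {f : Module.Dual ℂ H → M} (hf : ∀ χ, f χ ∈ weightSpace H M χ) {ψ : Module.Dual ℂ H} {x : M}
    (hx : x ∈ weightSpace H M ψ) (h : ∑ χ ∈ s, f χ = x) (h0 : x ≠ 0) : ψ ∈ s ∧ f ψ = x := by
  classical
  by_cases hψ : ψ ∈ s
  · refine ⟨hψ, ?_⟩
    have := sum_eq_zero_component (s := s) (f := fun χ => if χ = ψ then f χ - x else f χ)
      (fun χ _ => ?_) ?_ ψ hψ
    · simpa [sub_eq_zero] using this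
    · split_ifs with h1
      · subst h1; exact Submodule.sub_mem _ (hf _) hx
      · exact hf χ
    · rw [← Finset.add_sum_erase _ _ hψ] at h ⊢
      rw [Finset.sum_congr rfl (g := f)]
      · rw [if_pos rfl, ← h]; abel
      · intro χ hχ; rw [if_neg (Finset.ne_of_mem_erase hχ)]
  · exfalso
    have := sum_eq_zero_component (s := insert ψ s) (f := fun χ => if χ = ψ then -x else f χ)
      (fun χ _ => ?_) ?_ ψ (Finset.mem_insert_self _ _)
    · simp at this; exact h0 this
    · split_ifs with h1
      · subst h1; exact Submodule.neg_mem _ hx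
      · exact hf χ
    · rw [Finset.sum_insert hψ, if_pos rfl, Finset.sum_congr rfl (g := f), h, neg_add_cancel]
      intro χ hχ
      rw [if_neg]
      rintro rfl
      exact hψ hχ

/-- The projections of a weight module to its weight spaces. -/
lemma IsWeightModule.exists_proj {M : Rep.{u} L} (hM : IsWeightModule H M)
    (ψ : Module.Dual ℂ H) : ∃ p : M →ₗ[ℂ] M,
      (∀ x, p x ∈ weightSpace H M ψ) ∧ (∀ x ∈ weightSpace H M ψ, p x = x) ∧
      (∀ χ ≠ ψ, ∀ x ∈ weightSpace H M χ, p x = 0) ∧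
      ∀ (S : Submodule (U L) M), ∀ x ∈ S, p x ∈ S := by
  classical
  choose s f hf hs using hM.exists_sum
  let q (x : M) : M := if ψ ∈ s x then f x ψ else 0
  have hq (x : M) : q x ∈ weightSpace H M ψ := by
    dsimp only [q]; split_ifs
    · exact hf x ψ
    · exact Submodule.zero_mem _
  -- `q x` is characterized by the fact that the rest has no component of weight `ψ`
  have hrest (x : M) : ∃ (t : Finset (Module.Dual ℂ H)) (g : Module.Dual ℂ H → M),
      (∀ χ, g χ ∈ weightSpace H M χ) ∧ ψ ∉ t ∧ q x + ∑ χ ∈ t, g χ = x := by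
    refine ⟨(s x).erase ψ, f x, hf x, Finset.notMem_erase _ _, ?_⟩
    dsimp only [q]
    split_ifs with h
    · rw [Finset.add_sum_erase _ _ h, hs]
    · rw [Finset.erase_eq_of_notMem h, hs, zero_add]
  -- With `S = ⊥` this is uniqueness of the component of weight `ψ`; with general `S` it says that
  -- the projection preserves submodules.
  have huniq (x y : M) (hy : y ∈ weightSpace H M ψ) (t : Finset (Module.Dual ℂ H))
      (g : Module.Dual ℂ H → M) (hg : ∀ χ, g χ ∈ weightSpace H M χ) (ht : ψ ∉ t)
      (h : y + ∑ χ ∈ t, g χ = x) (S : Submodule (U L) M) (hxS : x ∈ S) : y ∈ S := by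
    have := component_mem S (insert ψ t) (fun χ => if χ = ψ then y else g χ) (fun χ _ => ?_) ?_ ψ
      (Finset.mem_insert_self _ _)
    · simpa using this
    · split_ifs with h1
      · subst h1; exact hy
      · exact hg χ
    · rw [Finset.sum_insert ht, if_pos rfl, Finset.sum_congr rfl (g := g), h]
      · exact hxS
      · intro χ hχ
        rw [if_neg]
        rintro rfl
        exact ht hχ
  have hq0 (x y : M) (hy : y ∈ weightSpace H M ψ) (t : Finset (Module.Dual ℂ H))
      (g : Module.Dual ℂ H → M) (hg : ∀ χ, g χ ∈ weightSpace H M χ) (ht : ψ ∉ t)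
      (h : y + ∑ χ ∈ t, g χ = x) : q x = y := by
    obtain ⟨t', g', hg', ht', h'⟩ := hrest x
    rw [← sub_eq_zero]
    have := huniq 0 (q x - y) (Submodule.sub_mem _ (hq x) hy) (t' ∪ t)
      (fun χ => (if χ ∈ t' then g' χ else 0) - (if χ ∈ t then g χ else 0)) (fun χ => ?_) (by
        simp [ht, ht']) ?_ ⊥ (Submodule.zero_mem _)
    · simpa using this
    · refine Submodule.sub_mem _ ?_ ?_
      · split_ifs
        · exact hg' χ
        · exact Submodule.zero_mem _
      · split_ifs
        · exact hg χ
        · exact Submodule.zero_mem _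
    · rw [Finset.sum_sub_distrib, Finset.sum_ite_mem, Finset.sum_ite_mem,
        Finset.inter_eq_right.mpr Finset.subset_union_left,
        Finset.inter_eq_right.mpr Finset.subset_union_right]
      rw [← sub_eq_zero.mpr (h'.trans h.symm)]
      abel
  have hadd (x y : M) : q (x + y) = q x + q y := by
    obtain ⟨t, g, hg, ht, h⟩ := hrest x
    obtain ⟨t', g', hg', ht', h'⟩ := hrest y
    refine hq0 _ _ (Submodule.add_mem _ (hq x) (hq y)) (t' ∪ t)
      (fun χ => (if χ ∈ t' then g' χ else 0) + (if χ ∈ t then g χ else 0)) (fun χ => ?_) (by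
        simp [ht, ht']) ?_
    · refine Submodule.add_mem _ ?_ ?_
      · split_ifs
        · exact hg' χ
        · exact Submodule.zero_mem _
      · split_ifs
        · exact hg χ
        · exact Submodule.zero_mem _
    · rw [Finset.sum_add_distrib, Finset.sum_ite_mem, Finset.sum_ite_mem,
        Finset.inter_eq_right.mpr Finset.subset_union_left,
        Finset.inter_eq_right.mpr Finset.subset_union_right]
      conv_rhs => rw [← h, ← h']
      abel
  have hsmul (c : ℂ) (x : M) : q (c • x) = c • q x := by
    obtain ⟨t, g, hg, ht, h⟩ := hrest x
    refine hq0 _ _ (Submodule.smul_mem _ _ (hq x)) t (fun χ => c • g χ)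
      (fun χ => Submodule.smul_mem _ _ (hg χ)) ht ?_
    rw [← Finset.smul_sum, ← smul_add, h]
  refine ⟨⟨⟨q, hadd⟩, hsmul⟩, hq, fun x hx => ?_, fun χ hχ x hx => ?_, fun S x hx => ?_⟩
  · exact hq0 x x hx ∅ 0 (fun _ => Submodule.zero_mem _) (by simp) (by simp)
  · refine hq0 x 0 (Submodule.zero_mem _) {χ} (fun φ => if φ = χ then x else 0) (fun φ => ?_)
      (by simpa using hχ.symm) (by simp)
    split_ifs with h
    · subst h; exact hx
    · exact Submodule.zero_mem _
  · obtain ⟨t, g, hg, ht, h⟩ := hrest x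
    exact huniq x (q x) (hq x) t g hg ht h S hx

end WeightModules

/-! ### Singular vectors of subquotients and words in lowering operators -/

section Singular

open scoped ModuleCat

variable {L : Type} [LieRing L] [LieAlgebra ℂ L]

namespace SlData

variable (D : SlData L) {M : Rep.{u} L}

/-- A weight vector of the quotient by `S` which is killed by the strictly upper triangular
matrices. -/
def Sing (S : Submodule (U L) M) (χ : Module.Dual ℂ D.H) (v : M) : Prop :=
  (∀ h : D.H, toU (h : L) • v - χ h • v ∈ S) ∧ ∀ x ∈ D.N, toU x • v ∈ S

lemma Sing.mono {S T : Submodule (U L) M} {χ : Module.Dual ℂ D.H} {v : M} (h : D.Sing S χ v)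
    (hST : S ≤ T) : D.Sing T χ v :=
  ⟨fun x => hST (h.1 x), fun x hx => hST (h.2 x hx)⟩

lemma Sing.congr {S : Submodule (U L) M} {χ : Module.Dual ℂ D.H} {v w : M} (h : D.Sing S χ v)
    (hw : v - w ∈ S) : D.Sing S χ w := by
  refine ⟨fun x => ?_, fun x hx => ?_⟩
  · have h1 := S.sub_mem (h.1 x) (S.sub_mem (S.smul_mem (toU (x : L)) hw)
      (Submodule.smul_of_tower_mem S (χ x) hw))
    convert h1 using 1
    rw [smul_sub, smul_sub]; abel
  · have h1 := S.sub_mem (h.2 x hx) (S.smul_mem (toU x) hw)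
    convert h1 using 1
    rw [smul_sub]; abel

lemma Sing.inf {S T : Submodule (U L) M} {χ : Module.Dual ℂ D.H} {v : M} (h : D.Sing S χ v)
    (hv : v ∈ T) : D.Sing (S ⊓ T) χ v :=
  ⟨fun x => ⟨h.1 x, T.sub_mem (T.smul_mem _ hv) (Submodule.smul_of_tower_mem T _ hv)⟩,
    fun x hx => ⟨h.2 x hx, T.smul_mem _ hv⟩⟩

lemma E_mem_N {i j : ℕ} (hj : j ∈ D.dom) (hij : i < j) : D.E i j ∈ D.N := by
  rw [D.N_eq]
  exact Submodule.subset_span ⟨i, j, D.dom_lt hij.le hj, hj, hij, rfl⟩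

lemma N_le {V : Submodule ℂ L} (h : ∀ i j, j ∈ D.dom → i < j → D.E i j ∈ V) : D.N ≤ V := by
  rw [D.N_eq, Submodule.span_le]
  rintro _ ⟨i, j, _, hj, hij, rfl⟩
  exact h i j hj hij

lemma mem_of_generators {V : Submodule ℂ L} (hH : D.H ≤ V) (hN : D.N ≤ V)
    (hE : ∀ i j, i ∈ D.dom → j < i → D.E i j ∈ V) (x : L) : x ∈ V := by
  have : D.H ⊔ Submodule.span ℂ
      {x | ∃ i j, i ∈ D.dom ∧ j ∈ D.dom ∧ i ≠ j ∧ x = D.E i j} ≤ V := by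
    refine sup_le hH (Submodule.span_le.mpr ?_)
    rintro _ ⟨i, j, hi, hj, hij, rfl⟩
    rcases lt_or_gt_of_ne hij with h | h
    · exact hN (D.E_mem_N hj h)
    · exact hE i j hi h
  rw [D.span_eq] at this
  exact this trivial

lemma toU_E_mem_weightSpace {i j : ℕ} (hi : i ∈ D.dom) (hj : j ∈ D.dom) (hij : i ≠ j)
    {χ : Module.Dual ℂ D.H} {v : M} (hv : v ∈ weightSpace D.H M χ) :
    toU (D.E i j) • v ∈ weightSpace D.H M (D.wt (root i j) + χ) := by
  rw [wt_root]
  exact toU_smul_mem_weightSpace D.H (fun h => D.lie_H_E h hi hj hij) hv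

/-- A singular vector modulo a submodule can be replaced by an honest weight vector. -/
lemma Sing.exists_weight (hM : IsWeightModule D.H M) {S : Submodule (U L) M}
    {χ : Module.Dual ℂ D.H} {v : M} (h : D.Sing S χ v) :
    ∃ w ∈ weightSpace D.H M χ, v - w ∈ S := by
  classical
  obtain ⟨s, f, hf, hs⟩ := hM.exists_sum v
  -- The operator `x - χ x` maps `v` into `S` and acts invertibly on the component of weight `ψ`
  -- once `x` separates `ψ` from `χ`.
  have hmem : ∀ ψ ∈ s, ψ ≠ χ → f ψ ∈ S := by
    intro ψ hψ hne
    obtain ⟨x, hx⟩ : ∃ x : D.H, ψ x ≠ χ x := by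
      by_contra! hc
      exact hne (LinearMap.ext hc)
    have h1 := h.1 x
    rw [← hs, Finset.smul_sum, Finset.smul_sum, ← Finset.sum_sub_distrib] at h1
    have h2 := component_mem (H := D.H) S s (fun φ => (φ x - χ x) • f φ)
      (fun φ _ => Submodule.smul_mem _ _ (hf φ)) (by
        convert h1 using 1
        refine Finset.sum_congr rfl fun φ _ => ?_
        rw [hf φ x, sub_smul]) ψ hψ
    have h3 := Submodule.smul_of_tower_mem S (ψ x - χ x)⁻¹ h2
    rwa [inv_smul_smul₀ (sub_ne_zero.mpr hx)] at h3
  by_cases hχ : χ ∈ s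
  · refine ⟨f χ, hf χ, ?_⟩
    rw [← hs, ← Finset.add_sum_erase _ _ hχ, add_sub_cancel_left]
    exact S.sum_mem fun ψ hψ => hmem ψ (Finset.mem_of_mem_erase hψ) (Finset.ne_of_mem_erase hψ)
  · refine ⟨0, Submodule.zero_mem _, ?_⟩
    rw [sub_zero, ← hs]
    refine S.sum_mem fun ψ hψ => hmem ψ hψ ?_
    rintro rfl
    exact hχ hψ

/-- The vectors obtained from `v` by applying lowering operators `E i j` for pairs satisfying `P`;
the weight of the vector differs from the one of `v` by `β`. -/
inductive Desc (v : M) (P : ℕ → ℕ → Prop) : (ℕ →₀ ℤ) → M → Prop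
  | base : Desc v P 0 v
  | step {i j : ℕ} {β : ℕ →₀ ℤ} {x : M} : i ∈ D.dom → j < i → P i j → Desc v P β x →
      Desc v P (β + root j i) (toU (D.E i j) • x)

variable {D} {v : M} {P : ℕ → ℕ → Prop} {β : ℕ →₀ ℤ} {x : M}

lemma Desc.mono {Q : ℕ → ℕ → Prop} (h : D.Desc v P β x) (hPQ : ∀ i j, P i j → Q i j) :
    D.Desc v Q β x := by
  induction h with
  | base => exact .base
  | step hi hij hP _ ih => exact .step hi hij (hPQ _ _ hP) ih

lemma hd_root_nonneg {i j : ℕ} (hij : j < i) (n : ℕ) : 0 ≤ hd n (root j i) := by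
  rw [hd_root]
  split_ifs <;> omega

lemma Desc.hd_nonneg (h : D.Desc v P β x) (n : ℕ) : 0 ≤ hd n β := by
  induction h with
  | base => simp
  | step hi hij hP _ ih =>
    rw [map_add]
    have := hd_root_nonneg hij n
    omega

lemma Desc.tot_eq (h : D.Desc v P β x) : tot β = 0 := by
  induction h with
  | base => simp
  | step hi hij hP _ ih => rw [map_add, ih, tot_root, add_zero]

lemma Desc.out (h : D.Desc v P β x) {k : ℕ} (hk : k ∉ D.dom) : β k = 0 := by
  induction h with
  | base => simp
  | @step i j _ _ hi hij hP _ ih =>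
    have h1 : k ≠ i := fun e => hk (e ▸ hi)
    have h2 : k ≠ j := fun e => hk (e ▸ D.dom_lt hij.le hi)
    simp [ih, root, Finsupp.single_eq_of_ne h1, Finsupp.single_eq_of_ne h2]

/-- No letter lowers a partial sum, and the letter `E i j` raises `hd n` exactly for `j < n ≤ i`. So
the final weight shows which letters can have occurred; this is the way in which weights are turned
into information on words. -/
lemma Desc.restrict (h : D.Desc v P β x) :
    D.Desc v (fun i j => P i j ∧ ∀ n, j < n → n ≤ i → 0 < hd n β) β x := by
  induction h with
  | base => exact .base
  | @step i j β x hi hij hP h ih =>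
    refine .step hi hij ⟨hP, fun n h1 h2 => ?_⟩ (ih.mono fun a b hab => ⟨hab.1, fun n h1 h2 => ?_⟩)
    · have := h.hd_nonneg n
      rw [map_add, hd_root, if_pos h1, if_neg (by omega)]
      omega
    · have := hab.2 n h1 h2
      have := hd_root_nonneg hij n
      rw [map_add]
      omega

lemma Desc.weight {χ : Module.Dual ℂ D.H} (h : D.Desc v P β x)
    (hv : v ∈ weightSpace D.H M χ) : x ∈ weightSpace D.H M (χ - D.wt β) := by
  induction h with
  | base => simpa using hv
  | @step i j β x hi hij hP _ ih =>
    have := D.toU_E_mem_weightSpace hi (D.dom_lt hij.le hi) hij.ne' ih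
    convert this using 1
    rw [map_add, wt_root, wt_root]
    abel_nf

lemma Desc.eq_of_hd (h : D.Desc v P β x) (hβ : ∀ n, hd n β = 0) : x = v := by
  cases h.restrict with
  | base => rfl
  | @step i j _ _ hi hij hP _ =>
    have := hP.2 i hij le_rfl
    rw [hβ] at this
    exact absurd this (lt_irrefl 0)

variable (D v P) in
/-- The span of all such vectors. -/
def words : Submodule ℂ M := Submodule.span ℂ {x | ∃ β, D.Desc v P β x}

lemma mem_words : D.Desc v P β x → x ∈ D.words v P := fun h => Submodule.subset_span ⟨β, h⟩

lemma v_mem_words : v ∈ D.words v P := mem_words .base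

lemma E_words {i j : ℕ} (hi : i ∈ D.dom) (hij : j < i) {y : M} (hy : y ∈ D.words v fun _ _ => True) :
    toU (D.E i j) • y ∈ D.words v fun _ _ => True := by
  induction hy using Submodule.span_induction with
  | mem x hx => exact mem_words (hx.choose_spec.step hi hij trivial)
  | zero => rw [smul_zero]; exact Submodule.zero_mem _
  | add x y _ _ hx hy => rw [smul_add]; exact Submodule.add_mem _ hx hy
  | smul c x _ hx => rw [smul_comm]; exact Submodule.smul_mem _ _ hx

/-- Highest weight modules are spanned by words in the lowering operators. -/
lemma Sing.sup_le_words {S : Submodule (U L) M} {χ : Module.Dual ℂ D.H} (h : D.Sing S χ v) {y : M}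
    (hy : y ∈ S ⊔ Submodule.span (U L) {v}) :
    y ∈ S.restrictScalars ℂ ⊔ D.words v fun _ _ => True := by
  set T := S.restrictScalars ℂ ⊔ D.words v fun _ _ => True with hT
  have hS : ∀ s ∈ S, s ∈ T := fun s hs => Submodule.mem_sup_left hs
  have hW : ∀ w ∈ D.words v fun _ _ => True, w ∈ T := fun w hw => Submodule.mem_sup_right hw
  have hET : ∀ i j, i ∈ D.dom → j < i → ∀ t ∈ T, toU (D.E i j) • t ∈ T := by
    intro i j hi hij t ht
    obtain ⟨s, hs, w, hw, rfl⟩ := Submodule.mem_sup.mp ht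
    rw [smul_add]
    exact T.add_mem (hS _ (S.smul_mem _ hs)) (hW _ (E_words hi hij hw))
  -- Induction on the word: `y` is moved past the leftmost letter `e` by `y e x = [y, e] x + e y x`.
  -- No ordering of the letters is needed, hence no PBW theorem.
  have key : ∀ β x, D.Desc v (fun _ _ => True) β x → ∀ y : L, toU y • x ∈ T := by
    intro β x hx
    induction hx with
    | base =>
      intro y
      refine D.mem_of_generators (V := intoSub T v) (fun a ha => ?_) (fun a ha => ?_)
        (fun i j hi hij => ?_) y
      · change toU a • v ∈ T
        have := h.1 ⟨a, ha⟩
        rw [← sub_add_cancel (toU a • v) (χ ⟨a, ha⟩ • v)]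
        exact T.add_mem (hS _ this) (T.smul_mem _ (hW _ v_mem_words))
      · exact hS _ (h.2 a ha)
      · exact hW _ (mem_words (Desc.base.step hi hij trivial))
    | @step i j β x hi hij _ _ ih =>
      intro y
      have h1 := lie_smul y (D.E i j) x
      rw [eq_sub_iff_add_eq] at h1
      rw [← h1]
      exact T.add_mem (ih _) (hET i j hi hij _ (ih y))
  have hL : ∀ y : L, ∀ t ∈ T, toU y • t ∈ T := by
    intro y t ht
    obtain ⟨s, hs, w, hw, rfl⟩ := Submodule.mem_sup.mp ht
    rw [smul_add]
    refine T.add_mem (hS _ (S.smul_mem _ hs)) ?_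
    clear ht
    induction hw using Submodule.span_induction with
    | mem x hx => exact key _ _ hx.choose_spec y
    | zero => rw [smul_zero]; exact Submodule.zero_mem _
    | add a b _ _ iha ihb => rw [smul_add]; exact Submodule.add_mem _ iha ihb
    | smul c a _ iha => rw [smul_comm]; exact Submodule.smul_mem _ _ iha
  have : S ⊔ Submodule.span (U L) {v} ≤ toSubmoduleU T hL :=
    sup_le (fun s hs => hS s hs)
      (Submodule.span_le.mpr (Set.singleton_subset_iff.mpr (hW _ v_mem_words)))
  exact this hy

/-- The weight vectors of a highest weight module are combinations of words of that weight. -/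
lemma Sing.mem_of_weight (hM : IsWeightModule D.H M) {S : Submodule (U L) M}
    {χ ψ : Module.Dual ℂ D.H} (h : D.Sing S χ v) (hv : v ∈ weightSpace D.H M χ) {y : M}
    (hy : y ∈ S ⊔ Submodule.span (U L) {v}) (hyψ : y ∈ weightSpace D.H M ψ) :
    ∃ s ∈ S, s ∈ weightSpace D.H M ψ ∧ ∃ w ∈ Submodule.span ℂ
      {x | ∃ β, D.Desc v (fun _ _ => True) β x ∧ χ - D.wt β = ψ}, y = s + w := by
  -- The projection to weight `ψ` preserves `S`, fixes the words of that weight and kills the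
  -- others.
  obtain ⟨p, hp1, hp2, hp3, hp4⟩ := hM.exists_proj ψ
  obtain ⟨s, hs, w, hw, rfl⟩ := Submodule.mem_sup.mp (h.sup_le_words hy)
  refine ⟨p s, hp4 S s hs, hp1 s, p w, ?_, ?_⟩
  · clear hy hyψ
    induction hw using Submodule.span_induction with
    | mem x hx =>
      obtain ⟨β, hx⟩ := hx
      by_cases hβ : χ - D.wt β = ψ
      · rw [hp2 x (hβ ▸ hx.weight hv)]
        exact Submodule.subset_span ⟨β, hx, hβ⟩
      · rw [hp3 _ hβ x (hx.weight hv)]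
        exact Submodule.zero_mem _
    | zero => rw [map_zero]; exact Submodule.zero_mem _
    | add a b _ _ iha ihb => rw [map_add]; exact Submodule.add_mem _ iha ihb
    | smul c a _ iha => rw [map_smul]; exact Submodule.smul_mem _ _ iha
  · rw [← map_add, hp2 _ hyψ]

variable (D) in
/-- The weights of singular vectors of subquotients of `T / S`. -/
def SW (S T : Submodule (U L) M) : Set (Module.Dual ℂ D.H) :=
  {χ | ∃ (R : Submodule (U L) M) (v : M), S ≤ R ∧ v ∈ T ∧ v ∉ R ∧ D.Sing R χ v}

/-- A vector singular modulo `R` either lies in `R ⊔ Q` and may be replaced by an element of `Q`, or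
it stays nonzero and singular modulo `R ⊔ Q`. -/
lemma SW_subset_union (S Q T : Submodule (U L) M) : D.SW S T ⊆ D.SW S Q ∪ D.SW Q T := by
  rintro χ ⟨R, v, hSR, hvT, hvR, hs⟩
  by_cases h : v ∈ R ⊔ Q
  · left
    obtain ⟨r, hr, q, hq, rfl⟩ := Submodule.mem_sup.mp h
    refine ⟨R, q, hSR, hq, fun hqR => hvR (R.add_mem hr hqR), hs.congr D ?_⟩
    rwa [add_sub_cancel_right]
  · right
    exact ⟨R ⊔ Q, v, le_sup_right, hvT, h, hs.mono D le_sup_left⟩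

variable (D) in
/-- Submodules with a finite filtration by highest weight modules with highest weights in `Ξ`. -/
inductive HwFilt (Ξ : Set (Module.Dual ℂ D.H)) : Submodule (U L) M → Prop
  | bot : HwFilt Ξ ⊥
  | step {S : Submodule (U L) M} {χ : Module.Dual ℂ D.H} {v : M} : HwFilt Ξ S → χ ∈ Ξ →
      D.Sing S χ v → HwFilt Ξ (S ⊔ Submodule.span (U L) {v})

lemma HwFilt.fg {Ξ : Set (Module.Dual ℂ D.H)} {S : Submodule (U L) M} (h : D.HwFilt Ξ S) :
    S.FG := by
  induction h with
  | bot => exact Submodule.fg_bot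
  | step _ _ _ ih => exact ih.sup (Submodule.fg_span_singleton _)

/-- The weights of a module with a filtration by highest weight modules. -/
lemma HwFilt.weight (hM : IsWeightModule D.H M) {Ξ : Set (Module.Dual ℂ D.H)}
    {S : Submodule (U L) M} (h : D.HwFilt Ξ S) {y : M} {ψ : Module.Dual ℂ D.H} (hy : y ∈ S)
    (hyψ : y ∈ weightSpace D.H M ψ) (hy0 : y ≠ 0) :
    ∃ χ ∈ Ξ, ∃ β : ℕ →₀ ℤ, ψ = χ - D.wt β ∧ (∀ n, 0 ≤ hd n β) ∧ tot β = 0 ∧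
      ∀ k ∉ D.dom, β k = 0 := by
  induction h generalizing y with
  | bot => exact absurd ((Submodule.mem_bot _).mp hy) hy0
  | @step S χ v _ hχ hs ih =>
    obtain ⟨v', hv', hvv⟩ := hs.exists_weight D hM
    have hT : S ⊔ Submodule.span (U L) {v} ≤ S ⊔ Submodule.span (U L) {v'} := by
      refine sup_le le_sup_left (Submodule.span_le.mpr (Set.singleton_subset_iff.mpr ?_))
      rw [← sub_add_cancel v v']
      exact Submodule.add_mem_sup hvv (Submodule.mem_span_singleton_self v')
    obtain ⟨s, hs', hsψ, w, hw, rfl⟩ := (hs.congr D hvv).mem_of_weight hM hv' (hT hy) hyψ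
    by_cases hs0 : s = 0
    · rw [hs0, zero_add] at hy0
      have hA : {x | ∃ β, D.Desc v' (fun _ _ => True) β x ∧ χ - D.wt β = ψ}.Nonempty := by
        by_contra hA
        rw [Set.not_nonempty_iff_eq_empty.mp hA, Submodule.span_empty, Submodule.mem_bot] at hw
        exact hy0 hw
      obtain ⟨x, β, hβ, hβψ⟩ := hA
      exact ⟨χ, hχ, β, hβψ.symm, hβ.hd_nonneg, hβ.tot_eq, fun k hk => hβ.out hk⟩
    · exact ih hs' hsψ hs0

end SlData

end Singular

/-! ### Local finiteness -/

section LocallyFinite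

open scoped ModuleCat

variable {L : Type} [LieRing L] [LieAlgebra ℂ L]

/-- The action of the Lie algebra as a linear map. -/
def actHom (M : Rep.{u} L) : L →ₗ[ℂ] M →ₗ[ℂ] M where
  toFun x := Algebra.lsmul ℂ ℂ M (toU x)
  map_add' x y := by simp [toU]
  map_smul' c x := by simp [toU]

lemma IsWeightModule.of_injective {H : Submodule ℂ L} {M M' : Rep.{u} L} (f : M ⟶ M')
    (hf : Function.Injective f.hom) (h : IsWeightModule H M') : IsWeightModule H M := by
  rw [IsWeightModule, eq_top_iff]
  rintro x -
  obtain ⟨s, g, hg, hs⟩ := h.exists_sum (f.hom x)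
  have hmem := component_mem (LinearMap.range f.hom) s g (fun χ _ => hg χ)
    (hs ▸ LinearMap.mem_range_self _ x)
  choose! k hk using hmem
  have hx : x = ∑ χ ∈ s, k χ := hf (by
    rw [map_sum, ← hs]; exact Finset.sum_congr rfl fun χ hχ => (hk χ hχ).symm)
  rw [hx]
  refine Submodule.sum_mem _ fun χ hχ => Submodule.mem_iSup_of_mem χ fun a => hf ?_
  rw [map_smul, hk χ hχ, hg χ a, ← hk χ hχ]
  exact (map_smul (f.hom.restrictScalars ℂ) (χ a) (k χ)).symm

lemma map_mem_weightSpace {H : Submodule ℂ L} {M M' : Rep.{u} L} (f : M ⟶ M')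
    {χ : Module.Dual ℂ H} {v : M} (hv : v ∈ weightSpace H M χ) :
    f.hom v ∈ weightSpace H M' χ := fun a => by
  rw [← map_smul, hv a]
  exact map_smul (f.hom.restrictScalars ℂ) (χ a) v

lemma IsWeightModule.of_surjective {H : Submodule ℂ L} {M M' : Rep.{u} L} (f : M ⟶ M')
    (hf : Function.Surjective f.hom) (h : IsWeightModule H M) : IsWeightModule H M' := by
  rw [IsWeightModule, eq_top_iff]
  rintro y -
  obtain ⟨x, rfl⟩ := hf y
  obtain ⟨s, g, hg, rfl⟩ := h.exists_sum x
  rw [map_sum]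
  exact Submodule.sum_mem _ fun χ _ => Submodule.mem_iSup_of_mem χ (map_mem_weightSpace f (hg χ))

lemma IsLocallyFinite.of_injective {N : Submodule ℂ L} {M M' : Rep.{u} L} (f : M ⟶ M')
    (hf : Function.Injective f.hom) (h : IsLocallyFinite N M') : IsLocallyFinite N M := by
  intro v
  obtain ⟨V, hV, hv, hN⟩ := h (f.hom v)
  let g : M →ₗ[ℂ] M' := f.hom.restrictScalars ℂ
  refine ⟨V.comap g, ?_, hv, fun x hx w hw => ?_⟩
  · let k : V.comap g →ₗ[ℂ] V := g.restrict fun _ h => h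
    refine FiniteDimensional.of_injective k fun a b hab => Subtype.ext (hf ?_)
    exact congrArg Subtype.val hab
  · change f.hom (toU x • w) ∈ V
    rw [map_smul]
    exact hN x hx _ hw

lemma IsLocallyFinite.of_surjective {N : Submodule ℂ L} {M M' : Rep.{u} L} (f : M ⟶ M')
    (hf : Function.Surjective f.hom) (h : IsLocallyFinite N M) : IsLocallyFinite N M' := by
  intro v
  obtain ⟨v, rfl⟩ := hf v
  obtain ⟨V, hV, hv, hN⟩ := h v
  let g : M →ₗ[ℂ] M' := f.hom.restrictScalars ℂ
  refine ⟨V.map g, inferInstance, Submodule.mem_map_of_mem hv, ?_⟩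
  rintro x hx _ ⟨w, hw, rfl⟩
  exact ⟨toU x • w, hN x hx w hw, map_smul f.hom _ _⟩

namespace SlData

variable (D : SlData L) {M : Rep.{u} L}

/-- A finite-dimensional subspace stable under the strictly upper triangular matrices. -/
def NStable (V : Submodule ℂ M) : Prop :=
  FiniteDimensional ℂ V ∧ ∀ x ∈ D.N, ∀ w ∈ V, toU x • w ∈ V

variable {D}

lemma NStable.sup {V W : Submodule ℂ M} (hV : D.NStable V) (hW : D.NStable W) :
    D.NStable (V ⊔ W) := by
  have := hV.1
  have := hW.1
  refine ⟨inferInstance, fun x hx w hw => ?_⟩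
  obtain ⟨a, ha, b, hb, rfl⟩ := Submodule.mem_sup.mp hw
  rw [smul_add]
  exact Submodule.add_mem_sup (hV.2 x hx a ha) (hW.2 x hx b hb)

lemma exists_nstable_of_fg {S : Submodule (U L) M}
    (h : ∀ x ∈ S, ∃ V : Submodule ℂ M, D.NStable V ∧ x ∈ V ∧ V ≤ S.restrictScalars ℂ)
    (Q : Submodule ℂ M) (hQ : Q.FG) (hQS : Q ≤ S.restrictScalars ℂ) :
    ∃ V : Submodule ℂ M, D.NStable V ∧ Q ≤ V ∧ V ≤ S.restrictScalars ℂ := by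
  induction Q, hQ using Submodule.fg_induction with
  | singleton x =>
    obtain ⟨V, hV, hx, hVS⟩ := h x (hQS (Submodule.mem_span_singleton_self x))
    exact ⟨V, hV, Submodule.span_le.mpr (Set.singleton_subset_iff.mpr hx), hVS⟩
  | sup A B _ _ ihA ihB =>
    obtain ⟨V, hV, hA, hVS⟩ := ihA (le_sup_left.trans hQS)
    obtain ⟨W, hW, hB, hWS⟩ := ihB (le_sup_right.trans hQS)
    exact ⟨V ⊔ W, hV.sup hW, sup_le_sup hA hB, sup_le hVS hWS⟩

lemma exists_fg_of_le_sup {V S : Submodule ℂ M} (Q : Submodule ℂ M) (hQ : Q.FG)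
    (h : Q ≤ V ⊔ S) : ∃ A ≤ S, A.FG ∧ Q ≤ V ⊔ A := by
  induction Q, hQ using Submodule.fg_induction with
  | singleton x =>
    obtain ⟨a, ha, b, hb, hx⟩ := Submodule.mem_sup.mp (h (Submodule.mem_span_singleton_self x))
    refine ⟨Submodule.span ℂ {b}, Submodule.span_le.mpr (Set.singleton_subset_iff.mpr hb),
      Submodule.fg_span_singleton _, Submodule.span_le.mpr (Set.singleton_subset_iff.mpr ?_)⟩
    exact hx ▸ Submodule.add_mem_sup ha (Submodule.mem_span_singleton_self b)
  | sup X Y _ _ ihX ihY =>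
    obtain ⟨A, hA, hA', hXA⟩ := ihX (le_sup_left.trans h)
    obtain ⟨B, hB, hB', hYB⟩ := ihY (le_sup_right.trans h)
    refine ⟨A ⊔ B, sup_le hA hB, hA'.sup hB', sup_le (hXA.trans ?_) (hYB.trans ?_)⟩
    · exact sup_le_sup le_rfl le_sup_left
    · exact sup_le_sup le_rfl le_sup_right

/-- Modules with a finite filtration by highest weight modules are locally finite. -/
lemma HwFilt.exists_nstable [FiniteDimensional ℂ L] {Ξ : Set (Module.Dual ℂ D.H)}
    {S : Submodule (U L) M} (h : D.HwFilt Ξ S) :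
    ∀ x ∈ S, ∃ V : Submodule ℂ M, D.NStable V ∧ x ∈ V ∧ V ≤ S.restrictScalars ℂ := by
  induction h with
  | bot =>
    intro x hx
    refine ⟨⊥, ⟨inferInstance, fun x _ w hw => ?_⟩, hx, bot_le⟩
    rw [(Submodule.mem_bot ℂ).mp hw, smul_zero]
    exact Submodule.zero_mem _
  | @step S χ v _ hχ hs ih =>
    -- vectors contained in a finite-dimensional subspace which is stable modulo `S`
    let T := S ⊔ Submodule.span (U L) {v}
    let G : Submodule ℂ M :=
      { carrier := {x | ∃ V : Submodule ℂ M, V.FG ∧ x ∈ V ∧ V ≤ T.restrictScalars ℂ ∧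
          ∀ y ∈ D.N, ∀ w ∈ V, toU y • w ∈ V ⊔ S.restrictScalars ℂ}
        zero_mem' := ⟨⊥, Submodule.fg_bot, Submodule.zero_mem _, bot_le, fun y _ w hw => by
          rw [(Submodule.mem_bot ℂ).mp hw, smul_zero]
          exact Submodule.zero_mem _⟩
        add_mem' := by
          rintro a b ⟨V, hV, ha, hVT, hVN⟩ ⟨W, hW, hb, hWT, hWN⟩
          refine ⟨V ⊔ W, hV.sup hW, Submodule.add_mem_sup ha hb, sup_le hVT hWT, ?_⟩
          intro y hy w hw
          obtain ⟨p, hp, q, hq, rfl⟩ := Submodule.mem_sup.mp hw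
          rw [smul_add]
          refine Submodule.add_mem _ (SetLike.le_def.mp ?_ (hVN y hy p hp))
            (SetLike.le_def.mp ?_ (hWN y hy q hq))
          · exact sup_le_sup le_sup_left le_rfl
          · exact sup_le_sup le_sup_right le_rfl
        smul_mem' := by
          rintro c a ⟨V, hV, ha, hVT, hVN⟩
          exact ⟨V, hV, V.smul_mem c ha, hVT, hVN⟩ }
    -- If `V` is stable modulo `S`, so is `V + L V`, by `y z w = [y, z] w + z y w`; it is finitely
    -- generated because `L` is finite-dimensional.
    have hGL : ∀ x : L, ∀ a ∈ G, toU x • a ∈ G := by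
      rintro x a ⟨V, hV, ha, hVT, hVN⟩
      let W := V ⊔ Submodule.map₂ (actHom M) ⊤ V
      have hLV : ∀ (z : L), ∀ w ∈ V, toU z • w ∈ W := fun z w hw =>
        Submodule.mem_sup_right (Submodule.apply_mem_map₂ _ trivial hw)
      refine ⟨W, hV.sup (Submodule.FG.map₂ _ (Module.Finite.fg_top) hV), hLV x a ha,
        sup_le hVT ?_, ?_⟩
      · rw [Submodule.map₂_le]
        exact fun z _ w hw => T.smul_mem _ (hVT hw)
      · intro y hy w hw
        have hWS : V ⊔ S.restrictScalars ℂ ≤ W ⊔ S.restrictScalars ℂ := sup_le_sup le_sup_left le_rfl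
        let k : M →ₗ[ℂ] M := actHom M y
        have : W ≤ (W ⊔ S.restrictScalars ℂ).comap k := by
          refine sup_le (fun w (hw : w ∈ V) => hWS (hVN y hy w hw))
            (Submodule.map₂_le.mpr fun z _ w hw => ?_)
          change toU y • toU z • w ∈ W ⊔ S.restrictScalars ℂ
          have h1 := lie_smul y z w
          rw [eq_sub_iff_add_eq] at h1
          rw [← h1]
          refine Submodule.add_mem _ (Submodule.mem_sup_left (hLV _ w hw)) ?_
          obtain ⟨p, hp, q, hq, hpq⟩ := Submodule.mem_sup.mp (hVN y hy w hw)
          rw [← hpq, smul_add]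
          exact Submodule.add_mem_sup (hLV z p hp) (S.smul_mem _ hq)
        exact this hw
    have hvG : v ∈ G := by
      refine ⟨Submodule.span ℂ {v}, Submodule.fg_span_singleton _,
        Submodule.mem_span_singleton_self v, Submodule.span_le.mpr
          (Set.singleton_subset_iff.mpr (Submodule.mem_sup_right
            (Submodule.mem_span_singleton_self v))), ?_⟩
      intro y hy w hw
      obtain ⟨c, rfl⟩ := Submodule.mem_span_singleton.mp hw
      rw [smul_comm]
      exact Submodule.smul_mem _ c (Submodule.mem_sup_right (hs.2 y hy))
    intro x hx
    obtain ⟨s, hs', w, hw, rfl⟩ := Submodule.mem_sup.mp hx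
    have hwG : w ∈ toSubmoduleU G hGL :=
      (Submodule.span_le.mpr (Set.singleton_subset_iff.mpr hvG) : _ ≤ toSubmoduleU G hGL) hw
    obtain ⟨V, hV, hwV, hVT, hVN⟩ := hwG
    -- `N V` leaves `V` only by a finite-dimensional amount of `S`, and by induction this amount
    -- lies in a finite-dimensional stable subspace `B` of `S`; then `V ⊔ B` is stable.
    have hQ : Submodule.map₂ (actHom M) D.N V ≤ V ⊔ S.restrictScalars ℂ :=
      Submodule.map₂_le.mpr fun y hy z hz => hVN y hy z hz
    have hNfg : D.N.FG := IsNoetherian.noetherian D.N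
    obtain ⟨A, hAS, hA, hQA⟩ := exists_fg_of_le_sup _ (hNfg.map₂ _ hV) hQ
    obtain ⟨B, hB, hAB, hBS⟩ := exists_nstable_of_fg ih (A ⊔ Submodule.span ℂ {s})
      (hA.sup (Submodule.fg_span_singleton s))
      (sup_le hAS (Submodule.span_le.mpr (Set.singleton_subset_iff.mpr hs')))
    have := hB.1
    have : FiniteDimensional ℂ V := Module.Finite.of_fg hV
    have hBT : B ≤ T.restrictScalars ℂ := fun b hb => Submodule.mem_sup_left (hBS hb)
    refine ⟨V ⊔ B, ⟨inferInstance, fun y hy z hz => ?_⟩, ?_, sup_le hVT hBT⟩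
    · obtain ⟨p, hp, q, hq, rfl⟩ := Submodule.mem_sup.mp hz
      rw [smul_add]
      refine Submodule.add_mem _ ?_ (Submodule.mem_sup_right (hB.2 y hy q hq))
      exact SetLike.le_def.mp (sup_le_sup le_rfl (le_sup_left.trans hAB))
        (hQA (Submodule.apply_mem_map₂ _ hy hp))
    · rw [add_comm]
      exact Submodule.add_mem_sup hwV
        (hAB (Submodule.mem_sup_right (Submodule.mem_span_singleton_self s)))

/-- A positive functional on the sums of positive roots. -/
def ht : (ℕ →₀ ℤ) →+ ℤ :=
  (Finsupp.linearCombination ℤ (fun i : ℕ => -(i : ℤ))).toAddMonoidHom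

lemma ht_root (i j : ℕ) : ht (root i j) = j - i := by
  simp [ht, root, map_sub]
  ring

/-- Finite-dimensional subspaces contain weight vectors for finitely many weights only. -/
lemma finite_weights {H : Submodule ℂ L} (V : Submodule ℂ M) [FiniteDimensional ℂ V] :
    {χ : Module.Dual ℂ H | ∃ y ∈ V, y ∈ weightSpace H M χ ∧ y ≠ 0}.Finite := by
  set A := {χ : Module.Dual ℂ H | ∃ y ∈ V, y ∈ weightSpace H M χ ∧ y ≠ 0}
  choose f hfV hf hf0 using fun χ : A => χ.2
  classical
  have hli : LinearIndependent ℂ (fun χ : A => (⟨f χ, hfV χ⟩ : V)) := by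
    rw [linearIndependent_iff']
    intro s g hg i hi
    have h1 : ∑ χ ∈ s, g χ • f χ = 0 := by
      have := congrArg Subtype.val hg
      simpa using this
    let F : Module.Dual ℂ H → M := fun χ => if h : χ ∈ A then g ⟨χ, h⟩ • f ⟨χ, h⟩ else 0
    have h2 := sum_eq_zero_component (H := H) (M := M) (s := s.map (Function.Embedding.subtype _))
      (f := F) (fun χ hχ => ?_) ?_ i (Finset.mem_map_of_mem _ hi)
    · simp only [F, i.2, dif_pos, Subtype.coe_eta] at h2
      exact (smul_eq_zero.mp h2).resolve_right (hf0 i)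
    · dsimp only [F]
      split_ifs with h
      · exact Submodule.smul_mem _ _ (hf _)
      · exact Submodule.zero_mem _
    · rw [Finset.sum_map, ← h1]
      refine Finset.sum_congr rfl fun χ _ => ?_
      simp [F, χ.2]
  exact Set.finite_coe_iff.mp hli.finite_of_isNoetherian

/-- A locally finite subquotient contains singular vectors. -/
lemma NStable.exists_sing {V : Submodule ℂ M} (hV : D.NStable V) (S : Submodule (U L) M)
    {χ : Module.Dual ℂ D.H} {x : M} (hxV : x ∈ V) (hx : x ∈ weightSpace D.H M χ) (hxS : x ∉ S) :
    ∃ y ∈ V, y ∉ S ∧ ∃ γ, y ∈ weightSpace D.H M (χ + D.wt γ) ∧ D.Sing S (χ + D.wt γ) y := by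
  have := hV.1
  -- The set records the weights `χ + wt γ` occurring in `V` outside of `S`. It is finite, and at an
  -- element of maximal height every raising operator must lead into `S`.
  let A : Set (ℕ →₀ ℤ) := {γ | tot γ = 0 ∧ (∀ i ∉ D.dom, γ i = 0) ∧
    ∃ y ∈ V, y ∉ S ∧ y ∈ weightSpace D.H M (χ + D.wt γ)}
  have hA : A.Finite := by
    refine Set.Finite.of_finite_image ((finite_weights (H := D.H) V).subset ?_)
      (f := fun γ => χ + D.wt γ) ?_
    · rintro _ ⟨γ, ⟨-, -, y, hy, hyS, hyw⟩, rfl⟩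
      exact ⟨y, hy, hyw, fun h => hyS (h ▸ S.zero_mem)⟩
    · rintro γ ⟨h1, h2, -⟩ δ ⟨h3, h4, -⟩ h
      exact D.wt_inj h2 h4 (h1.trans h3.symm) (add_left_cancel h)
  have h0 : (0 : ℕ →₀ ℤ) ∈ A := ⟨by simp, by simp, x, hxV, hxS, by simpa using hx⟩
  obtain ⟨γ, hγ, hmax⟩ := hA.exists_maximalFor ht A ⟨0, h0⟩
  obtain ⟨ht0, hout, y, hyV, hyS, hy⟩ := hγ
  refine ⟨y, hyV, hyS, γ, hy, fun a => by rw [hy a, sub_self]; exact S.zero_mem, fun z hz => ?_⟩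
  refine D.N_le (V := intoSub (S.restrictScalars ℂ) y) (fun i j hj hij => ?_) hz
  by_contra hn
  have hi := D.dom_lt hij.le hj
  have hmem : root i j + γ ∈ A := by
    refine ⟨by rw [map_add, tot_root, ht0, add_zero], fun k hk => ?_, toU (D.E i j) • y,
      hV.2 _ (D.E_mem_N hj hij) y hyV, hn, ?_⟩
    · have h1 : k ≠ i := fun e => hk (e ▸ hi)
      have h2 : k ≠ j := fun e => hk (e ▸ hj)
      simp [hout k hk, root, Finsupp.single_eq_of_ne h1, Finsupp.single_eq_of_ne h2]
    · have := D.toU_E_mem_weightSpace hi hj hij.ne hy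
      convert this using 1
      rw [map_add]
      abel_nf
  have h1 := hmax hmem
  simp only [map_add, ht_root] at h1
  have h2 := h1 (by omega)
  omega

/-- The modules of category `𝒪` have finite filtrations by highest weight modules. -/
lemma exists_hwFilt (hM : IsWeightModule D.H M) (hN : IsLocallyFinite D.N M)
    (S : Submodule (U L) M) (hS : D.HwFilt Set.univ S) (x : M) :
    ∃ T : Submodule (U L) M, D.HwFilt Set.univ T ∧ S ≤ T ∧ x ∈ T := by
  classical
  have hw (χ : Module.Dual ℂ D.H) (x : M) (hx : x ∈ weightSpace D.H M χ)
      (S : Submodule (U L) M) (hS : D.HwFilt Set.univ S) :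
      ∃ T : Submodule (U L) M, D.HwFilt Set.univ T ∧ S ≤ T ∧ x ∈ T := by
    obtain ⟨V, hVf, hxV, hV⟩ := hN x
    have hVN : D.NStable V := ⟨hVf, hV⟩
    -- The codimension of `V ∩ S` in `V` drops with each singular vector of `V` that is added to
    -- `S`, so `x` is reached after finitely many steps.
    induction hn : Module.finrank ℂ V - Module.finrank ℂ (V ⊓ S.restrictScalars ℂ : Submodule ℂ M)
      using Nat.strong_induction_on generalizing S with
    | _ n ih =>
    by_cases hxS : x ∈ S
    · exact ⟨S, hS, le_rfl, hxS⟩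
    · obtain ⟨y, hyV, hyS, γ, -, hy⟩ := hVN.exists_sing S hxV hx hxS
      have hlt : Module.finrank ℂ (V ⊓ S.restrictScalars ℂ : Submodule ℂ M) < Module.finrank ℂ
          (V ⊓ (S ⊔ Submodule.span (U L) {y}).restrictScalars ℂ : Submodule ℂ M) := by
        have : FiniteDimensional ℂ
            (V ⊓ (S ⊔ Submodule.span (U L) {y}).restrictScalars ℂ : Submodule ℂ M) :=
          Submodule.finiteDimensional_of_le inf_le_left
        refine Submodule.finrank_lt_finrank_of_lt (lt_of_le_of_ne ?_ fun h => hyS ?_)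
        · exact inf_le_inf le_rfl fun z hz => Submodule.mem_sup_left hz
        · have : y ∈ V ⊓ (S ⊔ Submodule.span (U L) {y}).restrictScalars ℂ :=
            ⟨hyV, Submodule.mem_sup_right (Submodule.mem_span_singleton_self y)⟩
          rw [← h] at this
          exact this.2
      have hle : Module.finrank ℂ
          (V ⊓ (S ⊔ Submodule.span (U L) {y}).restrictScalars ℂ : Submodule ℂ M) ≤
          Module.finrank ℂ V := Submodule.finrank_mono inf_le_left
      obtain ⟨T, hT, hST, hxT⟩ := ih _ (by omega) _ (hS.step trivial hy) rfl
      exact ⟨T, hT, le_sup_left.trans hST, hxT⟩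
  obtain ⟨s, f, hf, rfl⟩ := hM.exists_sum x
  induction s using Finset.induction_on with
  | empty => exact ⟨S, hS, le_rfl, by simp⟩
  | insert a s ha ih =>
    obtain ⟨T, hT, hST, hx⟩ := ih
    obtain ⟨T', hT', hTT, hx'⟩ := hw a (f a) (hf a) T hT
    refine ⟨T', hT', hST.trans hTT, ?_⟩
    rw [Finset.sum_insert ha]
    exact T'.add_mem hx' (hTT hx)

lemma hwFilt_top_of_categoryO (h : categoryO D.H D.N M) :
    D.HwFilt Set.univ (⊤ : Submodule (U L) M) := by
  obtain ⟨hfg, hM, hN⟩ := h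
  obtain ⟨t, ht⟩ := hfg.fg_top
  have key : ∀ t : Finset M, ∃ T : Submodule (U L) M, D.HwFilt Set.univ T ∧ ∀ x ∈ t, x ∈ T := by
    classical
    intro t
    induction t using Finset.induction_on with
    | empty => exact ⟨⊥, .bot, by simp⟩
    | insert a s ha ih =>
      obtain ⟨T, hT, hs⟩ := ih
      obtain ⟨T', hT', hTT, hx'⟩ := exists_hwFilt hM hN T hT a
      refine ⟨T', hT', fun x hx => ?_⟩
      rcases Finset.mem_insert.mp hx with rfl | hx
      · exact hx'
      · exact hTT (hs x hx)
  obtain ⟨T, hT, htT⟩ := key t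
  have : (⊤ : Submodule (U L) M) ≤ T := by
    rw [← ht, Submodule.span_le]
    exact fun x hx => htT x hx
  rwa [eq_top_iff.mpr this] at hT

end SlData

end LocallyFinite

/-! ### Central elements of the enveloping algebra of `sl_n` -/

section Center

open scoped ModuleCat

/-- By the universal property the identity of `U L` factors through `T`. -/
lemma U_subalgebra_eq_top {L : Type} [LieRing L] [LieAlgebra ℂ L] (T : Subalgebra ℂ (U L))
    (h : ∀ x : L, toU x ∈ T) (a : U L) : a ∈ T := by
  let j : L →ₗ⁅ℂ⁆ T :=
    { toFun := fun x => ⟨toU x, h x⟩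
      map_add' := fun x y => Subtype.ext (by simp [toU])
      map_smul' := fun c x => Subtype.ext (by simp [toU])
      map_lie' := fun {x y} => Subtype.ext (LieHom.map_lie (UniversalEnvelopingAlgebra.ι ℂ) x y) }
  have key : T.val.comp (UniversalEnvelopingAlgebra.lift ℂ j) = AlgHom.id ℂ (U L) := by
    apply UniversalEnvelopingAlgebra.hom_ext
    ext x
    exact congrArg Subtype.val (UniversalEnvelopingAlgebra.lift_ι_apply ℂ j x)
  have h2 : ((UniversalEnvelopingAlgebra.lift ℂ j a : T) : U L) = a := DFunLike.congr_fun key a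
  exact h2 ▸ (UniversalEnvelopingAlgebra.lift ℂ j a).2

variable {n : ℕ}

/-- The projection of a matrix to its traceless part. -/
def traceless (n : ℕ) : Matrix (Fin n) (Fin n) ℂ →ₗ[ℂ] slFin n where
  toFun A := ⟨A - (A.trace / n) • (1 : Matrix (Fin n) (Fin n) ℂ), by
    change (A - (A.trace / n) • (1 : Matrix (Fin n) (Fin n) ℂ)).trace = 0
    rcases Nat.eq_zero_or_pos n with h | h
    · subst h; simp [Matrix.trace]
    · have : (n : ℂ) ≠ 0 := by exact_mod_cast h.ne'
      rw [Matrix.trace_sub, Matrix.trace_smul, Matrix.trace_one, Fintype.card_fin, smul_eq_mul,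
        div_mul_cancel₀ _ this, sub_self]⟩
  map_add' A B := Subtype.ext (by
    change A + B - _ = (A - _) + (B - _)
    rw [Matrix.trace_add, add_div, add_smul]; abel)
  map_smul' c A := Subtype.ext (by
    change c • A - _ = c • (A - _)
    rw [Matrix.trace_smul, smul_eq_mul, mul_div_assoc, mul_smul, smul_sub])

lemma traceless_coe (x : slFin n) : traceless n x.1 = x := Subtype.ext (by
  change x.1 - (x.1.trace / n) • (1 : Matrix (Fin n) (Fin n) ℂ) = x.1
  have h : x.1.trace = 0 := x.2
  rw [h, zero_div, zero_smul, sub_zero])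

lemma lie_traceless (x : slFin n) (A : Matrix (Fin n) (Fin n) ℂ) :
    ⁅x, traceless n A⁆ = traceless n (x.1 * A - A * x.1) := Subtype.ext (by
  change x.1 * (A - (A.trace / n) • (1 : Matrix (Fin n) (Fin n) ℂ)) -
    (A - (A.trace / n) • (1 : Matrix (Fin n) (Fin n) ℂ)) * x.1 =
    (x.1 * A - A * x.1) - ((x.1 * A - A * x.1).trace / n) • (1 : Matrix (Fin n) (Fin n) ℂ)
  rw [Matrix.trace_sub, Matrix.trace_mul_comm, sub_self, zero_div, zero_smul, mul_sub, sub_mul,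
    mul_smul_comm, smul_mul_assoc, mul_one, one_mul]
  abel)

/-- The matrix whose entries are the traceless parts of the matrix units. -/
def genMat (n : ℕ) : Matrix (Fin n) (Fin n) (U (slFin n)) :=
  Matrix.of fun i j => toU (traceless n (Matrix.single i j 1))

/-- Matrices over the enveloping algebra which transform like `genMat`. -/
def Equivariant (A : Matrix (Fin n) (Fin n) (U (slFin n))) : Prop :=
  ∀ (y : slFin n) i j, toU y * A i j - A i j * toU y =
    ∑ k, y.1 k i • A k j - ∑ k, y.1 j k • A i k

lemma equivariant_one : Equivariant (1 : Matrix (Fin n) (Fin n) (U (slFin n))) := by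
  intro y i j
  simp only [Matrix.one_apply]
  by_cases h : i = j
  · subst h; simp
  · simp [h]

lemma equivariant_genMat : Equivariant (genMat n) := by
  intro y i j
  have h1 := LieHom.map_lie (UniversalEnvelopingAlgebra.ι ℂ) y (traceless n (Matrix.single i j 1))
  rw [lie_traceless] at h1
  change _ = toU y * genMat n i j - genMat n i j * toU y at h1
  rw [← h1]
  have h2 : y.1 * Matrix.single i j 1 = ∑ k, y.1 k i • Matrix.single k j (1 : ℂ) := by
    ext a b
    rw [Matrix.sum_apply, Finset.sum_eq_single a]
    · by_cases hb : b = j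
      · subst hb; simp
      · simp [Matrix.mul_single_apply_of_ne _ _ _ _ _ hb, Matrix.single_apply_of_col_ne _ _ (Ne.symm hb)]
    · intro k _ hk
      simp [Matrix.single_apply_of_row_ne hk]
    · simp
  have h3 : Matrix.single i j 1 * y.1 = ∑ k, y.1 j k • Matrix.single i k (1 : ℂ) := by
    ext a b
    rw [Matrix.sum_apply, Finset.sum_eq_single b]
    · by_cases ha : a = i
      · subst ha; simp
      · simp [Matrix.single_mul_apply_of_ne _ _ _ _ _ ha, Matrix.single_apply_of_row_ne (Ne.symm ha)]
    · intro k _ hk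
      simp [Matrix.single_apply_of_col_ne _ _ hk]
    · simp
  rw [h2, h3, map_sub, map_sub, map_sum, map_sum, map_sum, map_sum]
  simp only [map_smul]
  rfl

/-- The commutator is a derivation, and the two contributions of the contracted index cancel. -/
lemma Equivariant.mul {A B : Matrix (Fin n) (Fin n) (U (slFin n))} (hA : Equivariant A)
    (hB : Equivariant B) : Equivariant (A * B) := by
  intro y i j
  have h1 : toU y * (A * B) i j - (A * B) i j * toU y =
      ∑ k, ((toU y * A i k - A i k * toU y) * B k j + A i k * (toU y * B k j - B k j * toU y)) := by
    rw [Matrix.mul_apply, Finset.mul_sum, Finset.sum_mul, ← Finset.sum_sub_distrib]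
    refine Finset.sum_congr rfl fun k _ => ?_
    noncomm_ring
  rw [h1]
  simp only [hA y, hB y, Matrix.mul_apply, sub_mul, mul_sub, Finset.sum_mul, Finset.mul_sum,
    Finset.smul_sum, smul_mul_assoc, mul_smul_comm, Finset.sum_add_distrib, Finset.sum_sub_distrib]
  rw [Finset.sum_comm (f := fun k l => y.1 l i • (A l k * B k j)),
    Finset.sum_comm (f := fun k l => y.1 k l • (A i l * B k j)),
    Finset.sum_comm (f := fun k l => y.1 j l • (A i k * B k l))]
  abel

lemma equivariant_pow (p : ℕ) : Equivariant (genMat n ^ p) := by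
  induction p with
  | zero => rw [pow_zero]; exact equivariant_one
  | succ p ih => rw [pow_succ]; exact ih.mul equivariant_genMat

/-- The Gelfand invariants. -/
def gelfand (n p : ℕ) : U (slFin n) := (genMat n ^ p).trace

/-- On the trace of an equivariant matrix the two sums in the commutator are the same double sum, so
the trace commutes with the generators of the enveloping algebra. -/
lemma gelfand_comm (p : ℕ) (a : U (slFin n)) : a * gelfand n p = gelfand n p * a := by
  let T : Subalgebra ℂ (U (slFin n)) := Subalgebra.centralizer ℂ {gelfand n p}
  have : a ∈ T := by
    refine U_subalgebra_eq_top T (fun y => ?_) a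
    rw [Subalgebra.mem_centralizer_iff]
    rintro _ rfl
    symm
    rw [← sub_eq_zero, gelfand, Matrix.trace, Finset.mul_sum, Finset.sum_mul,
      ← Finset.sum_sub_distrib]
    simp only [Matrix.diag_apply, equivariant_pow p y, Finset.sum_sub_distrib]
    rw [Finset.sum_comm, sub_self]
  rw [Subalgebra.mem_centralizer_iff] at this
  exact (this _ rfl).symm

/-- The diagonal entries of the powers of `genMat` on a highest weight vector. -/
def diagVal {n : ℕ} (l : Fin n → ℂ) : ℕ → Fin n → ℂ
  | 0, _ => 1
  | p + 1, i => l i * diagVal l p i + ∑ k ∈ Finset.Ioi i, (diagVal l p i - diagVal l p k)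

/-- The eigenvalues of the Gelfand invariants. -/
def gelfandVal {n : ℕ} (l : Fin n → ℂ) (p : ℕ) : ℂ := ∑ i, diagVal l p i

lemma traceless_single_mem (i : Fin n) : traceless n (Matrix.single i i 1) ∈ cartan n := by
  intro a b hab
  change (Matrix.single i i (1 : ℂ) - _ • (1 : Matrix (Fin n) (Fin n) ℂ)) a b = 0
  rw [Matrix.sub_apply, Matrix.smul_apply, Matrix.one_apply_ne hab, smul_zero, sub_zero,
    Matrix.single_apply, if_neg]
  rintro ⟨rfl, rfl⟩
  exact hab rfl

/-- The coordinates of a weight of `sl_n`, normalized so that their sum is zero. -/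
def coords (χ : Module.Dual ℂ (cartan n)) (i : Fin n) : ℂ :=
  χ ⟨traceless n (Matrix.single i i 1), traceless_single_mem i⟩

lemma traceless_single_of_ne {i j : Fin n} (h : i ≠ j) :
    (traceless n (Matrix.single i j 1)).1 = Matrix.single i j 1 := by
  change Matrix.single i j (1 : ℂ) - _ • (1 : Matrix (Fin n) (Fin n) ℂ) = _
  rw [Matrix.trace_single_eq_of_ne _ _ _ h, zero_div, zero_smul, sub_zero]

lemma genMat_smul_mem {M : Rep.{u} (slFin n)} {S : Submodule (U (slFin n)) M}
    {χ : Module.Dual ℂ (cartan n)} {v : M} (hv : (slFinData n).Sing S χ v) {i j : Fin n}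
    (h : i < j) : genMat n i j • v ∈ S := by
  refine hv.2 _ ?_
  intro a b hba
  rw [traceless_single_of_ne h.ne, Matrix.single_apply, if_neg]
  rintro ⟨rfl, rfl⟩
  exact absurd hba (not_le.mpr h)

/-- This is equivariance of `A` under the matrix unit with indices `i, k`, read at the entry `(k,
j)`. For `i < k` it moves the raising operator to the right, where it kills a highest weight vector.
-/
lemma genMat_comm {i k : Fin n} (hik : i ≠ k) (A : Matrix (Fin n) (Fin n) (U (slFin n)))
    (hA : Equivariant A) (j : Fin n) : genMat n i k * A k j = A k j * genMat n i k +
      (A i j - if i = j then A k k else 0) := by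
  have h := hA (traceless n (Matrix.single i k 1)) k j
  rw [traceless_single_of_ne hik] at h
  rw [sub_eq_iff_eq_add'] at h
  change toU _ * A k j = _
  rw [h]
  congr 2
  · rw [Finset.sum_eq_single i]
    · simp
    · intro b _ hb; simp [Matrix.single_apply_of_row_ne (Ne.symm hb)]
    · simp
  · by_cases hij : i = j
    · subst hij
      rw [if_pos rfl, Finset.sum_eq_single k]
      · simp
      · intro b _ hb; simp [Matrix.single_apply_of_col_ne _ _ (Ne.symm hb)]
      · simp
    · rw [if_neg hij]
      exact Finset.sum_eq_zero fun b _ => by simp [Matrix.single_apply_of_row_ne hij]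

/-- Modulo `S`, the powers act on the singular vector as lower triangular matrices. In the sum over
`k` for `genMat * genMat ^ p`, the terms with `k < j` vanish by induction, and in those with `k > j`
the raising operator is commuted to the right. On the diagonal the commutators produce the recursion
of `diagVal`. -/
lemma pow_genMat_smul {M : Rep.{u} (slFin n)} {S : Submodule (U (slFin n)) M}
    {χ : Module.Dual ℂ (cartan n)} {v : M} (hv : (slFinData n).Sing S χ v) (p : ℕ) :
    (∀ i j, i < j → (genMat n ^ p) i j • v ∈ S) ∧
      ∀ i, (genMat n ^ p) i i • v - diagVal (coords χ) p i • v ∈ S := by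
  induction p with
  | zero =>
    constructor
    · intro i j hij
      rw [pow_zero, Matrix.one_apply_ne hij.ne, zero_smul]
      exact S.zero_mem
    · intro i
      rw [pow_zero, Matrix.one_apply_eq, one_smul, diagVal, one_smul, sub_self]
      exact S.zero_mem
  | succ p ih =>
    obtain ⟨ih1, ih2⟩ := ih
    set A := genMat n ^ p with hA
    have hE : Equivariant A := equivariant_pow p
    have hdiag (x : U (slFin n)) (k : Fin n) (hx : x • v ∈ S) : x • A k k • v ∈ S := by
      have h1 := S.smul_mem x (ih2 k)
      rw [smul_sub, smul_comm x (diagVal (coords χ) p k)] at h1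
      have := S.add_mem h1 (Submodule.smul_of_tower_mem S (diagVal (coords χ) p k) hx)
      rwa [sub_add_cancel] at this
    constructor
    · intro i j hij
      rw [pow_succ', Matrix.mul_apply, Finset.sum_smul]
      refine S.sum_mem fun k _ => ?_
      rw [mul_smul]
      rcases lt_trichotomy k j with hk | hk | hk
      · exact S.smul_mem _ (ih1 k j hk)
      · subst hk
        exact hdiag _ _ (genMat_smul_mem hv hij)
      · rw [← mul_smul, genMat_comm (hij.trans hk).ne A hE, if_neg hij.ne, sub_zero, add_smul,
          mul_smul]
        exact S.add_mem (S.smul_mem _ (genMat_smul_mem hv (hij.trans hk))) (ih1 i j hij)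
    · intro i
      rw [pow_succ', Matrix.mul_apply, diagVal, Finset.sum_smul, add_smul, Finset.sum_smul]
      have hsplit : (Finset.univ : Finset (Fin n)) = Finset.Iio i ∪ insert i (Finset.Ioi i) := by
        ext k; simp [lt_or_ge]
      rw [hsplit, Finset.sum_union (by
        rw [Finset.disjoint_left]
        intro k hk hk'
        simp only [Finset.mem_Iio, Finset.mem_insert, Finset.mem_Ioi] at hk hk'
        omega), Finset.sum_insert (by simp), add_sub_assoc, add_sub_add_comm,
        ← Finset.sum_sub_distrib]
      refine S.add_mem (S.sum_mem fun k hk => ?_) (S.add_mem ?_ (S.sum_mem fun k hk => ?_))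
      · rw [mul_smul]
        exact S.smul_mem _ (ih1 k i (Finset.mem_Iio.mp hk))
      · have h1 := S.smul_mem (genMat n i i) (ih2 i)
        have h2 := Submodule.smul_of_tower_mem S (diagVal (coords χ) p i)
          (hv.1 ⟨traceless n (Matrix.single i i 1), traceless_single_mem i⟩)
        have h3 := S.add_mem h1 h2
        convert h3 using 1
        rw [smul_sub, smul_sub, mul_smul, smul_comm (genMat n i i) (diagVal (coords χ) p i),
          mul_comm (coords χ i), mul_smul]
        change _ = genMat n i i • A i i • v - diagVal (coords χ) p i • genMat n i i • v +
          (diagVal (coords χ) p i • genMat n i i • v - diagVal (coords χ) p i • coords χ i • v)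
        abel
      · have hik := Finset.mem_Ioi.mp hk
        rw [genMat_comm hik.ne A hE, if_pos rfl, add_smul, mul_smul, add_sub_assoc, sub_smul,
          sub_smul, sub_sub_sub_comm]
        exact S.add_mem (S.smul_mem _ (genMat_smul_mem hv hik)) (S.sub_mem (ih2 i) (ih2 k))

/-- The Gelfand invariants act on highest weight vectors by scalars. -/
lemma gelfand_smul {M : Rep.{u} (slFin n)} {S : Submodule (U (slFin n)) M}
    {χ : Module.Dual ℂ (cartan n)} {v : M} (hv : (slFinData n).Sing S χ v) (p : ℕ) :
    gelfand n p • v - gelfandVal (coords χ) p • v ∈ S := by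
  rw [gelfand, gelfandVal, Matrix.trace, Finset.sum_smul, Finset.sum_smul,
    ← Finset.sum_sub_distrib]
  exact S.sum_mem fun i _ => (pow_genMat_smul hv p).2 i

end Center

/-! ### Central characters -/

section CentralCharacter

open PowerSeries in
/-- The generating function of the eigenvalues of the Gelfand invariants. -/
lemma prod_mul_gelfandVal {n : ℕ} (l : Fin n → ℂ) :
    (∏ i, (1 - C (l i + (i.rev : ℕ)) * X)) * (1 - X * PowerSeries.mk (gelfandVal l)) =
      ∏ i, (1 - C (l i + (i.rev : ℕ) + 1) * (X : ℂ⟦X⟧)) := by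
  induction n with
  | zero =>
    have : PowerSeries.mk (gelfandVal l) = 0 := by
      ext p; simp [gelfandVal]
    simp [this]
  | succ n ih =>
    -- The recursion at an index involves only larger indices, so the first coordinate can be split
    -- off.
    have hs : ∀ p i, diagVal l p (Fin.succ i) = diagVal (fun j => l j.succ) p i := by
      intro p
      induction p with
      | zero => intro i; rfl
      | succ p ihp =>
        intro i
        rw [diagVal, diagVal, Fin.sum_Ioi_succ]
        simp only [ihp]
    set B : ℂ⟦X⟧ := PowerSeries.mk fun p => diagVal l p 0 with hB
    set G : ℂ⟦X⟧ := PowerSeries.mk (gelfandVal fun j : Fin n => l j.succ) with hG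
    have h1 : PowerSeries.mk (gelfandVal l) = B + G := by
      ext p
      simp only [hB, hG, coeff_mk, map_add, gelfandVal, Fin.sum_univ_succ, hs]
    -- The recursion for the index `0`, summed as a power series: there are `n` larger indices,
    -- whence the shift `l 0 + n`, and their values add up to the invariants of the tail.
    have h2 : (1 - C (l 0 + n) * X) * B = 1 - X * G := by
      have h3 : B = 1 + X * (C (l 0 + n) * B - G) := by
        ext p
        cases p with
        | zero => simp [hB, diagVal]
        | succ p =>
          rw [map_add, coeff_succ_X_mul, map_sub, coeff_C_mul, coeff_one, if_neg (by omega),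
            zero_add, hB, hG, coeff_mk, coeff_mk, coeff_mk, diagVal, Fin.sum_Ioi_zero,
            Finset.sum_sub_distrib]
          simp only [hs, gelfandVal, Finset.sum_const, Finset.card_univ, Fintype.card_fin,
            nsmul_eq_mul]
          ring
      linear_combination h3
    rw [Fin.prod_univ_succ, Fin.prod_univ_succ, h1]
    have hr0 : (((0 : Fin (n + 1)).rev : ℕ) : ℂ) = n := by simp
    have hrs (i : Fin n) : ((i.succ.rev : Fin (n + 1)) : ℕ) = (i.rev : ℕ) := by
      simp [Fin.val_rev]
    simp only [hr0, hrs]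
    have h4 := ih (fun j => l j.succ)
    rw [← hG] at h4
    rw [← h4]
    have h5 : (C (l 0 + n + 1) : ℂ⟦X⟧) = C (l 0 + n) + 1 := by rw [map_add, map_one]
    rw [h5]
    linear_combination (-(X : ℂ⟦X⟧)) * (∏ i : Fin n, (1 - C (l i.succ + (i.rev : ℕ)) * X)) * h2

/-- The products in `prod_mul_gelfandVal` depend only on the multiset of the shifted coordinates `l
i + rev i`, where `rev i = n - 1 - i` plays the role of `ρ`; the first product can be cancelled. -/
lemma gelfandVal_congr {n : ℕ} {l l' : Fin n → ℂ} (σ : Equiv.Perm (Fin n))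
    (h : ∀ i, l i + (i.rev : ℕ) = l' (σ i) + ((σ i).rev : ℕ)) (p : ℕ) :
    gelfandVal l p = gelfandVal l' p := by
  have h1 := prod_mul_gelfandVal l
  have h2 := prod_mul_gelfandVal l'
  simp only [h] at h1
  rw [Equiv.prod_comp σ (fun i => 1 - PowerSeries.C (l' i + (i.rev : ℕ)) * PowerSeries.X),
    Equiv.prod_comp σ (fun i => 1 - PowerSeries.C (l' i + (i.rev : ℕ) + 1) * PowerSeries.X),
    ← h2] at h1
  have h0 : (∏ i : Fin n, (1 - PowerSeries.C (l' i + (i.rev : ℕ)) * PowerSeries.X)) ≠ 0 := by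
    rw [Finset.prod_ne_zero_iff]
    intro i _ h0
    have := congrArg (PowerSeries.constantCoeff (R := ℂ)) h0
    simp at this
  have h3 := mul_left_cancel₀ h0 h1
  rw [sub_right_inj] at h3
  have h4 := mul_left_cancel₀ PowerSeries.X_ne_zero h3
  have := congrArg (PowerSeries.coeff p) h4
  simpa using this

open Polynomial in
/-- The zeros of a polynomial `P` are determined by the quotient `P (X - 1) / P (X)`. -/
lemma multiset_eq_of_shift {n : ℕ} (m m' : Fin n → ℂ)
    (h : ∀ z : ℂ, z ≠ 0 → (∏ i, (z - m i)) * (∏ i, (z - (m' i + 1))) =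
      (∏ i, (z - (m i + 1))) * ∏ i, (z - m' i)) :
    Finset.univ.val.map m = Finset.univ.val.map m' := by
  let P : ℂ[X] := ∏ i, (X - C (m i))
  let Q : ℂ[X] := ∏ i, (X - C (m' i))
  obtain ⟨R, hR⟩ : ∃ R : ℝ, 0 < R ∧ ∀ i, ‖m i‖ < R ∧ ‖m' i‖ < R := by
    refine ⟨1 + ∑ i, (‖m i‖ + ‖m' i‖), by positivity, fun i => ?_⟩
    have h1 := Finset.single_le_sum (f := fun i => ‖m i‖ + ‖m' i‖)
      (fun i _ => by positivity) (Finset.mem_univ i)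
    have h2 := norm_nonneg (m i)
    have h3 := norm_nonneg (m' i)
    constructor <;> linarith
  -- Points one step apart, running to the left from beyond all zeros of `P` and `Q`.
  let z (j : ℕ) : ℂ := -((R + j : ℝ) : ℂ)
  have hz (j : ℕ) : R ≤ ‖z j‖ := by
    simp only [z, norm_neg, Complex.norm_real, Real.norm_eq_abs]
    rw [abs_of_nonneg (by have := hR.1; positivity)]
    simp
  have hz0 (j : ℕ) : z j ≠ 0 := fun h0 => by
    have := hz j; rw [h0, norm_zero] at this; linarith [hR.1]
  have hQ (j : ℕ) : Q.eval (z j) ≠ 0 := by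
    simp only [Q, eval_prod, eval_sub, eval_X, eval_C]
    rw [Finset.prod_ne_zero_iff]
    intro i _ h0
    have := hz j
    rw [sub_eq_zero.mp h0] at this
    linarith [(hR.2 i).2]
  -- The hypothesis says that `P / Q` takes the same value at consecutive points; being constant on
  -- an infinite set, it is constant.
  have hshift (j : ℕ) : P.eval (z j) * Q.eval (z (j + 1)) = P.eval (z (j + 1)) * Q.eval (z j) := by
    have := h (z j) (hz0 j)
    have e : z (j + 1) = z j - 1 := by simp [z]; ring
    simp only [P, Q, eval_prod, eval_sub, eval_X, eval_C, e]
    simpa only [sub_sub, add_comm] using this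
  have hc (j : ℕ) : P.eval (z j) * Q.eval (z 0) = P.eval (z 0) * Q.eval (z j) := by
    induction j with
    | zero => rfl
    | succ j ih =>
      refine mul_right_cancel₀ (hQ j) ?_
      linear_combination (-Q.eval (z 0)) * hshift j + Q.eval (z (j + 1)) * ih
  have hPQ : C (Q.eval (z 0)) * P = C (P.eval (z 0)) * Q := by
    refine Polynomial.eq_of_infinite_eval_eq _ _ ?_
    refine Set.Infinite.mono (s := Set.range z) ?_ (Set.infinite_range_of_injective ?_)
    · rintro _ ⟨j, rfl⟩
      simp only [Set.mem_ofPred_eq, eval_mul, eval_C]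
      linear_combination hc j
    · intro a b hab
      simpa [z] using hab
  have hmP : P.Monic := monic_prod_of_monic _ _ fun i _ => monic_X_sub_C _
  have hmQ : Q.Monic := monic_prod_of_monic _ _ fun i _ => monic_X_sub_C _
  have hlead := congrArg leadingCoeff hPQ
  rw [leadingCoeff_mul, leadingCoeff_mul, leadingCoeff_C, leadingCoeff_C, hmP.leadingCoeff,
    hmQ.leadingCoeff, mul_one, mul_one] at hlead
  rw [← hlead] at hPQ
  have hPQ' : P = Q := mul_left_cancel₀ (C_ne_zero.mpr (hQ 0)) hPQ
  have hroots (f : Fin n → ℂ) : (∏ i, (X - C (f i))).roots = Finset.univ.val.map f := by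
    have := Polynomial.roots_multiset_prod_X_sub_C (Finset.univ.val.map f)
    rw [Multiset.map_map] at this
    exact this
  rw [← hroots, ← hroots]
  exact congrArg roots hPQ'

/-- Equal eigenvalues give equal quotients of the two products in `prod_mul_gelfandVal`. Evaluated
at `z⁻¹` and cleared of denominators, this is the hypothesis of `multiset_eq_of_shift`. -/
lemma multiset_eq_of_gelfandVal {n : ℕ} {l l' : Fin n → ℂ}
    (h : ∀ p, gelfandVal l p = gelfandVal l' p) :
    Finset.univ.val.map (fun i => l i + ((i.rev : ℕ) : ℂ)) =
      Finset.univ.val.map (fun i => l' i + ((i.rev : ℕ) : ℂ)) := by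
  apply multiset_eq_of_shift
  have h1 := prod_mul_gelfandVal l
  have h2 := prod_mul_gelfandVal l'
  rw [show gelfandVal l = gelfandVal l' from funext h] at h1
  set m := fun i => l i + ((i.rev : ℕ) : ℂ)
  set m' := fun i => l' i + ((i.rev : ℕ) : ℂ)
  have h3 : (∏ i, (1 - PowerSeries.C (m i) * PowerSeries.X)) *
      (∏ i, (1 - PowerSeries.C (m' i + 1) * PowerSeries.X)) =
      (∏ i, (1 - PowerSeries.C (m i + 1) * PowerSeries.X)) *
      ∏ i, (1 - PowerSeries.C (m' i) * (PowerSeries.X : PowerSeries ℂ)) := by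
    rw [← h1, ← h2]; ring
  have h4 : (∏ i, (1 - Polynomial.C (m i) * Polynomial.X)) *
      (∏ i, (1 - Polynomial.C (m' i + 1) * Polynomial.X)) =
      (∏ i, (1 - Polynomial.C (m i + 1) * Polynomial.X)) *
      ∏ i, (1 - Polynomial.C (m' i) * (Polynomial.X : Polynomial ℂ)) := by
    apply Polynomial.coe_injective
    have hcoe (f : Fin n → ℂ) : ((∏ i, (1 - Polynomial.C (f i) * Polynomial.X) : Polynomial ℂ) :
        PowerSeries ℂ) = ∏ i, (1 - PowerSeries.C (f i) * PowerSeries.X) := by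
      rw [← Polynomial.coeToPowerSeries.ringHom_apply, map_prod]
      simp [Polynomial.coeToPowerSeries.ringHom_apply]
    rw [Polynomial.coe_mul, Polynomial.coe_mul, hcoe, hcoe, hcoe, hcoe]
    exact h3
  intro z hz
  have h5 := congrArg (Polynomial.eval z⁻¹) h4
  simp only [Polynomial.eval_mul, Polynomial.eval_prod, Polynomial.eval_sub, Polynomial.eval_one,
    Polynomial.eval_C, Polynomial.eval_X] at h5
  have hprod (f : Fin n → ℂ) : ∏ i, (z - f i) = z ^ n * ∏ i, (1 - f i * z⁻¹) := by
    rw [← Fin.prod_const, ← Finset.prod_mul_distrib]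
    refine Finset.prod_congr rfl fun i _ => ?_
    field_simp
  rw [hprod, hprod, hprod, hprod]
  linear_combination z ^ n * z ^ n * h5

/-- The integral weights in the dot orbit of zero under the finitary symmetric group. -/
def Linked (a : ℕ →₀ ℤ) : Prop := ∃ σ : Equiv.Perm ℕ, ∀ i : ℕ, a i = i - σ i

lemma Linked.zero : Linked 0 := ⟨1, fun i => by simp⟩

lemma sum_le_sum_image (s : Finset ℕ) : ∑ i ∈ Finset.range s.card, i ≤ ∑ i ∈ s, i := by
  induction s using Finset.strongInduction with
  | H s ih =>
    rcases s.eq_empty_or_nonempty with rfl | hs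
    · simp
    · have hm := s.max'_mem hs
      have h1 := ih _ (Finset.erase_ssubset hm)
      rw [Finset.card_erase_of_mem hm] at h1
      rw [← Finset.add_sum_erase _ _ hm]
      have hc := Finset.card_pos.mpr hs
      obtain ⟨c, hc'⟩ : ∃ c, s.card = c + 1 := ⟨s.card - 1, by omega⟩
      rw [hc', Finset.sum_range_succ]
      rw [hc', Nat.add_sub_cancel] at h1
      have h2 : s ⊆ Finset.range (s.max' hs + 1) := fun x hx =>
        Finset.mem_range.mpr (Nat.lt_succ_of_le (s.le_max' x hx))
      have h3 := Finset.card_le_card h2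
      rw [Finset.card_range, hc'] at h3
      omega

/-- The first `n` values of `σ` are distinct natural numbers, so their sum is at least `0 + 1 + ⋯ +
(n - 1)`. -/
lemma hd_le_zero_aux {a : ℕ →₀ ℤ} {σ : Equiv.Perm ℕ} (h : ∀ i : ℕ, a i = i - σ i) (n : ℕ) :
    hd n a ≤ 0 := by
  have h1 := sum_le_sum_image ((Finset.range n).map σ.toEmbedding)
  rw [Finset.card_map, Finset.card_range, Finset.sum_map] at h1
  rw [hd_apply, Finset.sum_congr rfl fun i _ => h i, Finset.sum_sub_distrib]
  have h2 : ((∑ i ∈ Finset.range n, i : ℕ) : ℤ) ≤ (∑ i ∈ Finset.range n, σ i : ℕ) := by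
    exact_mod_cast h1
  push_cast at h2
  linarith

lemma Linked.hd_nonpos {a : ℕ →₀ ℤ} (h : Linked a) (n : ℕ) : hd n a ≤ 0 := by
  obtain ⟨σ, hσ⟩ := h
  exact hd_le_zero_aux hσ n

lemma perm_lt {σ : Equiv.Perm ℕ} {n : ℕ} (h : ∀ i, n ≤ i → σ i = i) {i : ℕ} (hi : i < n) :
    σ i < n := by
  by_contra hc
  have h1 := σ.injective (h _ (not_lt.mp hc))
  omega

/-- Beyond the support of `a` the permutation fixes every index, so it permutes an initial segment
and preserves the sum over it. -/
lemma Linked.tot_eq {a : ℕ →₀ ℤ} (h : Linked a) : tot a = 0 := by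
  obtain ⟨n, hn⟩ := exists_bound a
  obtain ⟨σ, hσ⟩ := h
  have hfix : ∀ i, n ≤ i → σ i = i := fun i hi => by
    have := hσ i
    rw [hn i hi] at this
    omega
  rw [← hd_eq_tot hn, hd_apply, Finset.sum_congr rfl fun i _ => hσ i, Finset.sum_sub_distrib,
    sub_eq_zero]
  symm
  refine Finset.sum_bij (fun i _ => σ i) (fun i hi => ?_) (fun _ _ _ _ h => σ.injective h)
    (fun j hj => ?_) (fun _ _ => rfl)
  · exact Finset.mem_range.mpr (perm_lt hfix (Finset.mem_range.mp hi))
  · refine ⟨σ.symm j, ?_, σ.apply_symm_apply j⟩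
    have hfix' : ∀ i, n ≤ i → σ.symm i = i := fun i hi => by
      rw [Equiv.symm_apply_eq, hfix i hi]
    exact Finset.mem_range.mpr (perm_lt hfix' (Finset.mem_range.mp hj))

/-- There are finitely many linked weights with bounded support. -/
lemma finite_linked (n : ℕ) : {a : ℕ →₀ ℤ | Linked a ∧ ∀ i, n ≤ i → a i = 0}.Finite := by
  refine Set.Finite.of_finite_image (f := fun a (i : Fin n) => a i)
    (Set.Finite.subset (Set.Finite.pi' fun i : Fin n => Set.finite_Icc (-(n : ℤ)) n) ?_) ?_
  · rintro _ ⟨a, ⟨⟨σ, hσ⟩, hn⟩, rfl⟩ i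
    have hfix : ∀ i, n ≤ i → σ i = i := fun i hi => by
      have := hσ i
      rw [hn i hi] at this
      omega
    have := perm_lt hfix i.2
    have h1 := hσ i
    have h2 := i.2
    change -(n : ℤ) ≤ a i ∧ a i ≤ n
    omega
  · rintro a ⟨-, ha⟩ b ⟨-, hb⟩ h
    ext i
    by_cases hi : i < n
    · exact congrFun h ⟨i, hi⟩
    · rw [ha i (by omega), hb i (by omega)]

namespace SlData

variable {L : Type} [LieRing L] [LieAlgebra ℂ L] (D : SlData L)

/-- The weights linked to zero. -/
def lnk : Set (Module.Dual ℂ D.H) :=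
  {χ | ∃ a, Linked a ∧ (∀ i ∉ D.dom, a i = 0) ∧ χ = D.wt a}

end SlData

variable {n : ℕ}

/-- `coords` evaluates at traceless parts of diagonal units; the correction by the trace is a
multiple of `tot a`, hence zero. -/
lemma coords_wt (a : ℕ →₀ ℤ) (ht : tot a = 0) (ha : ∀ i, n ≤ i → a i = 0) (i : Fin n) :
    coords ((slFinData n).wt a) i = a i := by
  change (slFinData n).wt a ⟨_, _⟩ = _
  rw [SlData.wt_apply, Finsupp.sum, LinearMap.sum_apply]
  have h1 : ∀ k ∈ a.support, (a k • (slFinData n).ε k)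
      ⟨traceless n (Matrix.single i i 1), traceless_single_mem i⟩ =
      (a k : ℂ) * ((if k = i then 1 else 0) - 1 / n) := by
    intro k hk
    have hkn : k < n := by
      by_contra hc
      exact (Finsupp.mem_support_iff.mp hk) (ha k (by omega))
    have h2 : (slFinData n).ε k = eps ⟨k, hkn⟩ := dif_pos hkn
    rw [LinearMap.smul_apply, zsmul_eq_mul, h2]
    congr 1
    change (Matrix.single i i (1 : ℂ) - ((Matrix.single i i (1 : ℂ)).trace / n) •
      (1 : Matrix (Fin n) (Fin n) ℂ)) ⟨k, hkn⟩ ⟨k, hkn⟩ = _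
    rw [Matrix.sub_apply, Matrix.smul_apply, Matrix.one_apply_eq, Matrix.trace_single_eq_same,
      Matrix.single_apply, smul_eq_mul, mul_one]
    congr 1
    by_cases hki : k = i
    · rw [if_pos hki, if_pos]
      exact ⟨Fin.ext hki.symm, Fin.ext hki.symm⟩
    · rw [if_neg hki, if_neg]
      rintro ⟨h, -⟩
      exact hki (congrArg Fin.val h).symm
  rw [Finset.sum_congr rfl h1]
  simp only [mul_sub, Finset.sum_sub_distrib, mul_ite, mul_one, mul_zero]
  rw [← Finset.sum_mul]
  have h3 : (∑ k ∈ a.support, (a k : ℂ)) = 0 := by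
    rw [tot_apply, Finsupp.sum] at ht
    exact_mod_cast ht
  rw [h3, zero_mul, sub_zero, Finset.sum_ite_eq']
  split_ifs with h
  · rfl
  · rw [Finsupp.notMem_support_iff.mp h, Int.cast_zero]

/-- The value of a weight is determined by its coordinates. -/
lemma weight_ext {χ ψ : Module.Dual ℂ (cartan n)} (h : ∀ i, coords χ i = coords ψ i) : χ = ψ := by
  ext x
  have hx : x = ∑ i, (x : slFin n).1 i i •
      (⟨traceless n (Matrix.single i i 1), traceless_single_mem i⟩ : cartan n) := by
    apply Subtype.ext
    have h1 : (x : slFin n) = traceless n (∑ i, (x : slFin n).1 i i • Matrix.single i i 1) := by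
      conv_lhs => rw [← traceless_coe (x : slFin n)]
      congr 1
      ext a b
      rw [Matrix.sum_apply]
      by_cases hab : a = b
      · subst hab
        rw [Finset.sum_eq_single a]
        · simp
        · intro k _ hk
          simp [Matrix.single_apply_of_row_ne hk]
        · simp
      · rw [x.2 a b hab]
        symm
        refine Finset.sum_eq_zero fun k _ => ?_
        rw [Matrix.smul_apply, Matrix.single_apply, if_neg, smul_zero]
        rintro ⟨rfl, rfl⟩
        exact hab rfl
    have h2 (c : Fin n → ℂ) (g : Fin n → cartan n) :
        ((∑ i, c i • g i : cartan n) : slFin n) = ∑ i, c i • (g i : slFin n) := by simp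
    rw [h2]
    conv_lhs => rw [h1, map_sum]
    exact Finset.sum_congr rfl fun i _ => map_smul _ _ _
  rw [hx, map_sum, map_sum]
  refine Finset.sum_congr rfl fun i _ => ?_
  rw [map_smul, map_smul]
  exact congrArg _ (h i)

/-- With `a i = i - σ i`, the shifted coordinate `a i + (n - 1 - i)` is `n - 1 - σ i`, which is the
shifted coordinate of the weight zero at `σ i`. -/
lemma gelfandVal_linked {a : ℕ →₀ ℤ} (h : Linked a) (ha : ∀ i, n ≤ i → a i = 0) (p : ℕ) :
    gelfandVal (coords ((slFinData n).wt a)) p = gelfandVal (fun _ : Fin n => (0 : ℂ)) p := by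
  have ht := h.tot_eq
  obtain ⟨σ, hσ⟩ := h
  have hfix : ∀ i, n ≤ i → σ i = i := fun i hi => by
    have := hσ i
    rw [ha i hi] at this
    omega
  have hfix' : ∀ i, n ≤ i → σ.symm i = i := fun i hi => by
    rw [Equiv.symm_apply_eq, hfix i hi]
  let τ : Equiv.Perm (Fin n) :=
    { toFun := fun i => ⟨σ i, perm_lt hfix i.2⟩
      invFun := fun i => ⟨σ.symm i, perm_lt hfix' i.2⟩
      left_inv := fun i => Fin.ext (σ.symm_apply_apply i)
      right_inv := fun i => Fin.ext (σ.apply_symm_apply i) }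
  refine gelfandVal_congr τ (fun i => ?_) p
  rw [coords_wt a ht ha, hσ, Fin.val_rev, Fin.val_rev]
  have h1 := i.2
  have h2 := (τ i).2
  change _ = (0 : ℂ) + ((n - (σ i + 1) : ℕ) : ℂ)
  have h2 := perm_lt hfix i.2
  rw [Nat.cast_sub (by omega), Nat.cast_sub (by omega)]
  push_cast
  ring

/-- A weight with the central character of the trivial module is linked to zero. -/
lemma mem_lnk_of_gelfandVal {χ : Module.Dual ℂ (cartan n)}
    (h : ∀ p, gelfandVal (coords χ) p = gelfandVal (fun _ : Fin n => (0 : ℂ)) p) :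
    χ ∈ (slFinData n).lnk := by
  have h1 := multiset_eq_of_gelfandVal h
  -- Equality of the multisets matches each shifted coordinate of `χ` with one of zero. As the
  -- latter are distinct, so are the former, and the matching is a permutation.
  have h0 (i : Fin n) : ∃ j : Fin n, (0 : ℂ) + ((j.rev : ℕ) : ℂ) = coords χ i + ((i.rev : ℕ) : ℂ) := by
    have := Multiset.mem_map_of_mem (fun i => coords χ i + ((i.rev : ℕ) : ℂ)) (Finset.mem_univ_val i)
    rw [h1] at this
    obtain ⟨j, -, hj⟩ := Multiset.mem_map.mp this
    exact ⟨j, hj⟩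
  choose τ₀ hτ₀ using h0
  have hg : Function.Injective fun i : Fin n => (0 : ℂ) + ((i.rev : ℕ) : ℂ) := fun i j hij => by
    simpa [Fin.rev_inj, Fin.val_inj] using hij
  have hf : Function.Injective fun i : Fin n => coords χ i + ((i.rev : ℕ) : ℂ) := by
    have h2 : (Finset.univ.val.map fun i : Fin n => coords χ i + ((i.rev : ℕ) : ℂ)).Nodup := by
      rw [h1]
      exact Finset.univ.nodup.map hg
    intro i j hij
    exact Multiset.inj_on_of_nodup_map h2 i (Finset.mem_univ_val i) j (Finset.mem_univ_val j) hij
  have hτi : Function.Injective τ₀ := fun i j hij => hf (by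
    change coords χ i + _ = coords χ j + _
    rw [← hτ₀ i, ← hτ₀ j, hij])
  let τ : Equiv.Perm (Fin n) := Equiv.ofBijective τ₀ (Finite.injective_iff_bijective.mp hτi)
  -- The permutation is continued by the identity from `n` on.
  let σ : Equiv.Perm ℕ := τ.extendDomain (Fin.equivSubtype (n := n))
  have hσ (i : Fin n) : σ i = τ i := by
    have := Equiv.Perm.extendDomain_apply_image τ (Fin.equivSubtype (n := n)) i
    exact this
  have hσ' (i : ℕ) (hi : n ≤ i) : σ i = i :=
    Equiv.Perm.extendDomain_apply_not_subtype _ _ (by omega)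
  let a : ℕ →₀ ℤ := Finsupp.onFinset (Finset.range n) (fun i => i - σ i) (fun i hi => by
    rw [Finset.mem_range]
    by_contra hc
    rw [hσ' i (by omega)] at hi
    simp at hi)
  have ha : Linked a := ⟨σ, fun i => rfl⟩
  have ha0 : ∀ i, n ≤ i → a i = 0 := fun i hi => by
    change (i : ℤ) - σ i = 0
    rw [hσ' i hi, sub_self]
  refine ⟨a, ha, fun i hi => ha0 i (not_lt.mp hi), weight_ext fun i => ?_⟩
  rw [coords_wt a ha.tot_eq ha0]
  have h2 : coords χ i + _ = (0 : ℂ) + (((τ i).rev : ℕ) : ℂ) := (hτ₀ i).symm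
  change _ = (((i : ℕ) - (σ i : ℕ) : ℤ) : ℂ)
  rw [hσ, eq_sub_of_add_eq h2, Fin.val_rev, Fin.val_rev, Nat.cast_sub (by omega),
    Nat.cast_sub (by omega)]
  push_cast
  ring

end CentralCharacter

/-! ### Restriction to the subalgebras `sl_m` -/

section Levels

open scoped ModuleCat

/-- The restriction of a module along a homomorphism of Lie algebras. -/
abbrev res {L : Type} [LieRing L] [LieAlgebra ℂ L] {L' : Type} [LieRing L'] [LieAlgebra ℂ L']
    (f : L' →ₗ⁅ℂ⁆ L) (M : Rep.{u} L) : Rep.{u} L' :=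
  (ModuleCat.restrictScalars (mapU f).toRingHom).obj M

section Res

variable {L : Type} [LieRing L] [LieAlgebra ℂ L] {L' : Type} [LieRing L'] [LieAlgebra ℂ L']

lemma res_smul (f : L' →ₗ⁅ℂ⁆ L) {M : Rep.{u} L} (a : U L') (v : res f M) :
    a • v = (show res f M from mapU f a • (show M from v)) := rfl

lemma res_toU_smul (f : L' →ₗ⁅ℂ⁆ L) {M : Rep.{u} L} (x : L') (v : res f M) :
    toU x • v = (show res f M from toU (f x) • (show M from v)) := by
  rw [res_smul, mapU_toU]

lemma res_csmul (f : L' →ₗ⁅ℂ⁆ L) {M : Rep.{u} L} (c : ℂ) (v : res f M) :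
    c • v = (show res f M from c • (show M from v)) := by
  have h1 : c • v = algebraMap ℂ (U L') c • v := (algebraMap_smul (U L') c v).symm
  have h2 : c • (show M from v) = algebraMap ℂ (U L) c • (show M from v) :=
    (algebraMap_smul (U L) c (show M from v)).symm
  rw [h1, res_smul, h2, AlgHom.commutes]

/-- A submodule as a submodule of the restriction. -/
def resSub (f : L' →ₗ⁅ℂ⁆ L) {M : Rep.{u} L} (S : Submodule (U L) M) :
    Submodule (U L') (res f M) where
  carrier := {v | (show M from v) ∈ S}
  add_mem' ha hb := S.add_mem ha hb
  zero_mem' := S.zero_mem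
  smul_mem' a _ hv := S.smul_mem (mapU f a) hv

end Res

variable {L : Type} [LieRing L] [LieAlgebra ℂ L]

/-- An embedding of `sl_m` in `L` as the subalgebra on the first `m` indices. -/
structure Level (D : SlData L) (m : ℕ) where
  ι : slFin m →ₗ⁅ℂ⁆ L
  mem_dom : ∀ {i}, i < m → i ∈ D.dom
  ι_E : ∀ {i j}, i < m → j < m → i ≠ j → ι (finE m i j) = D.E i j
  ι_H : ∀ x : cartan m, ι (x : slFin m) ∈ D.H
  ε_ι : ∀ (x : cartan m) (i : ℕ), D.ε i ⟨ι (x : slFin m), ι_H x⟩ = finEps m i x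
  lie_ι : ∀ h : D.H, ∃ x : cartan m, ∀ y : slFin m, ⁅(h : L), ι y⁆ = ⁅ι (x : slFin m), ι y⁆

/-- Every index below `k` is an index below `m`. -/
def SlData.Adm (D : SlData L) (k m : ℕ) : Prop := k ≤ m ∨ ∀ i ∈ D.dom, i < m

/-- An exhausting family of subalgebras `sl_m`. -/
structure Levels (D : SlData L) where
  lev : Set ℕ
  level : ∀ m ∈ lev, Level D m
  nested : ∀ {m m'} (hm : m ∈ lev) (hm' : m' ∈ lev), m ≤ m' →
    ∀ x, ∃ y, (level m hm).ι x = (level m' hm').ι y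
  exhaust : ∀ k, ∃ m ∈ lev, D.Adm k m

/-- The second alternative of `Adm` is meant for `sl_n`: its only level is `m = n`, which may be
smaller than `k` but exhausts `dom`. -/
lemma SlData.Adm.apply_eq_zero {D : SlData L} {k m : ℕ} (h : D.Adm k m) {a : ℕ →₀ ℤ}
    (ha : ∀ i ∉ D.dom, a i = 0) (hk : ∀ i, k ≤ i → a i = 0) (i : ℕ) (hi : m ≤ i) : a i = 0 := by
  rcases h with h | h
  · exact hk i (h.trans hi)
  · exact ha i fun hd => absurd (h i hd) (not_lt.mpr hi)

/-- The weights in the root lattice of `sl_m`. -/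
def SlData.InLat (D : SlData L) (m : ℕ) (χ : Module.Dual ℂ D.H) : Prop :=
  ∃ a : ℕ →₀ ℤ, (∀ i, m ≤ i → a i = 0) ∧ tot a = 0 ∧ χ = D.wt a

/-- The letters of a word are bounded in terms of its weight. -/
lemma SlData.Desc.bounded {D : SlData L} {M : Rep.{u} L} {v x : M} {P : ℕ → ℕ → Prop} {β : ℕ →₀ ℤ}
    {m : ℕ} (h : D.Desc v P β x) (hβ : ∀ n, m ≤ n → hd n β = 0) :
    D.Desc v (fun i _ => i < m) β x := by
  induction h with
  | base => exact .base
  | @step i j β x hi hij hP h ih =>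
    -- Partial sums of the letters are nonnegative, so a vanishing total forces each summand to
    -- vanish.
    have h1 (n : ℕ) (hn : m ≤ n) : hd n β = 0 ∧ hd n (root j i) = 0 := by
      have h1 := h.hd_nonneg n
      have h2 := hd_root_nonneg hij n
      have h3 := hβ n hn
      rw [map_add] at h3
      omega
    refine .step hi hij ?_ (ih fun n hn => (h1 n hn).1)
    by_contra hc
    have := (h1 i (not_lt.mp hc)).2
    rw [hd_root, if_pos hij, if_neg (lt_irrefl i)] at this
    omega

lemma SlData.Adm.mono {D : SlData L} {k k' m : ℕ} (h : D.Adm k m) (hk : k' ≤ k) : D.Adm k' m :=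
  h.imp_left hk.trans

lemma SlData.Adm.lt {D : SlData L} {j m : ℕ} (h : D.Adm (j + 1) m) (hj : j ∈ D.dom) : j < m :=
  h.elim id fun h => h j hj

namespace Level

variable {D : SlData L} {m : ℕ} (l : Level D m)

/-- The embedding of the diagonal matrices. -/
def resH : cartan m →ₗ[ℂ] D.H where
  toFun x := ⟨l.ι (x : slFin m), l.ι_H x⟩
  map_add' x y := Subtype.ext (map_add l.ι (x : slFin m) y)
  map_smul' c x := Subtype.ext (map_smul l.ι c (x : slFin m))

/-- The restriction of a weight. -/
def pull (χ : Module.Dual ℂ D.H) : Module.Dual ℂ (cartan m) := χ ∘ₗ l.resH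

lemma pull_wt (a : ℕ →₀ ℤ) : l.pull (D.wt a) = (slFinData m).wt a := by
  ext x
  change D.wt a (l.resH x) = (slFinData m).wt a x
  rw [SlData.wt_apply, SlData.wt_apply, Finsupp.sum, Finsupp.sum, LinearMap.sum_apply]
  refine (Finset.sum_congr rfl fun i _ => ?_).trans (LinearMap.sum_apply _ _ _).symm
  exact congrArg (a i • ·) (l.ε_ι x i)

lemma ι_N {x : slFin m} (hx : x ∈ nilPlus m) : l.ι x ∈ D.N := by
  rw [nilPlus_eq] at hx
  induction hx using Submodule.span_induction with
  | mem x hx =>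
    obtain ⟨i, j, hi, hj, hij, rfl⟩ := hx
    rw [l.ι_E hi hj hij.ne]
    exact D.E_mem_N (l.mem_dom hj) hij
  | zero => rw [map_zero]; exact D.N.zero_mem
  | add x y _ _ hx hy => rw [map_add]; exact D.N.add_mem hx hy
  | smul c x _ hx => rw [map_smul]; exact D.N.smul_mem c hx

/-- The Gelfand invariants of `sl_m` in the enveloping algebra of `L`. -/
def gelf (p : ℕ) : U L := mapU l.ι (gelfand m p)

lemma sing_res {M : Rep.{u} L} {S : Submodule (U L) M} {χ : Module.Dual ℂ D.H} {v : M}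
    (hv : D.Sing S χ v) :
    (slFinData m).Sing (resSub l.ι S) (l.pull χ) (show res l.ι M from v) := by
  constructor
  · intro h
    rw [res_toU_smul, res_csmul]
    exact hv.1 (l.resH h)
  · intro x hx
    rw [res_toU_smul]
    exact hv.2 _ (l.ι_N hx)

lemma gelf_smul {M : Rep.{u} L} {S : Submodule (U L) M} {χ : Module.Dual ℂ D.H} {v : M}
    (hv : D.Sing S χ v) (p : ℕ) :
    l.gelf p • v - gelfandVal (coords (l.pull χ)) p • v ∈ S := by
  have h := gelfand_smul (l.sing_res hv) p
  rw [res_smul, res_csmul] at h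
  exact h

/-- The center of the enveloping algebra of `sl_m`. -/
def center : Subalgebra ℂ (U L) := (Subalgebra.center ℂ (U (slFin m))).map (mapU l.ι)

lemma gelf_mem_center (p : ℕ) : l.gelf p ∈ l.center :=
  ⟨gelfand m p, Subalgebra.mem_center_iff.mpr fun a => gelfand_comm p a, rfl⟩

variable {l} {z : U L}

lemma center_comm (hz : z ∈ l.center) (a : U (slFin m)) : z * mapU l.ι a = mapU l.ι a * z := by
  obtain ⟨z, hz, rfl⟩ := hz
  change mapU l.ι z * _ = _ * mapU l.ι z
  rw [← map_mul, ← map_mul, Subalgebra.mem_center_iff.mp hz a]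

lemma center_comm_E (hz : z ∈ l.center) {i j : ℕ} (hi : i < m) (hj : j < m) (hij : i ≠ j) :
    z * toU (D.E i j) = toU (D.E i j) * z := by
  have := center_comm hz (toU (finE m i j))
  rwa [mapU_toU, l.ι_E hi hj hij] at this

/-- By `lie_ι`, an element `h` of the diagonal differs from one of the diagonal of `sl_m` by
something that commutes with `sl_m`, hence with its enveloping algebra. -/
lemma center_comm_H (hz : z ∈ l.center) (h : D.H) : z * toU (h : L) = toU (h : L) * z := by
  obtain ⟨x, hx⟩ := l.lie_ι h
  have h1 := center_comm hz (toU (x : slFin m))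
  rw [mapU_toU] at h1
  -- the difference commutes with `sl_m`
  have h2 : ∀ a : U (slFin m), mapU l.ι a * (toU (h : L) - toU (l.ι (x : slFin m))) =
      (toU (h : L) - toU (l.ι (x : slFin m))) * mapU l.ι a := by
    intro a
    let T : Subalgebra ℂ (U (slFin m)) :=
      (Subalgebra.centralizer ℂ {toU (h : L) - toU (l.ι (x : slFin m))}).comap (mapU l.ι)
    have : a ∈ T := by
      refine U_subalgebra_eq_top T (fun y => ?_) a
      change mapU l.ι (toU y) ∈ Subalgebra.centralizer ℂ {toU (h : L) - toU (l.ι (x : slFin m))}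
      rw [mapU_toU, Subalgebra.mem_centralizer_iff]
      intro g hg
      rw [Set.mem_singleton_iff.mp hg]
      have e1 := LieHom.map_lie (UniversalEnvelopingAlgebra.ι ℂ) (h : L) (l.ι y)
      have e2 := LieHom.map_lie (UniversalEnvelopingAlgebra.ι ℂ) (l.ι (x : slFin m)) (l.ι y)
      rw [hx y] at e1
      rw [e1] at e2
      change toU (h : L) * toU (l.ι y) - toU (l.ι y) * toU (h : L) = toU _ * toU (l.ι y) -
        toU (l.ι y) * toU _ at e2
      rw [sub_mul, mul_sub, sub_eq_sub_iff_sub_eq_sub]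
      exact e2
    exact ((Subalgebra.mem_centralizer_iff (A := U L) ℂ).mp this _ rfl).symm
  obtain ⟨z, hz, rfl⟩ := hz
  have h3 := h2 z
  change mapU l.ι z * _ = _ * mapU l.ι z at h1 ⊢
  rw [mul_sub, sub_mul, h1, sub_left_inj] at h3
  exact h3

variable {M : Rep.{u} L} {S : Submodule (U L) M} {χ ψ : Module.Dual ℂ D.H} {v y : M}

lemma center_smul_weight (hz : z ∈ l.center) (hv : v ∈ weightSpace D.H M χ) :
    z • v ∈ weightSpace D.H M χ := fun h => by
  rw [← mul_smul, ← center_comm_H hz h, mul_smul, hv h, smul_comm]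

/-- The letters with indices below `m` belong to `sl_m` and commute with `z`, so the eigenvalue
modulo `S` at `v` is carried along the word. -/
lemma center_smul_desc (hz : z ∈ l.center) {c : ℂ} (hc : z • v - c • v ∈ S) {β : ℕ →₀ ℤ}
    (h : D.Desc v (fun i _ => i < m) β y) : z • y - c • y ∈ S := by
  induction h with
  | base => exact hc
  | @step i j β x hi hij hP _ ih =>
    rw [← mul_smul, center_comm_E hz hP (hij.trans hP) hij.ne', mul_smul,
      smul_comm c (toU (D.E i j)) x, ← smul_sub]
    exact S.smul_mem _ ih

lemma out_of_le {a : ℕ →₀ ℤ} (l : Level D m) (ha : ∀ i, m ≤ i → a i = 0) (i : ℕ)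
    (hi : i ∉ D.dom) : a i = 0 :=
  ha i (not_lt.mp fun h => hi (l.mem_dom h))

/-- The element `z` is central only for `sl_m`, not for `L`. But if both weights lie in the root
lattice of `sl_m`, their difference has no coordinates from `m` on, and `Desc.bounded` shows that
the words leading from `v` to `y` modulo `S` use letters of `sl_m` only; these commute with `z`. -/
lemma center_smul_of_mem (hM : IsWeightModule D.H M) (hs : D.Sing S χ v) (hχ : D.InLat m χ)
    (hψ : D.InLat m ψ) (hy : y ∈ S ⊔ Submodule.span (U L) {v}) (hyψ : y ∈ weightSpace D.H M ψ)
    (hz : z ∈ l.center) {c : ℂ} (hc : z • v - c • v ∈ S) : z • y - c • y ∈ S := by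
  obtain ⟨v', hv', hvv⟩ := hs.exists_weight D hM
  have hT : S ⊔ Submodule.span (U L) {v} ≤ S ⊔ Submodule.span (U L) {v'} := by
    refine sup_le le_sup_left (Submodule.span_le.mpr (Set.singleton_subset_iff.mpr ?_))
    rw [← sub_add_cancel v v']
    exact Submodule.add_mem_sup hvv (Submodule.mem_span_singleton_self v')
  have hsub : ∀ {w : M}, w ∈ S → z • w - c • w ∈ S := fun {w} hw =>
    S.sub_mem (S.smul_mem z hw) (by
      rw [← algebraMap_smul (U L) c w]; exact S.smul_mem _ hw)
  have hc' : z • v' - c • v' ∈ S := by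
    have h1 := S.sub_mem hc (hsub hvv)
    rw [smul_sub, smul_sub] at h1
    convert h1 using 1
    abel
  obtain ⟨s, hsS, -, w, hw, rfl⟩ := (hs.congr D hvv).mem_of_weight hM hv' (hT hy) hyψ
  rw [smul_add, smul_add, add_sub_add_comm]
  refine S.add_mem (hsub hsS) ?_
  obtain ⟨a, ha, hta, rfl⟩ := hχ
  obtain ⟨b, hb, htb, rfl⟩ := hψ
  clear hy hyψ
  induction hw using Submodule.span_induction with
  | mem x hx =>
    obtain ⟨β, hβ, hβψ⟩ := hx
    have hβ' : a - β = b := by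
      refine D.wt_inj (fun i hi => ?_) (fun i hi => l.out_of_le hb i hi) ?_ ?_
      · rw [Finsupp.sub_apply, l.out_of_le ha i hi, hβ.out hi, sub_zero]
      · rw [map_sub, hta, htb, hβ.tot_eq, sub_zero]
      · rw [map_sub, hβψ]
    have hβ0 : ∀ i, m ≤ i → β i = 0 := fun i hi => by
      have := DFunLike.congr_fun hβ' i
      rw [Finsupp.sub_apply, ha i hi, hb i hi] at this
      omega
    refine center_smul_desc hz hc' (hβ.bounded fun n hn => ?_)
    rw [hd_eq_tot fun k hk => hβ0 k (hn.trans hk), hβ.tot_eq]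
  | zero => rw [smul_zero, smul_zero, sub_zero]; exact S.zero_mem
  | add x y _ _ hx hy =>
    rw [smul_add, smul_add, add_sub_add_comm]
    exact S.add_mem hx hy
  | smul t x _ hx =>
    have : z • t • x - c • t • x = t • (z • x - c • x) := by
      rw [smul_sub, smul_comm z t x, smul_comm c t x]
    rw [this, ← algebraMap_smul (U L) t]
    exact S.smul_mem _ hx

end Level

end Levels

/-! ### Linkage and the decomposition by linkage classes -/

section Linkage

open scoped ModuleCat

variable {L : Type} [LieRing L] [LieAlgebra ℂ L]

/-- The central character provides some linked `b` of the same weight; supports below `m` and equal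
totals give `a = b`. -/
lemma linked_of_gelfandVal {m : ℕ} {a : ℕ →₀ ℤ} (ha : ∀ i, m ≤ i → a i = 0) (ht : tot a = 0)
    (h : ∀ p, gelfandVal (coords ((slFinData m).wt a)) p = gelfandVal (fun _ : Fin m => (0 : ℂ)) p) :
    Linked a := by
  obtain ⟨b, hb, hb0, hab⟩ := mem_lnk_of_gelfandVal h
  rw [(slFinData m).wt_inj (fun i hi => ha i (not_lt.mp hi)) hb0 (ht.trans hb.tot_eq.symm) hab]
  exact hb

lemma linked_iff_of_gelfandVal {m : ℕ} {a b : ℕ →₀ ℤ} (ha : ∀ i, m ≤ i → a i = 0) (ht : tot a = 0)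
    (hb : ∀ i, m ≤ i → b i = 0) (htb : tot b = 0)
    (h : ∀ p, gelfandVal (coords ((slFinData m).wt a)) p =
      gelfandVal (coords ((slFinData m).wt b)) p) : Linked a ↔ Linked b :=
  ⟨fun hl => linked_of_gelfandVal hb htb fun p => (h p).symm.trans (gelfandVal_linked hl ha p),
    fun hl => linked_of_gelfandVal ha ht fun p => (h p).trans (gelfandVal_linked hl hb p)⟩

namespace SlData

variable {D : SlData L}

variable (D) in
/-- The root lattice. -/
def lat : Set (Module.Dual ℂ D.H) := {χ | ∃ a, (∀ i ∉ D.dom, a i = 0) ∧ tot a = 0 ∧ χ = D.wt a}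

lemma lnk_subset_lat : D.lnk ⊆ D.lat := by
  rintro _ ⟨a, ha, hd, rfl⟩
  exact ⟨a, hd, ha.tot_eq, rfl⟩

lemma wt_mem_lnk {a : ℕ →₀ ℤ} (ha : ∀ i ∉ D.dom, a i = 0) (ht : tot a = 0) :
    D.wt a ∈ D.lnk ↔ Linked a := by
  refine ⟨?_, fun h => ⟨a, h, ha, rfl⟩⟩
  rintro ⟨b, hb, hb0, hab⟩
  rwa [D.wt_inj ha hb0 (ht.trans hb.tot_eq.symm) hab]

lemma sub_mem_lat_iff {χ : Module.Dual ℂ D.H} {β : ℕ →₀ ℤ} (hβ : ∀ i ∉ D.dom, β i = 0)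
    (ht : tot β = 0) : χ - D.wt β ∈ D.lat ↔ χ ∈ D.lat := by
  constructor
  · rintro ⟨a, ha, hta, h⟩
    refine ⟨a + β, fun i hi => ?_, ?_, ?_⟩
    · rw [Finsupp.add_apply, ha i hi, hβ i hi, add_zero]
    · rw [map_add, hta, ht, add_zero]
    · rw [map_add, ← h, sub_add_cancel]
  · rintro ⟨a, ha, hta, rfl⟩
    refine ⟨a - β, fun i hi => ?_, ?_, (map_sub _ _ _).symm⟩
    · rw [Finsupp.sub_apply, ha i hi, hβ i hi, sub_zero]
    · rw [map_sub, hta, ht, sub_zero]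

lemma exists_inLat {χ : Module.Dual ℂ D.H} (h : χ ∈ D.lat) :
    ∃ k, ∀ m, D.Adm k m → D.InLat m χ := by
  obtain ⟨a, ha, hta, rfl⟩ := h
  obtain ⟨k, hk⟩ := exists_bound a
  exact ⟨k, fun m hm => ⟨a, hm.apply_eq_zero ha hk, hta, rfl⟩⟩

lemma InLat.lnk_iff {m : ℕ} (l : Level D m) {χ ψ : Module.Dual ℂ D.H} (hχ : D.InLat m χ)
    (hψ : D.InLat m ψ) (h : ∀ p, gelfandVal (coords (l.pull χ)) p =
      gelfandVal (coords (l.pull ψ)) p) : χ ∈ D.lnk ↔ ψ ∈ D.lnk := by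
  obtain ⟨a, ha, hta, rfl⟩ := hχ
  obtain ⟨b, hb, htb, rfl⟩ := hψ
  rw [l.pull_wt, l.pull_wt] at h
  rw [wt_mem_lnk (l.out_of_le ha) hta, wt_mem_lnk (l.out_of_le hb) htb]
  exact linked_iff_of_gelfandVal ha hta hb htb h

variable {M : Rep.{u} L}

lemma csmul_mem (S : Submodule (U L) M) (c : ℂ) {v : M} (hv : v ∈ S) : c • v ∈ S := by
  rw [← algebraMap_smul (U L) c v]
  exact S.smul_mem _ hv

lemma mem_of_csmul_mem (S : Submodule (U L) M) {c : ℂ} (hc : c ≠ 0) {v : M} (hv : c • v ∈ S) :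
    v ∈ S := by
  have := csmul_mem S c⁻¹ hv
  rwa [smul_smul, inv_mul_cancel₀ hc, one_smul] at this

lemma sup_span_congr {S : Submodule (U L) M} {v w : M} (h : v - w ∈ S) :
    S ⊔ Submodule.span (U L) {v} = S ⊔ Submodule.span (U L) {w} := by
  apply le_antisymm
  · refine sup_le le_sup_left (Submodule.span_le.mpr (Set.singleton_subset_iff.mpr ?_))
    rw [← sub_add_cancel v w]
    exact Submodule.add_mem_sup h (Submodule.mem_span_singleton_self w)
  · refine sup_le le_sup_left (Submodule.span_le.mpr (Set.singleton_subset_iff.mpr ?_))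
    rw [← sub_sub_cancel v w, sub_eq_neg_add]
    exact Submodule.add_mem_sup (S.neg_mem h) (Submodule.mem_span_singleton_self v)

/-- The weights of a highest weight subquotient. -/
lemma Sing.weight_eq (hM : IsWeightModule D.H M) {S : Submodule (U L) M}
    {χ ψ : Module.Dual ℂ D.H} {v y : M} (h : D.Sing S χ v)
    (hy : y ∈ S ⊔ Submodule.span (U L) {v}) (hyψ : y ∈ weightSpace D.H M ψ) (hyS : y ∉ S) :
    ∃ β : ℕ →₀ ℤ, ψ = χ - D.wt β ∧ (∀ n, 0 ≤ hd n β) ∧ tot β = 0 ∧ ∀ k ∉ D.dom, β k = 0 := by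
  obtain ⟨v', hv', hvv⟩ := h.exists_weight D hM
  rw [sup_span_congr hvv] at hy
  obtain ⟨s, hs, hsψ, w, hw, rfl⟩ := (h.congr D hvv).mem_of_weight hM hv' hy hyψ
  have hA : {x | ∃ β, D.Desc v' (fun _ _ => True) β x ∧ χ - D.wt β = ψ}.Nonempty := by
    by_contra hA
    rw [Set.not_nonempty_iff_eq_empty.mp hA, Submodule.span_empty, Submodule.mem_bot] at hw
    rw [hw, add_zero] at hyS
    exact hyS hs
  obtain ⟨x, β, hβ, hβψ⟩ := hA
  exact ⟨β, hβψ.symm, hβ.hd_nonneg, hβ.tot_eq, fun k hk => hβ.out hk⟩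

/-- Replacing `R` by `R ⊓ T` keeps the vector singular, and the weight vector representing it modulo
`R ⊓ T` still lies in `T`. -/
lemma SW_exists_weight (hM : IsWeightModule D.H M) {S T : Submodule (U L) M} (hST : S ≤ T)
    {χ : Module.Dual ℂ D.H} (h : χ ∈ D.SW S T) : ∃ (R : Submodule (U L) M) (v : M),
      S ≤ R ∧ v ∈ T ∧ v ∉ R ∧ D.Sing R χ v ∧ v ∈ weightSpace D.H M χ := by
  obtain ⟨R, v, hSR, hvT, hvR, hs⟩ := h
  have hs' := hs.inf D hvT
  obtain ⟨w, hw, hvw⟩ := hs'.exists_weight D hM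
  refine ⟨R ⊓ T, w, le_inf hSR hST, ?_, fun hwR => hvR ?_, hs'.congr D hvw, hw⟩
  · have := T.sub_mem hvT hvw.2
    rwa [sub_sub_cancel] at this
  · have := R.add_mem hvw.1 hwR.1
    rwa [sub_add_cancel] at this

/-- The singular weights of a highest weight subquotient are linked to its highest weight. -/
lemma Sing.lnk_iff (Λ : Levels D) (hM : IsWeightModule D.H M) {S : Submodule (U L) M}
    {χ ψ : Module.Dual ℂ D.H} {v : M} (h : D.Sing S χ v)
    (hψ : ψ ∈ D.SW S (S ⊔ Submodule.span (U L) {v})) : ψ ∈ D.lnk ↔ χ ∈ D.lnk := by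
  obtain ⟨R, w, hSR, hwT, hwR, hs, hw⟩ := SW_exists_weight hM le_sup_left hψ
  obtain ⟨β, hβ, -, ht, hβ0⟩ := h.weight_eq hM hwT hw fun hwS => hwR (hSR hwS)
  have hlat : ψ ∈ D.lat ↔ χ ∈ D.lat := by rw [hβ]; exact sub_mem_lat_iff hβ0 ht
  by_cases hχ : χ ∈ D.lat
  · obtain ⟨k, hk⟩ := exists_inLat hχ
    obtain ⟨k', hk'⟩ := exists_inLat (hlat.mpr hχ)
    -- At a level whose root lattice contains both weights, the Gelfand invariants act on `w` modulo
    -- `R` by the eigenvalues for `ψ` and also by those for `χ`. As `w ∉ R`, these agree.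
    obtain ⟨m, hm, hadm⟩ := Λ.exhaust (max k k')
    have h1 := hk m (hadm.mono (le_max_left _ _))
    have h2 := hk' m (hadm.mono (le_max_right _ _))
    refine InLat.lnk_iff (Λ.level m hm) h2 h1 fun p => ?_
    have e1 := (Λ.level m hm).gelf_smul hs p
    have e2 := hSR (Level.center_smul_of_mem hM h h1 h2 hwT hw ((Λ.level m hm).gelf_mem_center p)
      ((Λ.level m hm).gelf_smul h p))
    by_contra hne
    refine hwR (mem_of_csmul_mem R (sub_ne_zero.mpr hne) ?_)
    have := R.sub_mem e2 e1
    rw [sub_sub_sub_cancel_left, ← sub_smul] at this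
    exact this
  · exact iff_of_false (fun h => hχ (hlat.mp (lnk_subset_lat h))) fun h => hχ (lnk_subset_lat h)

lemma SW_self (S : Submodule (U L) M) : D.SW S S = ∅ := by
  rw [Set.eq_empty_iff_forall_notMem]
  rintro χ ⟨R, v, hSR, hvT, hvR, -⟩
  exact hvR (hSR hvT)

lemma HwFilt.SW_subset (Λ : Levels D) (hM : IsWeightModule D.H M) {S : Submodule (U L) M}
    (h : D.HwFilt D.lnk S) : D.SW ⊥ S ⊆ D.lnk := by
  induction h with
  | bot => rw [SW_self]; exact Set.empty_subset _
  | step _ hχ hs ih =>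
    exact (SW_subset_union _ _ _).trans (Set.union_subset ih fun ψ hψ => (hs.lnk_iff Λ hM hψ).mpr hχ)

lemma HwFilt.SW_subset_compl (Λ : Levels D) (hM : IsWeightModule D.H M) {S : Submodule (U L) M}
    (h : D.HwFilt D.lnkᶜ S) : D.SW ⊥ S ⊆ D.lnkᶜ := by
  induction h with
  | bot => rw [SW_self]; exact Set.empty_subset _
  | step _ hχ hs ih =>
    exact (SW_subset_union _ _ _).trans (Set.union_subset ih fun ψ hψ h =>
      hχ ((hs.lnk_iff Λ hM hψ).mp h))

/-- A central element that kills a filtered submodule but not the singular vectors of a weight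
in the other linkage class. -/
lemma HwFilt.exists_center (hM : IsWeightModule D.H M) {Ξ : Set (Module.Dual ℂ D.H)}
    {Y : Submodule (U L) M} (h : D.HwFilt Ξ Y) {χ : Module.Dual ℂ D.H} (hχ : χ ∈ D.lat)
    (hΞ : ∀ μ ∈ Ξ, ¬ (μ ∈ D.lnk ↔ χ ∈ D.lnk)) :
    ∃ k, ∀ m (l : Level D m), D.Adm k m → ∃ z ∈ l.center,
      (∀ y ∈ Y, ∀ ψ, D.InLat m ψ → y ∈ weightSpace D.H M ψ → z • y = 0) ∧
      ∃ c : ℂ, c ≠ 0 ∧ ∀ (S : Submodule (U L) M) (v : M), D.Sing S χ v → z • v - c • v ∈ S := by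
  induction h with
  | bot =>
    refine ⟨0, fun m l _ => ⟨1, Subalgebra.one_mem _, fun y hy _ _ _ => ?_, 1, one_ne_zero, ?_⟩⟩
    · rw [(Submodule.mem_bot _).mp hy, smul_zero]
    · intro S v _
      rw [one_smul, one_smul, sub_self]
      exact S.zero_mem
  | @step S μ v _ hμ hs ih =>
    obtain ⟨k, hk⟩ := ih
    by_cases hlat : μ ∈ D.lat
    · obtain ⟨k₁, hk₁⟩ := exists_inLat hχ
      obtain ⟨k₂, hk₂⟩ := exists_inLat hlat
      refine ⟨max k (max k₁ k₂), fun m l hadm => ?_⟩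
      obtain ⟨z, hz, hzS, c, hc, hcz⟩ := hk m l (hadm.mono (le_max_left _ _))
      have h1 := hk₁ m (hadm.mono (by omega))
      have h2 := hk₂ m (hadm.mono (by omega))
      -- Weights in different linkage classes are separated by some Gelfand invariant.
      obtain ⟨p, hp⟩ : ∃ p, gelfandVal (coords (l.pull μ)) p ≠ gelfandVal (coords (l.pull χ)) p := by
        by_contra hcon
        push Not at hcon
        exact hΞ μ hμ (InLat.lnk_iff l h2 h1 hcon)
      set cμ := gelfandVal (coords (l.pull μ)) p
      set cχ := gelfandVal (coords (l.pull χ)) p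
      have hg : l.gelf p - algebraMap ℂ (U L) cμ ∈ l.center :=
        sub_mem (l.gelf_mem_center p) (Subalgebra.algebraMap_mem _ _)
      -- The right factor maps the new highest weight piece into `S`, where the element found before
      -- acts by zero; on singular vectors of weight `χ` both factors act by nonzero scalars.
      refine ⟨z * (l.gelf p - algebraMap ℂ (U L) cμ), mul_mem hz hg, fun y hy ψ hψ hyψ => ?_,
        c * (cχ - cμ), mul_ne_zero hc (sub_ne_zero.mpr hp.symm), fun R w hw => ?_⟩
      · rw [mul_smul]
        refine hzS _ ?_ ψ hψ (Level.center_smul_weight hg hyψ)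
        rw [sub_smul, algebraMap_smul]
        exact Level.center_smul_of_mem hM hs h2 hψ hy hyψ (l.gelf_mem_center p) (l.gelf_smul hs p)
      · have e1 := hcz R w hw
        have e2 := l.gelf_smul hw p
        have e3 := R.add_mem (R.smul_mem z e2) (csmul_mem R (cχ - cμ) e1)
        convert e3 using 1
        rw [mul_smul, sub_smul, algebraMap_smul, smul_sub, smul_sub, smul_sub, mul_smul,
          smul_comm c (cχ - cμ), sub_smul cχ cμ (z • w), smul_comm z cμ w, smul_comm z cχ w]
        abel
    · refine ⟨k, fun m l hadm => ?_⟩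
      obtain ⟨z, hz, hzS, c, hc, hcz⟩ := hk m l hadm
      refine ⟨z, hz, fun y hy ψ hψ hyψ => hzS y ?_ ψ hψ hyψ, c, hc, hcz⟩
      -- If `μ` is outside of the root lattice, so are all weights of the new subquotient: the
      -- weights under consideration do not see it and the old element still works.
      by_contra hyS
      obtain ⟨β, rfl, -, ht, hβ0⟩ := hs.weight_eq hM hy hyψ hyS
      obtain ⟨a, ha, hta, hab⟩ := hψ
      exact hlat ((sub_mem_lat_iff hβ0 ht).mp ⟨a, l.out_of_le ha, hta, hab⟩)

end SlData

end Linkage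

/-! ### Splitting off a linkage class -/

section Splitting

open scoped ModuleCat

variable {L : Type} [LieRing L] [LieAlgebra ℂ L] {D : SlData L} {M : Rep.{u} L}

namespace SlData

lemma mem_sup_weight (hM : IsWeightModule D.H M) {X Y : Submodule (U L) M} {w : M}
    {ψ : Module.Dual ℂ D.H} (hw : w ∈ X ⊔ Y) (hψ : w ∈ weightSpace D.H M ψ) :
    ∃ x ∈ X, x ∈ weightSpace D.H M ψ ∧ ∃ y ∈ Y, y ∈ weightSpace D.H M ψ ∧ x + y = w := by
  obtain ⟨x, hx, y, hy, rfl⟩ := Submodule.mem_sup.mp hw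
  obtain ⟨p, hp1, hp2, -, hp4⟩ := hM.exists_proj ψ
  refine ⟨p x, hp4 X x hx, hp1 x, p y, hp4 Y y hy, hp1 y, ?_⟩
  rw [← map_add, hp2 _ hψ]

lemma exists_weight_mem (hM : IsWeightModule D.H M) {Q : Submodule (U L) M} {x : M} (hx : x ∈ Q)
    {S : Submodule (U L) M} (hxS : x ∉ S) :
    ∃ ψ, ∃ y ∈ Q, y ∈ weightSpace D.H M ψ ∧ y ∉ S := by
  classical
  obtain ⟨s, f, hf, hs⟩ := hM.exists_sum x
  by_contra! hcon
  refine hxS (hs ▸ S.sum_mem fun ψ hψ => hcon ψ (f ψ) ?_ (hf ψ))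
  exact component_mem Q s f (fun χ _ => hf χ) (by rw [hs]; exact hx) ψ hψ

lemma disjoint_of_weight (hM : IsWeightModule D.H M) {X Y : Submodule (U L) M}
    (h : ∀ ψ, ∀ y ∈ X, y ∈ Y → y ∈ weightSpace D.H M ψ → y = 0) : Disjoint X Y := by
  rw [disjoint_iff, eq_bot_iff]
  intro x hx
  by_contra hx0
  obtain ⟨ψ, y, hy, hyψ, hy0⟩ := exists_weight_mem hM hx hx0
  exact hy0 ((Submodule.mem_bot _).mpr (h ψ y hy.1 hy.2 hyψ))

/-- A highest weight vector modulo a direct sum can be corrected to a highest weight vector modulo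
the summand in its linkage class. -/
lemma split_step_lat (Λ : Levels D) (hM : IsWeightModule D.H M) {X Y : Submodule (U L) M}
    (hXY : Disjoint X Y) {Ξ : Set (Module.Dual ℂ D.H)} (hY : D.HwFilt Ξ Y)
    {χ : Module.Dual ℂ D.H} (hχ : χ ∈ D.lat) (hΞ : ∀ μ ∈ Ξ, ¬ (μ ∈ D.lnk ↔ χ ∈ D.lnk)) {v : M}
    (hv : D.Sing (X ⊔ Y) χ v) : ∃ v', D.Sing X χ v' ∧
      X ⊔ Submodule.span (U L) {v'} ⊔ Y = X ⊔ Y ⊔ Submodule.span (U L) {v} ∧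
      Disjoint (X ⊔ Submodule.span (U L) {v'}) Y := by
  obtain ⟨v₀, hv₀, hvv⟩ := hv.exists_weight D hM
  rw [sup_span_congr hvv]
  replace hv := hv.congr D hvv
  clear hvv v
  obtain ⟨k, hk⟩ := hY.exists_center hM hχ hΞ
  obtain ⟨k₁, hk₁⟩ := exists_inLat hχ
  obtain ⟨m, hm, hadm⟩ := Λ.exhaust (max k k₁)
  obtain ⟨z, hz, hzY, c, hc, hcz⟩ := hk m (Λ.level m hm) (hadm.mono (le_max_left _ _))
  have hχm := hk₁ m (hadm.mono (le_max_right _ _))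
  have hzv := hcz _ _ hv
  have hzw := Level.center_smul_weight hz hv₀
  have hsing : D.Sing X χ (z • v₀) := by
    refine ⟨fun h => ?_, ?_⟩
    · rw [hzw h, sub_self]
      exact X.zero_mem
    suffices hN : D.N ≤ intoSub (X.restrictScalars ℂ) (z • v₀) from fun x hx => hN hx
    refine D.N_le fun i j hj hij => ?_
    change toU (D.E i j) • z • v₀ ∈ X
    -- The letter `E i j` need not commute with `z`. A second element `z'` is taken from a level
    -- that contains both `j` and the level of `z`, so that `z'` commutes with `E i j` and with `z`.
    obtain ⟨m', hm', hadm'⟩ := Λ.exhaust (max (max k k₁) (max (j + 1) m))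
    have hmm' : m ≤ m' := by
      rcases hadm' with h | h
      · omega
      · by_contra hlt
        exact lt_irrefl _ (h m' ((Λ.level m hm).mem_dom (not_le.mp hlt)))
    obtain ⟨z', hz', hzY', c', hc', hcz'⟩ := hk m' (Λ.level m' hm') (hadm'.mono (by omega))
    have hχm' := hk₁ m' (hadm'.mono (by omega))
    have hjm' : j < m' := (hadm'.mono (k' := j + 1) (by omega)).lt hj
    -- the product `z' v₀` is killed modulo `X`
    have hEv := hv.2 _ (D.E_mem_N hj hij)
    have hEw := D.toU_E_mem_weightSpace (D.dom_lt hij.le hj) hj hij.ne hv₀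
    obtain ⟨x, hx, hxw, y, hy, hyw, hxy⟩ := mem_sup_weight hM hEv hEw
    have hroot : D.InLat m' (D.wt (root i j) + χ) := by
      obtain ⟨a, ha, hta, rfl⟩ := hχm'
      refine ⟨root i j + a, fun i' hi' => ?_, ?_, (map_add _ _ _).symm⟩
      · rw [Finsupp.add_apply, ha i' hi', root, Finsupp.sub_apply,
          Finsupp.single_eq_of_ne (by omega), Finsupp.single_eq_of_ne (by omega)]
        rfl
      · rw [map_add, tot_root, hta, add_zero]
    have hEz' : toU (D.E i j) • z' • v₀ ∈ X := by
      rw [← mul_smul, ← Level.center_comm_E hz' (hij.trans hjm') hjm' hij.ne, mul_smul, ← hxy,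
        smul_add, hzY' y hy _ hroot hyw, add_zero]
      exact X.smul_mem _ hx
    obtain ⟨x₁, hx₁, -, y₁, hy₁, hyw₁, h1⟩ := mem_sup_weight hM hzv
      (Submodule.sub_mem _ hzw (Submodule.smul_mem _ c hv₀))
    obtain ⟨x₂, hx₂, -, y₂, hy₂, hyw₂, h2⟩ := mem_sup_weight hM (hcz' _ _ hv)
      (Submodule.sub_mem _ (Level.center_smul_weight hz' hv₀) (Submodule.smul_mem _ c' hv₀))
    have hcomm : z' * z = z * z' := by
      obtain ⟨a, ha, rfl⟩ := hz
      have hmem : mapU (Λ.level m hm).ι a ∈ (Subalgebra.centralizer ℂ {z'}) := by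
        let T : Subalgebra ℂ (U (slFin m)) :=
          (Subalgebra.centralizer ℂ {z'}).comap (mapU (Λ.level m hm).ι)
        refine U_subalgebra_eq_top T (fun y => ?_) a
        change mapU (Λ.level m hm).ι (toU y) ∈ Subalgebra.centralizer ℂ {z'}
        rw [mapU_toU, Subalgebra.mem_centralizer_iff]
        intro g hg
        rw [Set.mem_singleton_iff.mp hg]
        obtain ⟨y', hy'⟩ := Λ.nested hm hm' hmm' y
        rw [hy', ← mapU_toU]
        exact Level.center_comm hz' _
      exact (Subalgebra.mem_centralizer_iff (A := U L) ℂ).mp hmem _ rfl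
    -- Evaluating `z' z v₀ = z z' v₀` on both sides shows that `c' z v₀` and `c z' v₀` agree modulo
    -- `X`, because the components in `Y` are killed. So what is known for `z' v₀` holds for `z v₀`.
    have e1 : z' • z • v₀ = c • z' • v₀ + z' • x₁ := by
      have : z • v₀ = c • v₀ + (x₁ + y₁) := by rw [h1]; abel
      rw [this, smul_add, smul_add, hzY' y₁ hy₁ _ hχm' hyw₁, add_zero, smul_comm]
    have e2 : z • z' • v₀ = c' • z • v₀ + z • x₂ := by
      have : z' • v₀ = c' • v₀ + (x₂ + y₂) := by rw [h2]; abel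
      rw [this, smul_add, smul_add, hzY y₂ hy₂ _ hχm hyw₂, add_zero, smul_comm]
    have e3 : c' • z • v₀ = c • z' • v₀ + z' • x₁ - z • x₂ := by
      rw [← e1, eq_sub_iff_add_eq, ← e2, ← mul_smul, ← mul_smul, hcomm]
    refine mem_of_csmul_mem X hc' ?_
    rw [smul_comm, e3, smul_sub, smul_add, smul_comm]
    exact X.sub_mem (X.add_mem (csmul_mem X c hEz') (X.smul_mem _ (X.smul_mem _ hx₁)))
      (X.smul_mem _ (X.smul_mem _ hx₂))
  refine ⟨z • v₀, hsing, ?_, ?_⟩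
  · have hle : X ⊔ Y ⊔ Submodule.span (U L) {z • v₀} = X ⊔ Y ⊔ Submodule.span (U L) {v₀} := by
      rw [sup_span_congr hzv]
      have : Submodule.span (U L) {c • v₀} = Submodule.span (U L) {v₀} := by
        apply le_antisymm <;> refine Submodule.span_le.mpr (Set.singleton_subset_iff.mpr ?_)
        · exact csmul_mem _ c (Submodule.mem_span_singleton_self v₀)
        · exact mem_of_csmul_mem _ hc (Submodule.mem_span_singleton_self (c • v₀))
      rw [this]
    rw [← hle, sup_right_comm]
  -- On a common weight vector outside of `X`, a separating element of a large level acts by a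
  -- nonzero scalar modulo `X`, since it comes from the highest weight vector, and by zero, since
  -- the vector lies in `Y`.
  · refine disjoint_of_weight hM fun ψ y hyX hyY hyψ => ?_
    by_cases hyX' : y ∈ X
    · exact (Submodule.mem_bot (U L)).mp (disjoint_iff.mp hXY ▸ ⟨hyX', hyY⟩)
    obtain ⟨β, hβ, -, ht, hβ0⟩ := hsing.weight_eq hM hyX hyψ hyX'
    have hψ : ψ ∈ D.lat := by rw [hβ]; exact (sub_mem_lat_iff hβ0 ht).mpr hχ
    obtain ⟨k₂, hk₂⟩ := exists_inLat hψ
    obtain ⟨m', hm', hadm'⟩ := Λ.exhaust (max (max k k₁) k₂)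
    obtain ⟨z', hz', hzY', c', hc', hcz'⟩ := hk m' (Λ.level m' hm') (hadm'.mono (by omega))
    have h1 := hk₁ m' (hadm'.mono (by omega))
    have h2 := hk₂ m' (hadm'.mono (by omega))
    have h3 := Level.center_smul_of_mem hM hsing h1 h2 hyX hyψ hz' (hcz' X _ hsing)
    rw [hzY' y hyY ψ h2 hyψ, zero_sub] at h3
    exact absurd (mem_of_csmul_mem X hc' (X.neg_mem_iff.mp h3)) hyX'

/-- All weights of `Y` lie in the root lattice, while the weights derived from `χ` do not. So
nothing has to be corrected beyond passing to a weight vector, and no central element is needed. -/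
lemma split_step_not_lat (hM : IsWeightModule D.H M) {X Y : Submodule (U L) M}
    (hXY : Disjoint X Y) {Ξ : Set (Module.Dual ℂ D.H)} (hY : D.HwFilt Ξ Y)
    {χ : Module.Dual ℂ D.H} (hχ : χ ∉ D.lat) (hΞ : Ξ ⊆ D.lat) {v : M}
    (hv : D.Sing (X ⊔ Y) χ v) : ∃ v', D.Sing X χ v' ∧
      X ⊔ Submodule.span (U L) {v'} ⊔ Y = X ⊔ Y ⊔ Submodule.span (U L) {v} ∧
      Disjoint (X ⊔ Submodule.span (U L) {v'}) Y := by
  obtain ⟨v₀, hv₀, hvv⟩ := hv.exists_weight D hM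
  rw [sup_span_congr hvv]
  replace hv := hv.congr D hvv
  clear hvv v
  have hYlat : ∀ ψ, ∀ y ∈ Y, y ∈ weightSpace D.H M ψ → y ≠ 0 → ψ ∈ D.lat := by
    intro ψ y hy hyψ hy0
    obtain ⟨μ, hμ, β, rfl, -, ht, hβ0⟩ := hY.weight hM hy hyψ hy0
    exact (sub_mem_lat_iff hβ0 ht).mpr (hΞ hμ)
  have hsing : D.Sing X χ v₀ := by
    refine ⟨fun h => ?_, ?_⟩
    · rw [hv₀ h, sub_self]
      exact X.zero_mem
    suffices hN : D.N ≤ intoSub (X.restrictScalars ℂ) v₀ from fun x hx => hN hx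
    refine D.N_le fun i j hj hij => ?_
    change toU (D.E i j) • v₀ ∈ X
    have hi := D.dom_lt hij.le hj
    have hEw := D.toU_E_mem_weightSpace hi hj hij.ne hv₀
    obtain ⟨x, hx, hxw, y, hy, hyw, hxy⟩ := mem_sup_weight hM (hv.2 _ (D.E_mem_N hj hij)) hEw
    by_cases hy0 : y = 0
    · rw [← hxy, hy0, add_zero]
      exact hx
    · refine absurd ((sub_mem_lat_iff (β := root j i) (fun n hn => ?_) (tot_root j i)).mp
        (?_ : χ - D.wt (root j i) ∈ D.lat)) hχ
      · have h1 : n ≠ i := fun h => hn (h ▸ hi)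
        have h2 : n ≠ j := fun h => hn (h ▸ hj)
        rw [root, Finsupp.sub_apply, Finsupp.single_eq_of_ne h1, Finsupp.single_eq_of_ne h2,
          sub_zero]
      · have := hYlat _ y hy hyw hy0
        rw [wt_root] at this ⊢
        convert this using 1
        abel
  refine ⟨v₀, hsing, sup_right_comm _ _ _, disjoint_of_weight hM fun ψ y hyX hyY hyψ => ?_⟩
  by_cases hyX' : y ∈ X
  · exact (Submodule.mem_bot (U L)).mp (disjoint_iff.mp hXY ▸ ⟨hyX', hyY⟩)
  obtain ⟨β, rfl, -, ht, hβ0⟩ := hsing.weight_eq hM hyX hyψ hyX'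
  by_contra hy0
  exact hχ ((sub_mem_lat_iff hβ0 ht).mp (hYlat _ y hyY hyψ hy0))

/-- A filtered module is the direct sum of its linked and its unlinked part. -/
lemma HwFilt.exists_split (Λ : Levels D) (hM : IsWeightModule D.H M)
    {Ξ : Set (Module.Dual ℂ D.H)} {T : Submodule (U L) M} (h : D.HwFilt Ξ T) :
    ∃ X Y : Submodule (U L) M, Disjoint X Y ∧ X ⊔ Y = T ∧ D.HwFilt D.lnk X ∧
      D.HwFilt D.lnkᶜ Y := by
  induction h with
  | bot => exact ⟨⊥, ⊥, disjoint_bot_left, sup_idem ⊥, .bot, .bot⟩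
  | @step S χ v _ _ hs ih =>
    obtain ⟨X, Y, hXY, rfl, hX, hY⟩ := ih
    by_cases hχ : χ ∈ D.lnk
    · obtain ⟨v', h1, h2, h3⟩ := split_step_lat Λ hM hXY hY (lnk_subset_lat hχ)
        (fun μ hμ hiff => hμ (hiff.mpr hχ)) hs
      exact ⟨_, Y, h3, h2, hX.step hχ h1, hY⟩
    -- For an unlinked weight the two summands exchange their roles. Weights outside of the root
    -- lattice count as unlinked and need the separate argument.
    · rw [sup_comm X Y] at hs ⊢
      obtain ⟨v', h1, h2, h3⟩ : ∃ v', D.Sing Y χ v' ∧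
          Y ⊔ Submodule.span (U L) {v'} ⊔ X = Y ⊔ X ⊔ Submodule.span (U L) {v} ∧
          Disjoint (Y ⊔ Submodule.span (U L) {v'}) X := by
        by_cases hlat : χ ∈ D.lat
        · exact split_step_lat Λ hM hXY.symm hX hlat (fun μ hμ hiff => hχ (hiff.mp hμ)) hs
        · exact split_step_not_lat hM hXY.symm hX hlat lnk_subset_lat hs
      exact ⟨X, _, h3.symm, by rw [sup_comm, h2], hX, hY.step hχ h1⟩

end SlData

end Splitting

/-! ### Singular vectors in subquotients -/

section SingularVectors

open scoped ModuleCat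

/-- Summation by parts. At total zero it expresses the height as the sum of the partial sums, so
that weights with nonnegative partial sums have nonnegative height. -/
lemma sum_hd (N : ℕ) (a : ℕ →₀ ℤ) :
    ∑ n ∈ Finset.range (N + 1), hd n a = N * hd N a + ∑ i ∈ Finset.range N, -(i : ℤ) * a i := by
  induction N with
  | zero => simp [hd_apply]
  | succ N ih =>
    rw [Finset.sum_range_succ, ih, Finset.sum_range_succ _ N, hd_succ]
    push_cast
    ring

lemma ht_eq_sum_hd {N : ℕ} {a : ℕ →₀ ℤ} (h : ∀ i, N ≤ i → a i = 0) (ht0 : tot a = 0) :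
    SlData.ht a = ∑ n ∈ Finset.range (N + 1), hd n a := by
  rw [sum_hd, hd_eq_tot h, ht0, mul_zero, zero_add]
  change Finsupp.linearCombination ℤ (fun i : ℕ => -(i : ℤ)) a = _
  rw [Finsupp.linearCombination_apply, Finsupp.sum_of_support_subset a (s := Finset.range N)]
  · exact Finset.sum_congr rfl fun i _ => by rw [smul_eq_mul, mul_comm]
  · intro i hi
    rw [Finset.mem_range]
    by_contra hc
    exact Finsupp.mem_support_iff.mp hi (h i (not_lt.mp hc))
  · simp

lemma ht_nonneg {a : ℕ →₀ ℤ} (h : ∀ n, 0 ≤ hd n a) (ht0 : tot a = 0) : 0 ≤ SlData.ht a := by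
  obtain ⟨N, hN⟩ := exists_bound a
  rw [ht_eq_sum_hd hN ht0]
  exact Finset.sum_nonneg fun n _ => h n

variable {L : Type} [LieRing L] [LieAlgebra ℂ L] (D : SlData L)

namespace SlData

/-- Every nonzero subquotient contains a singular vector. -/
def SV (M : Rep.{u} L) : Prop :=
  ∀ S T : Submodule (U L) M, S < T → ∃ χ, ∃ v ∈ T, v ∉ S ∧ D.Sing S χ v

variable {D} {M M' : Rep.{u} L}

lemma sing_of_generators {S : Submodule (U L) M} {χ : Module.Dual ℂ D.H} {v : M}
    (hv : v ∈ weightSpace D.H M χ) (h : ∀ i j, j ∈ D.dom → i < j → toU (D.E i j) • v ∈ S) :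
    D.Sing S χ v := by
  refine ⟨fun h => ?_, ?_⟩
  · rw [hv h, sub_self]
    exact S.zero_mem
  · have hN : D.N ≤ intoSub (S.restrictScalars ℂ) v := D.N_le h
    exact fun x hx => hN hx

lemma root_out {i j : ℕ} (hi : i ∈ D.dom) (hj : j ∈ D.dom) (n : ℕ) (hn : n ∉ D.dom) :
    root i j n = 0 := by
  have h1 : n ≠ i := fun h => hn (h ▸ hi)
  have h2 : n ≠ j := fun h => hn (h ▸ hj)
  rw [root, Finsupp.sub_apply, Finsupp.single_eq_of_ne h1, Finsupp.single_eq_of_ne h2, sub_zero]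

/-- At the first step of the filtration where `T ⊓ Q ≤ S` fails, choose a weight vector `t` of `T`
outside of `S`; its weight is `χ - wt β`. A raising operator that keeps it outside of `S` lowers the
height of `β`, which cannot become negative, so this process ends with a singular vector. -/
lemma HwFilt.exists_sing (hM : IsWeightModule D.H M) {Ξ : Set (Module.Dual ℂ D.H)}
    {Q : Submodule (U L) M} (hQ : D.HwFilt Ξ Q) {S T : Submodule (U L) M} (h : ¬ T ⊓ Q ≤ S) :
    ∃ χ, ∃ v ∈ T, v ∉ S ∧ D.Sing S χ v := by
  induction hQ with
  | bot => exact absurd (inf_le_right.trans bot_le) h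
  | @step Q χ w _ _ hs ih =>
    by_cases hTQ : T ⊓ Q ≤ S
    swap
    · exact ih hTQ
    have key : ∀ n : ℕ, ∀ t ∈ T ⊓ (Q ⊔ Submodule.span (U L) {w}), t ∉ S → ∀ β : ℕ →₀ ℤ,
        t ∈ weightSpace D.H M (χ - D.wt β) → tot β = 0 → (∀ k ∉ D.dom, β k = 0) → ht β ≤ n →
        ∃ χ, ∃ v ∈ T, v ∉ S ∧ D.Sing S χ v := by
      intro n
      induction n with
      | zero | succ n ihn =>
        intro t htm htS β htβ hβ hβ0 hn
        by_cases hsing : ∀ i j, j ∈ D.dom → i < j → toU (D.E i j) • t ∈ S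
        · exact ⟨_, t, htm.1, htS, sing_of_generators htβ hsing⟩
        push Not at hsing
        obtain ⟨i, j, hj, hij, hE⟩ := hsing
        have hi := D.dom_lt hij.le hj
        have hET := Submodule.smul_mem _ (toU (D.E i j)) htm
        have hEw := D.toU_E_mem_weightSpace hi hj hij.ne htβ
        obtain ⟨γ, hγ, hγ0, hγt, hγd⟩ := hs.weight_eq hM hET.2 hEw fun h => hE (hTQ ⟨hET.1, h⟩)
        have hβγ : β - root i j = γ := by
          refine D.wt_inj (fun k hk => ?_) hγd ?_ ?_
          · rw [Finsupp.sub_apply, hβ0 k hk, root_out hi hj k hk, sub_zero]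
          · rw [map_sub, tot_root, hβ, hγt, sub_zero]
          · rw [map_sub]
            have h1 : D.wt γ = χ - (χ - D.wt γ) := by abel
            rw [h1, ← hγ]
            abel
        have h1 := ht_nonneg hγ0 hγt
        have h2 : ht γ = ht β - (j - i) := by rw [← hβγ, map_sub, ht_root]
        first
        | (push_cast at hn; omega)
        | exact ihn _ hET hE γ (hγ ▸ hEw) hγt hγd (by push_cast at hn; omega)
    obtain ⟨t, ht, htS⟩ := SetLike.not_le_iff_exists.mp h
    obtain ⟨ψ, t, ht, htψ, htS⟩ := exists_weight_mem hM ht htS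
    obtain ⟨β, rfl, hβ0, hβt, hβd⟩ := hs.weight_eq hM ht.2 htψ fun h => htS (hTQ ⟨ht.1, h⟩)
    exact key (SlData.ht β).toNat t ht htS β htψ hβt hβd (Int.self_le_toNat _)

lemma HwFilt.sv (hM : IsWeightModule D.H M) {Ξ : Set (Module.Dual ℂ D.H)}
    (h : D.HwFilt Ξ (⊤ : Submodule (U L) M)) : D.SV M := fun _ _ hST =>
  h.exists_sing hM (by rw [inf_top_eq]; exact not_le_of_gt hST)

lemma SV.hwFilt [IsNoetherian (U L) M] (h : D.SV M) :
    D.HwFilt Set.univ (⊤ : Submodule (U L) M) := by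
  obtain ⟨Q, hQ, hmax⟩ := WellFounded.has_min (wellFounded_gt (α := Submodule (U L) M))
    {Q | D.HwFilt Set.univ Q} ⟨⊥, .bot⟩
  by_cases hQt : Q = ⊤
  · exact hQt ▸ hQ
  obtain ⟨χ, v, -, hv, hs⟩ := h Q ⊤ (lt_top_iff_ne_top.mpr hQt)
  refine absurd (left_lt_sup.mpr fun hle => hv ?_) (hmax _ (HwFilt.step hQ (Set.mem_univ χ) hs))
  exact hle (Submodule.mem_span_singleton_self v)

lemma sing_comap_iff (f : M ⟶ M') {S : Submodule (U L) M'} {χ : Module.Dual ℂ D.H} {v : M} :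
    D.Sing (S.comap f.hom) χ v ↔ D.Sing S χ (f.hom v) := by
  have h (c : ℂ) : f.hom (c • v) = c • f.hom v := map_smul (f.hom.restrictScalars ℂ) c v
  simp only [Sing, Submodule.mem_comap, map_sub, map_smul, h]

lemma SV.of_injective (f : M ⟶ M') (hf : Function.Injective f.hom) (h : D.SV M') : D.SV M := by
  intro S T hST
  obtain ⟨χ, _, ⟨v, hv, rfl⟩, hvS, hs⟩ := h (S.map f.hom) (T.map f.hom)
    (Submodule.map_strictMono_of_injective hf hST)
  rw [← sing_comap_iff, Submodule.comap_map_eq_of_injective hf] at hs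
  exact ⟨χ, v, hv, fun h => hvS (Submodule.mem_map_of_mem h), hs⟩

lemma SV.of_surjective (f : M ⟶ M') (hf : Function.Surjective f.hom) (h : D.SV M) : D.SV M' := by
  intro S T hST
  obtain ⟨χ, v, hv, hvS, hs⟩ := h (S.comap f.hom) (T.comap f.hom)
    ((Submodule.comap_strictMono_of_surjective hf) hST)
  exact ⟨χ, f.hom v, hv, hvS, (sing_comap_iff f).mp hs⟩

/-- Either `S` and `T` already differ inside the first factor, or their images in the second factor
differ. In the latter case the elements of `T` with image in the image of `S` lie in `S`, so a
singular vector of the image lifts. -/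
lemma SV.prod (h : D.SV M) (h' : D.SV M') : D.SV (ModuleCat.of (U L) (M × M')) := by
  intro S T hST
  let i : M ⟶ ModuleCat.of (U L) (M × M') := ModuleCat.ofHom (LinearMap.inl (U L) M M')
  let q : ModuleCat.of (U L) (M × M') ⟶ M' := ModuleCat.ofHom (LinearMap.snd (U L) M M')
  by_cases hi : T.comap i.hom ≤ S.comap i.hom
  · have hq : S.map q.hom < T.map q.hom := by
      refine lt_of_le_of_ne (Submodule.map_mono hST.le) fun heq => hST.not_ge fun t ht => ?_
      obtain ⟨s, hs, hst⟩ : q.hom t ∈ S.map q.hom := heq ▸ Submodule.mem_map_of_mem ht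
      have h1 : t - s = i.hom (t.1 - s.1) := Prod.ext rfl (sub_eq_zero.mpr hst.symm)
      have h2 : t.1 - s.1 ∈ T.comap i.hom := by
        rw [Submodule.mem_comap, ← h1]
        exact T.sub_mem ht (hST.le hs)
      have h3 := hi h2
      rw [Submodule.mem_comap, ← h1] at h3
      have := S.add_mem h3 hs
      rwa [sub_add_cancel] at this
    obtain ⟨χ, _, ⟨t, ht, rfl⟩, htS, hs⟩ := h' _ _ hq
    rw [← sing_comap_iff] at hs
    have key : ∀ x ∈ T, x ∈ (S.map q.hom).comap q.hom → x ∈ S := by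
      rintro x hx ⟨s, hs, hsx⟩
      have h1 : x - s = i.hom (x.1 - s.1) := Prod.ext rfl (sub_eq_zero.mpr hsx.symm)
      have h2 : x.1 - s.1 ∈ T.comap i.hom := by
        rw [Submodule.mem_comap, ← h1]
        exact T.sub_mem hx (hST.le hs)
      have h3 := hi h2
      rw [Submodule.mem_comap, ← h1] at h3
      have := S.add_mem h3 hs
      rwa [sub_add_cancel] at this
    exact ⟨χ, t, ht, fun h => htS (Submodule.mem_map_of_mem h),
      fun a => key _ (T.sub_mem (T.smul_mem _ ht) (csmul_mem T _ ht)) (hs.1 a),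
      fun x hx => key _ (T.smul_mem _ ht) (hs.2 x hx)⟩
  · obtain ⟨t, ht, htS⟩ := SetLike.not_le_iff_exists.mp hi
    obtain ⟨χ, v, hv, hvS, hs⟩ := h (S.comap i.hom) (T.comap i.hom) (lt_of_le_of_ne
      (Submodule.comap_mono hST.le) fun heq => htS (heq ▸ ht))
    exact ⟨χ, i.hom v, hv, hvS, (sing_comap_iff i).mp hs⟩

lemma SW_of_injective (f : M ⟶ M') (hf : Function.Injective f.hom) :
    D.SW (⊥ : Submodule (U L) M) ⊤ ⊆ D.SW (⊥ : Submodule (U L) M') ⊤ := by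
  rintro χ ⟨R, v, -, -, hvR, hs⟩
  refine ⟨R.map f.hom, f.hom v, bot_le, trivial, ?_, ?_⟩
  · rintro ⟨w, hw, hwv⟩
    exact hvR (hf hwv ▸ hw)
  · rwa [← sing_comap_iff, Submodule.comap_map_eq_of_injective hf]

lemma SW_of_surjective (f : M ⟶ M') (hf : Function.Surjective f.hom) :
    D.SW (⊥ : Submodule (U L) M') ⊤ ⊆ D.SW (⊥ : Submodule (U L) M) ⊤ := by
  rintro χ ⟨R, v, -, -, hvR, hs⟩
  obtain ⟨v, rfl⟩ := hf v
  exact ⟨R.comap f.hom, v, bot_le, trivial, hvR, (sing_comap_iff f).mpr hs⟩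

end SlData

lemma isWeightModule_prod {H : Submodule ℂ L} {M M' : Rep.{u} L} (h : IsWeightModule H M)
    (h' : IsWeightModule H M') : IsWeightModule H (ModuleCat.of (U L) (M × M')) := by
  rw [IsWeightModule, eq_top_iff]
  let i : M ⟶ ModuleCat.of (U L) (M × M') := ModuleCat.ofHom (LinearMap.inl (U L) M M')
  let j : M' ⟶ ModuleCat.of (U L) (M × M') := ModuleCat.ofHom (LinearMap.inr (U L) M M')
  have key {M₁ : Rep.{u} L} (h : IsWeightModule H M₁) (i : M₁ ⟶ ModuleCat.of (U L) (M × M'))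
      (x : M₁) : i.hom x ∈ ⨆ χ, weightSpace H (ModuleCat.of (U L) (M × M')) χ := by
    obtain ⟨s, g, hg, rfl⟩ := h.exists_sum x
    rw [map_sum]
    exact Submodule.sum_mem _ fun χ _ => Submodule.mem_iSup_of_mem χ (map_mem_weightSpace i (hg χ))
  rintro ⟨x, y⟩ -
  have : ((x, y) : M × M') = i.hom x + j.hom y := Prod.ext (add_zero x).symm (zero_add y).symm
  rw [this]
  exact Submodule.add_mem _ (key h i x) (key h' j y)

lemma isLocallyFinite_prod {N : Submodule ℂ L} {M M' : Rep.{u} L} (h : IsLocallyFinite N M)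
    (h' : IsLocallyFinite N M') : IsLocallyFinite N (ModuleCat.of (U L) (M × M')) := by
  rintro ⟨x, y⟩
  obtain ⟨V, hV, hx, hVN⟩ := h x
  obtain ⟨W, hW, hy, hWN⟩ := h' y
  let i : M ⟶ ModuleCat.of (U L) (M × M') := ModuleCat.ofHom (LinearMap.inl (U L) M M')
  let j : M' ⟶ ModuleCat.of (U L) (M × M') := ModuleCat.ofHom (LinearMap.inr (U L) M M')
  refine ⟨V.map (i.hom.restrictScalars ℂ) ⊔ W.map (j.hom.restrictScalars ℂ), inferInstance, ?_, ?_⟩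
  · have : ((x, y) : M × M') = i.hom x + j.hom y := Prod.ext (add_zero x).symm (zero_add y).symm
    rw [this]
    exact Submodule.add_mem_sup (Submodule.mem_map_of_mem hx) (Submodule.mem_map_of_mem hy)
  · intro a ha w hw
    obtain ⟨_, ⟨w₁, hw₁, rfl⟩, _, ⟨w₂, hw₂, rfl⟩, rfl⟩ := Submodule.mem_sup.mp hw
    rw [smul_add]
    refine Submodule.add_mem_sup ⟨toU a • w₁, hVN a ha w₁ hw₁, ?_⟩ ⟨toU a • w₂, hWN a ha w₂ hw₂, ?_⟩
    · exact map_smul i.hom _ _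
    · exact map_smul j.hom _ _

end SingularVectors

/-! ### Blocks -/

section BlockTheory

open scoped ModuleCat

variable {L : Type} [LieRing L] [LieAlgebra ℂ L] (D : SlData L)

/-- Highest weight modules. -/
def IsHW (M : Rep.{u} L) (χ : Module.Dual ℂ D.H) : Prop :=
  ∃ v : M, v ≠ 0 ∧ Submodule.span (U L) {v} = ⊤ ∧ D.Sing ⊥ χ v

/-- A cyclic module with a highest weight submodule and a highest weight quotient in which the
generator of the submodule is obtained from the generator of the module, but not conversely. -/
def IsLink (M : Rep.{u} L) (χ χ' : Module.Dual ℂ D.H) : Prop :=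
  ∃ u v : M, Submodule.span (U L) {u} = ⊤ ∧ v ≠ 0 ∧ D.Sing ⊥ χ v ∧
    D.Sing (Submodule.span (U L) {v}) χ' u ∧ u ∉ Submodule.span (U L) {v} ∧
    u ∈ weightSpace D.H M χ' ∧ ∀ y ∈ Submodule.span (U L) {v}, y ∈ weightSpace D.H M χ' → y = 0

/-- The properties of a category of modules which allow to determine its principal block. -/
structure BlockData (P : ObjectProperty (Rep.{u} L)) : Prop where
  weight : ∀ {M}, P M → IsWeightModule D.H M
  hwFilt : ∀ {M : Rep.{u} L}, P M → D.HwFilt Set.univ (⊤ : Submodule (U L) M)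
  of_surjective : ∀ {M M' : Rep.{u} L} (f : M ⟶ M'), Function.Surjective f.hom → P M → P M'
  -- Only cyclic submodules are required: for these finite generation is immediate and Noetherianity
  -- does not enter.
  of_injective : ∀ {M M' : Rep.{u} L} (f : M ⟶ M') (x : M), Function.Injective f.hom →
    Submodule.span (U L) {x} = ⊤ → P M' → P M
  prod : ∀ {M M' : Rep.{u} L}, P M → P M' → P (ModuleCat.of (U L) (M × M'))
  trivial : ∀ {M}, IsTrivialRep M → P M
  link : ∀ (a : ℕ →₀ ℤ) (σ : Equiv.Perm ℕ), (∀ i : ℕ, a i = i - σ i) → (∀ i ∉ D.dom, a i = 0) →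
    ∀ i, i + 1 ∈ D.dom → σ i < σ (i + 1) →
    ∃ M, P M ∧ IsLink D M (D.wt a) (D.wt (a - ((σ (i + 1) : ℤ) - σ i) • root i (i + 1)))

variable {D}

lemma Sing_bot_weight {M : Rep.{u} L} {χ : Module.Dual ℂ D.H} {v : M} (h : D.Sing ⊥ χ v) :
    v ∈ weightSpace D.H M χ := fun a => sub_eq_zero.mp ((Submodule.mem_bot _).mp (h.1 a))

/-- The only word that does not change the weight is the empty one. -/
lemma SlData.Sing.weight_self {M : Rep.{u} L} (hM : IsWeightModule D.H M) {χ : Module.Dual ℂ D.H}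
    {v y : M} (h : D.Sing ⊥ χ v) (hy : y ∈ Submodule.span (U L) {v})
    (hyχ : y ∈ weightSpace D.H M χ) : ∃ c : ℂ, y = c • v := by
  obtain ⟨s, hs, -, w, hw, rfl⟩ := h.mem_of_weight hM (Sing_bot_weight h)
    (Submodule.mem_sup_right (S := ⊥) hy) hyχ
  rw [(Submodule.mem_bot _).mp hs, zero_add]
  have hsub : {x | ∃ β, D.Desc v (fun _ _ => True) β x ∧ χ - D.wt β = χ} ⊆ {v} := by
    rintro x ⟨β, hβ, hβχ⟩
    have h0 : β = 0 := D.eq_zero_of_wt (fun i hi => hβ.out hi) hβ.tot_eq (sub_eq_self.mp hβχ)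
    exact hβ.eq_of_hd fun n => by rw [h0, map_zero]
  obtain ⟨c, hc⟩ := Submodule.mem_span_singleton.mp (Submodule.span_mono hsub hw)
  exact ⟨c, hc.symm⟩

lemma IsTrivialRep.isHW {M : Rep.{u} L} (h : IsTrivialRep M) : IsHW D M 0 := by
  obtain ⟨h1, h2⟩ := h
  obtain ⟨v, hv, hv'⟩ := finrank_eq_one_iff'.mp h1
  refine ⟨v, hv, ?_, fun a => ?_, fun x _ => ?_⟩
  · rw [eq_top_iff]
    rintro w -
    obtain ⟨c, rfl⟩ := hv' w
    rw [← algebraMap_smul (U L) c v]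
    exact Submodule.smul_mem _ _ (Submodule.mem_span_singleton_self v)
  · rw [h2, LinearMap.zero_apply, zero_smul, sub_zero]
    exact Submodule.zero_mem _
  · rw [h2]
    exact Submodule.zero_mem _

variable (L) in
/-- The augmentation of the enveloping algebra. -/
def augmentation : U L →ₐ[ℂ] ℂ := UniversalEnvelopingAlgebra.lift ℂ (0 : L →ₗ⁅ℂ⁆ ℂ)

variable (L) in
/-- The trivial module. -/
def trivialRep : Rep.{u} L :=
  (ModuleCat.restrictScalars (augmentation L).toRingHom).obj (ModuleCat.of ℂ (ULift.{u} ℂ))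

lemma isTrivialRep_trivialRep : IsTrivialRep (trivialRep.{u} L) := by
  have hsmul (c : ℂ) (v : trivialRep.{u} L) :
      c • v = (show trivialRep.{u} L from c • (show ULift.{u} ℂ from v)) := by
    have h1 : c • v = algebraMap ℂ (U L) c • v := (algebraMap_smul (U L) c v).symm
    rw [h1]
    change (augmentation L (algebraMap ℂ (U L) c)) • (show ULift.{u} ℂ from v) = _
    rw [AlgHom.commutes]
    rfl
  constructor
  · refine finrank_eq_one_iff'.mpr ⟨(show trivialRep.{u} L from ULift.up 1), ?_, fun w => ?_⟩
    · intro h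
      exact one_ne_zero (congrArg ULift.down (show (ULift.up 1 : ULift.{u} ℂ) = ULift.up 0 from h))
    · refine ⟨(show ULift.{u} ℂ from w).down, ?_⟩
      rw [hsmul]
      exact ULift.down_injective (mul_one _)
  · intro x v
    change (augmentation L (toU x)) • (show ULift.{u} ℂ from v) = 0
    have : augmentation L (toU x) = 0 := UniversalEnvelopingAlgebra.lift_ι_apply ℂ _ x
    rw [this, zero_smul]

/-- An internal direct sum as a biproduct. -/
def isoBiprod {M : Rep.{u} L} {X Y : Submodule (U L) M} (h : IsCompl X Y) :
    M ≅ ModuleCat.of (U L) X ⊞ ModuleCat.of (U L) Y :=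
  (X.prodEquivOfIsCompl Y h).toModuleIso.symm ≪≫
    (ModuleCat.biprodIsoProd (ModuleCat.of (U L) X) (ModuleCat.of (U L) Y)).symm

section Decomposition

variable {P A B : ObjectProperty (Rep.{u} L)} (hAB : IsDirectSumDecomposition P A B)
  (hP : BlockData D P)
include hAB hP

/-- Highest weight modules are indecomposable. -/
lemma IsHW.left_or_right {M : Rep.{u} L} {χ : Module.Dual ℂ D.H} (h : IsHW D M χ) (hM : P M) :
    A M ∨ B M := by
  obtain ⟨v, hv0, hv, hs⟩ := h
  obtain ⟨X, Y, hX, hY, ⟨e⟩⟩ := hAB.exists_iso hM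
  let q : M ⟶ M := e.hom ≫ biprod.fst ≫ biprod.inl ≫ e.inv
  let r : M ⟶ M := e.hom ≫ biprod.snd ≫ biprod.inr ≫ e.inv
  have hqr : q + r = 𝟙 M := by
    have h1 := biprod.total (X := X) (Y := Y)
    have h2 : e.hom ≫ (biprod.fst ≫ biprod.inl + biprod.snd ≫ biprod.inr) ≫ e.inv = 𝟙 M := by
      rw [h1, Category.id_comp, e.hom_inv_id]
    rw [Preadditive.add_comp, Preadditive.comp_add, Category.assoc, Category.assoc] at h2
    exact h2
  have hqq : q ≫ q = q := by simp [q]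
  -- The projection to a summand multiplies the generator by a scalar, since its weight space is a
  -- line; the scalar is idempotent, so the projection is zero or the identity.
  obtain ⟨c, hc⟩ := hs.weight_self (hP.weight hM) (y := q.hom v) (by rw [hv]; trivial)
    (map_mem_weightSpace q (Sing_bot_weight hs))
  have hgen {M' : Rep.{u} L} (f g : M ⟶ M') (hfg : f.hom v = g.hom v) : f = g := by
    apply ModuleCat.hom_ext
    refine LinearMap.ext_on (s := {v}) hv fun x hx => ?_
    rw [Set.mem_singleton_iff.mp hx]
    exact hfg
  have hcc : c = 0 ∨ c = 1 := by
    have h1 : q.hom (q.hom v) = q.hom v := congrArg (fun f => f.hom v) hqq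
    rw [hc] at h1
    have h2 : q.hom (c • v) = c • q.hom v := map_smul (q.hom.restrictScalars ℂ) c v
    rw [h2, hc, smul_smul, ← sub_eq_zero, ← sub_smul] at h1
    have h3 : c * (c - 1) = 0 := by
      have := (smul_eq_zero.mp h1).resolve_right hv0
      linear_combination this
    exact (mul_eq_zero.mp h3).imp_right sub_eq_zero.mp
  rcases hcc with rfl | rfl
  · right
    have hq0 : q = 0 := hgen _ _ (by rw [hc, zero_smul]; rfl)
    rw [hq0, zero_add] at hqr
    have := hAB.right_iso
    exact B.prop_of_iso (X := Y) ⟨biprod.inr ≫ e.inv, e.hom ≫ biprod.snd, by simp,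
      by rw [← hqr]; simp [r]⟩ hY
  · left
    have hq1 : q = 𝟙 M := hgen _ _ (by rw [hc, one_smul]; rfl)
    have := hAB.left_iso
    exact A.prop_of_iso (X := X) ⟨biprod.inl ≫ e.inv, e.hom ≫ biprod.fst, by simp,
      by rw [← hq1]; simp [q]⟩ hX

/-- Highest weight modules with the same highest weight lie on the same side. -/
lemma IsHW.same_side {M M' : Rep.{u} L} {χ : Module.Dual ℂ D.H} (h : IsHW D M χ) (hM : A M)
    (h' : IsHW D M' χ) (hM' : P M') : A M' := by
  refine (h'.left_or_right hAB hP hM').resolve_right fun hB => ?_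
  obtain ⟨v, hv0, hv, hs⟩ := h
  obtain ⟨v', hv0', hv', hs'⟩ := h'
  -- The pair of the two generators generates a highest weight submodule of the product with nonzero
  -- maps to `M` and to `M'`. It lies on one side, so `M` and `M'` cannot lie on different sides.
  let V : Rep.{u} L := ModuleCat.of (U L) (M × M')
  let w : V := (v, v')
  let N : Rep.{u} L := ModuleCat.of (U L) (Submodule.span (U L) {w})
  let j : N ⟶ V := ModuleCat.ofHom (Submodule.subtype _)
  have hj : Function.Injective j.hom := Subtype.val_injective
  let y : N := ⟨w, Submodule.mem_span_singleton_self w⟩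
  have hy : Submodule.span (U L) {y} = ⊤ := by
    rw [eq_top_iff]
    rintro ⟨x, hx⟩ -
    obtain ⟨a, rfl⟩ := Submodule.mem_span_singleton.mp hx
    exact Submodule.mem_span_singleton.mpr ⟨a, rfl⟩
  have hV : P V := hP.prod (hAB.left_le _ hM) hM'
  have hN : P N := hP.of_injective j y hj hy hV
  have hws : D.Sing ⊥ χ w := by
    constructor
    · intro a
      rw [Submodule.mem_bot, sub_eq_zero]
      exact Prod.ext (Sing_bot_weight hs a) (Sing_bot_weight hs' a)
    · intro x hx
      rw [Submodule.mem_bot]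
      exact Prod.ext ((Submodule.mem_bot _).mp (hs.2 x hx)) ((Submodule.mem_bot _).mp (hs'.2 x hx))
  have hys : D.Sing ⊥ χ y := by
    have : (⊥ : Submodule (U L) N) = (⊥ : Submodule (U L) V).comap j.hom := by
      rw [Submodule.comap_bot, LinearMap.ker_eq_bot.mpr hj]
    rw [this, SlData.sing_comap_iff]
    exact hws
  have hy0 : y ≠ 0 := fun h0 => hv0 (congrArg Prod.fst (congrArg Subtype.val h0))
  rcases IsHW.left_or_right hAB hP ⟨y, hy0, hy, hys⟩ hN with hA | hB'
  · have h0 := hAB.hom_left_right hA hB (j ≫ ModuleCat.ofHom (LinearMap.snd (U L) M M'))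
    exact hv0' (congrArg (fun f => f.hom y) h0)
  · have h0 := hAB.hom_right_left hM hB' (j ≫ ModuleCat.ofHom (LinearMap.fst (U L) M M'))
    exact hv0 (congrArg (fun f => f.hom y) h0)

/-- The two highest weights of a link lie on the same side. -/
lemma IsLink.left {M : Rep.{u} L} {χ χ' : Module.Dual ℂ D.H} (h : IsLink D M χ χ') (hM : P M)
    (hχ : ∀ N, P N → IsHW D N χ → A N) {M' : Rep.{u} L} (h' : IsHW D M' χ') (hM' : P M') :
    A M' := by
  obtain ⟨u, v, hu, hv0, hv, hsu, huv, huw, hy⟩ := h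
  let S := Submodule.span (U L) {v}
  let V : Rep.{u} L := ModuleCat.of (U L) S
  let Q : Rep.{u} L := ModuleCat.of (U L) (M ⧸ S)
  let j : V ⟶ M := ModuleCat.ofHom S.subtype
  let q : M ⟶ Q := ModuleCat.ofHom S.mkQ
  have hj : Function.Injective j.hom := Subtype.val_injective
  have hq : Function.Surjective q.hom := S.mkQ_surjective
  let v₁ : V := ⟨v, Submodule.mem_span_singleton_self v⟩
  have hv₁ : Submodule.span (U L) {v₁} = ⊤ := by
    rw [eq_top_iff]
    rintro ⟨x, hx⟩ -
    obtain ⟨a, rfl⟩ := Submodule.mem_span_singleton.mp hx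
    exact Submodule.mem_span_singleton.mpr ⟨a, rfl⟩
  have hVs : D.Sing ⊥ χ v₁ := by
    have : (⊥ : Submodule (U L) V) = (⊥ : Submodule (U L) M).comap j.hom := by
      rw [Submodule.comap_bot, LinearMap.ker_eq_bot.mpr hj]
    rw [this, SlData.sing_comap_iff]
    exact hv
  have hVA : A V := hχ V (hP.of_injective j v₁ hj hv₁ hM)
    ⟨v₁, fun h => hv0 (congrArg Subtype.val h), hv₁, hVs⟩
  have hQP : P Q := hP.of_surjective q hq hM
  have hQ : IsHW D Q χ' := by
    refine ⟨q.hom u, fun h => huv ((Submodule.Quotient.mk_eq_zero S).mp h), ?_, ?_⟩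
    · rw [← Set.image_singleton, ← Submodule.map_span, hu, Submodule.map_top,
        LinearMap.range_eq_top.mpr hq]
    · rw [← SlData.sing_comap_iff]
      have : (⊥ : Submodule (U L) Q).comap q.hom = S := by
        rw [Submodule.comap_bot]
        exact S.ker_mkQ
      rwa [this]
  rcases hQ.left_or_right hAB hP hQP with hA | hB
  · exact hQ.same_side hAB hP hA h' hM'
  · exfalso
    -- Suppose the quotient is on the other side. Then `S` lies in the summand `X`, and `X` maps to
    -- zero in the quotient, so `X` lies in `S`. Since `S` has no vectors of the weight of `u`, the
    -- generator has no component in `X`, so `X` and with it `S` would vanish.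
    obtain ⟨X, Y, hX, hY, ⟨e⟩⟩ := hAB.exists_iso hM
    have h1 : j ≫ e.hom ≫ biprod.snd = 0 := hAB.hom_left_right hVA hY _
    have h2 : (biprod.inl ≫ e.inv) ≫ q = 0 := hAB.hom_left_right hX hB _
    -- the component of `u` in `X` lies in `S`, so it vanishes
    let p : M ⟶ M := e.hom ≫ biprod.fst ≫ biprod.inl ≫ e.inv
    have hp : p ≫ q = 0 := by
      have : p ≫ q = e.hom ≫ biprod.fst ≫ (biprod.inl ≫ e.inv) ≫ q := by simp [p]
      rw [this, h2]
      simp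
    have hpu : p.hom u = 0 := hy _ ((Submodule.Quotient.mk_eq_zero S).mp
      (congrArg (fun f => f.hom u) hp)) (map_mem_weightSpace p huw)
    have hp0 : p = 0 := by
      apply ModuleCat.hom_ext
      refine LinearMap.ext_on (s := {u}) hu fun x hx => ?_
      rw [Set.mem_singleton_iff.mp hx]
      exact hpu
    have h3 : e.hom ≫ biprod.fst = 0 := by
      have : e.hom ≫ biprod.fst = p ≫ e.hom ≫ biprod.fst := by simp [p]
      rw [this, hp0]
      simp
    have h4 : j ≫ e.hom = 0 := by
      apply biprod.hom_ext
      · rw [Category.assoc, h3]; simp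
      · rw [Category.assoc, h1]; simp
    have h5 : j = 0 := by
      rw [← cancel_mono e.hom, h4]; simp
    exact hv0 (congrArg (fun f => f.hom v₁) h5)

end Decomposition

end BlockTheory

/-! ### The principal block -/

section PrincipalBlock

open scoped ModuleCat

/-- A permutation of the natural numbers without descents is strictly increasing, as is its inverse,
so it is the identity. -/
lemma exists_descent {σ : Equiv.Perm ℕ} {n : ℕ} (hσ : ∀ i, n ≤ i → σ i = i) (h : σ ≠ 1) :
    ∃ i, i + 1 < n ∧ σ (i + 1) < σ i := by
  by_contra! hcon
  have hmono : StrictMono σ := strictMono_nat_of_lt_succ fun i => by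
    rcases lt_trichotomy (i + 1) n with hi | hi | hi
    · exact lt_of_le_of_ne (hcon i hi) fun h => by
        have := σ.injective h
        omega
    · rw [hσ (i + 1) hi.ge]
      exact (perm_lt hσ (by omega : i < n)).trans_eq hi.symm
    · rw [hσ i (by omega), hσ (i + 1) (by omega)]
      exact Nat.lt_succ_self i
  apply h
  ext i
  have h1 := hmono.le_apply (x := i)
  have hmono' : StrictMono σ.symm := fun a b hab => by
    by_contra hc
    have := hmono.monotone (not_lt.mp hc)
    rw [σ.apply_symm_apply, σ.apply_symm_apply] at this
    omega
  have h2 := hmono'.le_apply (x := σ i)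
  rw [σ.symm_apply_apply] at h2
  rw [Equiv.Perm.one_apply]
  omega

variable {L : Type} [LieRing L] [LieAlgebra ℂ L] {D : SlData L}

section Decomposition

variable {P A B : ObjectProperty (Rep.{u} L)} (hAB : IsDirectSumDecomposition P A B)
  (hP : BlockData D P) (hA : IsTrivialRep ≤ A)
include hAB hP hA

/-- The highest weight modules with linked highest weights lie in the principal block. -/
lemma IsHW.left_of_linked {a : ℕ →₀ ℤ} (ha : Linked a) (ha0 : ∀ i ∉ D.dom, a i = 0) :
    ∀ M : Rep.{u} L, P M → IsHW D M (D.wt a) → A M := by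
  by_contra! hcon
  obtain ⟨n, hn⟩ := exists_bound a
  -- a counterexample of maximal height
  let bad : Set (ℕ →₀ ℤ) := {b | (Linked b ∧ ∀ i, n ≤ i → b i = 0) ∧ (∀ i ∉ D.dom, b i = 0) ∧
    ∃ M : Rep.{u} L, P M ∧ IsHW D M (D.wt b) ∧ ¬ A M}
  have hfin : bad.Finite := (finite_linked n).subset fun b hb => hb.1
  obtain ⟨b, hb, hmax⟩ := Set.exists_max_image bad SlData.ht hfin ⟨a, ⟨ha, hn⟩, ha0, hcon⟩
  obtain ⟨⟨⟨σ, hσ⟩, hbn⟩, hb0, M, hM, hMb, hMA⟩ := hb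
  have hfix : ∀ i, n ≤ i → σ i = i := fun i hi => by
    have := hσ i
    rw [hbn i hi] at this
    omega
  by_cases h1 : σ = 1
  · have hb' : b = 0 := by
      ext i
      rw [hσ, h1]
      simp
    rw [hb', map_zero] at hMb
    exact hMA (IsHW.same_side hAB hP isTrivialRep_trivialRep.isHW
      (hA _ isTrivialRep_trivialRep) hMb hM)
  · obtain ⟨i, hin, hi⟩ := exists_descent hfix h1
    have hidom : i + 1 ∈ D.dom := by
      by_contra hd
      obtain ⟨j, hj⟩ : ∃ j, σ j = i + 1 := ⟨_, σ.apply_symm_apply (i + 1)⟩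
      have e1 := hσ (i + 1)
      rw [hb0 _ hd] at e1
      have e2 := hσ i
      by_cases hdi : i ∈ D.dom
      · -- the permutation fixes the indices outside of the domain
        have hfix' : ∀ k, i + 1 ≤ k → σ k = k := fun k hk => by
          have := hσ k
          rw [hb0 k fun hk' => hd (D.dom_lt hk hk')] at this
          omega
        have := perm_lt hfix' (Nat.lt_succ_self i)
        omega
      · rw [hb0 _ hdi] at e2
        omega
    -- Undoing the descent gives the weight `c` of the orbit, which is higher by `σ i - σ (i + 1)`
    -- times a simple root. By maximality of `b` it is no counterexample, and the link between `c`
    -- and `b` carries the conclusion over to `b`.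
    let τ : Equiv.Perm ℕ := σ * Equiv.swap i (i + 1)
    have hτi : τ i = σ (i + 1) := by simp [τ]
    have hτi' : τ (i + 1) = σ i := by simp [τ]
    have hτ (k : ℕ) (h1 : k ≠ i) (h2 : k ≠ i + 1) : τ k = σ k := by
      simp [τ, Equiv.swap_apply_of_ne_of_ne h1 h2]
    let c : ℕ →₀ ℤ := b + ((σ i : ℤ) - σ (i + 1)) • root i (i + 1)
    have hroot (k : ℕ) : root i (i + 1) k = (if k = i then 1 else 0) - if k = i + 1 then 1 else 0 := by
      rw [root, Finsupp.sub_apply, Finsupp.single_apply, Finsupp.single_apply]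
      simp only [eq_comm]
    have hc (k : ℕ) : c k = b k + ((σ i : ℤ) - σ (i + 1)) *
        ((if k = i then 1 else 0) - if k = i + 1 then 1 else 0) := by
      change (b + ((σ i : ℤ) - σ (i + 1)) • root i (i + 1)) k = _
      rw [Finsupp.add_apply, Finsupp.smul_apply, hroot, smul_eq_mul]
    have hcτ (k : ℕ) : c k = k - τ k := by
      rw [hc, hσ]
      by_cases h1 : k = i
      · subst h1
        rw [if_pos rfl, if_neg (by omega), hτi]
        ring
      · by_cases h2 : k = i + 1
        · subst h2
          rw [if_neg (by omega), if_pos rfl, hτi']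
          ring
        · rw [if_neg h1, if_neg h2, hτ k h1 h2]
          ring
    have hcn (k : ℕ) (hk : n ≤ k) : c k = 0 := by
      rw [hc, hbn k hk, if_neg (by omega), if_neg (by omega)]
      ring
    have hc0 (k : ℕ) (hk : k ∉ D.dom) : c k = 0 := by
      have h1 : k ≠ i := fun h => hk (h ▸ D.dom_lt (Nat.le_succ i) hidom)
      have h2 : k ≠ i + 1 := fun h => hk (h ▸ hidom)
      rw [hc, hb0 k hk, if_neg h1, if_neg h2]
      ring
    have hgood : ∀ N : Rep.{u} L, P N → IsHW D N (D.wt c) → A N := by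
      by_contra! hcon'
      have h1 := hmax c ⟨⟨⟨τ, hcτ⟩, hcn⟩, hc0, hcon'⟩
      have h2 : SlData.ht c = SlData.ht b + ((σ i : ℤ) - σ (i + 1)) := by
        change SlData.ht (b + ((σ i : ℤ) - σ (i + 1)) • root i (i + 1)) = _
        rw [map_add, map_zsmul, SlData.ht_root]
        push_cast
        rw [smul_eq_mul]
        ring
      omega
    obtain ⟨W, hW, hlink⟩ := hP.link c τ hcτ hc0 i hidom (by rw [hτi, hτi']; exact hi)
    have hcb : c - ((τ (i + 1) : ℤ) - τ i) • root i (i + 1) = b := by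
      rw [hτi, hτi', add_sub_cancel_right]
    rw [hcb] at hlink
    exact hMA (hlink.left hAB hP hW hgood hMb hM)

end Decomposition

lemma BlockData.of_iso {P : ObjectProperty (Rep.{u} L)} (hP : BlockData D P) {M M' : Rep.{u} L}
    (e : M ≅ M') (h : P M) : P M' :=
  hP.of_surjective e.hom e.toLinearEquiv.surjective h

/-- The decomposition of a category by linkage. -/
lemma isDirectSumDecomposition_linkage (Λ : Levels D) {P : ObjectProperty (Rep.{u} L)}
    (hP : BlockData D P) : IsDirectSumDecomposition P
      (fun M => P M ∧ D.SW (⊥ : Submodule (U L) M) ⊤ ⊆ D.lnk)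
      (fun M => P M ∧ D.SW (⊥ : Submodule (U L) M) ⊤ ⊆ D.lnkᶜ) where
  left_le _ h := h.1
  right_le _ h := h.1
  left_iso := ⟨fun e h => ⟨hP.of_iso e h.1,
    (SlData.SW_of_surjective e.hom e.toLinearEquiv.surjective).trans h.2⟩⟩
  right_iso := ⟨fun e h => ⟨hP.of_iso e h.1,
    (SlData.SW_of_surjective e.hom e.toLinearEquiv.surjective).trans h.2⟩⟩
  hom_left_right X Y hX hY f := by
    by_contra hf
    -- A nonzero morphism maps some vector singular modulo its kernel to a singular vector of the
    -- same weight, which would be both linked and unlinked.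
    have hker : LinearMap.ker f.hom < ⊤ := lt_top_iff_ne_top.mpr fun h =>
      hf (ModuleCat.hom_ext (LinearMap.ker_eq_top.mp h))
    obtain ⟨χ, v, -, hv, hs⟩ := (hP.hwFilt hX.1).sv (hP.weight hX.1) _ _ hker
    have h1 := hX.2 ⟨_, v, bot_le, trivial, hv, hs⟩
    rw [← Submodule.comap_bot, SlData.sing_comap_iff] at hs
    exact hY.2 ⟨⊥, f.hom v, bot_le, trivial, hv, hs⟩ h1
  hom_right_left X Y hX hY f := by
    by_contra hf
    have hker : LinearMap.ker f.hom < ⊤ := lt_top_iff_ne_top.mpr fun h =>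
      hf (ModuleCat.hom_ext (LinearMap.ker_eq_top.mp h))
    obtain ⟨χ, v, -, hv, hs⟩ := (hP.hwFilt hY.1).sv (hP.weight hY.1) _ _ hker
    have h1 := hY.2 ⟨_, v, bot_le, trivial, hv, hs⟩
    rw [← Submodule.comap_bot, SlData.sing_comap_iff] at hs
    exact h1 (hX.2 ⟨⊥, f.hom v, bot_le, trivial, hv, hs⟩)
  exists_iso M hM := by
    have hw := hP.weight hM
    obtain ⟨X, Y, hd, ht, hX, hY⟩ := (hP.hwFilt hM).exists_split Λ hw
    have hc : IsCompl X Y := ⟨hd, codisjoint_iff.mpr ht⟩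
    have sub (Z : Submodule (U L) M) : D.SW (⊥ : Submodule (U L) (ModuleCat.of (U L) Z)) ⊤ ⊆
        D.SW ⊥ Z := by
      rintro χ ⟨R, v, -, -, hvR, hs⟩
      let f : ModuleCat.of (U L) Z ⟶ M := ModuleCat.ofHom Z.subtype
      have hf : Function.Injective f.hom := Subtype.val_injective
      refine ⟨R.map f.hom, v.1, bot_le, v.2, ?_, ?_⟩
      · rintro ⟨w, hw, hwv⟩
        exact hvR (hf hwv ▸ hw)
      · change D.Sing (R.map f.hom) χ (f.hom v)
        rwa [← SlData.sing_comap_iff, Submodule.comap_map_eq_of_injective hf]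
    refine ⟨ModuleCat.of (U L) X, ModuleCat.of (U L) Y, ⟨?_, ?_⟩, ⟨?_, ?_⟩, ⟨isoBiprod hc⟩⟩
    · exact hP.of_surjective ((isoBiprod hc).hom ≫ biprod.fst)
        ((ModuleCat.epi_iff_surjective _).mp inferInstance) hM
    · exact (sub X).trans (hX.SW_subset Λ hw)
    · exact hP.of_surjective ((isoBiprod hc).hom ≫ biprod.snd)
        ((ModuleCat.epi_iff_surjective _).mp inferInstance) hM
    · exact (sub Y).trans (hY.SW_subset_compl Λ hw)

/-- The principal block consists of the modules all of whose singular weights are linked to zero. -/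
theorem blockContaining_iff (Λ : Levels D) {P : ObjectProperty (Rep.{u} L)} (hP : BlockData D P)
    (M : Rep.{u} L) : blockContaining P IsTrivialRep M ↔
      P M ∧ D.SW (⊥ : Submodule (U L) M) ⊤ ⊆ D.lnk := by
  constructor
  · rintro ⟨-, h⟩
    refine h _ _ (isDirectSumDecomposition_linkage Λ hP) fun T hT => ⟨hP.trivial hT, ?_⟩
    rintro χ ⟨R, v, -, -, hvR, hs⟩
    refine ⟨0, Linked.zero, fun _ _ => rfl, ?_⟩
    rw [map_zero]
    -- A trivial module has only the weight zero, which is linked.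
    ext a
    have h1 := hs.1 a
    rw [hT.2, zero_sub, R.neg_mem_iff] at h1
    by_contra hne
    exact hvR (SlData.mem_of_csmul_mem R hne h1)
  · rintro ⟨hM, hSW⟩
    refine ⟨hM, fun A B hAB hA => ?_⟩
    obtain ⟨X, Y, hX, hY, ⟨e⟩⟩ := hAB.exists_iso hM
    let j : Y ⟶ M := biprod.inr ≫ e.inv
    have hj : Function.Injective j.hom := (ModuleCat.mono_iff_injective _).mp inferInstance
    -- A singular vector of the summand on the wrong side would generate a highest weight module
    -- with linked weight. That module lies in `A` and embeds into an object of `B`.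
    have hY0 : ∀ y : Y, y = 0 := by
      by_contra! hne
      obtain ⟨y₀, hy₀⟩ := hne
      have hbot : (⊥ : Submodule (U L) Y) < ⊤ := bot_lt_iff_ne_bot.mpr fun h =>
        hy₀ ((Submodule.mem_bot (U L)).mp (h ▸ Submodule.mem_top))
      have hYP := hAB.right_le _ hY
      obtain ⟨χ, y, -, hy0, hs⟩ := (hP.hwFilt hYP).sv (hP.weight hYP) _ _ hbot
      have hχ : χ ∈ D.lnk := hSW (SlData.SW_of_injective j hj ⟨⊥, y, bot_le, trivial, hy0, hs⟩)
      obtain ⟨a, ha, ha0, rfl⟩ := hχ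
      let S := Submodule.span (U L) {y}
      let N : Rep.{u} L := ModuleCat.of (U L) S
      let i : N ⟶ Y := ModuleCat.ofHom S.subtype
      have hi : Function.Injective i.hom := Subtype.val_injective
      let y₁ : N := ⟨y, Submodule.mem_span_singleton_self y⟩
      have hy₁ : Submodule.span (U L) {y₁} = ⊤ := by
        rw [eq_top_iff]
        rintro ⟨x, hx⟩ -
        obtain ⟨b, rfl⟩ := Submodule.mem_span_singleton.mp hx
        exact Submodule.mem_span_singleton.mpr ⟨b, rfl⟩
      have hNs : D.Sing ⊥ (D.wt a) y₁ := by
        have : (⊥ : Submodule (U L) N) = (⊥ : Submodule (U L) Y).comap i.hom := by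
          rw [Submodule.comap_bot, LinearMap.ker_eq_bot.mpr hi]
        rw [this, SlData.sing_comap_iff]
        exact hs
      have hNA : A N := IsHW.left_of_linked hAB hP hA ha ha0 N
        (hP.of_injective i y₁ hi hy₁ hYP)
        ⟨y₁, fun h => hy0 ((Submodule.mem_bot _).mpr (congrArg Subtype.val h)), hy₁, hNs⟩
      have h0 := hAB.hom_left_right hNA hY i
      exact hy0 ((Submodule.mem_bot _).mpr (congrArg (fun f => f.hom y₁) h0))
    have hid : 𝟙 Y = 0 := by
      ext y
      rw [hY0 y]
      simp
    have hsnd : (biprod.snd : X ⊞ Y ⟶ Y) = 0 := by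
      rw [← Category.comp_id biprod.snd, hid, comp_zero]
    have h1 := biprod.total (X := X) (Y := Y)
    rw [hsnd, zero_comp, add_zero] at h1
    have := hAB.left_iso
    exact A.prop_of_iso (X := X) ⟨biprod.inl ≫ e.inv, e.hom ≫ biprod.fst, by simp, by
      rw [Category.assoc, ← Category.assoc biprod.fst, h1, Category.id_comp, e.hom_inv_id]⟩ hX

end PrincipalBlock

/-! ### Rational functions of the entries of a matrix with infinitely many rows -/

section Functions

open scoped ModuleCat TensorProduct

/-- Polynomials in variables `x_{jc}` for `j ∈ ℕ`, `c < k`. -/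
abbrev Pol (k : ℕ) : Type u := MvPolynomial (ULift.{u} (ℕ × Fin k)) ℂ

/-- Rational functions in variables `x_{jc}` for `j ∈ ℕ`, `c < k`. -/
abbrev Fn (k : ℕ) : Type u := FractionRing (Pol.{u} k)

namespace Fn

variable {k : ℕ}

/-- The coordinate functions. -/
def x (j : ℕ) (c : Fin k) : Fn.{u} k := algebraMap (Pol.{u} k) (Fn.{u} k) (MvPolynomial.X ⟨(j, c)⟩)

lemma der_apply_div (D : Derivation ℂ (Fn.{u} k) (Fn.{u} k)) (p q : Pol.{u} k)
    (hp : D (algebraMap _ _ p) = 0) (hq : D (algebraMap _ _ q) = 0) :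
    D (algebraMap _ _ p / algebraMap _ _ q) = 0 := by
  rw [Derivation.leibniz_div, hp, hq, smul_zero, smul_zero, sub_zero, smul_zero]

lemma der_eq_zero_of_vars (D : Derivation ℂ (Fn.{u} k) (Fn.{u} k)) (p : Pol.{u} k)
    (h : ∀ i ∈ p.vars, D (x i.down.1 i.down.2) = 0) : D (algebraMap _ _ p) = 0 := by
  let D' : Derivation ℂ (Pol.{u} k) (Fn.{u} k) := D.compAlgebraMap (Pol.{u} k)
  exact MvPolynomial.derivation_eq_zero_of_forall_mem_vars (D := D') fun i hi => h i hi

lemma der_eq_zero (D : Derivation ℂ (Fn.{u} k) (Fn.{u} k)) (h : ∀ j c, D (x j c) = 0) : D = 0 := by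
  ext f
  obtain ⟨p, q, -, rfl⟩ := IsFractionRing.div_surjective (A := Pol.{u} k) f
  exact der_apply_div D p q (der_eq_zero_of_vars D p fun _ _ => h _ _)
    (der_eq_zero_of_vars D q fun _ _ => h _ _)

lemma der_ext {D D' : Derivation ℂ (Fn.{u} k) (Fn.{u} k)} (h : ∀ j c, D (x j c) = D' (x j c)) :
    D = D' := by
  rw [← sub_eq_zero]
  exact der_eq_zero _ fun j c => by rw [Derivation.sub_apply, h, sub_self]

/-- Localizations are formally étale, which is why a derivation of the polynomial ring extends to
the rational functions. -/
instance : Algebra.FormallyEtale (Pol.{u} k) (Fn.{u} k) :=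
  Algebra.FormallyEtale.of_isLocalization (nonZeroDivisors (Pol.{u} k))

/-- The derivation with prescribed values on the coordinate functions. -/
def mkDer (g : ℕ → Fin k → Fn.{u} k) : Derivation ℂ (Fn.{u} k) (Fn.{u} k) :=
  let d : Derivation ℂ (Pol.{u} k) (Fn.{u} k) :=
    MvPolynomial.mkDerivation ℂ fun i => g i.down.1 i.down.2
  (((d.liftKaehlerDifferential).liftBaseChange (Fn.{u} k)).comp
    (KaehlerDifferential.tensorKaehlerEquivOfFormallyEtale ℂ (Pol.{u} k)
      (Fn.{u} k)).symm.toLinearMap).compDer (KaehlerDifferential.D ℂ (Fn.{u} k))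

lemma mkDer_x (g : ℕ → Fin k → Fn.{u} k) (j : ℕ) (c : Fin k) : mkDer g (x j c) = g j c := by
  have h : (KaehlerDifferential.tensorKaehlerEquivOfFormallyEtale ℂ (Pol.{u} k)
      (Fn.{u} k)).symm (KaehlerDifferential.D ℂ (Fn.{u} k) (x j c)) =
      (1 : Fn.{u} k) ⊗ₜ KaehlerDifferential.D ℂ (Pol.{u} k) (MvPolynomial.X ⟨(j, c)⟩) := by
    rw [LinearEquiv.symm_apply_eq]
    simp [x]
  change (LinearMap.liftBaseChange (Fn.{u} k) _) ((KaehlerDifferential.tensorKaehlerEquivOfFormallyEtale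
    ℂ (Pol.{u} k) (Fn.{u} k)).symm (KaehlerDifferential.D ℂ (Fn.{u} k) (x j c))) = _
  rw [h]
  simp

/-- The linear combination of the coordinate functions in a column. -/
def lc (c : Fin k) : (ℕ →₀ ℂ) →ₗ[ℂ] Fn.{u} k := Finsupp.linearCombination ℂ fun i => x i c

lemma lc_single (c : Fin k) (i : ℕ) : lc c (Finsupp.single i 1) = x.{u} i c := by simp [lc]

/-- The derivation through which a finitary matrix acts. -/
def act (T : Module.End ℂ (ℕ →₀ ℂ)) : Derivation ℂ (Fn.{u} k) (Fn.{u} k) :=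
  mkDer fun j c => lc c (T (Finsupp.single j 1))

lemma act_x (T : Module.End ℂ (ℕ →₀ ℂ)) (j : ℕ) (c : Fin k) :
    act T (x j c) = lc.{u} c (T (Finsupp.single j 1)) := mkDer_x _ j c

lemma act_lc (T : Module.End ℂ (ℕ →₀ ℂ)) (c : Fin k) (v : ℕ →₀ ℂ) :
    act T (lc c v) = lc.{u} c (T v) := by
  have : (act T).toLinearMap ∘ₗ lc c = lc.{u} c ∘ₗ T := by
    refine Finsupp.lhom_ext' fun j => LinearMap.ext_ring ?_
    change act T (lc c (Finsupp.single j 1)) = lc c (T (Finsupp.single j 1))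
    rw [lc_single, act_x]
  exact LinearMap.congr_fun this v

/-- The action of finitary matrices by derivations. -/
def actHom : Module.End ℂ (ℕ →₀ ℂ) →ₗ⁅ℂ⁆ Derivation ℂ (Fn.{u} k) (Fn.{u} k) where
  toFun := act
  map_add' S T := der_ext fun j c => by
    rw [Derivation.add_apply, act_x, act_x, act_x, LinearMap.add_apply, map_add]
  map_smul' t T := der_ext fun j c => by
    rw [RingHom.id_apply, Derivation.smul_apply, act_x, act_x, LinearMap.smul_apply, map_smul]
  map_lie' {S T} := der_ext fun j c => by
    rw [Derivation.commutator_apply, act_x, act_x, act_x, act_lc, act_lc, ← map_sub]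
    rfl

/-- The action of `sl_∞` on rational functions. -/
def rho : U slInf →ₐ[ℂ] Module.End ℂ (Fn.{u} k) :=
  UniversalEnvelopingAlgebra.lift ℂ
    { toFun := fun T => (act T.1).toLinearMap
      map_add' := fun S T => by
        change ((actHom (S.1 + T.1)).toLinearMap : Fn.{u} k →ₗ[ℂ] Fn.{u} k) = _
        rw [map_add]
        rfl
      map_smul' := fun t T => by
        change ((actHom (t • T.1)).toLinearMap : Fn.{u} k →ₗ[ℂ] Fn.{u} k) = _
        rw [map_smul]
        rfl
      map_lie' := fun {S T} => by
        change ((actHom ⁅S.1, T.1⁆).toLinearMap : Fn.{u} k →ₗ[ℂ] Fn.{u} k) = _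
        rw [LieHom.map_lie, Derivation.commutator_coe_linear_map]
        rfl }

end Fn

/-- The rational functions as a module over `sl_∞`. -/
def funRep (k : ℕ) : Rep.{u} slInf :=
  (ModuleCat.restrictScalars (Fn.rho (k := k)).toRingHom).obj
    (ModuleCat.of (Module.End ℂ (Fn.{u} k)) (Fn.{u} k))

/-- A rational function as an element of the module. -/
def ofFn {k : ℕ} (f : Fn.{u} k) : funRep.{u} k := f

variable {k : ℕ}

lemma toU_ofFn (T : slInf) (f : Fn.{u} k) : toU T • ofFn f = ofFn (Fn.act T.1 f) := by
  change Fn.rho (toU T) f = _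
  rw [Fn.rho, UniversalEnvelopingAlgebra.lift_ι_apply]
  rfl

lemma csmul_ofFn (c : ℂ) (f : Fn.{u} k) : c • ofFn f = ofFn (c • f) := by
  have h1 : c • ofFn f = algebraMap ℂ (U slInf) c • ofFn f := (algebraMap_smul (U slInf) c _).symm
  rw [h1]
  change Fn.rho (algebraMap ℂ (U slInf) c) f = _
  rw [AlgHom.commutes]
  rfl

end Functions

/-! ### Minors -/

section Minors

lemma der_prod {A : Type*} [CommRing A] [Algebra ℂ A] (T : Derivation ℂ A A) {ι : Type*}
    [DecidableEq ι] (s : Finset ι) (f : ι → A) :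
    T (∏ i ∈ s, f i) = ∑ i ∈ s, T (f i) * ∏ j ∈ s.erase i, f j := by
  induction s using Finset.induction_on with
  | empty => simp
  | insert a s ha ih =>
    rw [Finset.prod_insert ha, Derivation.leibniz, ih, Finset.sum_insert ha,
      Finset.erase_insert ha, smul_eq_mul, smul_eq_mul, Finset.mul_sum, add_comm, mul_comm]
    congr 1
    refine Finset.sum_congr rfl fun i hi => ?_
    have hai : a ≠ i := fun h => ha (h ▸ hi)
    rw [Finset.erase_insert_of_ne hai, Finset.prod_insert (by simp [ha])]
    ring

lemma der_det {A : Type*} [CommRing A] [Algebra ℂ A] (T : Derivation ℂ A A) {r : ℕ}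
    (M : Matrix (Fin r) (Fin r) A) :
    T M.det = ∑ a, (M.updateRow a fun b => T (M a b)).det := by
  simp only [← Matrix.det_transpose M, ← Matrix.det_transpose (M.updateRow _ _), Matrix.det_apply',
    Matrix.transpose_apply]
  rw [map_sum, Finset.sum_comm]
  refine Finset.sum_congr rfl fun σ _ => ?_
  rw [Derivation.leibniz, Derivation.map_intCast, smul_zero, add_zero, der_prod, smul_eq_mul,
    Finset.mul_sum]
  refine Finset.sum_congr rfl fun a _ => ?_
  rw [← Finset.mul_prod_erase _ _ (Finset.mem_univ a), Matrix.updateRow_self]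
  congr 2
  refine Finset.prod_congr rfl fun j hj => ?_
  rw [Matrix.updateRow_ne (Finset.ne_of_mem_erase hj)]

namespace Fn

variable {k : ℕ}

/-- The action of a matrix unit. -/
def δ (i j : ℕ) : Derivation ℂ (Fn.{u} k) (Fn.{u} k) := act (unitOp i j)

lemma δ_x (i j l : ℕ) (c : Fin k) : δ i j (x.{u} l c) = if l = j then x i c else 0 := by
  rw [δ, act_x, unitOp_single]
  split_ifs
  · rw [lc_single]
  · rw [map_zero]

/-- The minor with the given rows in the first columns. -/
def minor {r : ℕ} (hr : r ≤ k) (ρ : Fin r → ℕ) : Fn.{u} k :=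
  Matrix.det (Matrix.of fun a b => x (ρ a) (Fin.castLE hr b))

variable {r : ℕ} {hr : r ≤ k} {ρ : Fin r → ℕ}

lemma minor_eq_zero {a b : Fin r} (hab : a ≠ b) (h : ρ a = ρ b) : minor.{u} hr ρ = 0 :=
  Matrix.det_zero_of_row_eq hab (by
    ext c
    simp [h])

/-- The underlying polynomial takes the value one at the matrix whose rows `ρ a` are the standard
unit vectors. -/
lemma minor_ne_zero (hρ : Function.Injective ρ) : minor.{u} hr ρ ≠ 0 := by
  have h1 : minor.{u} hr ρ = algebraMap (Pol.{u} k) (Fn.{u} k)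
      (Matrix.det (Matrix.of fun a b => MvPolynomial.X ⟨(ρ a, Fin.castLE hr b)⟩)) := by
    rw [RingHom.map_det]
    rfl
  rw [h1, Ne, FaithfulSMul.algebraMap_eq_zero_iff]
  intro h0
  have h2 := congrArg (MvPolynomial.eval fun p : ULift.{u} (ℕ × Fin k) =>
    if ∃ a : Fin r, p.down = (ρ a, Fin.castLE hr a) then (1 : ℂ) else 0) h0
  rw [RingHom.map_det, map_zero] at h2
  have h3 : (MvPolynomial.eval fun p : ULift.{u} (ℕ × Fin k) =>
      if ∃ a : Fin r, p.down = (ρ a, Fin.castLE hr a) then (1 : ℂ) else 0).mapMatrix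
      (Matrix.of fun a b => MvPolynomial.X ⟨(ρ a, Fin.castLE hr b)⟩) = 1 := by
    ext a b
    rw [RingHom.mapMatrix_apply, Matrix.map_apply, Matrix.of_apply, MvPolynomial.eval_X,
      Matrix.one_apply]
    refine if_congr ⟨?_, ?_⟩ rfl rfl
    · rintro ⟨c, hc⟩
      obtain ⟨h1, h2⟩ := Prod.mk.inj hc
      rw [hρ h1, Fin.castLE_injective hr h2]
    · rintro rfl
      exact ⟨a, rfl⟩
  rw [h3, Matrix.det_one] at h2
  exact one_ne_zero h2

lemma δ_minor (i j : ℕ) : δ i j (minor.{u} hr ρ) =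
    ∑ a, if ρ a = j then minor hr (Function.update ρ a i) else 0 := by
  rw [minor, der_det]
  refine Finset.sum_congr rfl fun a _ => ?_
  simp only [Matrix.of_apply, δ_x]
  split_ifs with h
  · rw [minor]
    congr 1
    ext b c
    by_cases hb : b = a
    · subst hb
      simp
    · rw [Matrix.updateRow_ne hb, Matrix.of_apply, Matrix.of_apply, Function.update_of_ne hb]
  · refine Matrix.det_eq_zero_of_row_eq_zero a fun c => ?_
    rw [Matrix.updateRow_self]

lemma δ_minor_of_notMem {i j : ℕ} (h : ∀ a, ρ a ≠ j) : δ i j (minor.{u} hr ρ) = 0 := by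
  rw [δ_minor]
  exact Finset.sum_eq_zero fun a _ => if_neg (h a)

lemma δ_minor_of_eq (hρ : Function.Injective ρ) {i j : ℕ} {a : Fin r} (h : ρ a = j) :
    δ i j (minor.{u} hr ρ) = minor hr (Function.update ρ a i) := by
  rw [δ_minor, Finset.sum_eq_single a, if_pos h]
  · intro b _ hb
    rw [if_neg]
    exact fun h' => hb (hρ (h'.trans h.symm))
  · simp

/-- Replacing the row `j` by the row `i`, which is already present, creates two equal rows. -/
lemma δ_minor_of_mem (hρ : Function.Injective ρ) {i j : ℕ} (hij : i ≠ j) {b : Fin r} (h : ρ b = i) :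
    δ i j (minor.{u} hr ρ) = 0 := by
  by_cases hj : ∃ a, ρ a = j
  · obtain ⟨a, ha⟩ := hj
    have hab : a ≠ b := fun hab => hij (by rw [← h, ← ha, hab])
    rw [δ_minor_of_eq hρ ha]
    refine minor_eq_zero hab ?_
    rw [Function.update_self, Function.update_of_ne hab.symm, h]
  · exact δ_minor_of_notMem fun a ha => hj ⟨a, ha⟩

lemma δ_self_minor_of_mem (hρ : Function.Injective ρ) {b : Fin r} :
    δ (ρ b) (ρ b) (minor.{u} hr ρ) = minor hr ρ := by
  rw [δ_minor_of_eq hρ rfl, Function.update_eq_self]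

/-- `f` is an eigenvector of `T`. -/
def Eig (T : Derivation ℂ (Fn.{u} k) (Fn.{u} k)) (f : Fn.{u} k) (c : ℂ) : Prop := T f = c • f

section Eig

variable {T : Derivation ℂ (Fn.{u} k) (Fn.{u} k)} {f g : Fn.{u} k} {c d : ℂ}

lemma Eig.mul (hf : Eig T f c) (hg : Eig T g d) : Eig T (f * g) (c + d) := by
  rw [Eig] at *
  rw [Derivation.leibniz, hf, hg, smul_eq_mul, smul_eq_mul, mul_smul_comm, mul_smul_comm, add_smul,
    mul_comm g f, add_comm]

lemma Eig.zpow (hf : Eig T f c) (h0 : f ≠ 0) (n : ℤ) : Eig T (f ^ n) (n * c) := by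
  rw [Eig] at *
  rw [Derivation.leibniz_zpow, hf, smul_eq_mul, mul_smul_comm, ← zpow_add_one₀ h0,
    sub_add_cancel, mul_smul, Int.cast_smul_eq_zsmul]

lemma Eig.inv (hf : Eig T f c) (h0 : f ≠ 0) : Eig T f⁻¹ (-c) := by
  have := hf.zpow h0 (-1)
  rwa [zpow_neg_one, Int.cast_neg, Int.cast_one, neg_one_mul] at this

lemma Eig.div (hf : Eig T f c) (hg : Eig T g d) (h0 : g ≠ 0) : Eig T (f / g) (c - d) := by
  rw [div_eq_mul_inv, sub_eq_add_neg]
  exact hf.mul (hg.inv h0)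

lemma Eig.one : Eig T 1 0 := by
  rw [Eig, Derivation.map_one_eq_zero, zero_smul]

lemma Eig.prod {ι : Type*} (s : Finset ι) (g : ι → Fn.{u} k) (c : ι → ℂ)
    (h : ∀ i ∈ s, Eig T (g i) (c i)) : Eig T (∏ i ∈ s, g i) (∑ i ∈ s, c i) := by
  classical
  induction s using Finset.induction_on with
  | empty => simpa using Eig.one
  | insert a s ha ih =>
    rw [Finset.prod_insert ha, Finset.sum_insert ha]
    exact (h a (Finset.mem_insert_self a s)).mul (ih fun i hi => h i (Finset.mem_insert_of_mem hi))

end Eig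

/-- The leading principal minors. -/
def pm (r : ℕ) : Fn.{u} k := if h : r ≤ k then minor h (fun a => (a : ℕ)) else 1

lemma pm_ne_zero (r : ℕ) : pm.{u} (k := k) r ≠ 0 := by
  rw [pm]
  split_ifs with h
  · exact minor_ne_zero Fin.val_injective
  · exact one_ne_zero

lemma δ_pm_upper {i j : ℕ} (hij : i < j) (r : ℕ) : δ i j (pm.{u} (k := k) r) = 0 := by
  rw [pm]
  split_ifs with h
  · by_cases hj : j < r
    · exact δ_minor_of_mem Fin.val_injective hij.ne (b := ⟨i, hij.trans hj⟩) rfl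
    · refine δ_minor_of_notMem fun a ha => ?_
      omega
  · exact Derivation.map_one_eq_zero _

lemma δ_pm_out {i j : ℕ} {r : ℕ} (h : r ≤ j) : δ i j (pm.{u} (k := k) r) = 0 := by
  rw [pm]
  split_ifs with hr
  · refine δ_minor_of_notMem fun a ha => ?_
    omega
  · exact Derivation.map_one_eq_zero _

lemma δ_pm_in {i j : ℕ} (hij : i ≠ j) {r : ℕ} (h : i < r) : δ i j (pm.{u} (k := k) r) = 0 := by
  rw [pm]
  split_ifs with hr
  · exact δ_minor_of_mem Fin.val_injective hij (b := ⟨i, h⟩) rfl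
  · exact Derivation.map_one_eq_zero _

lemma eig_pm (j : ℕ) {r : ℕ} (hr : r ≤ k) :
    Eig (δ j j) (pm.{u} (k := k) r) (if j < r then 1 else 0) := by
  rw [Eig, pm, dif_pos hr]
  split_ifs with h
  · rw [one_smul]
    exact δ_self_minor_of_mem Fin.val_injective (b := ⟨j, h⟩)
  · rw [zero_smul]
    refine δ_minor_of_notMem fun a ha => ?_
    omega

/-- The highest weight vector of weight `a`. -/
def hv (a : ℕ →₀ ℤ) : Fn.{u} k := ∏ r : Fin k, pm ((r : ℕ) + 1) ^ (a r - a (r + 1))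

lemma hv_ne_zero (a : ℕ →₀ ℤ) : hv.{u} (k := k) a ≠ 0 :=
  Finset.prod_ne_zero_iff.mpr fun _ _ => zpow_ne_zero _ (pm_ne_zero _)

lemma eig_hv_of_zero {T : Derivation ℂ (Fn.{u} k) (Fn.{u} k)} (a : ℕ →₀ ℤ)
    (h : ∀ r : Fin k, T (pm ((r : ℕ) + 1)) = 0) : T (hv a) = 0 := by
  have := Eig.prod (T := T) Finset.univ
    (fun r : Fin k => pm ((r : ℕ) + 1) ^ (a r - a (r + 1))) (fun _ => 0) fun r _ => by
      have h1 : Eig T (pm ((r : ℕ) + 1)) 0 := by rw [Eig, h, zero_smul]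
      have h2 := h1.zpow (pm_ne_zero _) (a r - a (r + 1))
      rwa [mul_zero] at h2
  rw [Finset.sum_const_zero, Eig, zero_smul] at this
  exact this

lemma δ_hv_upper {i j : ℕ} (hij : i < j) (a : ℕ →₀ ℤ) : δ i j (hv.{u} (k := k) a) = 0 :=
  eig_hv_of_zero a fun _ => δ_pm_upper hij _

lemma δ_hv_out {i j : ℕ} (hj : k ≤ j) (a : ℕ →₀ ℤ) : δ i j (hv.{u} (k := k) a) = 0 :=
  eig_hv_of_zero a fun r => δ_pm_out (by omega)

/-- The minor `pm (r + 1)` has weight `ε 0 + ⋯ + ε r`, so the exponents telescope to `a j - a k`,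
and `a k` vanishes. The exponents may be negative, which is the reason for working in a field of
fractions. -/
lemma eig_hv (j : ℕ) {a : ℕ →₀ ℤ} (ha : ∀ i, k ≤ i → a i = 0) :
    Eig (δ j j) (hv.{u} (k := k) a) (a j) := by
  have h := Eig.prod (T := δ j j) Finset.univ
    (fun r : Fin k => pm.{u} (k := k) ((r : ℕ) + 1) ^ (a r - a (r + 1)))
    (fun r => ((a r - a (r + 1) : ℤ) : ℂ) * if j < (r : ℕ) + 1 then 1 else 0)
    fun r _ => (eig_pm j (by omega)).zpow (pm_ne_zero _) _
  suffices hs : ∑ r : Fin k, ((a r - a (r + 1) : ℤ) : ℂ) * (if j < (r : ℕ) + 1 then 1 else 0) = a j by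
    rw [hs] at h
    exact h
  rw [Fin.sum_univ_eq_sum_range
    (fun r => ((a r - a (r + 1) : ℤ) : ℂ) * if j < r + 1 then 1 else 0) k]
  have key : ∀ n, ∑ r ∈ Finset.range n, ((a r - a (r + 1) : ℤ) : ℂ) * (if j < r + 1 then 1 else 0) =
      if j < n then ((a j - a n : ℤ) : ℂ) else 0 := by
    intro n
    induction n with
    | zero => simp
    | succ n ih =>
      rw [Finset.sum_range_succ, ih]
      by_cases h1 : j < n
      · rw [if_pos h1, if_pos (by omega), if_pos (by omega)]
        push_cast
        ring
      · rw [if_neg h1]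
        by_cases h2 : j < n + 1
        · have : j = n := by omega
          rw [if_pos h2, if_pos h2, this]
          push_cast
          ring
        · rw [if_neg h2, if_neg h2]
          ring
  rw [key]
  split_ifs with h1
  · rw [ha k le_rfl, sub_zero]
  · rw [ha j (by omega), Int.cast_zero]

/-- The rows of the principal minor of size `i + 1` with the last one shifted. -/
def shiftRows (i : ℕ) : Fin (i + 1) → ℕ := Function.update (fun a => (a : ℕ)) (Fin.last i) (i + 1)

lemma shiftRows_last (i : ℕ) : shiftRows i (Fin.last i) = i + 1 := Function.update_self _ _ _

lemma shiftRows_of_ne {i : ℕ} {a : Fin (i + 1)} (h : a ≠ Fin.last i) : shiftRows i a = a :=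
  Function.update_of_ne h _ _

lemma lt_of_ne_last {i : ℕ} {a : Fin (i + 1)} (h : a ≠ Fin.last i) : (a : ℕ) < i :=
  lt_of_le_of_ne (Nat.lt_succ_iff.mp a.2) fun h' => h (Fin.ext h')

lemma shiftRows_injective (i : ℕ) : Function.Injective (shiftRows i) := by
  intro a b hab
  by_cases ha : a = Fin.last i <;> by_cases hb : b = Fin.last i
  · rw [ha, hb]
  · rw [ha, shiftRows_last, shiftRows_of_ne hb] at hab
    have := lt_of_ne_last hb
    omega
  · rw [hb, shiftRows_last, shiftRows_of_ne ha] at hab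
    have := lt_of_ne_last ha
    omega
  · rw [shiftRows_of_ne ha, shiftRows_of_ne hb] at hab
    exact Fin.ext hab

/-- The quotient of the shifted minor by the principal minor. -/
def qt {i : ℕ} (hi : i + 1 ≤ k) : Fn.{u} k := minor hi (shiftRows i) / pm (i + 1)

variable {i : ℕ} {hi : i + 1 ≤ k}

lemma qt_ne_zero : qt.{u} hi ≠ 0 :=
  div_ne_zero (minor_ne_zero (shiftRows_injective i)) (pm_ne_zero _)

lemma der_qt_of_zero {T : Derivation ℂ (Fn.{u} k) (Fn.{u} k)}
    (h : T (minor hi (shiftRows i)) = 0) (h' : T (pm (i + 1)) = 0) : T (qt hi) = 0 := by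
  rw [qt, Derivation.leibniz_div, h, h', smul_zero, smul_zero, sub_zero, smul_zero]

lemma δ_qt_upper {j l : ℕ} (hjl : j < l) (h : ¬ (j = i ∧ l = i + 1)) : δ j l (qt.{u} hi) = 0 := by
  refine der_qt_of_zero ?_ (δ_pm_upper hjl _)
  by_cases hl : ∃ a, shiftRows i a = l
  · obtain ⟨a, rfl⟩ := hl
    have hj : j < i := by
      by_cases ha : a = Fin.last i
      · rw [ha, shiftRows_last] at hjl h
        omega
      · rw [shiftRows_of_ne ha] at hjl
        exact hjl.trans (lt_of_ne_last ha)
    refine δ_minor_of_mem (shiftRows_injective i) hjl.ne (b := ⟨j, by omega⟩) ?_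
    exact shiftRows_of_ne fun h => hj.ne (congrArg Fin.val h)
  · exact δ_minor_of_notMem fun a ha => hl ⟨a, ha⟩

lemma δ_qt_out {j l : ℕ} (hl : k ≤ l) (hi' : i + 1 < k) : δ j l (qt.{u} hi) = 0 := by
  refine der_qt_of_zero (δ_minor_of_notMem fun a ha => ?_) (δ_pm_out (by omega))
  by_cases h : a = Fin.last i
  · rw [h, shiftRows_last] at ha
    omega
  · rw [shiftRows_of_ne h] at ha
    omega

lemma minor_update_last : minor.{u} hi (Function.update (shiftRows i) (Fin.last i) i) =
    pm (i + 1) := by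
  rw [pm, dif_pos hi, shiftRows, Function.update_idem]
  congr 1
  exact Function.update_eq_self (Fin.last i) fun a : Fin (i + 1) => (a : ℕ)

lemma δ_qt_raise : δ i (i + 1) (qt.{u} hi) = 1 := by
  rw [qt, Derivation.leibniz_div, δ_pm_upper (Nat.lt_succ_self i),
    δ_minor_of_eq (shiftRows_injective i) (shiftRows_last i), minor_update_last, smul_zero,
    sub_zero, smul_eq_mul, smul_eq_mul]
  have := pm_ne_zero.{u} (k := k) (i + 1)
  field_simp

lemma δ_pm_lower : δ (i + 1) i (pm.{u} (k := k) (i + 1)) = qt hi * pm (i + 1) := by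
  rw [qt, div_mul_cancel₀ _ (pm_ne_zero _), pm, dif_pos hi]
  exact δ_minor_of_eq Fin.val_injective (Fin.val_last i)

/-- The shifted minor `qt * pm` already contains the row `i + 1` and is killed, while `pm` is
multiplied by `qt`; the Leibniz rule gives the value. Together with `δ_qt_raise`, the two simple
root vectors act on `qt` as on an affine coordinate of the projective line. -/
lemma δ_qt_lower : δ (i + 1) i (qt.{u} hi) = -(qt hi) ^ 2 := by
  have h1 : δ (i + 1) i (minor.{u} hi (shiftRows i)) = 0 :=
    δ_minor_of_mem (shiftRows_injective i) (by omega) (shiftRows_last i)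
  have h2 : minor.{u} hi (shiftRows i) = qt hi * pm (i + 1) := by
    rw [qt, div_mul_cancel₀ _ (pm_ne_zero _)]
  rw [h2, Derivation.leibniz, δ_pm_lower (hi := hi), smul_eq_mul, smul_eq_mul] at h1
  refine mul_left_cancel₀ (pm_ne_zero.{u} (k := k) (i + 1)) ?_
  linear_combination h1

lemma eig_qt (j : ℕ) : Eig (δ j j) (qt.{u} hi) (-(root i (i + 1) j : ℤ)) := by
  have h1 : Eig (δ j j) (minor.{u} hi (shiftRows i)) (if j < i ∨ j = i + 1 then 1 else 0) := by
    rw [Eig]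
    split_ifs with h
    · rw [one_smul]
      rcases h with h | h
      · have : shiftRows i ⟨j, by omega⟩ = j :=
          shiftRows_of_ne fun h' => h.ne (congrArg Fin.val h')
        nth_rw 1 2 [← this]
        exact δ_self_minor_of_mem (shiftRows_injective i)
      · rw [h]
        nth_rw 1 2 [← shiftRows_last i]
        exact δ_self_minor_of_mem (shiftRows_injective i)
    · rw [zero_smul]
      refine δ_minor_of_notMem fun a ha => h ?_
      by_cases hl : a = Fin.last i
      · rw [hl, shiftRows_last] at ha
        exact Or.inr ha.symm
      · rw [shiftRows_of_ne hl] at ha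
        exact Or.inl (ha ▸ lt_of_ne_last hl)
  have h2 := h1.div (eig_pm j hi) (pm_ne_zero _)
  suffices hs : (-(root i (i + 1) j : ℤ) : ℂ) =
      (if j < i ∨ j = i + 1 then 1 else 0) - (if j < i + 1 then 1 else 0) by
    rw [hs]
    exact h2
  rw [root, Finsupp.sub_apply, Finsupp.single_apply, Finsupp.single_apply]
  split_ifs <;> first | omega | simp

/-- Only the factor `pm (i + 1)` contributes: smaller minors do not contain the row `i`, and larger
ones contain the row `i + 1` as well. -/
lemma δ_hv_lower (hi' : i + 1 < k) (a : ℕ →₀ ℤ) :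
    δ (i + 1) i (hv.{u} (k := k) a) = ((a i - a (i + 1) : ℤ) : ℂ) • (qt hi * hv a) := by
  classical
  rw [hv, der_prod, Finset.sum_eq_single (⟨i, by omega⟩ : Fin k)]
  · rw [← Finset.mul_prod_erase Finset.univ _ (Finset.mem_univ (⟨i, by omega⟩ : Fin k)),
      Derivation.leibniz_zpow, δ_pm_lower (hi := hi)]
    have h0 := pm_ne_zero.{u} (k := k) (i + 1)
    have h1 : pm.{u} (k := k) (i + 1) ^ (a i - a (i + 1)) =
        pm (i + 1) ^ (a i - a (i + 1) - 1) * pm (i + 1) := by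
      rw [← zpow_add_one₀ h0, sub_add_cancel]
    rw [Int.cast_smul_eq_zsmul]
    simp only [h1, smul_eq_mul, zsmul_eq_mul]
    ring
  · intro r _ hr
    rw [Derivation.leibniz_zpow]
    have : δ (i + 1) i (pm.{u} (k := k) ((r : ℕ) + 1)) = 0 := by
      by_cases h : (r : ℕ) < i
      · exact δ_pm_out (by omega)
      · have : (r : ℕ) ≠ i := fun h => hr (Fin.ext h)
        exact δ_pm_in (by omega) (by omega)
    rw [this]
    simp
  · simp

end Fn

end Minors

/-! ### Links between highest weights -/

section Links

open scoped ModuleCat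

variable {L : Type} [LieRing L] [LieAlgebra ℂ L] {D : SlData L}

/-- The sum of the weight spaces is stable under the root vectors and the diagonal, so it is a
submodule containing the generator. -/
lemma isWeightModule_of_cyclic {M : Rep.{u} L} {u : M} {χ : Module.Dual ℂ D.H}
    (hu : Submodule.span (U L) {u} = ⊤) (huχ : u ∈ weightSpace D.H M χ) : IsWeightModule D.H M := by
  let T : Submodule ℂ M := ⨆ χ, weightSpace D.H M χ
  have hmem {χ : Module.Dual ℂ D.H} {v : M} (hv : v ∈ weightSpace D.H M χ) : v ∈ T :=
    Submodule.mem_iSup_of_mem χ hv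
  let V : Submodule ℂ L :=
    { carrier := {x | ∀ v ∈ T, toU x • v ∈ T}
      add_mem' := fun {x y} hx hy v hv => by
        rw [toU_add_smul]
        exact T.add_mem (hx v hv) (hy v hv)
      zero_mem' := fun v _ => by
        rw [toU, map_zero, zero_smul]
        exact T.zero_mem
      smul_mem' := fun c x hx v hv => by
        rw [toU_smul_smul]
        exact T.smul_mem c (hx v hv) }
  have key (x : L) (h : ∀ χ, ∀ v ∈ weightSpace D.H M χ, toU x • v ∈ T) : x ∈ V := by
    intro v hv
    have : T ≤ T.comap (Algebra.lsmul ℂ ℂ M (toU x)) := iSup_le fun χ w hw => h χ w hw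
    exact this hv
  have hV (x : L) : x ∈ V := by
    refine D.mem_of_generators (fun x hx => key x fun χ v hv => ?_) (D.N_le fun i j hj hij =>
      key _ fun χ v hv => ?_) (fun i j hi hij => key _ fun χ v hv => ?_) x
    · rw [hv ⟨x, hx⟩]
      exact T.smul_mem _ (hmem hv)
    · exact hmem (D.toU_E_mem_weightSpace (D.dom_lt hij.le hj) hj hij.ne hv)
    · exact hmem (D.toU_E_mem_weightSpace hi (D.dom_lt hij.le hi) hij.ne' hv)
  rw [IsWeightModule, eq_top_iff]
  rintro x -
  have hx : x ∈ Submodule.span (U L) {u} := by rw [hu]; trivial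
  obtain ⟨b, rfl⟩ := Submodule.mem_span_singleton.mp hx
  exact U_smul_mem T hV b (hmem huχ)

namespace SlData

lemma Desc.mono_lt {M : Rep.{u} L} {v x : M} {P Q : ℕ → ℕ → Prop} {β : ℕ →₀ ℤ}
    (h : D.Desc v P β x) (hPQ : ∀ i j, j < i → P i j → Q i j) : D.Desc v Q β x := by
  induction h with
  | base => exact .base
  | step hi hij hP _ ih => exact .step hi hij (hPQ _ _ hij hP) ih

lemma Desc.eq_pow {M : Rep.{u} L} {v x : M} {β : ℕ →₀ ℤ} {i : ℕ}
    (h : D.Desc v (fun p j => p = i + 1 ∧ j = i) β x) :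
    ∃ N : ℕ, β = (N : ℤ) • root i (i + 1) ∧ x = toU (D.E (i + 1) i) ^ N • v := by
  induction h with
  | base => exact ⟨0, by simp, by simp⟩
  | @step p j β x _ _ hP _ ih =>
    obtain ⟨rfl, rfl⟩ := hP
    obtain ⟨N, rfl, rfl⟩ := ih
    refine ⟨N + 1, ?_, ?_⟩
    · push_cast
      rw [add_smul, one_smul]
    · rw [pow_succ', mul_smul]

lemma hd_simple (i n : ℕ) : hd n (root i (i + 1)) = if n = i + 1 then 1 else 0 := by
  rw [hd_root]
  split_ifs <;> omega

end SlData

/-- The weights differ by a multiple of one simple root, so the only word that leads from `v` to the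
weight of `u` is the `m`-th power of one lowering operator, and `hf` says that it gives zero. Hence
this weight does not occur in the span of `v`, and in particular `u` is not in it. -/
lemma IsLink.of_vectors {M : Rep.{u} L} (hM : IsWeightModule D.H M) {a : ℕ →₀ ℤ}
    {i : ℕ} (hi : i + 1 ∈ D.dom) {m : ℕ} {u v : M}
    (hu : Submodule.span (U L) {u} = ⊤) (hv0 : v ≠ 0) (hu0 : u ≠ 0) (hv : D.Sing ⊥ (D.wt a) v)
    (huw : u ∈ weightSpace D.H M (D.wt (a - (m : ℤ) • root i (i + 1))))
    (hE : ∀ j l, l ∈ D.dom → j < l → ¬ (j = i ∧ l = i + 1) → toU (D.E j l) • u = 0)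
    (he : toU (D.E i (i + 1)) • u ∈ Submodule.span (U L) {v})
    (hf : toU (D.E (i + 1) i) ^ m • v = 0) :
    IsLink D M (D.wt a) (D.wt (a - (m : ℤ) • root i (i + 1))) := by
  have hi' := D.dom_lt (Nat.le_succ i) hi
  have key : ∀ y ∈ Submodule.span (U L) {v},
      y ∈ weightSpace D.H M (D.wt (a - (m : ℤ) • root i (i + 1))) → y = 0 := by
    intro y hy hyw
    obtain ⟨s, hs, -, w, hw, rfl⟩ := hv.mem_of_weight hM (Sing_bot_weight hv)
      (Submodule.mem_sup_right (S := ⊥) hy) hyw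
    rw [(Submodule.mem_bot _).mp hs, zero_add]
    have hsub : {x | ∃ β, D.Desc v (fun _ _ => True) β x ∧ D.wt a - D.wt β =
        D.wt (a - (m : ℤ) • root i (i + 1))} ⊆ {0} := by
      rintro x ⟨β, hβ, hβw⟩
      have h0 : β = (m : ℤ) • root i (i + 1) := by
        refine D.wt_inj (fun n hn => hβ.out hn) (fun n hn => ?_) ?_ ?_
        · rw [Finsupp.smul_apply, SlData.root_out hi' hi n hn, smul_zero]
        · rw [hβ.tot_eq, map_zsmul, tot_root, smul_zero]
        · rw [map_sub] at hβw
          exact sub_right_injective hβw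
      have hd' (n : ℕ) : hd n β = if n = i + 1 then (m : ℤ) else 0 := by
        rw [h0, map_zsmul, SlData.hd_simple, smul_eq_mul]
        split_ifs <;> simp
      -- The partial sums of `β` vanish except at `i + 1`. By `Desc.restrict` a letter `E p j` needs
      -- positive partial sums for all `n` with `j < n ≤ p`, which leaves `E (i + 1) i` alone.
      obtain ⟨N, hN, rfl⟩ := SlData.Desc.eq_pow (D := D) (i := i) (v := v) (x := x) (β := β)
        (hβ.restrict.mono_lt fun p j hjp h => by
          have h1 := h.2 p hjp le_rfl
          have h2 := h.2 (j + 1) (Nat.lt_succ_self j) hjp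
          rw [hd'] at h1 h2
          split_ifs at h1 h2 <;> omega)
      have hNm : (N : ℤ) = m := by
        have h1 := hd' (i + 1)
        rw [hN, map_zsmul, SlData.hd_simple, if_pos rfl, if_pos rfl] at h1
        simpa using h1
      have : N = m := by exact_mod_cast hNm
      rw [this]
      exact hf
    simpa using Submodule.span_mono hsub hw
  refine ⟨u, v, hu, hv0, hv, SlData.sing_of_generators huw fun j l hl hjl => ?_, fun h =>
    hu0 (key u h huw), huw, key⟩
  by_cases h : j = i ∧ l = i + 1
  · rw [h.1, h.2]
    exact he
  · rw [hE j l hl hjl h]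
    exact Submodule.zero_mem _

/-- An embedding in `sl_∞` compatible with the root data. -/
structure Emb (D : SlData L) where
  emb : L →ₗ⁅ℂ⁆ slInf
  emb_E : ∀ {i j}, i ∈ D.dom → j ∈ D.dom → i ≠ j → emb (D.E i j) = infE i j
  emb_H : ∀ h : D.H, emb (h : L) ∈ cartanInf
  emb_ε : ∀ (h : D.H) (i : ℕ), D.ε i h = entry i i (emb (h : L))

/-- A diagonal element of `sl_∞` has finite support, so it is a finite combination of the diagonal
units, although these do not belong to `sl_∞` themselves. -/
lemma act_diag {k : ℕ} {T : slInf} (hT : T ∈ cartanInf) {f : Fn.{u} k} {b : ℕ →₀ ℤ}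
    (hf : ∀ j, Fn.Eig (Fn.δ j j) f (b j)) :
    Fn.act T.1 f = (b.sum fun j c => (c : ℂ) * entry j j T) • f := by
  obtain ⟨n, y, rfl⟩ := slInf_eq_inclInf T
  have h0 (j : ℕ) (hj : n ≤ j) : entry j j (inclInf n y) = 0 := extend_entry_of_le n y.1 j j hj
  have hT' : (inclInf n y).1 = ∑ j ∈ Finset.range n, entry j j (inclInf n y) • unitOp j j := by
    refine Finsupp.lhom_ext' fun l => LinearMap.ext_ring ?_
    change (inclInf n y).1 (Finsupp.single l 1) = _
    rw [apply_eq_of_diag hT l]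
    change _ = (∑ j ∈ Finset.range n, entry j j (inclInf n y) • unitOp j j) (Finsupp.single l 1)
    rw [LinearMap.sum_apply]
    simp only [LinearMap.smul_apply, unitOp_single]
    by_cases hl : l < n
    · rw [Finset.sum_eq_single l, if_pos rfl, Finsupp.smul_single, smul_eq_mul, mul_one]
      · rfl
      · intro j _ hj
        rw [if_neg (Ne.symm hj), smul_zero]
      · exact fun h => absurd (Finset.mem_range.mpr hl) h
    · rw [Finset.sum_eq_zero]
      · have := h0 l (not_lt.mp hl)
        rw [entry] at this
        rw [this, Finsupp.single_zero]
      · intro j hj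
        rw [if_neg, smul_zero]
        rintro rfl
        exact hl (Finset.mem_range.mp hj)
  have h1 : Fn.act (inclInf n y).1 f =
      ∑ j ∈ Finset.range n, entry j j (inclInf n y) • Fn.δ j j f := by
    conv_lhs => rw [hT']
    change Fn.actHom (∑ j ∈ Finset.range n, entry j j (inclInf n y) • unitOp j j) f = _
    have hsum (s : Finset ℕ) (d : ℕ → Derivation ℂ (Fn.{u} k) (Fn.{u} k)) :
        (∑ j ∈ s, d j) f = ∑ j ∈ s, d j f :=
      map_sum ((Pi.evalAddMonoidHom _ f).comp Derivation.coeFnAddMonoidHom) d s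
    rw [map_sum, hsum]
    refine Finset.sum_congr rfl fun j _ => ?_
    rw [map_smul]
    rfl
  rw [h1, Finset.sum_congr rfl fun j _ => by rw [hf j, smul_smul], ← Finset.sum_smul]
  congr 1
  rw [Finsupp.sum]
  have h2 : ∑ j ∈ Finset.range n, entry j j (inclInf n y) * (b j : ℂ) =
      ∑ j ∈ Finset.range n ∪ b.support, entry j j (inclInf n y) * (b j : ℂ) := by
    refine Finset.sum_subset Finset.subset_union_left fun j _ hj => ?_
    rw [h0 j (by simpa using hj), zero_mul]
  rw [h2]
  symm
  rw [Finset.sum_congr rfl fun j _ => mul_comm (b j : ℂ) _]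
  refine Finset.sum_subset Finset.subset_union_right fun j _ hj => ?_
  rw [Finsupp.notMem_support_iff.mp hj, Int.cast_zero, mul_zero]

namespace Emb

variable (e : Emb D) {k : ℕ}

/-- Rational functions as a module over `L`. -/
abbrev fn (k : ℕ) : Rep.{u} L := res e.emb (funRep.{u} k)

/-- A rational function as an element of the module. -/
def of (f : Fn.{u} k) : e.fn k := (show e.fn k from ofFn f)

lemma E_of {i j : ℕ} (hi : i ∈ D.dom) (hj : j ∈ D.dom) (hij : i ≠ j) (f : Fn.{u} k) :
    toU (D.E i j) • e.of f = e.of (Fn.δ i j f) := by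
  rw [res_toU_smul, e.emb_E hi hj hij]
  change toU (infE i j) • ofFn f = _
  rw [toU_ofFn, infE_coe hij]
  rfl

lemma smul_of (c : ℂ) (f : Fn.{u} k) : c • e.of f = e.of (c • f) := by
  rw [res_csmul]
  exact csmul_ofFn c f

lemma of_mem_weightSpace {f : Fn.{u} k} {b : ℕ →₀ ℤ} (hf : ∀ j, Fn.Eig (Fn.δ j j) f (b j)) :
    e.of f ∈ weightSpace D.H (e.fn k) (D.wt b) := by
  intro h
  rw [res_toU_smul]
  change toU (e.emb (h : L)) • ofFn f = _
  rw [toU_ofFn, act_diag (e.emb_H h) hf, smul_of]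
  congr 2
  rw [SlData.wt_apply, Finsupp.sum, Finsupp.sum, LinearMap.sum_apply]
  refine Finset.sum_congr rfl fun j _ => ?_
  rw [LinearMap.smul_apply, e.emb_ε, zsmul_eq_mul]

/-- The generator of the link module. -/
def linkFn (a : ℕ →₀ ℤ) {i : ℕ} (hi : i + 1 ≤ k) (m : ℕ) : Fn.{u} k := Fn.hv a * Fn.qt hi ^ m

variable {a : ℕ →₀ ℤ} {i : ℕ} {hi : i + 1 ≤ k} {m : ℕ}

lemma linkFn_zero : linkFn.{u} a hi 0 = Fn.hv a := by rw [linkFn, pow_zero, mul_one]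

lemma linkFn_ne_zero : linkFn.{u} a hi m ≠ 0 :=
  mul_ne_zero (Fn.hv_ne_zero a) (pow_ne_zero _ Fn.qt_ne_zero)

lemma eig_linkFn (ha : ∀ i, k ≤ i → a i = 0) (j : ℕ) :
    Fn.Eig (Fn.δ j j) (linkFn.{u} a hi m) ((a - (m : ℤ) • root i (i + 1)) j : ℤ) := by
  have h := (Fn.eig_hv.{u} j ha).mul ((Fn.eig_qt (hi := hi) j).zpow Fn.qt_ne_zero m)
  rw [zpow_natCast] at h
  suffices hs : (((a - (m : ℤ) • root i (i + 1)) j : ℤ) : ℂ) =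
      (a j : ℂ) + (m : ℤ) * (-(root i (i + 1) j : ℤ) : ℂ) by
    rw [hs]
    exact h
  rw [Finsupp.sub_apply, Finsupp.smul_apply, smul_eq_mul]
  push_cast
  ring

lemma der_linkFn {T : Derivation ℂ (Fn.{u} k) (Fn.{u} k)} (h : T (Fn.hv a) = 0)
    (h' : T (Fn.qt hi) = 0) : T (linkFn a hi m) = 0 := by
  rw [linkFn, Derivation.leibniz, Derivation.leibniz_pow, h, h']
  simp

lemma raise_linkFn : Fn.δ i (i + 1) (linkFn.{u} a hi (m + 1)) = ((m : ℂ) + 1) • linkFn a hi m := by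
  rw [linkFn, Derivation.leibniz, Derivation.leibniz_pow, Fn.δ_hv_upper (Nat.lt_succ_self i),
    Fn.δ_qt_raise, linkFn, Nat.add_sub_cancel]
  simp only [smul_eq_mul, nsmul_eq_mul]
  rw [Algebra.smul_def (R := ℂ)]
  simp only [map_add, map_natCast, map_one]
  push_cast
  ring

/-- The factor `hv a` contributes `a i - a (i + 1)` and the power of `qt` contributes `-m`. The
coefficient vanishes exactly at `m = a i - a (i + 1)`, where the string of lowering operators
starting at `hv a` breaks off. -/
lemma lower_linkFn (hi' : i + 1 < k) : Fn.δ (i + 1) i (linkFn.{u} a hi m) =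
    ((a i - a (i + 1) : ℤ) - (m : ℂ)) • linkFn a hi (m + 1) := by
  rw [linkFn, Derivation.leibniz, Derivation.leibniz_pow, Fn.δ_hv_lower (hi := hi) hi',
    Fn.δ_qt_lower, linkFn]
  simp only [smul_eq_mul, nsmul_eq_mul]
  simp only [Algebra.smul_def (R := ℂ) (A := Fn.{u} k), map_sub, map_natCast, map_intCast]
  cases m with
  | zero =>
    simp only [Nat.cast_zero, sub_zero, pow_zero, zero_add, pow_one, zero_mul, mul_zero]
    ring
  | succ m =>
    rw [Nat.add_sub_cancel]
    push_cast
    ring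

lemma linkFn_mem_up (e : Emb D) (hi1 : i + 1 ∈ D.dom) :
    e.of (Fn.hv a) ∈ Submodule.span (U L) {e.of (linkFn.{u} a hi m)} := by
  suffices h : ∀ n, n ≤ m → e.of (linkFn.{u} a hi (m - n)) ∈
      Submodule.span (U L) {e.of (linkFn.{u} a hi m)} by
    have := h m le_rfl
    rwa [Nat.sub_self, linkFn_zero] at this
  intro n
  induction n with
  | zero => exact fun _ => Submodule.mem_span_singleton_self _
  | succ n ih =>
    intro hn
    have h1 := Submodule.smul_mem _ (toU (D.E i (i + 1))) (ih (by omega))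
    rw [e.E_of (D.dom_lt (Nat.le_succ i) hi1) hi1 (by omega)] at h1
    obtain ⟨p, hp⟩ : ∃ p, m - n = p + 1 := ⟨m - n - 1, by omega⟩
    have hp' : m - (n + 1) = p := by omega
    rw [hp, raise_linkFn, ← smul_of] at h1
    rw [hp']
    refine SlData.mem_of_csmul_mem _ ?_ h1
    exact_mod_cast Nat.succ_ne_zero p

lemma linkFn_mem_down (e : Emb D) (hi1 : i + 1 ∈ D.dom) (hi' : i + 1 < k)
    (hm : a i - a (i + 1) = (m : ℤ)) (n : ℕ) (hn : n ≤ m) :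
    e.of (linkFn.{u} a hi n) ∈ Submodule.span (U L) {e.of (Fn.hv.{u} (k := k) a)} := by
  induction n with
  | zero =>
    rw [linkFn_zero]
    exact Submodule.mem_span_singleton_self _
  | succ n ih =>
    have h1 := Submodule.smul_mem _ (toU (D.E (i + 1) i)) (ih (by omega))
    rw [e.E_of hi1 (D.dom_lt (Nat.le_succ i) hi1) (by omega), lower_linkFn hi', ← smul_of, hm] at h1
    refine SlData.mem_of_csmul_mem _ ?_ h1
    rw [Int.cast_natCast, sub_ne_zero]
    exact_mod_cast (by omega : m ≠ n)

lemma pow_lower (e : Emb D) (hi1 : i + 1 ∈ D.dom) (hi' : i + 1 < k) (n : ℕ) :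
    ∃ c : ℂ, toU (D.E (i + 1) i) ^ n • e.of (Fn.hv.{u} (k := k) a) = c • e.of (linkFn a hi n) := by
  induction n with
  | zero => exact ⟨1, by rw [linkFn_zero, pow_zero, one_smul, one_smul]⟩
  | succ n ih =>
    obtain ⟨c, hc⟩ := ih
    rw [pow_succ', mul_smul, hc, smul_comm, e.E_of hi1 (D.dom_lt (Nat.le_succ i) hi1) (by omega),
      lower_linkFn hi', ← smul_of, smul_smul]
    exact ⟨_, rfl⟩

/-- After `m` steps the string has reached the function at which the coefficient in `lower_linkFn`
is zero. -/
lemma pow_lower_eq_zero (e : Emb D) (hi1 : i + 1 ∈ D.dom) (hi' : i + 1 < k)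
    (hm : a i - a (i + 1) = (m : ℤ)) :
    toU (D.E (i + 1) i) ^ (m + 1) • e.of (Fn.hv.{u} (k := k) a) = 0 := by
  obtain ⟨c, hc⟩ := e.pow_lower (hi := hi'.le) hi1 hi' m (a := a)
  rw [pow_succ', mul_smul, hc, smul_comm, e.E_of hi1 (D.dom_lt (Nat.le_succ i) hi1) (by omega),
    lower_linkFn hi', ← smul_of, hm, Int.cast_natCast, sub_self, zero_smul, smul_zero]

end Emb

end Links

/-! ### Link modules -/

section LinkModules

open scoped ModuleCat

variable {L : Type} [LieRing L] [LieAlgebra ℂ L] {D : SlData L}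

lemma IsLink.hwFilt {M : Rep.{u} L} {χ χ' : Module.Dual ℂ D.H} (h : IsLink D M χ χ')
    {Ξ : Set (Module.Dual ℂ D.H)} (hχ : χ ∈ Ξ) (hχ' : χ' ∈ Ξ) :
    D.HwFilt Ξ (⊤ : Submodule (U L) M) := by
  obtain ⟨u, v, hu, -, hv, hus, -⟩ := h
  have h1 : D.HwFilt Ξ (⊥ ⊔ Submodule.span (U L) {v}) := .step .bot hχ hv
  rw [bot_sup_eq] at h1
  have h2 := SlData.HwFilt.step h1 hχ' hus
  rwa [hu, sup_top_eq] at h2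

section Cyclic

variable {X : Rep.{u} L} (x : X)

/-- The submodule generated by a vector, as a module. -/
def cyc : Rep.{u} L := ModuleCat.of (U L) (Submodule.span (U L) {x})

/-- The inclusion of a cyclic submodule. -/
def cycIncl : cyc x ⟶ X := ModuleCat.ofHom (Submodule.subtype (Submodule.span (U L) {x}))

/-- An element of a cyclic submodule. -/
def cycMk {x : X} {y : X} (hy : y ∈ Submodule.span (U L) {x}) : cyc x :=
  (⟨y, hy⟩ : Submodule.span (U L) {x})

lemma cycIncl_injective : Function.Injective (cycIncl x).hom := Subtype.val_injective

/-- The generator of a cyclic submodule. -/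
def cycGen : cyc x := cycMk (Submodule.mem_span_singleton_self x)

lemma span_cycGen : Submodule.span (U L) {cycGen x} = ⊤ := by
  rw [eq_top_iff]
  rintro ⟨y, hy⟩ -
  obtain ⟨b, rfl⟩ := Submodule.mem_span_singleton.mp hy
  exact Submodule.mem_span_singleton.mpr ⟨b, rfl⟩

lemma mem_weightSpace_of_injective {M M' : Rep.{u} L} {f : M ⟶ M'}
    (hf : Function.Injective f.hom) {χ : Module.Dual ℂ D.H} {y : M}
    (h : f.hom y ∈ weightSpace D.H M' χ) : y ∈ weightSpace D.H M χ := fun a => hf (by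
  have := h a
  rw [map_smul, this]
  exact ((f.hom.restrictScalars ℂ).map_smul (χ a) y).symm)

end Cyclic

namespace Emb

variable (e : Emb D) {k : ℕ} (a : ℕ →₀ ℤ) {i : ℕ} (hi : i + 1 ≤ k) (m : ℕ)

/-- The module generated by a link function. -/
abbrev linkRep : Rep.{u} L := cyc (e.of (linkFn.{u} a hi m))

/-- The inclusion of a link module in the module of rational functions. -/
abbrev linkIncl : e.linkRep.{u} a hi m ⟶ e.fn k := cycIncl _

/-- The generator of a link module. -/
abbrev linkGen : e.linkRep.{u} a hi m := cycGen _

variable {a} {m} (ha : ∀ j, k ≤ j → a j = 0)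

include ha in
lemma linkGen_mem_weightSpace : e.linkGen.{u} a hi m ∈
    weightSpace D.H (e.linkRep.{u} a hi m) (D.wt (a - (m : ℤ) • root i (i + 1))) :=
  mem_weightSpace_of_injective (cycIncl_injective _) (e.of_mem_weightSpace (eig_linkFn ha))

include ha in
lemma isWeightModule_linkRep : IsWeightModule D.H (e.linkRep.{u} a hi m) :=
  isWeightModule_of_cyclic (span_cycGen _) (e.linkGen_mem_weightSpace hi ha)

-- The generator `u = hv a * qt ^ (m + 1)` lies one step beyond the end of the lowering string of `v
-- = hv a`. Repeated raising leads from `u` to `v`, with nonzero coefficients. Raising `u` once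
-- gives a multiple of `hv a * qt ^ m`, which is in the span of `v`, but lowering cannot return from
-- `v` to `u`. The weight of `u` is the image of `a` under the dot action of the simple reflection.
include ha in
lemma isLink_linkRep (hi1 : i + 1 ∈ D.dom) (hi' : i + 1 < k) (hm : a i - a (i + 1) = (m : ℤ)) :
    IsLink D (e.linkRep.{u} a hi (m + 1)) (D.wt a)
      (D.wt (a - ((m + 1 : ℕ) : ℤ) • root i (i + 1))) := by
  have hinj : Function.Injective (e.linkIncl.{u} a hi (m + 1)).hom := cycIncl_injective _
  have hval (x : L) (y : e.linkRep.{u} a hi (m + 1)) :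
      (e.linkIncl a hi (m + 1)).hom (toU x • y) = toU x • (e.linkIncl a hi (m + 1)).hom y :=
    map_smul _ _ _
  have hi0 : i ∈ D.dom := D.dom_lt (Nat.le_succ i) hi1
  let v : e.linkRep.{u} a hi (m + 1) := cycMk (e.linkFn_mem_up hi1)
  have hv : (e.linkIncl a hi (m + 1)).hom v = e.of (Fn.hv a) := rfl
  have hu : (e.linkIncl a hi (m + 1)).hom (e.linkGen a hi (m + 1)) = e.of (linkFn a hi (m + 1)) :=
    rfl
  have hE0 (j l : ℕ) (hl : l ∈ D.dom) (hjl : j < l) {f : Fn.{u} k} (hf : Fn.δ j l f = 0) :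
      toU (D.E j l) • e.of f = 0 := by
    rw [e.E_of (D.dom_lt hjl.le hl) hl hjl.ne, hf]
    rfl
  refine IsLink.of_vectors (v := v) (e.isWeightModule_linkRep hi ha) hi1 (span_cycGen _)
    ?_ ?_ ?_ (e.linkGen_mem_weightSpace hi ha) ?_ ?_ ?_
  · exact fun h => Fn.hv_ne_zero a (congrArg (e.linkIncl a hi (m + 1)).hom h)
  · exact fun h => linkFn_ne_zero (congrArg (e.linkIncl a hi (m + 1)).hom h)
  · refine SlData.sing_of_generators
      (mem_weightSpace_of_injective hinj (e.of_mem_weightSpace fun j => Fn.eig_hv j ha))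
      fun j l hl hjl => ?_
    refine (Submodule.mem_bot _).mpr (hinj ?_)
    rw [hval, hv, hE0 j l hl hjl (Fn.δ_hv_upper hjl a), map_zero]
  · intro j l hl hjl hjl'
    apply hinj
    rw [hval, hu, hE0 j l hl hjl (der_linkFn (Fn.δ_hv_upper hjl a) (Fn.δ_qt_upper hjl hjl')),
      map_zero]
  · obtain ⟨b, hb⟩ := Submodule.mem_span_singleton.mp (e.linkFn_mem_down (hi := hi) hi1 hi' hm m le_rfl)
    refine Submodule.mem_span_singleton.mpr ⟨((m : ℂ) + 1) • b, ?_⟩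
    apply hinj
    rw [hval, hu, e.E_of hi0 hi1 (by omega), raise_linkFn, ← smul_of, ← hb, map_smul, hv, smul_assoc]
  · apply hinj
    have := e.pow_lower_eq_zero hi1 hi' hm
    rw [map_smul, hv, this, map_zero]

end Emb

end LinkModules

/-! ### Finite length -/

section FiniteLength

open scoped ModuleCat

variable {L : Type} [LieRing L] [LieAlgebra ℂ L] {D : SlData L} {M : Rep.{u} L}

namespace SlData

/-- The sum of the weight spaces with weights in a set. -/
def partOf (D : SlData L) (M : Rep.{u} L) (Ξ : Set (Module.Dual ℂ D.H)) : Submodule ℂ M :=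
  ⨆ χ ∈ Ξ, weightSpace D.H M χ

/-- Two nested submodules differ by a singular vector, whose weight belongs to `Ξ`; so they already
differ on the sum of these weight spaces. -/
lemma SV.strictMono (hM : IsWeightModule D.H M) (h : D.SV M) {Ξ : Set (Module.Dual ℂ D.H)}
    (hΞ : D.SW (⊥ : Submodule (U L) M) ⊤ ⊆ Ξ) :
    StrictMono fun S : Submodule (U L) M =>
      (S.restrictScalars ℂ).submoduleOf (D.partOf M Ξ) := by
  intro S T hST
  refine lt_of_le_of_ne (fun x hx => hST.le hx) fun heq => ?_
  obtain ⟨χ, v, hvT, hvS, hs⟩ := h S T hST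
  have hχ : χ ∈ Ξ := hΞ ⟨S, v, bot_le, trivial, hvS, hs⟩
  obtain ⟨w, hw, hvw⟩ := hs.exists_weight D hM
  have hwT : w ∈ T := by
    have := T.sub_mem hvT (hST.le hvw)
    rwa [sub_sub_cancel] at this
  have hwp : w ∈ D.partOf M Ξ := Submodule.mem_iSup_of_mem χ (Submodule.mem_iSup_of_mem hχ hw)
  have : (⟨w, hwp⟩ : D.partOf M Ξ) ∈ (S.restrictScalars ℂ).submoduleOf (D.partOf M Ξ) := by
    dsimp only at heq
    rw [heq]
    exact hwT
  exact hvS ((Submodule.sub_mem_iff_left _ (show w ∈ S from this)).mp hvw)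

/-- The lattice of submodules maps strictly monotonically to the subspaces of a finite-dimensional
space, which bounds chains in both directions. -/
lemma SV.finiteLength (hM : IsWeightModule D.H M) (h : D.SV M) {Ξ : Set (Module.Dual ℂ D.H)}
    (hfin : Ξ.Finite) (hΞ : D.SW (⊥ : Submodule (U L) M) ⊤ ⊆ Ξ)
    (hfd : ∀ χ ∈ Ξ, FiniteDimensional ℂ (weightSpace D.H M χ)) :
    IsNoetherian (U L) M ∧ IsArtinian (U L) M := by
  have : FiniteDimensional ℂ (D.partOf M Ξ) := by
    have : Finite Ξ := hfin
    have h1 (χ : Ξ) : FiniteDimensional ℂ (weightSpace D.H M χ) := hfd χ χ.2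
    rw [partOf, iSup_subtype']
    infer_instance
  exact ⟨isNoetherian_iff'.mpr ((h.strictMono hM hΞ).wellFoundedGT),
    (h.strictMono hM hΞ).wellFoundedLT⟩

lemma ht_le_of_desc {v x : M} {P : ℕ → ℕ → Prop} {β : ℕ →₀ ℤ} (h : D.Desc v P β x) : 0 ≤ ht β :=
  ht_nonneg h.hd_nonneg h.tot_eq

/-- Every letter increases the height by at least one, so the height bounds the length of a word,
and there are finitely many letters to choose from. -/
lemma finite_desc_of_pairs (v : M) (F : Finset (ℕ × ℕ)) (N : ℕ) : ∀ β : ℕ →₀ ℤ, ht β ≤ N →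
    {x | D.Desc v (fun i j => (i, j) ∈ F) β x}.Finite := by
  induction N with
  | zero =>
    intro β hβ
    refine (Set.finite_singleton v).subset fun x hx => ?_
    cases hx with
    | base => rfl
    | @step i j β x _ hij _ h =>
      have := ht_le_of_desc h
      rw [map_add, ht_root] at hβ
      omega
  | succ N ih =>
    intro β hβ
    refine ((Set.finite_singleton v).union (F.finite_toSet.biUnion (t := fun p =>
      if p.2 < p.1 then (fun x => toU (D.E p.1 p.2) • x) ''
        {x | D.Desc v (fun i j => (i, j) ∈ F) (β - root p.2 p.1) x} else ∅) ?_)).subset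
      fun x hx => ?_
    · intro p _
      split_ifs with h
      · refine (ih _ ?_).image _
        rw [map_sub, ht_root]
        push_cast at hβ
        omega
      · exact Set.finite_empty
    · cases hx with
      | base => exact Or.inl rfl
      | @step i j β x _ hij hP h =>
        refine Or.inr (Set.mem_biUnion (x := (i, j)) hP ?_)
        rw [if_pos hij, add_sub_cancel_right]
        exact ⟨x, h, rfl⟩

lemma finite_desc (v : M) (β : ℕ →₀ ℤ) : {x | D.Desc v (fun _ _ => True) β x}.Finite := by
  by_cases h0 : ∃ x, D.Desc v (fun _ _ => True) β x
  · obtain ⟨x₀, hx₀⟩ := h0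
    obtain ⟨n, hn⟩ := exists_bound β
    refine (finite_desc_of_pairs (D := D) v (Finset.range n ×ˢ Finset.range n) (ht β).toNat β
      (Int.self_le_toNat _)).subset fun x hx => ?_
    refine (hx.bounded (m := n) fun l hl => ?_).restrict.mono_lt fun i j hji h => ?_
    · rw [hd_eq_tot fun i hi => hn i (hl.trans hi), hx₀.tot_eq]
    · rw [Finset.mem_product, Finset.mem_range, Finset.mem_range]
      exact ⟨h.1, hji.trans h.1⟩
  · push Not at h0
    exact Set.finite_empty.subset fun x hx => (h0 x hx).elim

/-- At most one `β` of total zero has weight `χ - ψ`, and `finite_desc` leaves finitely many words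
for it; they span `Q`. -/
lemma Sing.finiteDimensional (hM : IsWeightModule D.H M) {S : Submodule (U L) M}
    {χ ψ : Module.Dual ℂ D.H} {v : M} (h : D.Sing S χ v) (hv : v ∈ weightSpace D.H M χ) :
    ∃ Q : Submodule ℂ M, FiniteDimensional ℂ Q ∧ ∀ y ∈ S ⊔ Submodule.span (U L) {v},
      y ∈ weightSpace D.H M ψ → ∃ s ∈ S, s ∈ weightSpace D.H M ψ ∧ ∃ w ∈ Q, y = s + w := by
  by_cases h0 : ∃ β : ℕ →₀ ℤ, (∀ k ∉ D.dom, β k = 0) ∧ tot β = 0 ∧ χ - D.wt β = ψ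
  · obtain ⟨β, hβ, hβ0, rfl⟩ := h0
    refine ⟨Submodule.span ℂ {x | D.Desc v (fun _ _ => True) β x},
      FiniteDimensional.span_of_finite ℂ (finite_desc v β), fun y hy hyψ => ?_⟩
    obtain ⟨s, hs, hsψ, w, hw, rfl⟩ := h.mem_of_weight hM hv hy hyψ
    refine ⟨s, hs, hsψ, w, Submodule.span_mono ?_ hw, rfl⟩
    rintro x ⟨γ, hγ, hγβ⟩
    have : γ = β := D.wt_inj (fun k hk => hγ.out hk) hβ (hγ.tot_eq.trans hβ0.symm)
      (sub_right_injective hγβ)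
    rwa [← this]
  · refine ⟨⊥, inferInstance, fun y hy hyψ => ?_⟩
    obtain ⟨s, hs, hsψ, w, hw, rfl⟩ := h.mem_of_weight hM hv hy hyψ
    refine ⟨s, hs, hsψ, w, ?_, rfl⟩
    have : {x | ∃ β, D.Desc v (fun _ _ => True) β x ∧ χ - D.wt β = ψ} ⊆ ∅ := by
      rintro x ⟨γ, hγ, hγβ⟩
      exact h0 ⟨γ, fun k hk => hγ.out hk, hγ.tot_eq, hγβ⟩
    simpa using Submodule.span_mono this hw

lemma HwFilt.finiteDimensional (hM : IsWeightModule D.H M) {Ξ : Set (Module.Dual ℂ D.H)}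
    {S : Submodule (U L) M} (h : D.HwFilt Ξ S) (ψ : Module.Dual ℂ D.H) :
    ∃ Q : Submodule ℂ M, FiniteDimensional ℂ Q ∧ ∀ y ∈ S, y ∈ weightSpace D.H M ψ → y ∈ Q := by
  induction h with
  | bot => exact ⟨⊥, inferInstance, fun y hy _ => (Submodule.mem_bot _).mpr ((Submodule.mem_bot _).mp hy)⟩
  | @step S χ v _ _ hs ih =>
    obtain ⟨Q, hQ, hSQ⟩ := ih
    obtain ⟨w, hw, hvw⟩ := hs.exists_weight D hM
    obtain ⟨Q', hQ', h'⟩ := (hs.congr D hvw).finiteDimensional hM hw (ψ := ψ)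
    refine ⟨Q ⊔ Q', inferInstance, fun y hy hyψ => ?_⟩
    rw [sup_span_congr hvw] at hy
    obtain ⟨s, hs, hsψ, w, hw, rfl⟩ := h' y hy hyψ
    exact Submodule.add_mem_sup (hSQ s hs hsψ) hw

lemma HwFilt.finiteDimensional_weightSpace (hM : IsWeightModule D.H M)
    {Ξ : Set (Module.Dual ℂ D.H)} (h : D.HwFilt Ξ (⊤ : Submodule (U L) M))
    (ψ : Module.Dual ℂ D.H) : FiniteDimensional ℂ (weightSpace D.H M ψ) := by
  obtain ⟨Q, hQ, hQ'⟩ := h.finiteDimensional hM ψ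
  exact Submodule.finiteDimensional_of_le fun y hy => hQ' y trivial hy

end SlData

end FiniteLength

/-! ### Finite levels of `sl_n` and `sl_∞` -/

section LevelInstances

/-- `sl_n` as its own only level. -/
def finLevel (n : ℕ) : Level (slFinData n) n where
  ι := LieHom.id
  mem_dom h := h
  ι_E _ _ _ := rfl
  ι_H x := x.2
  ε_ι _ _ := rfl
  lie_ι h := ⟨h, fun _ => rfl⟩

/-- `sl_n` has one level. -/
def finLevels (n : ℕ) : Levels (slFinData n) where
  lev := {n}
  level m hm := by
    obtain rfl : m = n := hm
    exact finLevel m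
  nested {m m'} hm hm' _ x := by
    obtain rfl : m = n := hm
    obtain rfl : m' = m := hm'
    exact ⟨x, rfl⟩
  exhaust _ := ⟨n, rfl, Or.inr fun _ h => h⟩

/-- The traceless part of the left upper corner of a diagonal matrix. -/
def cornerCartan (m : ℕ) (h : slInf) : slFin m :=
  ⟨Matrix.diagonal fun i => entry i i h - (∑ j : Fin m, entry j j h) / m, by
    change Matrix.trace (Matrix.diagonal fun i : Fin m => entry i i h -
      (∑ j : Fin m, entry j j h) / m) = 0
    rw [Matrix.trace_diagonal, Finset.sum_sub_distrib, Finset.sum_const, Finset.card_univ,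
      Fintype.card_fin, nsmul_eq_mul]
    rcases Nat.eq_zero_or_pos m with rfl | hm
    · simp
    · rw [mul_div_cancel₀ _ (by exact_mod_cast hm.ne'), sub_self]⟩

lemma cornerCartan_mem (m : ℕ) (h : slInf) : cornerCartan m h ∈ cartan m := fun _ _ hij =>
  Matrix.diagonal_apply_ne _ hij

/-- The levels of `sl_∞`. -/
def infLevel (m : ℕ) : Level slInfData m where
  ι := inclInf m
  mem_dom _ := trivial
  ι_E hi hj hij := inclInf_finE_eq hi hj hij
  ι_H x := inclInf_mem_cartanInf x.2
  ε_ι x i := (finEps_apply m i x).symm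
  lie_ι h := by
    -- Subtracting the mean from the first `m` diagonal entries changes `h` by a scalar on these
    -- coordinates, which the bracket with `sl_m` does not see.
    refine ⟨⟨cornerCartan m h, cornerCartan_mem m h⟩, fun y => ?_⟩
    let V : Submodule ℂ (slFin m) := LinearMap.ker
      ((LieAlgebra.ad ℂ slInf (h : slInf) -
        LieAlgebra.ad ℂ slInf (inclInf m (cornerCartan m h)) : Module.End ℂ slInf) ∘ₗ
          (inclInf m : slFin m →ₗ[ℂ] slInf))
    have hmem (y : slFin m) : y ∈ V ↔
        ⁅(h : slInf), inclInf m y⁆ = ⁅inclInf m (cornerCartan m h), inclInf m y⁆ :=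
      sub_eq_zero
    refine (hmem y).mp ?_
    have hc : inclInf m (cornerCartan m h) ∈ cartanInf :=
      inclInf_mem_cartanInf (cornerCartan_mem m h)
    have hle : cartan m ⊔ Submodule.span ℂ
        {x | ∃ i j, i ∈ Set.Iio m ∧ j ∈ Set.Iio m ∧ i ≠ j ∧ x = finE m i j} ≤ V := by
      refine sup_le (fun z hz => ?_) (Submodule.span_le.mpr ?_)
      · rw [hmem]
        have hz' : inclInf m z ∈ cartanInf := inclInf_mem_cartanInf hz
        exact (slInfData.lie_H h ⟨_, hz'⟩).trans (slInfData.lie_H ⟨_, hc⟩ ⟨_, hz'⟩).symm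
      · rintro _ ⟨i, j, hi, hj, hij, rfl⟩
        refine (hmem _).mpr ?_
        rw [inclInf_finE_eq hi hj hij]
        refine (slInfData.lie_H_E h trivial trivial hij).trans
          (Eq.trans ?_ (slInfData.lie_H_E ⟨_, hc⟩ trivial trivial hij).symm)
        congr 1
        have key (i : ℕ) (hi : i < m) : slInfData.ε i ⟨_, hc⟩ =
            slInfData.ε i h - (∑ j : Fin m, entry j j (h : slInf)) / m :=
          (inclInf_entry m (cornerCartan m h) ⟨i, hi⟩ ⟨i, hi⟩).trans
            (Matrix.diagonal_apply_eq _ _)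
        rw [key i hi, key j hj]
        ring
    exact hle (sl_span m y)

/-- The system of levels of `sl_∞`. -/
def infLevels : Levels slInfData where
  lev := Set.univ
  level m _ := infLevel m
  nested {m m'} _ _ h x := by
    obtain ⟨y, hy⟩ := exists_extend_of_le h x
    exact ⟨y, Subtype.ext hy.symm⟩
  exhaust k := ⟨k, trivial, Or.inl le_rfl⟩

/-- `sl_n` in `sl_∞`. -/
def finEmb (n : ℕ) : Emb (slFinData n) where
  emb := inclInf n
  emb_E hi hj hij := inclInf_finE_eq hi hj hij
  emb_H h := inclInf_mem_cartanInf h.2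
  emb_ε h i := finEps_apply n i h

/-- `sl_∞` in itself. -/
def infEmb : Emb slInfData where
  emb := LieHom.id
  emb_E _ _ _ := rfl
  emb_H h := h.2
  emb_ε _ _ := rfl

end LevelInstances

/-! ### The principal block of category `𝒪` for `sl_n` -/

section PrincipalBlockFinite

open scoped ModuleCat

variable {L : Type} [LieRing L] [LieAlgebra ℂ L] {D : SlData L}

lemma IsTrivialRep.isWeightModule {M : Rep.{u} L} (h : IsTrivialRep M) (H : Submodule ℂ L) :
    IsWeightModule H M := by
  rw [IsWeightModule, eq_top_iff]
  have h0 : (⊤ : Submodule ℂ M) ≤ weightSpace H M 0 := fun v _ a => by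
    rw [h.2, LinearMap.zero_apply, zero_smul]
  exact h0.trans (le_iSup _ 0)

/-- With `a j = j - σ j`, the difference `a i - a (i + 1)` is `σ (i + 1) - σ i - 1`, a natural
number as `i` is not a descent. The number of columns is chosen to bound the support of `a` and to
exceed `i + 1`. -/
lemma exists_link (e : Emb D) {a : ℕ →₀ ℤ} {σ : Equiv.Perm ℕ} (hσ : ∀ i : ℕ, a i = i - σ i)
    {i : ℕ} (hi : i + 1 ∈ D.dom) (hi' : σ i < σ (i + 1)) :
    ∃ (k : ℕ) (hk : i + 1 < k) (m : ℕ), (∀ j, k ≤ j → a j = 0) ∧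
      (σ (i + 1) : ℤ) - σ i = (m + 1 : ℕ) ∧
      IsLink D (e.linkRep.{u} a hk.le (m + 1)) (D.wt a)
        (D.wt (a - ((σ (i + 1) : ℤ) - σ i) • root i (i + 1))) := by
  obtain ⟨n, hn⟩ := exists_bound a
  obtain ⟨m, hm⟩ : ∃ m, σ (i + 1) = σ i + (m + 1) := ⟨σ (i + 1) - σ i - 1, by omega⟩
  have hk : i + 1 < max n (i + 2) := by omega
  have ha : ∀ j, max n (i + 2) ≤ j → a j = 0 := fun j hj => hn j (le_trans (le_max_left _ _) hj)
  have hm' : (σ (i + 1) : ℤ) - σ i = (m + 1 : ℕ) := by rw [hm]; push_cast; ring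
  refine ⟨_, hk, m, ha, hm', ?_⟩
  rw [hm']
  refine e.isLink_linkRep hk.le ha hi hk ?_
  rw [hσ, hσ, hm]
  push_cast
  ring

lemma blockData_catO (n : ℕ) : BlockData (slFinData n) (catO.{u} n) where
  weight h := h.2.1
  hwFilt h := SlData.hwFilt_top_of_categoryO (D := slFinData n) h
  of_surjective f hf h := by
    have := h.1
    exact ⟨Module.Finite.of_surjective f.hom hf, h.2.1.of_surjective f hf,
      h.2.2.of_surjective f hf⟩
  of_injective f x hf hx h := ⟨⟨⟨{x}, by simpa using hx⟩⟩, h.2.1.of_injective f hf,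
    h.2.2.of_injective f hf⟩
  prod {M M'} h h' := by
    have := h.1
    have := h'.1
    exact ⟨inferInstanceAs (Module.Finite (U (slFin n)) (M × M')), isWeightModule_prod h.2.1 h'.2.1,
      isLocallyFinite_prod h.2.2 h'.2.2⟩
  trivial {M} h := by
    have hfin : Module.Finite ℂ M := Module.finite_of_finrank_eq_succ h.1
    refine ⟨Module.Finite.of_restrictScalars_finite ℂ _ _, h.isWeightModule _, fun v =>
      ⟨⊤, inferInstance, trivial, fun _ _ _ _ => trivial⟩⟩
  link a σ hσ ha i hi hi' := by
    obtain ⟨k, hk, m, hak, -, h⟩ := exists_link (finEmb n) hσ hi hi'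
    refine ⟨_, ⟨⟨⟨{cycGen _}, by simpa using span_cycGen _⟩⟩,
      (finEmb n).isWeightModule_linkRep hk.le hak, fun v => ?_⟩, h⟩
    obtain ⟨V, hV, hv, -⟩ := (h.hwFilt (Ξ := Set.univ) trivial trivial).exists_nstable v trivial
    exact ⟨V, hV.1, hv, hV.2⟩

/-- The principal block consists of the modules all of whose highest weights are linked to zero. -/
lemma catO₀_iff {n : ℕ} (M : Rep.{u} (slFin n)) : catO₀ n M ↔
    catO n M ∧ (slFinData n).SW (⊥ : Submodule (U (slFin n)) M) ⊤ ⊆ (slFinData n).lnk :=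
  blockContaining_iff (finLevels n) (blockData_catO n) M

end PrincipalBlockFinite

/-! ### Finite length modules -/

section FiniteLengthCategory

open scoped ModuleCat

variable {L : Type} [LieRing L] [LieAlgebra ℂ L] {D : SlData L} {M : Rep.{u} L}

lemma covBy_sup_span {S T : Submodule (U L) M} (h : S ⋖ T) {v : M} (hv : v ∈ T) (hvS : v ∉ S) :
    S ⊔ Submodule.span (U L) {v} = T := by
  refine (h.eq_or_eq le_sup_left (sup_le h.le ?_)).resolve_left fun h' => hvS ?_
  · rwa [Submodule.span_singleton_le_iff_mem]
  · rw [← h']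
    exact Submodule.mem_sup_right (Submodule.mem_span_singleton_self v)

lemma exists_sing_of_isSimpleHighestWeight {S T : Submodule (U L) M}
    (h : IsSimpleHighestWeight D.H D.N (ModuleCat.of (U L) (T ⧸ S.submoduleOf T))) :
    ∃ χ, ∃ v ∈ T, v ∉ S ∧ D.Sing S χ v := by
  obtain ⟨-, χ, v, hv0, hv, hN⟩ := h
  obtain ⟨⟨v, hvT⟩, rfl⟩ := Submodule.Quotient.mk_surjective _ v
  refine ⟨χ, v, hvT, fun hvS => hv0 ((Submodule.Quotient.mk_eq_zero _).mpr hvS), fun a => ?_,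
    fun x hx => ?_⟩
  · have h1 := hv a
    have h2 : (toU (a : L) • (⟨v, hvT⟩ : T) - algebraMap ℂ (U L) (χ a) • (⟨v, hvT⟩ : T)) ∈
        S.submoduleOf T := by
      rw [← Submodule.Quotient.mk_eq_zero, Submodule.Quotient.mk_sub, sub_eq_zero]
      exact h1
    exact h2
  · exact (Submodule.Quotient.mk_eq_zero (S.submoduleOf T)).mp (hN x hx)

lemma isSimpleHighestWeight_of_sing {S T : Submodule (U L) M}
    (h : S ⋖ T) {χ : Module.Dual ℂ D.H} {v : M} (hvT : v ∈ T) (hvS : v ∉ S) (hs : D.Sing S χ v) :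
    IsSimpleHighestWeight D.H D.N (ModuleCat.of (U L) (T ⧸ S.submoduleOf T)) := by
  refine ⟨(covBy_iff_quot_is_simple h.le).mp h, χ, Submodule.Quotient.mk ⟨v, hvT⟩,
    fun h0 => hvS ((Submodule.Quotient.mk_eq_zero (S.submoduleOf T)).mp h0), fun a => ?_,
    fun x hx => (Submodule.Quotient.mk_eq_zero (S.submoduleOf T)).mpr (hs.2 x hx)⟩
  have h2 : (toU (a : L) • (⟨v, hvT⟩ : T) - algebraMap ℂ (U L) (χ a) • (⟨v, hvT⟩ : T)) ∈
      S.submoduleOf T := hs.1 a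
  rw [← Submodule.Quotient.mk_eq_zero, Submodule.Quotient.mk_sub, sub_eq_zero] at h2
  exact h2

/-- A simple subquotient is a highest weight module iff it contains a singular vector. So a
composition series of the required kind is a filtration by highest weight subquotients, and
conversely any composition series will do once singular vectors exist everywhere. -/
lemma categoryOfl_iff : categoryOfl D.H D.N M ↔
    IsWeightModule D.H M ∧ IsNoetherian (U L) M ∧ IsArtinian (U L) M ∧ D.SV M := by
  constructor
  · rintro ⟨hM, s, hs0, hs1, hs⟩
    have hfl := isFiniteLength_of_exists_compositionSeries ⟨s, hs0, hs1⟩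
    have hna := isFiniteLength_iff_isNoetherian_isArtinian.mp hfl
    refine ⟨hM, hna.1, hna.2, ?_⟩
    have key (i : ℕ) (hi : i < s.length + 1) : D.HwFilt Set.univ (s ⟨i, hi⟩) := by
      induction i with
      | zero =>
        have : s ⟨0, hi⟩ = ⊥ := hs0
        rw [this]
        exact .bot
      | succ i ih =>
        obtain ⟨χ, v, hv, hvS, hsing⟩ := exists_sing_of_isSimpleHighestWeight (hs ⟨i, by omega⟩)
        have h1 := SlData.HwFilt.step (ih (by omega)) (Set.mem_univ χ) hsing
        have h2 := covBy_sup_span (s.step ⟨i, by omega⟩) hv hvS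
        exact h2 ▸ h1
    have h := key s.length (Nat.lt_succ_self _)
    have hl : s ⟨s.length, Nat.lt_succ_self _⟩ = ⊤ := hs1
    rw [hl] at h
    exact h.sv hM
  · rintro ⟨hM, _, _, hsv⟩
    obtain ⟨s, hs0, hs1⟩ := exists_compositionSeries_of_isNoetherian_isArtinian (U L) M
    refine ⟨hM, s, hs0, hs1, fun i => ?_⟩
    obtain ⟨χ, v, hv, hvS, hs⟩ := hsv _ _ (s.step i).lt
    exact isSimpleHighestWeight_of_sing (s.step i) hv hvS hs

end FiniteLengthCategory

/-! ### The Capelli identity -/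

section Capelli

lemma der_sum_apply {A : Type*} [CommRing A] [Algebra ℂ A] {ι : Type*} (s : Finset ι)
    (d : ι → Derivation ℂ A A) (f : A) : (∑ j ∈ s, d j) f = ∑ j ∈ s, d j f :=
  map_sum ((Pi.evalAddMonoidHom _ f).comp Derivation.coeFnAddMonoidHom) d s

/-- A matrix with a first column added. -/
def bordered {A : Type*} {q : ℕ} (v : Fin (q + 1) → A) (X : Matrix (Fin (q + 1)) (Fin q) A) :
    Matrix (Fin (q + 1)) (Fin (q + 1)) A :=
  Matrix.of fun a => Fin.cons (v a) (X a)

section Ring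

variable {A : Type*} [CommRing A] {q : ℕ} (v : Fin (q + 1) → A) (X : Matrix (Fin (q + 1)) (Fin q) A)

lemma det_bordered : (bordered v X).det =
    ∑ a : Fin (q + 1), (-1) ^ (a : ℕ) * (v a * (X.submatrix a.succAbove id).det) := by
  rw [Matrix.det_succ_column_zero]
  refine Finset.sum_congr rfl fun a _ => ?_
  rw [mul_assoc]
  rfl

/-- The left side arises from the bordered matrix by exchanging its first column with the column
`b`. -/
lemma det_bordered_updateCol (b : Fin q) :
    (bordered (fun a => X a b) (X.updateCol b v)).det = -(bordered v X).det := by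
  have h : bordered (fun a => X a b) (X.updateCol b v) =
      (bordered v X).submatrix id (Equiv.swap 0 b.succ) := by
    ext a j
    refine Fin.cases ?_ (fun j => ?_) j
    · rw [Matrix.submatrix_apply, Equiv.swap_apply_left]
      rfl
    · rw [Matrix.submatrix_apply]
      by_cases hj : j = b
      · subst hj
        rw [Equiv.swap_apply_right]
        change (X.updateCol j v) a j = v a
        rw [Matrix.updateCol_self]
      · rw [Equiv.swap_apply_of_ne_of_ne (Fin.succ_ne_zero j) (fun h => hj (Fin.succ_inj.mp h))]
        change (X.updateCol b v) a j = X a j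
        rw [Matrix.updateCol_ne hj]
  rw [h, Matrix.det_permute', Equiv.Perm.sign_swap (Fin.succ_ne_zero b).symm]
  simp

lemma der_det_col [Algebra ℂ A] (T : Derivation ℂ A A) (M : Matrix (Fin q) (Fin q) A) :
    T M.det = ∑ b, (M.updateCol b fun a => T (M a b)).det := by
  rw [← Matrix.det_transpose, der_det]
  refine Finset.sum_congr rfl fun b _ => ?_
  rw [← Matrix.det_transpose, Matrix.updateRow_transpose, Matrix.transpose_transpose]
  rfl

end Ring

namespace Fn

variable {k : ℕ}

/-- The partial derivatives. -/
def pd (r : ℕ) (c : Fin k) : Derivation ℂ (Fn.{u} k) (Fn.{u} k) :=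
  mkDer fun j c' => if j = r ∧ c' = c then 1 else 0

lemma δ_eq_sum_pd (i j : ℕ) (f : Fn.{u} k) : δ i j f = ∑ c, x i c * pd j c f := by
  have h : δ i j = ∑ c : Fin k, x.{u} i c • pd j c := der_ext fun l c => by
    rw [der_sum_apply, δ_x]
    simp only [Derivation.smul_apply, pd, mkDer_x, smul_eq_mul]
    split_ifs with h
    · simp [h]
    · simp [h]
  rw [h, der_sum_apply]
  rfl

/-- A matrix of coordinate functions with given rows and columns. -/
def mx {p q : ℕ} (i : Fin p → ℕ) (c : Fin q → Fin k) : Matrix (Fin p) (Fin q) (Fn.{u} k) :=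
  Matrix.of fun a b => x (i a) (c b)

/-- Iterated partial derivatives. -/
def pdl : (q : ℕ) → (Fin q → ℕ) → (Fin q → Fin k) → Fn.{u} k → Fn.{u} k
  | 0, _, _, f => f
  | q + 1, ρ, c, f => pd (ρ 0) (c 0) (pdl q (Fin.tail ρ) (Fin.tail c) f)

/-- The normally ordered Capelli determinants. -/
def capA (q : ℕ) (i ρ : Fin q → ℕ) (f : Fn.{u} k) : Fn.{u} k :=
  ∑ c : Fin q → Fin k, (mx i c).det * pdl q ρ c f

lemma capA_zero (i ρ : Fin 0 → ℕ) (f : Fn.{u} k) : capA 0 i ρ f = f := by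
  simp [capA, pdl]

/-- With more rows than columns, every choice of columns repeats one, and the determinant of
coordinate functions vanishes. -/
lemma capA_eq_zero {q : ℕ} (hq : k < q) (i ρ : Fin q → ℕ) (f : Fn.{u} k) : capA q i ρ f = 0 := by
  refine Finset.sum_eq_zero fun c _ => ?_
  obtain ⟨a, b, hab, h⟩ := Fintype.exists_ne_map_eq_of_card_lt c (by simpa using hq)
  have h0 : (mx.{u} i c).det = 0 :=
    Matrix.det_zero_of_column_eq hab fun l => congrArg (fun c₀ => x (i l) c₀) h
  rw [h0, zero_mul]

/-- Differentiating each of the `q` columns and summing over `a` gives minus a determinant bordered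
by the column of the indicators `i a = r`. The second terms add up to `q` times the same
determinant, so they are exactly the correction that is needed. -/
lemma sum_δ_det {q : ℕ} (i : Fin (q + 1) → ℕ) (r : ℕ) (c : Fin q → Fin k) :
    ∑ a : Fin (q + 1), (-1 : Fn.{u} k) ^ (a : ℕ) *
      (δ (i a) r (mx (i ∘ a.succAbove) c).det +
        (if i a = r then 1 else 0) * (q * (mx (i ∘ a.succAbove) c).det)) = 0 := by
  have h1 (a : Fin (q + 1)) : δ (i a) r (mx.{u} (i ∘ a.succAbove) c).det =
      ∑ b, x (i a) (c b) * (((mx i c).updateCol b fun l => if i l = r then 1 else 0).submatrix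
        a.succAbove id).det := by
    rw [der_det_col]
    refine Finset.sum_congr rfl fun b _ => ?_
    rw [show ((mx.{u} i c).updateCol b fun l => if i l = r then 1 else 0).submatrix a.succAbove id =
      (mx (i ∘ a.succAbove) c).updateCol b fun l => if i (a.succAbove l) = r then 1 else 0 from by
        ext l j
        simp only [Matrix.submatrix_apply, Matrix.updateCol_apply, id]
        rfl, ← Matrix.det_updateCol_smul]
    congr 2
    funext l
    change δ (i a) r (x (i (a.succAbove l)) (c b)) = x (i a) (c b) * _
    rw [δ_x, mul_ite, mul_one, mul_zero]
  have h2 : ∑ a : Fin (q + 1), (-1 : Fn.{u} k) ^ (a : ℕ) * δ (i a) r (mx (i ∘ a.succAbove) c).det =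
      ∑ _b : Fin q, -(bordered (fun l => if i l = r then 1 else 0) (mx.{u} i c)).det := by
    simp only [h1, Finset.mul_sum]
    rw [Finset.sum_comm]
    refine Finset.sum_congr rfl fun b _ => ?_
    rw [← det_bordered_updateCol, det_bordered]
    rfl
  simp only [mul_add, Finset.sum_add_distrib]
  rw [h2, Finset.sum_const, Finset.card_univ, Fintype.card_fin, nsmul_eq_mul, det_bordered,
    mul_neg, Finset.mul_sum, neg_add_eq_zero]
  refine Finset.sum_congr rfl fun a _ => ?_
  have : (mx.{u} i c).submatrix a.succAbove id = mx (i ∘ a.succAbove) c := rfl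
  rw [this]
  ring

/-- Expansion along the first column collects `x` and the partial derivatives into the operators
`δ`, still acting to the right of the smaller minor. Moving `δ` in front of that minor costs the
derivative of the minor, which `sum_δ_det` evaluates. This is the Capelli identity in recursive
form. -/
lemma capA_succ {q : ℕ} (i ρ : Fin (q + 1) → ℕ) (f : Fn.{u} k) :
    capA (q + 1) i ρ f = ∑ a : Fin (q + 1), (-1 : Fn.{u} k) ^ (a : ℕ) *
      (δ (i a) (ρ 0) (capA q (i ∘ a.succAbove) (Fin.tail ρ) f) +
        (if i a = ρ 0 then 1 else 0) * (q * capA q (i ∘ a.succAbove) (Fin.tail ρ) f)) := by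
  have h1 : capA (q + 1) i ρ f = ∑ c : Fin q → Fin k, ∑ a : Fin (q + 1), (-1 : Fn.{u} k) ^ (a : ℕ) *
      ((mx (i ∘ a.succAbove) c).det * δ (i a) (ρ 0) (pdl q (Fin.tail ρ) c f)) := by
    rw [capA, ← (Fin.consEquiv fun _ : Fin (q + 1) => Fin k).sum_comp, Fintype.sum_prod_type,
      Finset.sum_comm]
    refine Finset.sum_congr rfl fun c _ => ?_
    have h2 (c₀ : Fin k) : (mx.{u} i (Fin.cons c₀ c : Fin (q + 1) → Fin k)).det =
        ∑ a : Fin (q + 1), (-1) ^ (a : ℕ) * (x (i a) c₀ * (mx (i ∘ a.succAbove) c).det) := by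
      rw [Matrix.det_succ_column_zero]
      refine Finset.sum_congr rfl fun a _ => ?_
      rw [mul_assoc]
      rfl
    have h3 (c₀ : Fin k) : (mx.{u} i ((Fin.consEquiv fun _ : Fin (q + 1) => Fin k) (c₀, c))).det *
        pdl (q + 1) ρ ((Fin.consEquiv fun _ : Fin (q + 1) => Fin k) (c₀, c)) f =
        ∑ a : Fin (q + 1), (-1) ^ (a : ℕ) * (x (i a) c₀ * (mx (i ∘ a.succAbove) c).det) *
          pd (ρ 0) c₀ (pdl q (Fin.tail ρ) c f) := by
      rw [← Finset.sum_mul, ← h2]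
      rfl
    simp only [h3, δ_eq_sum_pd]
    rw [Finset.sum_comm]
    refine Finset.sum_congr rfl fun a _ => ?_
    rw [Finset.mul_sum, Finset.mul_sum]
    refine Finset.sum_congr rfl fun c₀ _ => ?_
    ring
  have h2 (c : Fin q → Fin k) := congrArg (· * pdl q (Fin.tail ρ) c f) (sum_δ_det i (ρ 0) c)
  simp only [zero_mul, Finset.sum_mul] at h2
  have h3 := Finset.sum_eq_zero (s := Finset.univ) fun c _ => h2 c
  rw [h1]
  refine ((add_zero _).symm.trans (congrArg _ h3.symm)).trans ?_
  simp only [capA, map_sum, Finset.mul_sum, ← Finset.sum_add_distrib]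
  rw [Finset.sum_comm]
  refine Finset.sum_congr rfl fun c _ => Finset.sum_congr rfl fun a _ => ?_
  rw [Derivation.leibniz, smul_eq_mul, smul_eq_mul]
  ring

/-- A rational function involves the variables of finitely many rows only. -/
lemma exists_δ_eq_zero (f : Fn.{u} k) : ∃ n, ∀ l, n ≤ l → ∀ j, δ j l f = 0 := by
  obtain ⟨p, q, -, rfl⟩ := IsFractionRing.div_surjective (A := Pol.{u} k) f
  have h (p : Pol.{u} k) : ∃ n, ∀ l, n ≤ l → ∀ j, δ j l (algebraMap _ (Fn.{u} k) p) = 0 := by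
    refine ⟨p.vars.sup (fun i => i.down.1) + 1, fun l hl j => der_eq_zero_of_vars _ p fun i hi => ?_⟩
    have := Finset.le_sup (f := fun i : ULift.{u} (ℕ × Fin k) => i.down.1) hi
    rw [δ_x, if_neg]
    omega
  obtain ⟨n, hn⟩ := h p
  obtain ⟨m, hm⟩ := h q
  exact ⟨max n m, fun l hl j => der_apply_div _ p q (hn l (by omega) j) (hm l (by omega) j)⟩

lemma δ_comm (l i j : ℕ) (f : Fn.{u} k) : δ l l (δ i j f) =
    δ i j (δ l l f) + (((if i = l then 1 else 0) - (if j = l then 1 else 0) : ℤ) : ℂ) • δ i j f := by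
  have h1 : ⁅unitOp l l, unitOp i j⁆ =
      (((if i = l then 1 else 0) - (if j = l then 1 else 0) : ℤ) : ℂ) • unitOp i j := by
    rw [lie_diag_unitOp (fun a b hab => ?_)]
    · congr 1
      rw [unitOp_single, unitOp_single]
      split_ifs <;> simp_all
    · rw [unitOp_single]
      split_ifs with h
      · subst h
        exact Finsupp.single_eq_of_ne hab
      · rfl
  have h2 := congrArg (fun d => d f) (congrArg (actHom.{u} (k := k)) h1)
  rw [LieHom.map_lie, map_smul] at h2
  have h3 : δ l l (δ i j f) - δ i j (δ l l f) =
    (((if i = l then 1 else 0) - (if j = l then 1 else 0) : ℤ) : ℂ) • δ i j f := h2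
  rw [← h3, add_sub_cancel]

end Fn

end Capelli

/-! ### The principal block for `sl_∞` -/

section PrincipalBlockInfinite

open scoped ModuleCat

/-- The sum of the `ε_i` over a family of indices. -/
def epsSum {q : ℕ} (i : Fin q → ℕ) : ℕ →₀ ℤ := ∑ a, Finsupp.single (i a) 1

lemma epsSum_succAbove {q : ℕ} (i : Fin (q + 1) → ℕ) (a : Fin (q + 1)) :
    epsSum i = Finsupp.single (i a) 1 + epsSum (i ∘ a.succAbove) :=
  Fin.sum_univ_succAbove _ a

lemma epsSum_tail {q : ℕ} (i : Fin (q + 1) → ℕ) :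
    epsSum i = Finsupp.single (i 0) 1 + epsSum (Fin.tail i) :=
  Fin.sum_univ_succ _

variable {k : ℕ} {M : Rep.{u} slInf} (φ : M ⟶ infEmb.fn.{u} k)

lemma toU_of (T : slInf) (f : Fn.{u} k) : toU T • infEmb.of f = infEmb.of (Fn.act T.1 f) := by
  rw [res_toU_smul]
  exact toU_ofFn T f

/-- The functions which are images of the elements of a submodule. -/
def FnIn (R : Submodule (U slInf) M) (g : Fn.{u} k) : Prop := ∃ y ∈ R, φ.hom y = infEmb.of g

variable {φ} {R : Submodule (U slInf) M} {g g' : Fn.{u} k}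

lemma FnIn.add (h : FnIn φ R g) (h' : FnIn φ R g') : FnIn φ R (g + g') := by
  obtain ⟨y, hy, hyg⟩ := h
  obtain ⟨y', hy', hyg'⟩ := h'
  exact ⟨y + y', R.add_mem hy hy', by rw [map_add, hyg, hyg']; rfl⟩

lemma FnIn.zero : FnIn φ R 0 := ⟨0, R.zero_mem, map_zero _⟩

lemma FnIn.sum {ι : Type*} (s : Finset ι) (g : ι → Fn.{u} k) (h : ∀ i ∈ s, FnIn φ R (g i)) :
    FnIn φ R (∑ i ∈ s, g i) :=
  Finset.sum_induction _ _ (fun _ _ => FnIn.add) FnIn.zero h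

lemma FnIn.csmul (c : ℂ) (h : FnIn φ R g) : FnIn φ R (c • g) := by
  obtain ⟨y, hy, hyg⟩ := h
  refine ⟨c • y, SlData.csmul_mem R c hy, ?_⟩
  have : φ.hom (c • y) = c • φ.hom y := (φ.hom.restrictScalars ℂ).map_smul c y
  rw [this, hyg, Emb.smul_of]

lemma FnIn.sign (n : ℕ) (h : FnIn φ R g) : FnIn φ R ((-1) ^ n * g) := by
  rcases neg_one_pow_eq_or (Fn.{u} k) n with h' | h'
  · rwa [h', one_mul]
  · rw [h', neg_one_mul, ← neg_one_smul ℂ g]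
    exact h.csmul _

lemma FnIn.δ {i j : ℕ} (hij : i ≠ j) (h : FnIn φ R g) : FnIn φ R (Fn.δ i j g) := by
  obtain ⟨y, hy, hyg⟩ := h
  refine ⟨toU (infE i j) • y, R.smul_mem _ hy, ?_⟩
  rw [map_smul, hyg]
  exact infEmb.E_of (D := slInfData) trivial trivial hij g

/-- Images of weight vectors in a submodule. -/
def FnWt (φ : M ⟶ infEmb.fn.{u} k) (R : Submodule (U slInf) M) (γ : ℕ →₀ ℤ) (g : Fn.{u} k) : Prop :=
  (∀ j, Fn.Eig (Fn.δ j j) g (γ j)) ∧ FnIn φ R g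

variable {γ : ℕ →₀ ℤ}

lemma FnWt.csmul (c : ℂ) (h : FnWt φ R γ g) : FnWt φ R γ (c • g) :=
  ⟨fun j => by rw [Fn.Eig, Derivation.map_smul, h.1 j, smul_comm], h.2.csmul c⟩

lemma FnWt.sign (n : ℕ) (h : FnWt φ R γ g) : FnWt φ R γ ((-1) ^ n * g) := by
  rcases neg_one_pow_eq_or (Fn.{u} k) n with h' | h'
  · rwa [h', one_mul]
  · rw [h', neg_one_mul, ← neg_one_smul ℂ g]
    exact h.csmul _

lemma FnWt.add (h : FnWt φ R γ g) (h' : FnWt φ R γ g') : FnWt φ R γ (g + g') :=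
  ⟨fun j => by rw [Fn.Eig, map_add, h.1 j, h'.1 j, smul_add], h.2.add h'.2⟩

lemma FnWt.zero : FnWt φ R γ 0 := ⟨fun j => by rw [Fn.Eig, map_zero, smul_zero], FnIn.zero⟩

lemma FnWt.δ {i j : ℕ} (h : FnWt φ R γ g) :
    FnWt φ R (γ + Finsupp.single i 1 - Finsupp.single j 1) (Fn.δ i j g) := by
  refine ⟨fun l => ?_, ?_⟩
  · rw [Fn.Eig, Fn.δ_comm, h.1 l, Derivation.map_smul, ← add_smul]
    congr 1
    rw [Finsupp.sub_apply, Finsupp.add_apply, Finsupp.single_apply, Finsupp.single_apply]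
    push_cast
    ring
  · by_cases hij : i = j
    · subst hij
      rw [h.1 i]
      exact h.2.csmul _
    · exact h.2.δ hij

lemma natCast_mul_eq_smul (q : ℕ) (f : Fn.{u} k) : (q : Fn.{u} k) * f = (q : ℂ) • f := by
  rw [Algebra.smul_def, map_natCast]

/-- By `capA_succ` the Capelli operators are built from the operators `δ`. The off-diagonal ones
come from `sl_∞`, and the diagonal ones act by scalars on weight vectors, so the result stays in the
submodule. -/
lemma FnWt.capA {b : ℕ →₀ ℤ} {f : Fn.{u} k} (h : FnWt φ R b f) (q : ℕ) :
    ∀ i ρ : Fin q → ℕ, FnWt φ R (b + epsSum i - epsSum ρ) (Fn.capA q i ρ f) := by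
  induction q with
  | zero =>
    intro i ρ
    rw [Fn.capA_zero]
    simpa [epsSum] using h
  | succ q ih =>
    intro i ρ
    rw [Fn.capA_succ]
    refine Finset.sum_induction _ _ (fun _ _ => FnWt.add) FnWt.zero fun a _ => ?_
    have h1 := ih (i ∘ a.succAbove) (Fin.tail ρ)
    have hw : b + epsSum i - epsSum ρ = b + epsSum (i ∘ a.succAbove) - epsSum (Fin.tail ρ) +
        Finsupp.single (i a) 1 - Finsupp.single (ρ 0) 1 := by
      rw [epsSum_succAbove i a, epsSum_tail ρ]
      abel
    rw [hw]
    refine FnWt.sign _ (h1.δ.add ?_)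
    split_ifs with hi
    · rw [one_mul, natCast_mul_eq_smul, hi, add_sub_cancel_right]
      exact h1.csmul _
    · rw [zero_mul]
      exact FnWt.zero

variable (hM : IsWeightModule slInfData.H M) (hφ : Function.Injective φ.hom)

/-- The diagonal unit at `j` is not traceless, but far out there is an index `l` whose unit kills
`f` and where `b` vanishes, so the coroot for `j` and `l` acts on `f` like the unit at `j`. -/
lemma eig_of_mem_weightSpace {w : M} {f : Fn.{u} k} (hf : φ.hom w = infEmb.of f) {b : ℕ →₀ ℤ}
    (hw : w ∈ weightSpace slInfData.H M (slInfData.wt b)) (j : ℕ) : Fn.Eig (Fn.δ j j) f (b j) := by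
  obtain ⟨n, hn⟩ := Fn.exists_δ_eq_zero f
  obtain ⟨m, hm⟩ := exists_bound b
  obtain ⟨l, hnl, hml, hjl⟩ : ∃ l, n ≤ l ∧ m ≤ l ∧ j ≠ l := ⟨n + m + j + 1, by omega, by omega, by omega⟩
  have h1 := congrArg φ.hom (hw (slInfData.h j l))
  have h2 : φ.hom (slInfData.wt b (slInfData.h j l) • w) =
      slInfData.wt b (slInfData.h j l) • φ.hom w := (φ.hom.restrictScalars ℂ).map_smul _ _
  rw [map_smul, h2, hf, toU_of, Emb.smul_of, slInfData.wt_h b trivial trivial hjl, hm l hml] at h1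
  have h3 : (slInfData.h j l : slInf).1 = unitOp j j - unitOp l l :=
    inclInf_finH (by omega) (by omega) hjl
  have h4 : Fn.act (unitOp j j - unitOp l l) f = Fn.δ j j f - Fn.δ l l f :=
    congrArg (fun d => d f) (map_sub (Fn.actHom.{u} (k := k)).toLinearMap (unitOp j j) (unitOp l l))
  rw [h3, h4, hn l hnl, sub_zero, Int.cast_zero, sub_zero] at h1
  exact h1

-- Words in lowering operators never raise a partial sum, so a vector generated by `w` whose weight
-- exceeds `b` in some partial sum must come from `R`.
include hM hφ in
lemma FnWt.mem_of_hd_pos {b θ : ℕ →₀ ℤ} {w : M} (hs : slInfData.Sing R (slInfData.wt b) w)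
    (hw : w ∈ weightSpace slInfData.H M (slInfData.wt b))
    (h : FnWt φ (Submodule.span (U slInf) {w}) (b + θ) g) (ht : tot θ = 0) {n : ℕ}
    (hn : 0 < hd n θ) : FnIn φ R g := by
  obtain ⟨y, hy, hyg⟩ := h.2
  refine ⟨y, ?_, hyg⟩
  have hyw : y ∈ weightSpace slInfData.H M (slInfData.wt (b + θ)) :=
    mem_weightSpace_of_injective hφ (by rw [hyg]; exact infEmb.of_mem_weightSpace h.1)
  obtain ⟨s, hs, -, z, hz, rfl⟩ := hs.mem_of_weight hM hw (Submodule.mem_sup_right (S := R) hy) hyw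
  have hsub : {x | ∃ β, slInfData.Desc w (fun _ _ => True) β x ∧
      slInfData.wt b - slInfData.wt β = slInfData.wt (b + θ)} ⊆ ∅ := by
    rintro x ⟨β, hβ, hβw⟩
    have h0 : -β = θ := by
      refine slInfData.wt_inj (fun n hn => (hn trivial).elim) (fun n hn => (hn trivial).elim) ?_ ?_
      · rw [map_neg, hβ.tot_eq, ht, neg_zero]
      · rw [map_add, sub_eq_add_neg, add_right_inj] at hβw
        rw [map_neg, hβw]
    have := hβ.hd_nonneg n
    rw [← h0, map_neg] at hn
    omega
  have : z = 0 := by simpa using Submodule.span_mono hsub hz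
  rwa [this, add_zero]

-- In the recursion `capA_succ` all terms but the first end with a lowering operator applied to a
-- vector of weight above `b`, which lies in `R`. The first term multiplies by `b (ρ 0) + q`. So
-- modulo `R` the operator acts by a product of such numbers.
include hM hφ in
lemma exists_capA {b : ℕ →₀ ℤ} {w : M} {f : Fn.{u} k} (hs : slInfData.Sing R (slInfData.wt b) w)
    (hw : w ∈ weightSpace slInfData.H M (slInfData.wt b)) (hf : φ.hom w = infEmb.of f) (q : ℕ) :
    ∀ ρ : Fin q → ℕ, StrictMono ρ → (∀ l, 0 ≤ b (ρ l)) → (∀ l : Fin q, (l : ℕ) + 1 = q → 0 < b (ρ l)) →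
    ∃ c : ℂ, c ≠ 0 ∧ FnIn φ R (Fn.capA q ρ ρ f - c • f) := by
  induction q with
  | zero =>
    intro ρ _ _ _
    refine ⟨1, one_ne_zero, ?_⟩
    rw [Fn.capA_zero, one_smul, sub_self]
    exact FnIn.zero
  | succ q ih =>
    intro ρ hρ h0 hpos
    obtain ⟨c, hc, hcR⟩ := ih (Fin.tail ρ) (fun i j hij => hρ (Fin.succ_lt_succ_iff.mpr hij))
      (fun l => h0 l.succ) fun l hl => hpos l.succ (by rw [Fin.val_succ, hl])
    have hfw : FnWt φ (Submodule.span (U slInf) {w}) b f :=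
      ⟨eig_of_mem_weightSpace hf hw, w, Submodule.mem_span_singleton_self w, hf⟩
    -- For `q > 0` the summand `q` makes the nonnegative entry positive. For `q = 0` the row is the
    -- last one, the only one where `b` has to be positive.
    have hne : ((b (ρ 0) : ℤ) : ℂ) + q ≠ 0 := by
      have h1 := h0 0
      have h2 : b (ρ 0) + q ≠ 0 := by
        rcases Nat.eq_zero_or_pos q with rfl | hq
        · have := hpos 0 rfl
          omega
        · omega
      exact_mod_cast h2
    refine ⟨((b (ρ 0) : ℤ) + q) * c, mul_ne_zero hne hc, ?_⟩
    have hfirst : Fn.δ (ρ 0) (ρ 0) (Fn.capA q (Fin.tail ρ) (Fin.tail ρ) f) =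
        ((b (ρ 0) : ℤ) : ℂ) • Fn.capA q (Fin.tail ρ) (Fin.tail ρ) f := by
      have := (hfw.capA q (Fin.tail ρ) (Fin.tail ρ)).1 (ρ 0)
      rwa [add_sub_cancel_right] at this
    rw [Fn.capA_succ, Fin.sum_univ_succ, if_pos rfl, one_mul, natCast_mul_eq_smul]
    have h1 : ρ ∘ (0 : Fin (q + 1)).succAbove = Fin.tail ρ := by
      funext l
      rw [Function.comp_apply, Fin.succAbove_zero]
      rfl
    rw [h1, hfirst, ← add_smul, Fin.val_zero, pow_zero, one_mul, add_sub_right_comm, mul_smul,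
      ← smul_sub]
    refine (hcR.csmul _).add (FnIn.sum _ _ fun a _ => ?_)
    have hlt : ρ 0 < ρ a.succ := hρ (Fin.succ_pos a)
    rw [if_neg hlt.ne', zero_mul, add_zero]
    refine FnIn.sign _ (FnIn.δ hlt.ne' ?_)
    have h2 := hfw.capA q (ρ ∘ a.succ.succAbove) (Fin.tail ρ)
    have h3 : b + epsSum (ρ ∘ a.succ.succAbove) - epsSum (Fin.tail ρ) =
        b + root (ρ 0) (ρ a.succ) := by
      have := (epsSum_succAbove ρ a.succ).symm.trans (epsSum_tail ρ)
      rw [root, add_sub_assoc, add_right_inj, sub_eq_sub_iff_add_eq_add, add_comm, this]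
    rw [h3] at h2
    refine h2.mem_of_hd_pos hM hφ hs hw (tot_root _ _) (n := ρ 0 + 1) ?_
    rw [hd_root, if_pos (Nat.lt_succ_self _), if_neg (by omega)]
    norm_num

include hM hφ in
/-- The weights of singular vectors in a module of functions of `k` columns have at most `k`
positive entries far out. -/
lemma eq_zero_of_capelli {b : ℕ →₀ ℤ} {w : M} (hs : slInfData.Sing R (slInfData.wt b) w)
    (hw : w ∈ weightSpace slInfData.H M (slInfData.wt b)) (hwR : w ∉ R)
    (h0 : ∀ r, k ≤ r → 0 ≤ b r) (r : ℕ) (hr : 2 * k ≤ r) : b r = 0 := by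
  by_contra hne
  have hpos : 0 < b r := lt_of_le_of_ne (h0 r (by omega)) (Ne.symm hne)
  let f : Fn.{u} k := φ.hom w
  have hf : φ.hom w = infEmb.of f := rfl
  -- The rows are `k, k + 1, …, 2 * k - 1` and then `r`. They increase because `2 * k ≤ r`, and
  -- their number exceeds the number of columns, so the Capelli operator is zero while it should act
  -- on `w` modulo `R` by a nonzero scalar.
  let ρ : Fin (k + 1) → ℕ := fun l => if (l : ℕ) = k then r else k + l
  obtain ⟨c, hc, y, hy, hyf⟩ := exists_capA hM hφ hs hw hf (k + 1) ρ
    (fun i j hij => by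
      have hij' : (i : ℕ) < j := hij
      have := j.2
      dsimp only [ρ]
      split_ifs <;> omega)
    (fun l => h0 _ (by dsimp only [ρ]; split_ifs <;> omega))
    fun l hl => by
      have : (l : ℕ) = k := by omega
      dsimp only [ρ]
      rwa [if_pos this]
  rw [Fn.capA_eq_zero (Nat.lt_succ_self k), zero_sub, ← neg_smul, ← Emb.smul_of, ← hf] at hyf
  have h1 : y = (-c) • w := hφ (hyf.trans ((φ.hom.restrictScalars ℂ).map_smul _ _).symm)
  rw [h1] at hy
  exact hwR (SlData.mem_of_csmul_mem R (neg_ne_zero.mpr hc) hy)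

end PrincipalBlockInfinite

/-! ### Locally nilpotent operators -/

section LocallyNilpotent

open scoped ModuleCat

variable {L : Type} [LieRing L] [LieAlgebra ℂ L] {M : Rep.{u} L}

/-- The vectors killed by a power of an element of the Lie algebra. -/
def nilPart (M : Rep.{u} L) (y : L) : Submodule ℂ M where
  carrier := {x | ∃ N : ℕ, toU y ^ N • x = 0}
  add_mem' {a b} := by
    rintro ⟨m, hm⟩ ⟨n, hn⟩
    refine ⟨m + n, ?_⟩
    rw [smul_add, pow_add, mul_smul, mul_smul, hn, smul_zero, ← mul_smul, ← pow_add, add_comm m n,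
      pow_add, mul_smul, hm, smul_zero, add_zero]
  zero_mem' := ⟨0, smul_zero _⟩
  smul_mem' c x := by
    rintro ⟨n, hn⟩
    exact ⟨n, by rw [smul_comm, hn, smul_zero]⟩

lemma mem_nilPart_of_smul {y : L} {x : M} (h : toU y • x ∈ nilPart M y) : x ∈ nilPart M y := by
  obtain ⟨N, hN⟩ := h
  exact ⟨N + 1, by rw [pow_succ, mul_smul, hN]⟩

/-- Induction on the exponent with `y z x = z y x + [y, z] x`: stability under `z` follows from
stability under `[y, z]`. -/
lemma nilPart_stable_of_lie {y z : L} (h : ∀ x ∈ nilPart M y, toU ⁅y, z⁆ • x ∈ nilPart M y) {x : M}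
    (hx : x ∈ nilPart M y) : toU z • x ∈ nilPart M y := by
  obtain ⟨N, hN⟩ := hx
  induction N generalizing x with
  | zero =>
    rw [pow_zero, one_smul] at hN
    rw [hN, smul_zero]
    exact Submodule.zero_mem _
  | succ N ih =>
    apply mem_nilPart_of_smul
    have h1 : toU y • toU z • x = toU z • toU y • x + toU ⁅y, z⁆ • x := by
      rw [lie_smul]
      abel
    rw [h1]
    refine Submodule.add_mem _ (ih ?_) (h x ⟨N + 1, hN⟩)
    rw [← mul_smul, ← pow_succ, hN]

/-- As `ad y` has vanishing third power, three applications of `nilPart_stable_of_lie` show that the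
vectors killed by powers of `y` form a submodule; it contains the generator. -/
lemma nilPart_eq_top {y : L} (hy : ∀ z : L, ⁅y, ⁅y, ⁅y, z⁆⁆⁆ = 0) {u : M}
    (hu : Submodule.span (U L) {u} = ⊤) (hyu : toU y • u = 0) (x : M) : x ∈ nilPart M y := by
  have hstab (z : L) : ∀ x ∈ nilPart M y, toU z • x ∈ nilPart M y := fun x hx =>
    nilPart_stable_of_lie (fun x hx => nilPart_stable_of_lie (fun x hx =>
      nilPart_stable_of_lie (fun x _ => by
        rw [hy, toU, map_zero, zero_smul]
        exact Submodule.zero_mem _) hx) hx) hx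
  have hx : x ∈ Submodule.span (U L) {u} := by rw [hu]; trivial
  obtain ⟨a, rfl⟩ := Submodule.mem_span_singleton.mp hx
  exact U_smul_mem _ hstab a ⟨1, by rw [pow_one, hyu]⟩

variable {D : SlData L}

lemma raise_lower_pow {R : Submodule (U L) M} {b : ℕ →₀ ℤ} {w : M} {i j : ℕ} (hij : i < j)
    (hj : j ∈ D.dom) (hs : D.Sing R (D.wt b) w) (hw : w ∈ weightSpace D.H M (D.wt b)) (n : ℕ) :
    toU (D.E i j) • toU (D.E j i) ^ (n + 1) • w -
      (((n : ℂ) + 1) * ((b i : ℂ) - b j - n)) • toU (D.E j i) ^ n • w ∈ R := by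
  have hi : i ∈ D.dom := D.dom_lt hij.le hj
  have hwt (n : ℕ) : toU (D.E j i) ^ n • w ∈
      weightSpace D.H M (D.wt ((n : ℤ) • root j i + b)) := by
    induction n with
    | zero => simpa using hw
    | succ n ih =>
      have := D.toU_E_mem_weightSpace hj hi hij.ne' ih
      rw [← map_add] at this
      rw [pow_succ', mul_smul]
      convert this using 2
      push_cast
      rw [add_smul, one_smul]
      abel_nf
  have hcomm (x : M) : toU (D.E i j) • toU (D.E j i) • x =
      toU (D.E j i) • toU (D.E i j) • x + toU (D.h i j : L) • x := by
    rw [← D.lie_E_swap hi hj hij.ne, lie_smul]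
    abel
  have hh (n : ℕ) : toU (D.h i j : L) • toU (D.E j i) ^ n • w =
      ((b i : ℂ) - b j - 2 * n) • toU (D.E j i) ^ n • w := by
    rw [hwt n, D.wt_h _ hi hj hij.ne]
    congr 1
    simp only [root, Finsupp.add_apply, Finsupp.smul_apply, Finsupp.sub_apply,
      Finsupp.single_eq_same, Finsupp.single_eq_of_ne hij.ne, Finsupp.single_eq_of_ne hij.ne',
      smul_eq_mul]
    push_cast
    ring
  induction n with
  | zero =>
    have h1 := hh 0
    rw [pow_zero, one_smul] at h1
    rw [zero_add, pow_one, hcomm, h1, pow_zero, one_smul]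
    have h2 := R.smul_mem (toU (D.E j i)) (hs.2 _ (D.E_mem_N hj hij))
    convert h2 using 1
    rw [sub_eq_iff_eq_add]
    congr 2
    simp
  | succ n ih =>
    rw [pow_succ', mul_smul, hcomm, hh]
    have h1 := R.smul_mem (toU (D.E j i)) ih
    rw [smul_sub, smul_comm (toU (D.E j i)) (_ : ℂ), ← mul_smul (toU (D.E j i)) (_ ^ n),
      ← pow_succ'] at h1
    have hc : (((n + 1 : ℕ) : ℂ) + 1) * ((b i : ℂ) - b j - (n + 1 : ℕ)) =
        ((n : ℂ) + 1) * ((b i : ℂ) - b j - n) + ((b i : ℂ) - b j - 2 * (n + 1 : ℕ)) := by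
      push_cast
      ring
    rw [hc, add_smul, add_sub_add_right_eq_sub]
    exact h1

/-- This is `sl_2`-theory modulo `R`. If `n + 1` is the least exponent for which the power of the
lowering operator maps `w` into `R`, then `raise_lower_pow` forces `b i - b j = n`. -/
lemma exists_nat_of_sing {R : Submodule (U L) M} {b : ℕ →₀ ℤ} {w : M} {i j : ℕ} (hij : i < j)
    (hj : j ∈ D.dom) (hs : D.Sing R (D.wt b) w) (hw : w ∈ weightSpace D.H M (D.wt b)) (hwR : w ∉ R)
    (hnil : w ∈ nilPart M (D.E j i)) : b j ≤ b i := by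
  classical
  have hex : ∃ N : ℕ, toU (D.E j i) ^ N • w ∈ R := by
    obtain ⟨N, hN⟩ := hnil
    exact ⟨N, by rw [hN]; exact R.zero_mem⟩
  have hN := Nat.find_spec hex
  obtain ⟨n, hn⟩ : ∃ n, Nat.find hex = n + 1 := Nat.exists_eq_succ_of_ne_zero fun h0 => by
    rw [h0, pow_zero, one_smul] at hN
    exact hwR hN
  rw [hn] at hN
  have hnR : toU (D.E j i) ^ n • w ∉ R := Nat.find_min hex (by omega)
  have h1 := raise_lower_pow hij hj hs hw n
  have h2 := (Submodule.sub_mem_iff_right R (R.smul_mem (toU (D.E i j)) hN)).mp h1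
  by_contra hlt
  refine hnR (SlData.mem_of_csmul_mem R (mul_ne_zero ?_ ?_) h2)
  · exact_mod_cast Nat.succ_ne_zero n
  · have : b i - b j - (n : ℤ) ≠ 0 := by omega
    exact_mod_cast this

lemma commutator_three {A : Type*} [Ring A] {f : A} (h : f * f = 0) (g : A) :
    ⁅f, ⁅f, ⁅f, g⁆⁆⁆ = 0 := by
  have h1 (x : A) : f * (f * x) = 0 := by rw [← mul_assoc, h, zero_mul]
  simp [LieRing.of_associative_ring_bracket, mul_sub, sub_mul, mul_assoc, h1, h]

lemma lie_infE_three {i j : ℕ} (hij : i ≠ j) (z : slInf) :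
    ⁅infE i j, ⁅infE i j, ⁅infE i j, z⁆⁆⁆ = 0 := by
  apply Subtype.ext
  change ⁅(infE i j).1, ⁅(infE i j).1, ⁅(infE i j).1, z.1⁆⁆⁆ = 0
  rw [infE_coe hij]
  have h : unitOp i j * unitOp i j = 0 := by rw [unitOp_mul, if_neg hij.symm]
  exact commutator_three h z.1

end LocallyNilpotent

/-! ### Finite length of the link modules and the principal block of `sl_∞` -/

section PrincipalBlockInfinite

open scoped ModuleCat

lemma catOInf_iff {M : Rep.{u} slInf} : catOInf M ↔
    IsWeightModule cartanInf M ∧ IsNoetherian (U slInf) M ∧ IsArtinian (U slInf) M ∧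
      slInfData.SV M := categoryOfl_iff (D := slInfData)

lemma linked_swap {a : ℕ →₀ ℤ} {σ : Equiv.Perm ℕ} (hσ : ∀ i : ℕ, a i = i - σ i) (i : ℕ) :
    Linked (a - ((σ (i + 1) : ℤ) - σ i) • root i (i + 1)) := by
  refine ⟨σ * Equiv.swap i (i + 1), fun j => ?_⟩
  rw [Equiv.Perm.mul_apply, Finsupp.sub_apply, Finsupp.smul_apply, hσ, root, Finsupp.sub_apply,
    Finsupp.single_apply, Finsupp.single_apply, smul_eq_mul]
  by_cases h1 : j = i
  · subst h1
    rw [Equiv.swap_apply_left, if_pos rfl, if_neg (by omega)]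
    ring
  · by_cases h2 : j = i + 1
    · subst h2
      rw [Equiv.swap_apply_right, if_neg (by omega), if_pos rfl]
      ring
    · rw [Equiv.swap_apply_of_ne_of_ne h1 h2, if_neg (Ne.symm h1), if_neg (Ne.symm h2)]
      ring

/-- The filtration makes all singular weights linked, and the Capelli argument makes them vanish
from index `2 * k` on, so there are finitely many. Their weight spaces are finite-dimensional,
whence finite length. -/
lemma catOInf_linkRep {a : ℕ →₀ ℤ} {i k m : ℕ} (hk : i + 1 < k) (ha : ∀ j, k ≤ j → a j = 0)
    {b b' : ℕ →₀ ℤ} (hb : Linked b) (hb' : Linked b')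
    (h : IsLink slInfData (infEmb.linkRep.{u} a hk.le m) (slInfData.wt b) (slInfData.wt b')) :
    catOInf (infEmb.linkRep.{u} a hk.le m) := by
  have hM : IsWeightModule slInfData.H (infEmb.linkRep.{u} a hk.le m) :=
    infEmb.isWeightModule_linkRep hk.le ha
  have hmem {b : ℕ →₀ ℤ} (hb : Linked b) : slInfData.wt b ∈ slInfData.lnk :=
    ⟨b, hb, fun i hi => (hi trivial).elim, rfl⟩
  have hF := h.hwFilt (hmem hb) (hmem hb')
  have hφ : Function.Injective (infEmb.linkIncl.{u} a hk.le m).hom := cycIncl_injective _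
  have hSW : slInfData.SW (⊥ : Submodule (U slInf) (infEmb.linkRep.{u} a hk.le m)) ⊤ ⊆
      slInfData.wt '' {b | Linked b ∧ ∀ r, 2 * k ≤ r → b r = 0} := by
    intro χ hχ
    obtain ⟨b, hb, -, rfl⟩ := hF.SW_subset infLevels hM hχ
    obtain ⟨R, w, -, -, hwR, hs, hw⟩ := SlData.SW_exists_weight hM bot_le hχ
    refine ⟨b, ⟨hb, eq_zero_of_capelli hM hφ hs hw hwR fun r hr => ?_⟩, rfl⟩
    obtain ⟨n, hn⟩ := exists_bound b
    have hrs : r < n + r + 1 := by omega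
    -- The generator does not involve rows from `k` on, so this lowering operator kills it and is
    -- locally nilpotent on the module. Hence `b r` is at least an entry of `b` beyond its support,
    -- i.e. nonnegative, as the Capelli argument requires.
    have hE : Fn.δ (n + r + 1) r (Emb.linkFn.{u} a hk.le m) = 0 :=
      Emb.der_linkFn (Fn.δ_hv_out hr a) (Fn.δ_qt_out hr hk)
    have hE' : toU (slInfData.E (n + r + 1) r) • infEmb.of (Emb.linkFn.{u} a hk.le m) = 0 := by
      rw [infEmb.E_of (D := slInfData) trivial trivial hrs.ne', hE]
      rfl
    have h0 := exists_nat_of_sing (D := slInfData) hrs trivial hs hw hwR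
      (nilPart_eq_top (lie_infE_three hrs.ne') (span_cycGen _) (hφ (by
        rw [map_smul, map_zero]
        exact hE')) w)
    rwa [hn (n + r + 1) (by omega)] at h0
  have hsv := hF.sv hM
  obtain ⟨h1, h2⟩ := hsv.finiteLength hM ((finite_linked (2 * k)).image _) hSW fun χ _ =>
    hF.finiteDimensional_weightSpace hM χ
  exact catOInf_iff.mpr ⟨hM, h1, h2, hsv⟩

lemma blockData_catOInf : BlockData slInfData catOInf.{u} where
  weight h := h.1
  hwFilt h := by
    obtain ⟨-, _, -, h⟩ := catOInf_iff.mp h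
    exact h.hwFilt
  of_surjective f hf h := by
    obtain ⟨h1, _, _, h2⟩ := catOInf_iff.mp h
    exact catOInf_iff.mpr ⟨h1.of_surjective f hf, isNoetherian_of_surjective f.hom
      (LinearMap.range_eq_top.mpr hf), isArtinian_of_surjective _ f.hom hf, h2.of_surjective f hf⟩
  of_injective f x hf _ h := by
    obtain ⟨h1, _, _, h2⟩ := catOInf_iff.mp h
    exact catOInf_iff.mpr ⟨h1.of_injective f hf, isNoetherian_of_injective f.hom hf,
      isArtinian_of_injective f.hom hf, h2.of_injective f hf⟩
  prod {M M'} h h' := by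
    obtain ⟨h1, _, _, h2⟩ := catOInf_iff.mp h
    obtain ⟨h1', _, _, h2'⟩ := catOInf_iff.mp h'
    exact catOInf_iff.mpr ⟨isWeightModule_prod h1 h1',
      inferInstanceAs (IsNoetherian (U slInf) (M × M')),
      inferInstanceAs (IsArtinian (U slInf) (M × M')), h2.prod h2'⟩
  trivial {M} h := by
    have hfin : Module.Finite ℂ M := Module.finite_of_finrank_eq_succ h.1
    have hM : IsWeightModule slInfData.H M := h.isWeightModule _
    obtain ⟨v, -, hv, hs⟩ := h.isHW (D := slInfData)
    have hF : slInfData.HwFilt Set.univ (⊤ : Submodule (U slInf) M) := by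
      have := SlData.HwFilt.step .bot (Set.mem_univ _) hs
      rwa [hv, sup_top_eq] at this
    exact catOInf_iff.mpr ⟨hM, isNoetherian_of_tower ℂ inferInstance,
      isArtinian_of_tower ℂ inferInstance, hF.sv hM⟩
  link a σ hσ _ i hi hi' := by
    obtain ⟨k, hk, m, hak, -, h⟩ := exists_link infEmb hσ hi hi'
    exact ⟨_, catOInf_linkRep hk hak ⟨σ, hσ⟩ (linked_swap hσ i) h, h⟩

/-- The principal block consists of the modules all of whose highest weights are linked to zero. -/
lemma catOInf₀_iff (M : Rep.{u} slInf) : catOInf₀ M ↔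
    catOInf M ∧ slInfData.SW (⊥ : Submodule (U slInf) M) ⊤ ⊆ slInfData.lnk :=
  blockContaining_iff infLevels blockData_catOInf M

end PrincipalBlockInfinite

/-! ### Truncation -/

section Homs

open scoped ModuleCat

variable {L : Type} [LieRing L] [LieAlgebra ℂ L]

/-- A linear map which commutes with the Lie algebra is a morphism of modules. -/
def mkHom {M M' : Rep.{u} L} (f : M →ₗ[ℂ] M') (h : ∀ (x : L) (v : M), f (toU x • v) = toU x • f v) :
    M ⟶ M' :=
  ModuleCat.ofHom
    { toFun := f
      map_add' := map_add f
      map_smul' := fun a v => by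
        -- The graph of `f` is stable under the Lie algebra, hence under its enveloping algebra.
        let G : Submodule ℂ (ModuleCat.of (U L) (M × M')) :=
          { carrier := {p | f p.1 = p.2}
            add_mem' := fun {p q} hp hq => by
              change f (p.1 + q.1) = p.2 + q.2
              rw [map_add, hp, hq]
            zero_mem' := map_zero f
            smul_mem' := fun c p hp => by
              change f (c • p.1) = c • p.2
              rw [map_smul, hp] }
        have hG : (a • (v, f v) : M × M') ∈ G := U_smul_mem (M := ModuleCat.of (U L) (M × M')) G
          (fun x p hp => by
            change f (toU x • p.1) = toU x • p.2
            rw [h, hp]) a (v := (v, f v)) rfl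
        exact hG }

/-- A bijective morphism is an isomorphism. -/
def isoOfBijective {M M' : Rep.{u} L} (f : M ⟶ M') (h : Function.Bijective f.hom) : M ≅ M' :=
  (LinearEquiv.ofBijective f.hom h).toModuleIso

lemma isoOfBijective_hom {M M' : Rep.{u} L} (f : M ⟶ M') (h : Function.Bijective f.hom) :
    (isoOfBijective f h).hom = f := rfl

lemma hom_csmul {M M' : Rep.{u} L} (f : M ⟶ M') (c : ℂ) (v : M) : f.hom (c • v) = c • f.hom v :=
  (f.hom.restrictScalars ℂ).map_smul c v

end Homs

/-! ### Truncation of modules and submodules to a level -/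

section Truncation

open scoped ModuleCat

variable {L : Type} [LieRing L] [LieAlgebra ℂ L] {D : SlData L} {m : ℕ}

namespace Level

/-- The sum of the weight spaces for the weights in the root lattice of a level. -/
def space (_ : Level D m) (M : Rep.{u} L) : Submodule ℂ M := D.partOf M {χ | D.InLat m χ}

variable (l : Level D m) {M : Rep.{u} L}

lemma weightSpace_le_space {χ : Module.Dual ℂ D.H} (h : D.InLat m χ) :
    weightSpace D.H M χ ≤ l.space M := le_iSup₂_of_le χ h le_rfl

lemma space_induction {V : Submodule ℂ M} (h : ∀ a : ℕ →₀ ℤ, (∀ i, m ≤ i → a i = 0) → tot a = 0 →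
    ∀ v ∈ weightSpace D.H M (D.wt a), v ∈ V) {v : M} (hv : v ∈ l.space M) : v ∈ V := by
  have : l.space M ≤ V := iSup₂_le fun χ hχ w hw => by
    obtain ⟨a, ha, ht, rfl⟩ := hχ
    exact h a ha ht w hw
  exact this hv

lemma inLat_add_root {a : ℕ →₀ ℤ} (ha : ∀ i, m ≤ i → a i = 0) (ht : tot a = 0) {i j : ℕ}
    (hi : i < m) (hj : j < m) : D.InLat m (D.wt (root i j) + D.wt a) := by
  refine ⟨root i j + a, fun n hn => ?_, by rw [map_add, tot_root, ht, add_zero], (map_add _ _ _).symm⟩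
  rw [Finsupp.add_apply, ha n hn, root, Finsupp.sub_apply, Finsupp.single_eq_of_ne (by omega),
    Finsupp.single_eq_of_ne (by omega), sub_zero, add_zero]

lemma toU_mem_space (x : slFin m) {v : M} (hv : v ∈ l.space M) : toU (l.ι x) • v ∈ l.space M := by
  suffices h : ∀ a : ℕ →₀ ℤ, (∀ i, m ≤ i → a i = 0) → tot a = 0 →
      ∀ v ∈ weightSpace D.H M (D.wt a), v ∈
        (l.space M).comap (Algebra.lsmul ℂ ℂ M (toU (l.ι x))) from l.space_induction h hv
  intro a ha ht v hv
  let V : Submodule ℂ (slFin m) := (intoSub (l.space M) v).comap (l.ι : slFin m →ₗ[ℂ] L)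
  have hV : cartan m ⊔ Submodule.span ℂ
      {x | ∃ i j, i ∈ Set.Iio m ∧ j ∈ Set.Iio m ∧ i ≠ j ∧ x = finE m i j} ≤ V := by
    refine sup_le (fun y hy => ?_) (Submodule.span_le.mpr ?_)
    · change toU (l.ι y) • v ∈ l.space M
      rw [hv ⟨l.ι y, l.ι_H ⟨y, hy⟩⟩]
      exact Submodule.smul_mem _ _ (l.weightSpace_le_space ⟨a, ha, ht, rfl⟩ hv)
    · rintro _ ⟨i, j, hi, hj, hij, rfl⟩
      change toU (l.ι (finE m i j)) • v ∈ l.space M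
      rw [l.ι_E hi hj hij]
      exact l.weightSpace_le_space (inLat_add_root ha ht hi hj)
        (D.toU_E_mem_weightSpace (l.mem_dom hi) (l.mem_dom hj) hij hv)
  exact hV (sl_span m x)

variable (M) in
/-- The truncation of a module. -/
def obj : Rep.{u} (slFin m) := ModuleCat.of (U (slFin m))
  ({ carrier := {v | (show M from v) ∈ l.space M}
     add_mem' := fun ha hb => (l.space M).add_mem ha hb
     zero_mem' := (l.space M).zero_mem
     smul_mem' := fun a _ hv => mapU_smul_mem l.ι (l.space M) (fun x _ hv => l.toU_mem_space x hv) a hv } :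
    Submodule (U (slFin m)) (res l.ι M))

variable (M) in
/-- The inclusion of the truncation of a module. -/
def val : l.obj M →ₗ[ℂ] M where
  toFun y := y.1
  map_add' _ _ := rfl
  map_smul' c y := by
    change ((algebraMap ℂ (U (slFin m)) c • y).1 : res l.ι M) = c • (show M from y.1)
    rw [← algebraMap_smul (U L) c (show M from y.1), ← (mapU l.ι).commutes c]
    rfl

lemma val_injective : Function.Injective (l.val M) := Subtype.val_injective

lemma val_mem (y : l.obj M) : l.val M y ∈ l.space M := y.2

/-- An element of the truncation. -/
def elt {v : M} (hv : v ∈ l.space M) : l.obj M := ⟨v, hv⟩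

@[simp] lemma val_elt {v : M} (hv : v ∈ l.space M) : l.val M (l.elt hv) = v := rfl

lemma val_smul (a : U (slFin m)) (y : l.obj M) : l.val M (a • y) = mapU l.ι a • l.val M y := rfl

lemma val_toU (x : slFin m) (y : l.obj M) : l.val M (toU x • y) = toU (l.ι x) • l.val M y := by
  rw [val_smul, mapU_toU]

/-- The difference of `h` and the image of `x` commutes with `sl_m`, so all `ε i` with `i < m` take
the same value on it; a weight with total zero supported there vanishes. -/
lemma wt_lie {h : D.H} {x : cartan m} (hx : ∀ y : slFin m, ⁅(h : L), l.ι y⁆ = ⁅l.ι x, l.ι y⁆)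
    {a : ℕ →₀ ℤ} (ha : ∀ i, m ≤ i → a i = 0) (ht : tot a = 0) :
    D.wt a h = (slFinData m).wt a x := by
  rw [← l.pull_wt]
  change D.wt a h = D.wt a (l.resH x)
  rw [← sub_eq_zero, ← map_sub]
  have h0 (i : ℕ) (hi : i < m) : D.ε i (h - l.resH x) = D.ε 0 (h - l.resH x) := by
    rcases Nat.eq_zero_or_pos i with rfl | hi0
    · rfl
    have hm0 : 0 < m := by omega
    have h1 : ⁅((h - l.resH x : D.H) : L), D.E i 0⁆ = 0 := by
      rw [← l.ι_E hi hm0 hi0.ne']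
      change ⁅(h : L) - l.ι x, _⁆ = 0
      rw [sub_lie, hx, sub_self]
    rw [D.lie_H_E _ (l.mem_dom hi) (l.mem_dom hm0) hi0.ne'] at h1
    have h2 : D.E i 0 ≠ 0 := fun h2 => by
      have h3 := D.lie_E_swap (l.mem_dom hi) (l.mem_dom hm0) hi0.ne'
      rw [h2, zero_lie] at h3
      have h4 := D.ε_h (k := i) (l.mem_dom hi) (l.mem_dom hm0) hi0.ne'
      have h5 : D.h i 0 = 0 := Subtype.ext h3.symm
      rw [h5, map_zero, if_pos rfl, if_neg hi0.ne'] at h4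
      norm_num at h4
    exact sub_eq_zero.mp ((smul_eq_zero.mp h1).resolve_right h2)
  rw [SlData.wt_apply, Finsupp.sum, LinearMap.sum_apply]
  rw [tot_apply, Finsupp.sum] at ht
  have h1 : ∑ i ∈ a.support, (a i • D.ε i) (h - l.resH x) =
      ∑ i ∈ a.support, a i • D.ε 0 (h - l.resH x) := Finset.sum_congr rfl fun i hi => by
    rw [LinearMap.smul_apply, h0 i]
    by_contra hi'
    exact Finsupp.mem_support_iff.mp hi (ha i (by omega))
  rw [h1, ← Finset.sum_smul, ht, zero_smul]

lemma smul_of_lie {h : D.H} {x : cartan m} (hx : ∀ y : slFin m, ⁅(h : L), l.ι y⁆ = ⁅l.ι x, l.ι y⁆)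
    {v : M} (hv : v ∈ l.space M) : toU (h : L) • v = toU (l.ι x) • v := by
  let E : M →ₗ[ℂ] M := Algebra.lsmul ℂ ℂ M (toU (h : L)) - Algebra.lsmul ℂ ℂ M (toU (l.ι x))
  have : v ∈ LinearMap.ker E := l.space_induction (fun a ha ht v hv => by
    change toU (h : L) • v - toU (l.ι x) • v = 0
    rw [hv h, hv ⟨l.ι x, l.ι_H x⟩, l.wt_lie hx ha ht, ← l.pull_wt]
    exact sub_self _) hv
  exact sub_eq_zero.mp this

/-- On the truncation every `h` acts like some element of the diagonal of `sl_m`, with matching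
weights by `wt_lie`. So no information is lost on restricting weights to `sl_m`. -/
lemma val_mem_weightSpace {a : ℕ →₀ ℤ} (ha : ∀ i, m ≤ i → a i = 0) (ht : tot a = 0) {y : l.obj M} :
    l.val M y ∈ weightSpace D.H M (D.wt a) ↔
      y ∈ weightSpace (cartan m) (l.obj M) ((slFinData m).wt a) := by
  constructor
  · intro hy x
    apply l.val_injective
    rw [val_toU, map_smul, hy ⟨l.ι x, l.ι_H x⟩, ← l.pull_wt]
    rfl
  · intro hy h
    obtain ⟨x, hx⟩ := l.lie_ι h
    rw [l.smul_of_lie hx (l.val_mem y), ← l.val_toU, hy x, map_smul, l.wt_lie hx ha ht]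
    rfl

lemma isWeightModule_obj : IsWeightModule (cartan m) (l.obj M) := by
  rw [IsWeightModule, eq_top_iff]
  rintro y -
  have h : l.val M y ∈ (⨆ χ, weightSpace (cartan m) (l.obj M) χ).map (l.val M) :=
    l.space_induction (V := (⨆ χ, weightSpace (cartan m) (l.obj M) χ).map (l.val M))
      (fun a ha ht v hv => ⟨l.elt (l.weightSpace_le_space ⟨a, ha, ht, rfl⟩ hv), Submodule.mem_iSup_of_mem _
        ((l.val_mem_weightSpace ha ht).mp hv), rfl⟩) (l.val_mem y)
  obtain ⟨z, hz, hzy⟩ := h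
  rwa [← l.val_injective hzy]

/-- The truncation of a submodule. -/
def cut (S : Submodule (U L) M) : Submodule (U (slFin m)) (l.obj M) where
  carrier := {y | l.val M y ∈ S}
  add_mem' ha hb := by
    change l.val M (_ + _) ∈ S
    rw [map_add]
    exact S.add_mem ha hb
  zero_mem' := by
    change l.val M 0 ∈ S
    rw [map_zero]
    exact S.zero_mem
  smul_mem' a y hy := S.smul_mem (mapU l.ι a) hy

lemma mem_cut {S : Submodule (U L) M} {y : l.obj M} : y ∈ l.cut S ↔ l.val M y ∈ S := Iff.rfl

lemma cut_bot : l.cut (⊥ : Submodule (U L) M) = ⊥ := by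
  ext y
  rw [mem_cut, Submodule.mem_bot, Submodule.mem_bot, map_eq_zero_iff _ l.val_injective]

lemma cut_top : l.cut (⊤ : Submodule (U L) M) = ⊤ := rfl

lemma sing_cut {S : Submodule (U L) M} {χ : Module.Dual ℂ D.H} {y : l.obj M}
    (h : D.Sing S χ (l.val M y)) : (slFinData m).Sing (l.cut S) (l.pull χ) y := by
  refine ⟨fun x => ?_, fun x hx => ?_⟩
  · rw [mem_cut, map_sub, val_toU, map_smul]
    exact h.1 (l.resH x)
  · rw [mem_cut, val_toU]
    exact h.2 _ (l.ι_N hx)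

/-- An equivariant map with values in the truncation. -/
def lift {N : Rep.{u} (slFin m)} (f : N →ₗ[ℂ] M) (hf : ∀ y, f y ∈ l.space M)
    (h : ∀ (x : slFin m) (y : N), f (toU x • y) = toU (l.ι x) • f y) : N ⟶ l.obj M :=
  mkHom
    { toFun := fun y => l.elt (hf y)
      map_add' := fun y z => l.val_injective
        ((map_add f y z).trans (map_add (l.val M) (l.elt (hf y)) (l.elt (hf z))).symm)
      map_smul' := fun c y => l.val_injective
        ((map_smul f c y).trans (map_smul (l.val M) c (l.elt (hf y))).symm) }
    fun x y => l.val_injective (by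
      rw [val_toU]
      exact h x y)

lemma val_lift {N : Rep.{u} (slFin m)} (f : N →ₗ[ℂ] M) (hf : ∀ y, f y ∈ l.space M)
    (h : ∀ (x : slFin m) (y : N), f (toU x • y) = toU (l.ι x) • f y) (y : N) :
    l.val M ((l.lift f hf h).hom y) = f y := rfl

lemma map_mem_space {M' : Rep.{u} L} (f : M ⟶ M') {v : M} (hv : v ∈ l.space M) :
    f.hom v ∈ l.space M' :=
  l.space_induction (V := (l.space M').comap (f.hom.restrictScalars ℂ)) (fun a ha ht _ hv =>
    l.weightSpace_le_space ⟨a, ha, ht, rfl⟩ (map_mem_weightSpace f hv)) hv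

/-- The truncation of a morphism. -/
def map {M' : Rep.{u} L} (f : M ⟶ M') : l.obj M ⟶ l.obj M' :=
  l.lift (f.hom.restrictScalars ℂ ∘ₗ l.val M) (fun y => l.map_mem_space f (l.val_mem y)) fun x y => by
    rw [LinearMap.comp_apply, LinearMap.comp_apply, val_toU]
    exact map_smul f.hom _ _

@[simp] lemma val_map {M' : Rep.{u} L} (f : M ⟶ M') (y : l.obj M) :
    l.val M' ((l.map f).hom y) = f.hom (l.val M y) := rfl

end Level

end Truncation

/-! ### Modules all of whose weights are sums of negative roots -/

section SupportedWeights

open scoped ModuleCat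

variable {L : Type} [LieRing L] [LieAlgebra ℂ L] {D : SlData L} {M : Rep.{u} L}

namespace SlData

lemma isWeightModule_of_partOf {Ξ : Set (Module.Dual ℂ D.H)} (h : D.partOf M Ξ = ⊤) :
    IsWeightModule D.H M :=
  top_le_iff.mp (h.symm.le.trans (iSup₂_le fun χ _ => le_iSup (weightSpace D.H M) χ))

lemma mem_of_partOf {Ξ : Set (Module.Dual ℂ D.H)} (h : D.partOf M Ξ = ⊤) {χ : Module.Dual ℂ D.H}
    {v : M} (hv : v ∈ weightSpace D.H M χ) (h0 : v ≠ 0) : χ ∈ Ξ := by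
  obtain ⟨s, f, hf, hs, hsum⟩ := iSup_weightSpace_exists (ι := Ξ) (x := v) (by
    change v ∈ D.partOf M Ξ
    rw [h]
    trivial)
  exact hs _ (sum_eq_component hf hv hsum h0).1

variable (D) in
/-- The weights which are sums of negative roots. -/
def negWt : Set (Module.Dual ℂ D.H) :=
  {χ | ∃ a : ℕ →₀ ℤ, (∀ i ∉ D.dom, a i = 0) ∧ tot a = 0 ∧ (∀ j, hd j a ≤ 0) ∧ χ = D.wt a}

/-- Steps that add nothing are dropped; each remaining one exhibits its weight as the weight of a
singular vector. -/
lemma HwFilt.of_SW {Ξ Ξ' : Set (Module.Dual ℂ D.H)} {S : Submodule (U L) M} (h : D.HwFilt Ξ S)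
    (hΞ : D.SW (⊥ : Submodule (U L) M) ⊤ ⊆ Ξ') : D.HwFilt Ξ' S := by
  induction h with
  | bot => exact .bot
  | @step S χ v _ _ hs ih =>
    by_cases hv : v ∈ S
    · rwa [sup_eq_left.mpr ((Submodule.span_singleton_le_iff_mem _ _).mpr hv)]
    · exact ih.step (hΞ ⟨S, v, bot_le, trivial, hv, hs⟩) hs

/-- Linked weights have nonpositive partial sums, and the weights below them arise by subtracting
elements with nonnegative ones. -/
lemma HwFilt.partOf_negWt (hM : IsWeightModule D.H M)
    (h : D.HwFilt D.lnk (⊤ : Submodule (U L) M)) : D.partOf M D.negWt = ⊤ := by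
  rw [← top_le_iff, ← hM]
  refine iSup_le fun χ v hv => ?_
  by_cases h0 : v = 0
  · rw [h0]
    exact Submodule.zero_mem _
  · obtain ⟨_, ⟨a, ha, ha', rfl⟩, β, rfl, hβ, ht, hβ'⟩ := h.weight hM trivial hv h0
    refine Submodule.mem_iSup_of_mem _ (Submodule.mem_iSup_of_mem
      ⟨a - β, fun i hi => ?_, ?_, fun j => ?_, (map_sub _ _ _).symm⟩ hv)
    · rw [Finsupp.sub_apply, ha' i hi, hβ' i hi, sub_zero]
    · rw [map_sub, ha.tot_eq, ht, sub_zero]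
    · rw [map_sub]
      have := ha.hd_nonpos j
      have := hβ j
      omega

end SlData

end SupportedWeights

/-! ### Truncation of `sl_∞`-modules -/

section TruncationInfinite

open scoped ModuleCat

variable {n : ℕ}

lemma catO_of_hwFilt {N : Rep.{u} (slFin n)} (hN : IsWeightModule (cartan n) N)
    {Ξ : Set (Module.Dual ℂ (cartan n))}
    (h : (slFinData n).HwFilt Ξ (⊤ : Submodule (U (slFin n)) N)) : catO n N :=
  ⟨⟨h.fg⟩, hN, fun v => by
    obtain ⟨V, hV, hv, -⟩ := h.exists_nstable v trivial
    exact ⟨V, hV.1, hv, hV.2⟩⟩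

lemma catO₀_of_hwFilt {N : Rep.{u} (slFin n)} (hN : IsWeightModule (cartan n) N)
    (h : (slFinData n).HwFilt (slFinData n).lnk (⊤ : Submodule (U (slFin n)) N)) : catO₀ n N :=
  (catO₀_iff N).mpr ⟨catO_of_hwFilt hN h, h.SW_subset (finLevels n) hN⟩

lemma hwFilt_of_catO₀ {N : Rep.{u} (slFin n)} (h : catO₀ n N) :
    (slFinData n).HwFilt (slFinData n).lnk (⊤ : Submodule (U (slFin n)) N) :=
  ((blockData_catO n).hwFilt ((catO₀_iff N).mp h).1).of_SW ((catO₀_iff N).mp h).2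

lemma partOf_of_catO₀ {N : Rep.{u} (slFin n)} (h : catO₀ n N) :
    (slFinData n).partOf N (slFinData n).negWt = ⊤ :=
  (hwFilt_of_catO₀ h).partOf_negWt ((blockData_catO n).weight ((catO₀_iff N).mp h).1)

lemma hwFilt_of_catOInf₀ {M : Rep.{u} slInf} (h : catOInf₀ M) :
    slInfData.HwFilt slInfData.lnk (⊤ : Submodule (U slInf) M) :=
  (blockData_catOInf.hwFilt ((catOInf₀_iff M).mp h).1).of_SW ((catOInf₀_iff M).mp h).2

lemma partOf_of_catOInf₀ {M : Rep.{u} slInf} (h : catOInf₀ M) :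
    slInfData.partOf M slInfData.negWt = ⊤ :=
  (hwFilt_of_catOInf₀ h).partOf_negWt (blockData_catOInf.weight ((catOInf₀_iff M).mp h).1)

lemma fin_out_iff {a : ℕ →₀ ℤ} : (∀ i ∉ (slFinData n).dom, a i = 0) ↔ ∀ i, n ≤ i → a i = 0 :=
  ⟨fun h i hi => h i (not_lt.mpr hi), fun h i hi => h i (not_lt.mp hi)⟩

lemma inf_wt_inj {a b : ℕ →₀ ℤ} (h : tot a = tot b) (hab : slInfData.wt a = slInfData.wt b) :
    a = b := slInfData.wt_inj (fun _ h => (h trivial).elim) (fun _ h => (h trivial).elim) h hab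

variable {M : Rep.{u} slInf}

/-- Decomposing `y` by weights of `sl_∞` gives components of weights `wt a` for `sl_n`. If `χ` were
none of them, the projection of `y` to its own weight would be zero. -/
lemma obj_weight {y : (infLevel n).obj M} {χ : Module.Dual ℂ (cartan n)}
    (hy : y ∈ weightSpace (cartan n) ((infLevel n).obj M) χ) (h0 : y ≠ 0) :
    ∃ a : ℕ →₀ ℤ, (∀ i, n ≤ i → a i = 0) ∧ tot a = 0 ∧ χ = (slFinData n).wt a := by
  obtain ⟨s, f, hf, hs, hsum⟩ := iSup_weightSpace_exists ((infLevel n).val_mem y)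
  choose a ha hat hχ using hs
  have h1 : y = ∑ χ ∈ s.attach, (infLevel n).elt
      ((infLevel n).weightSpace_le_space ⟨a χ χ.2, ha χ χ.2, hat χ χ.2, hχ χ χ.2⟩ (hf χ)) := by
    apply (infLevel n).val_injective
    rw [map_sum, ← hsum, ← Finset.sum_attach]
    rfl
  by_contra hcon
  obtain ⟨p, hp1, hp2, hp3, -⟩ := (infLevel n).isWeightModule_obj (M := M).exists_proj χ
  refine h0 ?_
  rw [← hp2 y hy, h1, map_sum]
  refine Finset.sum_eq_zero fun ψ _ => hp3 ((slFinData n).wt (a ψ ψ.2)) (fun h => ?_) _ ?_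
  · exact hcon ⟨_, ha ψ ψ.2, hat ψ ψ.2, h.symm⟩
  · rw [← (infLevel n).val_mem_weightSpace (ha ψ ψ.2) (hat ψ ψ.2), Level.val_elt, ← hχ ψ ψ.2]
    exact hf ψ

lemma cut_le {T : Submodule (U slInf) M} {K : Submodule (U (slFin n)) ((infLevel n).obj M)}
    (h : ∀ b : ℕ →₀ ℤ, (∀ i, n ≤ i → b i = 0) → tot b = 0 → ∀ y : (infLevel n).obj M,
      (infLevel n).val M y ∈ T → (infLevel n).val M y ∈ weightSpace slInfData.H M (slInfData.wt b) →
      y ∈ K) : (infLevel n).cut T ≤ K := by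
  intro y hy
  by_contra hyK
  obtain ⟨ψ, z, hz, hzψ, hzK⟩ := (slFinData n).exists_weight_mem ((infLevel n).isWeightModule_obj (M := M)) hy hyK
  obtain ⟨b, hb, ht, rfl⟩ := obj_weight hzψ (fun h0 => hzK (h0 ▸ K.zero_mem))
  exact hzK (h b hb ht z hz (((infLevel n).val_mem_weightSpace hb ht).mpr hzψ))

variable {S : Submodule (U slInf) M} {a : ℕ →₀ ℤ} {v : M}

/-- A word leading from `a` to a weight in the root lattice of `sl_n` has all its letters in `sl_n`
by `Desc.bounded`, so it can be formed inside the truncation starting from `y`. -/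
lemma cut_sup_span (hM : IsWeightModule slInfData.H M) (ha : ∀ i, n ≤ i → a i = 0) (ht : tot a = 0)
    (hs : slInfData.Sing S (slInfData.wt a) v)
    (hv : v ∈ weightSpace slInfData.H M (slInfData.wt a)) {y : (infLevel n).obj M}
    (hy : (infLevel n).val M y = v) : (infLevel n).cut (S ⊔ Submodule.span (U slInf) {v}) =
      (infLevel n).cut S ⊔ Submodule.span (U (slFin n)) {y} := by
  refine le_antisymm (cut_le fun b hb htb z hz hzb => ?_) (sup_le (fun z hz => ?_) ?_)
  · obtain ⟨s, hs, hsb, w, hw, hzw⟩ := hs.mem_of_weight hM hv hz hzb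
    have hw' : w ∈ Submodule.map ((infLevel n).val M)
        ((Submodule.span (U (slFin n)) {y}).restrictScalars ℂ) := by
      refine Submodule.span_le.mpr ?_ hw
      rintro x ⟨β, hβ, hβb⟩
      have hβ0 : a - β = b := inf_wt_inj (by rw [map_sub, ht, hβ.tot_eq, htb, sub_zero])
        (by rw [map_sub, hβb])
      have hd0 (j : ℕ) (hj : n ≤ j) : hd j β = 0 := by
        rw [hd_eq_tot fun i hi => ?_, hβ.tot_eq]
        have := DFunLike.congr_fun hβ0 i
        rw [Finsupp.sub_apply, ha i (hj.trans hi), hb i (hj.trans hi)] at this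
        omega
      have hβ' := hβ.bounded hd0
      clear hβ hβb hd0 hβ0
      induction hβ' with
      | base => exact ⟨y, Submodule.mem_span_singleton_self y, hy⟩
      | @step i j β x _ hji hi _ ih =>
        obtain ⟨x', hx', rfl⟩ := ih
        refine ⟨toU (finE n i j) • x',
          (Submodule.span (U (slFin n)) {y}).smul_mem (toU (finE n i j)) hx', ?_⟩
        rw [Level.val_toU, (infLevel n).ι_E hi (hji.trans hi) hji.ne']
    obtain ⟨w', hw', rfl⟩ := hw'
    have hzw' : z = (z - w') + w' := (sub_add_cancel z w').symm
    rw [hzw']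
    refine Submodule.add_mem_sup ?_ hw'
    rw [Level.mem_cut, map_sub, hzw, add_sub_cancel_right]
    exact hs
  · exact Submodule.mem_sup_left hz
  · rw [Submodule.span_singleton_le_iff_mem, Level.mem_cut, hy]
    exact Submodule.mem_sup_right (Submodule.mem_span_singleton_self v)

/-- Weights below `a` have negative partial sum at `j`, whereas weights in the root lattice of
`sl_n` have partial sum zero there; so the subquotient contributes nothing. -/
lemma cut_sup_span_of_hd (hM : IsWeightModule slInfData.H M) (ht : tot a = 0) {j : ℕ} (hj : n ≤ j)
    (haj : hd j a < 0) (hs : slInfData.Sing S (slInfData.wt a) v) :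
    (infLevel n).cut (S ⊔ Submodule.span (U slInf) {v}) = (infLevel n).cut S := by
  refine le_antisymm (cut_le fun b hb htb z hz hzb => ?_) fun z hz => Submodule.mem_sup_left hz
  by_contra hzS
  obtain ⟨β, hβ, hβ', hβt, -⟩ := hs.weight_eq hM hz hzb hzS
  have hβ0 : b = a - β := inf_wt_inj (by rw [map_sub, ht, hβt, htb, sub_zero])
    (by rw [map_sub, hβ])
  have h1 : hd j b = 0 := by rw [hd_eq_tot fun i hi => hb i (hj.trans hi), htb]
  rw [hβ0, map_sub] at h1
  have := hβ' j
  omega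

lemma exists_hd_neg (hl : Linked a) (ha : ¬ ∀ i, n ≤ i → a i = 0) : ∃ j, n ≤ j ∧ hd j a < 0 := by
  by_contra! hcon
  exact ha (eq_zero_of_hd fun j hj => le_antisymm (hl.hd_nonpos j) (hcon j hj))

/-- A step whose highest weight is supported below `n` survives with the restricted weight. Any
other linked weight has a negative partial sum from `n` on by `exists_hd_neg`, and its step
disappears. -/
lemma HwFilt_cut (hM : IsWeightModule slInfData.H M) (h : slInfData.HwFilt slInfData.lnk S) :
    (slFinData n).HwFilt (slFinData n).lnk ((infLevel n).cut S) := by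
  induction h with
  | bot =>
    rw [Level.cut_bot]
    exact .bot
  | @step S χ v _ hχ hs ih =>
    obtain ⟨a, hl, -, rfl⟩ := hχ
    obtain ⟨w, hw, hvw⟩ := hs.exists_weight slInfData hM
    have hsw := hs.congr slInfData hvw
    rw [SlData.sup_span_congr hvw]
    by_cases ha : ∀ i, n ≤ i → a i = 0
    · rw [cut_sup_span hM ha hl.tot_eq hsw hw
        (y := (infLevel n).elt ((infLevel n).weightSpace_le_space ⟨a, ha, hl.tot_eq, rfl⟩ hw)) rfl]
      refine SlData.HwFilt.step ih (χ := (slFinData n).wt a) ⟨a, hl, fin_out_iff.mpr ha, rfl⟩ ?_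
      have := (infLevel n).sing_cut (y := (infLevel n).elt
        ((infLevel n).weightSpace_le_space ⟨a, ha, hl.tot_eq, rfl⟩ hw)) hsw
      rwa [Level.pull_wt] at this
    · obtain ⟨j, hj, haj⟩ := exists_hd_neg hl ha
      rwa [cut_sup_span_of_hd hM hl.tot_eq hj haj hsw]

/-- Truncations of modules in the principal block are in the principal block. -/
lemma catO₀_obj (h : catOInf₀ M) (n : ℕ) : catO₀ n ((infLevel n).obj M) :=
  catO₀_of_hwFilt (infLevel n).isWeightModule_obj
    (HwFilt_cut (blockData_catOInf.weight ((catOInf₀_iff M).mp h).1) (hwFilt_of_catOInf₀ h))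

/-- The raising operators with `j < n` belong to `sl_n`. For `n ≤ j` the result has partial sum one
at `j`, and `hpos` is the assumption that such vectors lie in `S`. -/
lemma sing_of_sing_cut {b : ℕ →₀ ℤ} (hb : ∀ i, n ≤ i → b i = 0) (htb : tot b = 0)
    {y : (infLevel n).obj M} (hy : y ∈ weightSpace (cartan n) ((infLevel n).obj M) ((slFinData n).wt b))
    {χ : Module.Dual ℂ (cartan n)} (hs : (slFinData n).Sing ((infLevel n).cut S) χ y)
    (hpos : ∀ c : ℕ →₀ ℤ, tot c = 0 → ∀ j, n ≤ j → 0 < hd j c → ∀ x ∈ Submodule.span (U slInf)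
      {(infLevel n).val M y}, x ∈ weightSpace slInfData.H M (slInfData.wt c) → x ∈ S) :
    slInfData.Sing S (slInfData.wt b) ((infLevel n).val M y) := by
  have hw := ((infLevel n).val_mem_weightSpace hb htb).mpr hy
  refine SlData.sing_of_generators hw fun i j _ hij => ?_
  by_cases hj : j < n
  · have := hs.2 _ ((slFinData n).E_mem_N (i := i) hj hij)
    rw [Level.mem_cut, Level.val_toU] at this
    rwa [← (infLevel n).ι_E (hij.trans hj) hj hij.ne]
  · refine hpos (root i j + b) (by rw [map_add, tot_root, htb, add_zero]) j (not_lt.mp hj) ?_ _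
      (Submodule.smul_mem _ _ (Submodule.mem_span_singleton_self _)) ?_
    · rw [map_add, hd_root, if_pos hij, if_neg (lt_irrefl _),
        hd_eq_tot fun i hi => hb i ((not_lt.mp hj).trans hi), htb]
      norm_num
    · rw [map_add]
      exact slInfData.toU_E_mem_weightSpace trivial trivial hij.ne hw

/-- A submodule strictly above the truncation of `S` contains a vector that is singular modulo it
for `sl_n`. It is singular modulo `S` for `sl_∞` too, because no weight of `T` over `S` exceeds `a`.
By simplicity it generates `T` over `S`, and `cut_sup_span` turns this into generation of the
truncation. -/
lemma cut_covBy (hM : IsWeightModule slInfData.H M) (hsv : (slFinData n).SV ((infLevel n).obj M))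
    {T : Submodule (U slInf) M} (hST : S ⋖ T) (ha : ∀ i, n ≤ i → a i = 0) (ht : tot a = 0)
    (hvT : v ∈ T) (hvS : v ∉ S) (hs : slInfData.Sing S (slInfData.wt a) v)
    (hv : v ∈ weightSpace slInfData.H M (slInfData.wt a)) :
    (infLevel n).cut S ⋖ (infLevel n).cut T := by
  have hle : (infLevel n).cut S ≤ (infLevel n).cut T := fun y hy => hST.le hy
  have hv' := (infLevel n).weightSpace_le_space (M := M) ⟨a, ha, ht, rfl⟩ hv
  refine ⟨lt_of_le_of_ne hle fun h => hvS ?_, fun R h1 h2 => ?_⟩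
  · have : (infLevel n).elt hv' ∈ (infLevel n).cut T := hvT
    rw [← h] at this
    exact this
  · have hO := (infLevel n).isWeightModule_obj (M := M)
    obtain ⟨χ, y, hyR, hyS, hsy⟩ := hsv _ _ h1
    obtain ⟨w, hw, hyw⟩ := hsy.exists_weight (slFinData n) hO
    have hwR : w ∈ R := by
      have := R.sub_mem hyR (h1.le hyw)
      rwa [sub_sub_cancel] at this
    have hwS : w ∉ (infLevel n).cut S := fun h => hyS ((Submodule.sub_mem_iff_left _ h).mp hyw)
    obtain ⟨b, hb, htb, rfl⟩ := obj_weight hw (fun h0 => hwS (h0 ▸ Submodule.zero_mem _))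
    have hwT : (infLevel n).val M w ∈ T := h2.le hwR
    have hsw := sing_of_sing_cut hb htb hw (hsy.congr (slFinData n) hyw)
      fun c hc j hj hcj x hx hxc => by
        by_contra hxS
        have hxT : x ∈ S ⊔ Submodule.span (U slInf) {v} := by
          rw [covBy_sup_span hST hvT hvS]
          exact (Submodule.span_singleton_le_iff_mem _ _).mpr hwT hx
        obtain ⟨β, hβ, hβ', hβt, -⟩ := hs.weight_eq hM hxT hxc hxS
        have hβ0 : c = a - β := inf_wt_inj (by rw [map_sub, ht, hβt, hc, sub_zero])
          (by rw [map_sub, hβ])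
        have h3 : hd j a = 0 := by rw [hd_eq_tot fun i hi => ha i (hj.trans hi), ht]
        rw [hβ0, map_sub, h3] at hcj
        have := hβ' j
        omega
    refine h2.not_ge ?_
    rw [← covBy_sup_span hST hwT hwS, cut_sup_span hM hb htb hsw
      (((infLevel n).val_mem_weightSpace hb htb).mpr hw) rfl]
    exact sup_le h1.le ((Submodule.span_singleton_le_iff_mem _ _).mpr hwR)

/-- The length of the truncations is eventually the length of the module. -/
lemma length_obj (h : catOInf₀ M) : ∃ l N : ℕ, ∀ n ≥ N,
    Module.length (U (slFin n)) ((infLevel n).obj M) = l := by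
  have hc := (catOInf_iff.mp ((catOInf₀_iff M).mp h).1)
  obtain ⟨hM, _, _, hsv⟩ := hc
  obtain ⟨s, hs0, hs1⟩ := exists_compositionSeries_of_isNoetherian_isArtinian (U slInf) M
  have key (i : Fin s.length) : ∃ a : ℕ →₀ ℤ, tot a = 0 ∧ ∃ v ∈ s i.succ, v ∉ s i.castSucc ∧
      slInfData.Sing (s i.castSucc) (slInfData.wt a) v ∧
      v ∈ weightSpace slInfData.H M (slInfData.wt a) := by
    obtain ⟨χ, v, hv, hvS, hs⟩ := hsv _ _ (s.step i).lt
    obtain ⟨w, hw, hvw⟩ := hs.exists_weight slInfData hM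
    obtain ⟨a, hl, -, rfl⟩ := ((catOInf₀_iff M).mp h).2 ⟨_, v, bot_le, trivial, hvS, hs⟩
    refine ⟨a, hl.tot_eq, w, ?_, fun h => hvS ((Submodule.sub_mem_iff_left _ h).mp hvw),
      hs.congr slInfData hvw, hw⟩
    have := (s i.succ).sub_mem hv ((s.step i).le hvw)
    rwa [sub_sub_cancel] at this
  choose a ht v hvT hvS hs hv using key
  -- From the maximum of these bounds on, the root lattice of `sl_n` contains the highest weights of
  -- all composition factors, and none is lost.
  choose b hb using fun i => exists_bound (a i)
  refine ⟨s.length, Finset.univ.sup b, fun n hn => ?_⟩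
  have hsv' : (slFinData n).SV ((infLevel n).obj M) :=
    (hwFilt_of_catO₀ (catO₀_obj h n)).sv (infLevel n).isWeightModule_obj
  let t : CompositionSeries (Submodule (U (slFin n)) ((infLevel n).obj M)) :=
    ⟨s.length, fun i => (infLevel n).cut (s i), fun i => cut_covBy hM hsv' (s.step i)
      (fun j hj => hb i j (((Finset.le_sup (Finset.mem_univ i)).trans hn).trans hj)) (ht i) (hvT i)
      (hvS i) (hs i) (hv i)⟩
  have h0 : t.head = ⊥ := by
    change (infLevel n).cut s.head = ⊥
    rw [hs0, Level.cut_bot]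
  have h1 : t.last = ⊤ := by
    change (infLevel n).cut s.last = ⊤
    rw [hs1, Level.cut_top]
  exact (Module.length_compositionSeries t h0 h1).symm

end TruncationInfinite

/-! ### The truncation functors -/

section TruncationFunctors

open scoped ModuleCat

variable {n : ℕ}

/-- `sl_n` in `sl_{n+1}`. -/
def finStep (n : ℕ) : Level (slFinData (n + 1)) n where
  ι := slIncl n
  mem_dom h := h.trans (Nat.lt_succ_self n)
  ι_E hi hj hij := inclInf_injective (n + 1) (by
    rw [inclInf_slIncl, inclInf_finE_eq hi hj hij]
    exact (inclInf_finE_eq (hi.trans (Nat.lt_succ_self n)) (hj.trans (Nat.lt_succ_self n)) hij).symm)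
  ι_H x a b hab := by
    rw [← inclInf_entry, inclInf_slIncl]
    exact inclInf_mem_cartanInf x.2 a b fun h => hab (Fin.ext h)
  ε_ι x i := (finEps_apply (n + 1) i _).trans (by
    rw [finEps_apply]
    exact congrArg (entry i i) (inclInf_slIncl n x))
  lie_ι h := by
    obtain ⟨x, hx⟩ := (infLevel n).lie_ι ⟨inclInf (n + 1) h, inclInf_mem_cartanInf h.2⟩
    refine ⟨x, fun y => inclInf_injective (n + 1) ?_⟩
    rw [LieHom.map_lie, LieHom.map_lie, inclInf_slIncl, inclInf_slIncl]
    exact hx y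

/-- The weights in the root lattice of a level form a group. -/
def SlData.latGroup {L : Type} [LieRing L] [LieAlgebra ℂ L] (D : SlData L) (m : ℕ) :
    AddSubgroup (Module.Dual ℂ D.H) where
  carrier := {χ | D.InLat m χ}
  add_mem' := by
    rintro _ _ ⟨a, ha, hta, rfl⟩ ⟨b, hb, htb, rfl⟩
    exact ⟨a + b, fun i hi => by rw [Finsupp.add_apply, ha i hi, hb i hi, add_zero],
      by rw [map_add, hta, htb, add_zero], (map_add _ _ _).symm⟩
  zero_mem' := ⟨0, fun _ _ => rfl, map_zero _, (map_zero _).symm⟩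
  neg_mem' := by
    rintro _ ⟨a, ha, hta, rfl⟩
    exact ⟨-a, fun i hi => by rw [Finsupp.neg_apply, ha i hi, neg_zero],
      by rw [map_neg, hta, neg_zero], (map_neg _ _).symm⟩

lemma eps_sub_eps (i j : Fin n) : eps i.castSucc - eps j.castSucc =
    (slFinData (n + 1)).wt (root i j) := by
  rw [SlData.wt_root]
  change _ = finEps (n + 1) i - finEps (n + 1) j
  rw [finEps, finEps, dif_pos (i.2.trans (Nat.lt_succ_self n)),
    dif_pos (j.2.trans (Nat.lt_succ_self n))]
  rfl

lemma mem_subRootLattice {χ : Module.Dual ℂ (cartan (n + 1))} :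
    χ ∈ subRootLattice n ↔ (slFinData (n + 1)).InLat n χ := by
  constructor
  · intro h
    have : subRootLattice n ≤ (slFinData (n + 1)).latGroup n := by
      refine (AddSubgroup.closure_le _).mpr ?_
      rintro _ ⟨i, j, -, rfl⟩
      refine ⟨root i j, fun k hk => ?_, tot_root _ _, eps_sub_eps i j⟩
      rw [root, Finsupp.sub_apply, Finsupp.single_eq_of_ne (by omega),
        Finsupp.single_eq_of_ne (by omega), sub_zero]
    exact this h
  · rintro ⟨a, ha, hta, rfl⟩
    -- Since the total is zero, `ε 0` may be subtracted from each `ε i` without changing the weight,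
    -- which exhibits it as a combination of roots.
    have h1 : (slFinData (n + 1)).wt a =
        ∑ i ∈ a.support, a i • (slFinData (n + 1)).wt (root i 0) := by
      rw [SlData.wt_apply, Finsupp.sum, ← sub_eq_zero, ← Finset.sum_sub_distrib]
      rw [tot_apply, Finsupp.sum] at hta
      have h2 (i : ℕ) : a i • (slFinData (n + 1)).ε i - a i • (slFinData (n + 1)).wt (root i 0) =
          a i • (slFinData (n + 1)).ε 0 := by
        rw [SlData.wt_root, smul_sub, sub_sub_cancel]
      rw [Finset.sum_congr rfl fun i _ => h2 i, ← Finset.sum_smul, hta, zero_smul]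
    rw [h1]
    refine AddSubgroup.sum_mem _ fun i hi => AddSubgroup.zsmul_mem _ ?_ _
    have hi' : i < n := by
      by_contra h
      exact Finsupp.mem_support_iff.mp hi (ha i (by omega))
    by_cases h0 : i = 0
    · rw [h0, root, sub_self, map_zero]
      exact AddSubgroup.zero_mem _
    · exact AddSubgroup.subset_closure ⟨⟨i, hi'⟩, ⟨0, by omega⟩, fun h => h0 (congrArg Fin.val h),
        (eps_sub_eps (⟨i, hi'⟩ : Fin n) ⟨0, by omega⟩).symm⟩

lemma truncSpace_eq (N : Rep.{u} (slFin (n + 1))) : truncSpace n N = (finStep n).space N := by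
  have : (subRootLattice n : Set (Module.Dual ℂ (cartan (n + 1)))) =
    {χ | (slFinData (n + 1)).InLat n χ} := Set.ext fun χ => mem_subRootLattice
  change ⨆ χ ∈ (subRootLattice n : Set (Module.Dual ℂ (cartan (n + 1)))), _ = _
  rw [this]
  rfl

/-- The inclusion of the truncation of an `sl_{n+1}`-module. -/
def truncVal (n : ℕ) (N : Rep.{u} (slFin (n + 1))) : (trunc n).obj N →ₗ[ℂ] N where
  toFun y := y.1
  map_add' _ _ := rfl
  map_smul' c y := by
    change ((algebraMap ℂ (U (slFin n)) c • y).1 : res (slIncl n) N) = c • (show N from y.1)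
    rw [← algebraMap_smul (U (slFin (n + 1))) c (show N from y.1), ← (mapU (slIncl n)).commutes c]
    rfl

lemma truncVal_injective (N : Rep.{u} (slFin (n + 1))) : Function.Injective (truncVal n N) :=
  Subtype.val_injective

lemma truncVal_mem {N : Rep.{u} (slFin (n + 1))} (y : (trunc n).obj N) :
    truncVal n N y ∈ (finStep n).space N := (truncSpace_eq N).le y.2

lemma truncVal_toU {N : Rep.{u} (slFin (n + 1))} (x : slFin n) (y : (trunc n).obj N) :
    truncVal n N (toU x • y) = toU (slIncl n x) • truncVal n N y := by
  rw [← mapU_toU]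
  rfl

lemma exists_truncVal {N : Rep.{u} (slFin (n + 1))} {v : N} (hv : v ∈ (finStep n).space N) :
    ∃ y, truncVal n N y = v := ⟨⟨v, (truncSpace_eq N).ge hv⟩, rfl⟩

lemma truncVal_map {N N' : Rep.{u} (slFin (n + 1))} (f : N ⟶ N') (y : (trunc n).obj N) :
    truncVal n N' (((trunc n).map f).hom y) = f.hom (truncVal n N y) := rfl

variable (M : Rep.{u} slInf)

lemma space_mono {m n : ℕ} (h : m ≤ n) : (infLevel m).space M ≤ (infLevel n).space M := fun _ hv =>
  (infLevel m).space_induction (V := (infLevel n).space M) (fun a ha ht _ hv =>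
    (infLevel n).weightSpace_le_space ⟨a, fun i hi => ha i (h.trans hi), ht, rfl⟩ hv) hv

variable {M} in
lemma val_mem_space {y : (infLevel (n + 1)).obj M} : (infLevel (n + 1)).val M y ∈ (infLevel n).space M ↔
    y ∈ (finStep n).space ((infLevel (n + 1)).obj M) := by
  constructor
  · intro hy
    have : (infLevel (n + 1)).val M y ∈ ((finStep n).space ((infLevel (n + 1)).obj M)).map
        ((infLevel (n + 1)).val M) :=
      (infLevel n).space_induction (V := ((finStep n).space ((infLevel (n + 1)).obj M)).map
        ((infLevel (n + 1)).val M)) (fun a ha ht v hv =>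
        ⟨(infLevel (n + 1)).elt (space_mono M (Nat.le_succ n)
          ((infLevel n).weightSpace_le_space ⟨a, ha, ht, rfl⟩ hv)),
          (finStep n).weightSpace_le_space ⟨a, ha, ht, rfl⟩
            (((infLevel (n + 1)).val_mem_weightSpace (fun i hi => ha i (by omega)) ht).mp hv), rfl⟩) hy
    obtain ⟨z, hz, hzy⟩ := this
    rwa [← (infLevel (n + 1)).val_injective hzy]
  · exact fun hy => (finStep n).space_induction
      (V := ((infLevel n).space M).comap ((infLevel (n + 1)).val M)) (fun a ha ht v hv =>
        (infLevel n).weightSpace_le_space ⟨a, ha, ht, rfl⟩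
          (((infLevel (n + 1)).val_mem_weightSpace (fun i hi => ha i (by omega)) ht).mpr hv)) hy

/-- The truncations of an `sl_∞`-module are compatible. -/
def truncHom (n : ℕ) : (trunc n).obj ((infLevel (n + 1)).obj M) ⟶ (infLevel n).obj M :=
  (infLevel n).lift ((infLevel (n + 1)).val M ∘ₗ truncVal n _)
    (fun y => val_mem_space.mpr (truncVal_mem y)) fun x y => by
      rw [LinearMap.comp_apply, LinearMap.comp_apply, truncVal_toU, Level.val_toU]
      exact congrArg (fun z => toU z • _) (inclInf_slIncl n x)

lemma val_truncHom (n : ℕ) (y : (trunc n).obj ((infLevel (n + 1)).obj M)) :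
    (infLevel n).val M ((truncHom M n).hom y) = (infLevel (n + 1)).val M (truncVal n _ y) := by
  rw [truncHom, Level.val_lift, LinearMap.comp_apply]

lemma truncHom_injective (n : ℕ) : Function.Injective (truncHom M n).hom := by
  intro y z h
  have := congrArg ((infLevel n).val M) h
  rw [val_truncHom, val_truncHom] at this
  exact truncVal_injective _ ((infLevel (n + 1)).val_injective this)

lemma exists_step {n : ℕ} {v : M} (hv : v ∈ (infLevel n).space M) :
    ∃ y : (trunc n).obj ((infLevel (n + 1)).obj M), (infLevel (n + 1)).val M (truncVal n _ y) = v := by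
  have h1 : v ∈ (infLevel (n + 1)).space M := space_mono M (Nat.le_succ n) hv
  have h2 : (infLevel (n + 1)).val M ((infLevel (n + 1)).elt h1) ∈ (infLevel n).space M := hv
  obtain ⟨z, hz⟩ := exists_truncVal (val_mem_space.mp h2)
  exact ⟨z, by rw [hz, Level.val_elt]⟩

lemma truncHom_surjective (n : ℕ) : Function.Surjective (truncHom M n).hom := by
  intro y
  obtain ⟨z, hz⟩ := exists_step M ((infLevel n).val_mem y)
  refine ⟨z, (infLevel n).val_injective ?_⟩
  rw [val_truncHom, hz]

lemma truncHom_bijective (n : ℕ) : Function.Bijective (truncHom M n).hom :=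
  ⟨truncHom_injective M n, truncHom_surjective M n⟩

end TruncationFunctors

/-! ### The functor to the inverse limit -/

section TruncationsFunctor

open scoped ModuleCat

variable (M : Rep.{u} slInf)

/-- The compatibility isomorphisms of the truncations of a module. -/
def truncIso (n : ℕ) : (trunc n).obj ((infLevel (n + 1)).obj M) ≅ (infLevel n).obj M :=
  isoOfBijective (truncHom M n) (truncHom_bijective M n)

lemma truncIso_hom (n : ℕ) : (truncIso M n).hom = truncHom M n := isoOfBijective_hom _ _

/-- The truncations of an `sl_∞`-module form an object of the inverse limit. -/
def truncations : LimRep.{u} := InverseLimit.mk (fun k => (infLevel (k + 2)).obj M)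
  (fun k => truncIso M (k + 2))

variable {M} in
lemma catCRes_truncations (h : catOInf₀ M) : catCRes (truncations M) := by
  refine ⟨fun k => catO₀_obj h (k + 2), ?_⟩
  obtain ⟨l, N, hl⟩ := length_obj h
  exact ⟨l, N, fun k hk => hl (k + 2) (by omega)⟩

variable {M} {M' : Rep.{u} slInf}

lemma truncHom_naturality (n : ℕ) (f : M ⟶ M') :
    (trunc n).map ((infLevel (n + 1)).map f) ≫ truncHom M' n = truncHom M n ≫ (infLevel n).map f := by
  apply ModuleCat.hom_ext
  ext y
  apply (infLevel n).val_injective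
  rw [ModuleCat.comp_apply, ModuleCat.comp_apply, val_truncHom, truncVal_map, Level.val_map,
    Level.val_map, val_truncHom]

/-- The truncations of a morphism. -/
def truncationsMap (f : M ⟶ M') : truncations M ⟶ truncations M' :=
  InverseLimit.Hom.mk (fun k => (infLevel (k + 2)).map f) fun k => by
    change _ ≫ (truncIso M' (k + 2)).hom = (truncIso M (k + 2)).hom ≫ _
    rw [truncIso_hom, truncIso_hom]
    exact truncHom_naturality (k + 2) f

lemma truncationsMap_injective (hM : ∀ v : M, ∃ n, v ∈ (infLevel n).space M) {f f' : M ⟶ M'}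
    (h : truncationsMap f = truncationsMap f') : f = f' := by
  apply ModuleCat.hom_ext
  ext v
  obtain ⟨n, hn⟩ := hM v
  have hv := space_mono M (Nat.le_add_right n 2) hn
  have h1 : (infLevel (n + 2)).map f = (infLevel (n + 2)).map f' :=
    congrFun (congrArg InverseLimit.Hom.app h) n
  have h2 := congrArg (fun p => (infLevel (n + 2)).val M' (p.hom ((infLevel (n + 2)).elt hv))) h1
  simp only [Level.val_map, Level.val_elt] at h2
  exact h2

/-- The components of a morphism between families of truncations. -/
def appHom (g : truncations M ⟶ truncations M') (k : ℕ) :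
    (infLevel (k + 2)).obj M ⟶ (infLevel (k + 2)).obj M' := InverseLimit.Hom.app g k

lemma appHom_comm (g : truncations M ⟶ truncations M') (k : ℕ) :
    (trunc (k + 2)).map (appHom g (k + 1)) ≫ truncHom M' (k + 2) =
      truncHom M (k + 2) ≫ appHom g k := by
  have := InverseLimit.Hom.comm g k
  change _ ≫ (truncIso M' (k + 2)).hom = (truncIso M (k + 2)).hom ≫ _ at this
  rw [truncIso_hom, truncIso_hom] at this
  exact this

/-- Compatibility of a family of morphisms, read inside the ambient `sl_∞`-modules: consecutive
components agree on a vector of the smaller truncation. -/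
lemma val_appHom_succ (g : truncations M ⟶ truncations M') {k : ℕ}
    {y : (infLevel (k + 2)).obj M} {z : (infLevel (k + 3)).obj M}
    (h : (infLevel (k + 2)).val M y = (infLevel (k + 3)).val M z) :
    (infLevel (k + 2)).val M' ((appHom g k).hom y) =
      (infLevel (k + 3)).val M' ((appHom g (k + 1)).hom z) := by
  obtain ⟨x, hx⟩ := exists_step M ((infLevel (k + 2)).val_mem y)
  have hz : truncVal (k + 2) _ x = z := (infLevel (k + 3)).val_injective (hx.trans h)
  have hy : (truncHom M (k + 2)).hom x = y := (infLevel (k + 2)).val_injective (by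
    rw [val_truncHom]
    exact hx)
  have h1 := congrArg (fun p => (infLevel (k + 2)).val M' (p.hom x)) (appHom_comm g k)
  simp only [ModuleCat.comp_apply] at h1
  rw [val_truncHom, truncVal_map, hz, hy] at h1
  exact h1.symm

lemma val_appHom_le (g : truncations M ⟶ truncations M') {k l : ℕ} (hkl : k ≤ l)
    {y : (infLevel (k + 2)).obj M} {z : (infLevel (l + 2)).obj M}
    (h : (infLevel (k + 2)).val M y = (infLevel (l + 2)).val M z) :
    (infLevel (k + 2)).val M' ((appHom g k).hom y) =
      (infLevel (l + 2)).val M' ((appHom g l).hom z) := by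
  induction l, hkl using Nat.le_induction with
  | base => rw [(infLevel (k + 2)).val_injective h]
  | succ l hkl ih =>
    have hy : (infLevel (k + 2)).val M y ∈ (infLevel (l + 2)).space M :=
      space_mono M (by omega) ((infLevel (k + 2)).val_mem y)
    have h1 := (infLevel (l + 2)).val_elt hy
    exact (ih h1.symm).trans (val_appHom_succ g (h1.trans h))

/-- Each vector is lifted to some truncation and mapped there; by `val_appHom_le` the value does not
depend on the truncation. -/
lemma exists_glue (hM : ∀ v : M, ∃ n, v ∈ (infLevel n).space M)
    (g : truncations M ⟶ truncations M') : ∃ F : M → M', ∀ (k : ℕ) (y : (infLevel (k + 2)).obj M),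
      F ((infLevel (k + 2)).val M y) = (infLevel (k + 2)).val M' ((appHom g k).hom y) := by
  have hex (v : M) : ∃ (k : ℕ) (y : (infLevel (k + 2)).obj M), (infLevel (k + 2)).val M y = v := by
    obtain ⟨n, hn⟩ := hM v
    exact ⟨n, (infLevel (n + 2)).elt (space_mono M (Nat.le_add_right n 2) hn), Level.val_elt _ _⟩
  choose κ η hη using hex
  refine ⟨fun v => (infLevel (κ v + 2)).val M' ((appHom g (κ v)).hom (η v)), fun k y => ?_⟩
  rcases le_total (κ ((infLevel (k + 2)).val M y)) k with h | h
  · exact val_appHom_le g h (hη _)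
  · exact (val_appHom_le g h (hη _).symm).symm

lemma exists_lift (hM : ∀ v : M, ∃ n, v ∈ (infLevel n).space M) (v : M) :
    ∃ N : ℕ, ∀ k ≥ N, ∃ y, (infLevel (k + 2)).val M y = v := by
  obtain ⟨n, hn⟩ := hM v
  exact ⟨n, fun k hk => ⟨(infLevel (k + 2)).elt (space_mono M (by omega) hn), Level.val_elt _ _⟩⟩

lemma exists_inclInf_eq (x : slInf) : ∃ n, ∀ k ≥ n, ∃ y : slFin k, inclInf k y = x := by
  obtain ⟨n, x, rfl⟩ := slInf_eq_inclInf x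
  refine ⟨n, fun k hk => ?_⟩
  obtain ⟨y, hy⟩ := exists_extend_of_le hk x
  exact ⟨y, Subtype.ext hy⟩

/-- Additivity and equivariance of the glued map may be tested in a single truncation that contains
the vectors and the element of `sl_∞` involved. -/
lemma truncationsMap_surjective (hM : ∀ v : M, ∃ n, v ∈ (infLevel n).space M)
    (g : truncations M ⟶ truncations M') : ∃ f : M ⟶ M', truncationsMap f = g := by
  obtain ⟨F, hF⟩ := exists_glue hM g
  have hadd (v w : M) : F (v + w) = F v + F w := by
    obtain ⟨K, hK⟩ := exists_lift hM v
    obtain ⟨K', hK'⟩ := exists_lift hM w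
    obtain ⟨y, rfl⟩ := hK (max K K') (le_max_left _ _)
    obtain ⟨z, rfl⟩ := hK' (max K K') (le_max_right _ _)
    rw [← map_add, hF, hF, hF, map_add, map_add]
  have hsmul (c : ℂ) (v : M) : F (c • v) = c • F v := by
    obtain ⟨K, hK⟩ := exists_lift hM v
    obtain ⟨y, rfl⟩ := hK K le_rfl
    rw [← map_smul, hF, hF, hom_csmul, map_smul]
  have hU (x : slInf) (v : M) : F (toU x • v) = toU x • F v := by
    obtain ⟨n, hn⟩ := exists_inclInf_eq x
    obtain ⟨K, hK⟩ := exists_lift hM v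
    obtain ⟨y, rfl⟩ := hK (max n K) (le_max_right _ _)
    obtain ⟨x', hx⟩ := hn (max n K + 2) (by omega)
    have hx' : (infLevel (max n K + 2)).ι x' = x := hx
    rw [← hx', ← Level.val_toU, hF, hF, map_smul, Level.val_toU]
  let f : M →ₗ[ℂ] M' := { toFun := F, map_add' := hadd, map_smul' := hsmul }
  refine ⟨mkHom f hU, InverseLimit.Hom.ext (funext fun k => ModuleCat.hom_ext
    (LinearMap.ext fun y => (infLevel (k + 2)).val_injective ?_))⟩
  exact (Level.val_map (infLevel (k + 2)) (mkHom f hU) y).trans (hF k y)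

lemma exists_mem_space {Ξ : Set (Module.Dual ℂ cartanInf)}
    (hΞ : ∀ χ ∈ Ξ, ∃ a : ℕ →₀ ℤ, tot a = 0 ∧ χ = slInfData.wt a)
    (h : slInfData.partOf M Ξ = ⊤) (v : M) : ∃ n, v ∈ (infLevel n).space M := by
  rw [← Submodule.mem_iSup_of_directed _ (Monotone.directed_le fun _ _ h => space_mono M h)]
  have : slInfData.partOf M Ξ ≤ ⨆ n, (infLevel n).space M := iSup₂_le fun χ hχ => by
    obtain ⟨a, ha, rfl⟩ := hΞ χ hχ
    obtain ⟨n, hn⟩ := exists_bound a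
    exact ((infLevel n).weightSpace_le_space ⟨a, hn, ha, rfl⟩).trans
      (le_iSup (fun n => (infLevel n).space M) n)
  exact this (h ▸ trivial)

lemma exists_mem_space_of_catOInf₀ (h : catOInf₀ M) (v : M) : ∃ n, v ∈ (infLevel n).space M :=
  exists_mem_space (fun _ hχ => by
    obtain ⟨a, -, ha, -, rfl⟩ := hχ
    exact ⟨a, ha, rfl⟩) (partOf_of_catOInf₀ h) v

/-- The truncation functor from the category for `sl_∞` to the inverse limit. -/
def truncationFunctor : catOInf₀.{u}.FullSubcategory ⥤ catCRes.{u}.FullSubcategory where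
  obj M := ⟨truncations M.obj, catCRes_truncations M.property⟩
  map f := ObjectProperty.homMk (truncationsMap f.hom)
  map_id _ := ObjectProperty.hom_ext _ (InverseLimit.Hom.ext (funext fun k => ModuleCat.hom_ext
    (LinearMap.ext fun _ => (infLevel (k + 2)).val_injective (Level.val_map _ _ _))))
  map_comp _ _ := ObjectProperty.hom_ext _ (InverseLimit.Hom.ext (funext fun k => ModuleCat.hom_ext
    (LinearMap.ext fun _ => (infLevel (k + 2)).val_injective (Level.val_map _ _ _))))

instance : truncationFunctor.{u}.Faithful where
  map_injective {M _} f f' h := by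
    have h1 : truncationsMap f.hom = truncationsMap f'.hom := congrArg (fun p => p.hom) h
    exact ObjectProperty.hom_ext _
      (truncationsMap_injective (exists_mem_space_of_catOInf₀ M.property) h1)

instance : truncationFunctor.{u}.Full where
  map_surjective {M _} g := by
    obtain ⟨f, hf⟩ := truncationsMap_surjective (exists_mem_space_of_catOInf₀ M.property) g.hom
    exact ⟨ObjectProperty.homMk f, ObjectProperty.hom_ext _ hf⟩

end TruncationsFunctor

/-! ### Recognizing the principal block by truncations -/

section Recognition

open scoped ModuleCat

lemma SlData.SV.exists_weight {L : Type} [LieRing L] [LieAlgebra ℂ L] {D : SlData L} {M : Rep.{u} L}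
    (h : D.SV M) (hM : IsWeightModule D.H M) {S T : Submodule (U L) M} (hST : S < T) :
    ∃ χ, ∃ w ∈ T, w ∉ S ∧ w ∈ weightSpace D.H M χ ∧ D.Sing S χ w := by
  obtain ⟨χ, z, hzT, hzS, hs⟩ := h _ _ hST
  obtain ⟨w, hw, hzw⟩ := hs.exists_weight D hM
  refine ⟨χ, w, ?_, fun h => hzS ((Submodule.sub_mem_iff_left _ h).mp hzw), hw, hs.congr D hzw⟩
  have := Submodule.sub_mem _ hzT (hST.le hzw)
  rwa [sub_sub_cancel] at this

lemma Level.cut_lt {L : Type} [LieRing L] [LieAlgebra ℂ L] {D : SlData L} {M : Rep.{u} L} {m : ℕ}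
    (l : Level D m) {S T : Submodule (U L) M} (hST : S < T) {y : l.obj M} (hT : l.val M y ∈ T)
    (hS : l.val M y ∉ S) : l.cut S < l.cut T :=
  SetLike.lt_iff_le_and_exists.mpr ⟨fun _ hz => hST.le hz, y, hT, hS⟩

variable {M : Rep.{u} slInf}

lemma exists_lift_le (hM : ∀ v : M, ∃ n, v ∈ (infLevel n).space M) (v : M) :
    ∃ N : ℕ, ∀ n ≥ N, ∃ y, (infLevel n).val M y = v := by
  obtain ⟨n, hn⟩ := hM v
  exact ⟨n, fun k hk => ⟨(infLevel k).elt (space_mono M hk hn), Level.val_elt _ _⟩⟩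

lemma exists_lift_two_le (hM : ∀ v : M, ∃ n, v ∈ (infLevel n).space M) (v : M) :
    ∃ n, 2 ≤ n ∧ ∃ y, (infLevel n).val M y = v := by
  obtain ⟨N, hN⟩ := exists_lift_le hM v
  exact ⟨max N 2, le_max_right _ _, hN _ (le_max_left _ _)⟩

lemma partOf_negWt_of_obj (hM : ∀ v : M, ∃ n, v ∈ (infLevel n).space M)
    (h : ∀ n ≥ 2, catO₀ n ((infLevel n).obj M)) : slInfData.partOf M slInfData.negWt = ⊤ := by
  rw [eq_top_iff]
  rintro v -
  obtain ⟨N, h2, y, rfl⟩ := exists_lift_two_le hM v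
  have hle : (slFinData N).partOf ((infLevel N).obj M) (slFinData N).negWt ≤
      (slInfData.partOf M slInfData.negWt).comap ((infLevel N).val M) := by
    refine iSup₂_le fun χ hχ z hz => ?_
    obtain ⟨a, ha, ht, hneg, rfl⟩ := hχ
    exact Submodule.mem_iSup_of_mem _ (Submodule.mem_iSup_of_mem
      ⟨a, fun _ hi => (hi trivial).elim, ht, hneg, rfl⟩
      (((infLevel N).val_mem_weightSpace (fin_out_iff.mp ha) ht).mpr hz))
  have hy : y ∈ (slFinData N).partOf ((infLevel N).obj M) (slFinData N).negWt := by
    rw [partOf_of_catO₀ (h N h2)]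
    trivial
  exact hle hy

/-- Some truncation distinguishes `S` from `T` and provides a vector singular for `sl_N`. It is
singular for `sl_∞` as well: no weight of `M` has a positive partial sum, so raising operators
outside of `sl_N` kill it. -/
lemma sv_of_obj (hM : ∀ v : M, ∃ n, v ∈ (infLevel n).space M)
    (h : ∀ n ≥ 2, catO₀ n ((infLevel n).obj M)) : slInfData.SV M := by
  intro S T hST
  have hneg := partOf_negWt_of_obj hM h
  obtain ⟨v, hvT, hvS⟩ := SetLike.exists_of_lt hST
  obtain ⟨N, h2, y, rfl⟩ := exists_lift_two_le hM v
  have hO := (infLevel N).isWeightModule_obj (M := M)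
  have hsv : (slFinData N).SV ((infLevel N).obj M) := (hwFilt_of_catO₀ (h N h2)).sv hO
  have hlt := (infLevel N).cut_lt hST hvT hvS
  obtain ⟨χ, w, hwT, hwS, hw, hs⟩ := hsv.exists_weight (D := slFinData N) hO hlt
  obtain ⟨b, hb, htb, rfl⟩ := obj_weight hw (fun h0 => hwS (h0 ▸ Submodule.zero_mem _))
  refine ⟨slInfData.wt b, (infLevel N).val M w, hwT, hwS, sing_of_sing_cut hb htb hw hs ?_⟩
  intro c hc j _ hcj x _ hx
  by_cases h0 : x = 0
  · rw [h0]
    exact S.zero_mem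
  · obtain ⟨c', -, htc, hneg', hcc⟩ := SlData.mem_of_partOf hneg hx h0
    rw [inf_wt_inj (hc.trans htc.symm) hcc] at hcj
    exact absurd (hneg' j) (not_le.mpr hcj)

/-- The weight is seen at a level bounding its support, where the singular vector survives
truncation and the principal block of `sl_N` forces linkage. -/
lemma SW_subset_lnk_of_obj (hM : ∀ v : M, ∃ n, v ∈ (infLevel n).space M)
    (h : ∀ n ≥ 2, catO₀ n ((infLevel n).obj M)) :
    slInfData.SW (⊥ : Submodule (U slInf) M) ⊤ ⊆ slInfData.lnk := by
  rintro χ ⟨R, v, -, -, hvR, hs⟩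
  have hneg := partOf_negWt_of_obj hM h
  obtain ⟨w, hw, hvw⟩ := hs.exists_weight slInfData (SlData.isWeightModule_of_partOf hneg)
  have hwR : w ∉ R := fun h => hvR ((Submodule.sub_mem_iff_left _ h).mp hvw)
  obtain ⟨a, ha, ht, -, rfl⟩ := SlData.mem_of_partOf hneg hw (fun h0 => hwR (h0 ▸ R.zero_mem))
  obtain ⟨N, h2, ha'⟩ : ∃ N, 2 ≤ N ∧ ∀ i, N ≤ i → a i = 0 := by
    obtain ⟨n, hn⟩ := exists_bound a
    exact ⟨max n 2, le_max_right _ _, fun i hi => hn i ((le_max_left _ _).trans hi)⟩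
  have hwN := (infLevel N).weightSpace_le_space ⟨a, ha', ht, rfl⟩ hw
  have hs' := (infLevel N).sing_cut (y := (infLevel N).elt hwN) (hs.congr slInfData hvw)
  rw [Level.pull_wt] at hs'
  have := ((catO₀_iff _).mp (h N h2)).2 ⟨_, _, bot_le, trivial, hwR, hs'⟩
  exact ⟨a, (SlData.wt_mem_lnk (fin_out_iff.mpr ha') ht).mp this, ha, rfl⟩

/-- Finitely many vectors witness the strictness of a chain of submodules, and they all lie in a
sufficiently large truncation, where the chain remains strict. -/
lemma length_le_of_obj (hM : ∀ v : M, ∃ n, v ∈ (infLevel n).space M) {l N : ℕ}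
    (hl : ∀ n ≥ N, Module.length (U (slFin n)) ((infLevel n).obj M) = l) :
    Module.length (U slInf) M ≤ l := by
  rw [← WithBot.coe_le_coe, Module.coe_length]
  refine iSup_le fun s => ?_
  have key (i : Fin s.length) : ∃ v ∈ s i.succ, v ∉ s i.castSucc := SetLike.exists_of_lt (s.step i)
  choose v hv hvS using key
  choose K hK using fun i => exists_lift_le hM (v i)
  let k := max N (Finset.univ.sup K)
  let t : LTSeries (Submodule (U (slFin k)) ((infLevel k).obj M)) :=
    ⟨s.length, fun i => (infLevel k).cut (s i), fun i => by
      obtain ⟨y, hy⟩ := hK i k ((Finset.le_sup (Finset.mem_univ i)).trans (le_max_right _ _))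
      exact (infLevel k).cut_lt (s.step i) (hy.symm ▸ hv i) (hy.symm ▸ hvS i)⟩
  have h1 := Order.LTSeries.length_le_krullDim t
  rw [← Module.coe_length, hl k (le_max_left _ _)] at h1
  exact h1

/-- An `sl_∞`-module which is the union of its truncations lies in the principal block as soon as
the truncations do and have bounded length. -/
lemma catOInf₀_of_obj (hM : ∀ v : M, ∃ n, v ∈ (infLevel n).space M)
    (h : ∀ n ≥ 2, catO₀ n ((infLevel n).obj M)) {l N : ℕ}
    (hl : ∀ n ≥ N, Module.length (U (slFin n)) ((infLevel n).obj M) = l) :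
    catOInf₀ M := by
  have hlen : Module.length (U slInf) M ≠ ⊤ :=
    ((length_le_of_obj hM hl).trans_lt (ENat.natCast_lt_top l)).ne
  have hfl := isFiniteLength_iff_isNoetherian_isArtinian.mp (Module.length_ne_top_iff.mp hlen)
  have hW : IsWeightModule slInfData.H M := SlData.isWeightModule_of_partOf (partOf_negWt_of_obj hM h)
  exact (catOInf₀_iff M).mpr ⟨catOInf_iff.mpr
    ⟨hW, hfl.1, hfl.2, sv_of_obj hM h⟩,
    SW_subset_lnk_of_obj hM h⟩

end Recognition

/-! ### Direct limits of modules over the `sl_n` -/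

section DirectLimits

open scoped ModuleCat

section OfAction

variable {L : Type} [LieRing L] [LieAlgebra ℂ L] {V : Type u} [AddCommGroup V] [Module ℂ V]

/-- The module given by an action of a Lie algebra. -/
def repOf (ρ : L →ₗ⁅ℂ⁆ Module.End ℂ V) : Rep.{u} L :=
  (ModuleCat.restrictScalars (UniversalEnvelopingAlgebra.lift ℂ ρ).toRingHom).obj
    (ModuleCat.of (Module.End ℂ V) V)

/-- The identification of the space of an action with the module. -/
def toRepOf (ρ : L →ₗ⁅ℂ⁆ Module.End ℂ V) : V →ₗ[ℂ] repOf ρ where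
  toFun v := v
  map_add' _ _ := rfl
  map_smul' c v := by
    change (c • v : V) = UniversalEnvelopingAlgebra.lift ℂ ρ (algebraMap ℂ (U L) c) v
    rw [AlgHom.commutes]
    rfl

lemma toU_toRepOf (ρ : L →ₗ⁅ℂ⁆ Module.End ℂ V) (x : L) (v : V) :
    toU x • toRepOf ρ v = toRepOf ρ (ρ x v) := by
  change UniversalEnvelopingAlgebra.lift ℂ ρ (toU x) v = _
  rw [UniversalEnvelopingAlgebra.lift_ι_apply]
  rfl

lemma toRepOf_bijective (ρ : L →ₗ⁅ℂ⁆ Module.End ℂ V) : Function.Bijective (toRepOf ρ) :=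
  Function.bijective_id

end OfAction

/-- A sequence of modules over the `sl_n` with compatible maps. -/
structure Tower where
  obj : ∀ k, Rep.{u} (slFin (k + 2))
  map : ∀ k, obj k →ₗ[ℂ] obj (k + 1)
  map_toU : ∀ k (x : slFin (k + 2)) (v : obj k),
    map k (toU x • v) = toU (slIncl (k + 2) x) • map k v

namespace Tower

variable (T : Tower.{u})

/-- The composite transition maps. -/
def trans {i l : ℕ} (h : i ≤ l) : T.obj i →ₗ[ℂ] T.obj l :=
  Nat.leRec (motive := fun l _ => T.obj i →ₗ[ℂ] T.obj l) LinearMap.id (fun k _ g => T.map k ∘ₗ g) h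

lemma trans_self (i : ℕ) (v : T.obj i) : T.trans le_rfl v = v := by
  rw [trans, Nat.leRec_self]
  rfl

lemma trans_succ {i l : ℕ} (h : i ≤ l) (v : T.obj i) :
    T.trans (h.trans (Nat.le_succ l)) v = T.map l (T.trans h v) := by
  rw [trans, Nat.leRec_succ _ _ h]
  rfl

lemma trans_trans {i l m : ℕ} (h : i ≤ l) (h' : l ≤ m) (v : T.obj i) :
    T.trans h' (T.trans h v) = T.trans (h.trans h') v := by
  induction m, h' using Nat.le_induction with
  | base => rw [trans_self]
  | succ m h' ih => rw [T.trans_succ h', T.trans_succ (h.trans h'), ih]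

lemma trans_toU {i l : ℕ} (h : i ≤ l) {x : slFin (i + 2)} {y : slFin (l + 2)}
    (hxy : inclInf (i + 2) x = inclInf (l + 2) y) (v : T.obj i) :
    T.trans h (toU x • v) = toU y • T.trans h v := by
  induction l, h using Nat.le_induction with
  | base =>
    rw [trans_self, trans_self, inclInf_injective _ hxy]
  | succ l h ih =>
    obtain ⟨z, hz⟩ := exists_extend_of_le (show i + 2 ≤ l + 2 by omega) x
    have hz' : inclInf (i + 2) x = inclInf (l + 2) z := Subtype.ext hz.symm
    have hy : slIncl (l + 2) z = y := inclInf_injective (l + 3)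
      ((inclInf_slIncl (l + 2) z).trans (hz'.symm.trans hxy))
    rw [T.trans_succ h, T.trans_succ h, ih hz', map_toU, hy]

instance : DirectedSystem (fun k => T.obj k) fun _ _ h => T.trans h where
  map_self := T.trans_self
  map_map _ _ _ h h' v := T.trans_trans h h' v

/-- The direct limit as a vector space. -/
abbrev Lim : Type u := Module.DirectLimit (fun k => T.obj k) fun _ _ h => T.trans h

/-- The maps to the direct limit. -/
abbrev toLim (k : ℕ) : T.obj k →ₗ[ℂ] T.Lim :=
  Module.DirectLimit.of ℂ ℕ (fun k => T.obj k) (fun _ _ h => T.trans h) k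

lemma toLim_trans {i l : ℕ} (h : i ≤ l) (v : T.obj i) : T.toLim l (T.trans h v) = T.toLim i v :=
  Module.DirectLimit.of_f

lemma exists_toLim (v : T.Lim) : ∃ N, ∀ k ≥ N, ∃ w, T.toLim k w = v := by
  obtain ⟨i, w, rfl⟩ := Module.DirectLimit.exists_of v
  exact ⟨i, fun k hk => ⟨T.trans hk w, T.toLim_trans hk w⟩⟩

lemma toLim_toU_congr {k l : ℕ} (h : k ≤ l) {x : slFin (k + 2)} {y : slFin (l + 2)}
    (hxy : inclInf (k + 2) x = inclInf (l + 2) y) {v : T.obj k} {w : T.obj l} (hw : T.trans h v = w) :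
    T.toLim k (toU x • v) = T.toLim l (toU y • w) := by
  rw [← T.toLim_trans h, T.trans_toU h hxy, hw]

lemma exists_level (x : slInf) (i : ℕ) :
    ∃ (k : ℕ) (_ : i ≤ k) (y : slFin (k + 2)), inclInf (k + 2) y = x := by
  obtain ⟨n, hn⟩ := exists_inclInf_eq x
  exact ⟨max i n, le_max_left _ _, hn _ (by omega)⟩

/-- An element of `sl_∞` acts on a member of the tower only after moving to a level where it is
defined; equivariance of the transition maps makes the result independent of that level. -/
lemma exists_preAct (x : slInf) (i : ℕ) : ∃ g : T.obj i →ₗ[ℂ] T.Lim, ∀ (k : ℕ) (h : i ≤ k)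
    (y : slFin (k + 2)), inclInf (k + 2) y = x → ∀ v, g v = T.toLim k (toU y • T.trans h v) := by
  obtain ⟨l, hl, z, hz⟩ := exists_level x i
  refine ⟨T.toLim l ∘ₗ Algebra.lsmul ℂ ℂ (T.obj l) (toU z) ∘ₗ T.trans hl, fun k hk y hy v => ?_⟩
  change T.toLim l (toU z • T.trans hl v) = _
  rcases le_total l k with h | h
  · exact T.toLim_toU_congr h (hz.trans hy.symm) (T.trans_trans _ _ _)
  · exact (T.toLim_toU_congr h (hy.trans hz.symm) (T.trans_trans _ _ _)).symm

/-- The action of an element of `sl_∞` on a member of the tower. -/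
def preAct (x : slInf) (i : ℕ) : T.obj i →ₗ[ℂ] T.Lim := (T.exists_preAct x i).choose

lemma preAct_eq {x : slInf} {i k : ℕ} (h : i ≤ k) {y : slFin (k + 2)} (hy : inclInf (k + 2) y = x)
    (v : T.obj i) : T.preAct x i v = T.toLim k (toU y • T.trans h v) :=
  (T.exists_preAct x i).choose_spec k h y hy v

/-- The action of an element of `sl_∞` on the direct limit. -/
def act (x : slInf) : T.Lim →ₗ[ℂ] T.Lim :=
  Module.DirectLimit.lift ℂ ℕ _ _ (T.preAct x) fun i l h v => by
    obtain ⟨k, hk, y, hy⟩ := exists_level x l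
    rw [T.preAct_eq hk hy, T.preAct_eq (h.trans hk) hy, T.trans_trans]

lemma act_toLim {x : slInf} {k : ℕ} {y : slFin (k + 2)} (hy : inclInf (k + 2) y = x) (v : T.obj k) :
    T.act x (T.toLim k v) = T.toLim k (toU y • v) := by
  rw [act, Module.DirectLimit.lift_of, T.preAct_eq le_rfl hy, T.trans_self]

lemma exists_common (x y : slInf) (v : T.Lim) : ∃ (k : ℕ) (x' y' : slFin (k + 2)) (w : T.obj k),
    inclInf (k + 2) x' = x ∧ inclInf (k + 2) y' = y ∧ T.toLim k w = v := by
  obtain ⟨n, hn⟩ := exists_inclInf_eq x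
  obtain ⟨m, hm⟩ := exists_inclInf_eq y
  obtain ⟨N, hN⟩ := T.exists_toLim v
  obtain ⟨x', hx⟩ := hn (max (max n m) N + 2) (by omega)
  obtain ⟨y', hy⟩ := hm (max (max n m) N + 2) (by omega)
  obtain ⟨w, hw⟩ := hN (max (max n m) N) (le_max_right _ _)
  exact ⟨_, x', y', w, hx, hy, hw⟩

/-- The action of `sl_∞` on the direct limit. -/
def rho : slInf →ₗ⁅ℂ⁆ Module.End ℂ T.Lim where
  toFun := T.act
  map_add' x y := LinearMap.ext fun v => by
    obtain ⟨k, x', y', w, rfl, rfl, rfl⟩ := T.exists_common x y v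
    rw [LinearMap.add_apply, T.act_toLim rfl, T.act_toLim rfl, T.act_toLim (map_add _ x' y'), toU,
      map_add, add_smul, map_add]
  map_smul' c x := LinearMap.ext fun v => by
    obtain ⟨k, x', -, w, rfl, -, rfl⟩ := T.exists_common x x v
    have h1 : (toU (c • x') : U (slFin (k + 2))) = c • toU x' :=
      map_smul (UniversalEnvelopingAlgebra.ι ℂ) c x'
    rw [LinearMap.smul_apply, T.act_toLim rfl, T.act_toLim (map_smul _ c x'), h1, smul_assoc, map_smul]
    rfl
  map_lie' {x y} := LinearMap.ext fun v => by
    obtain ⟨k, x', y', w, rfl, rfl, rfl⟩ := T.exists_common x y v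
    have h1 : (toU ⁅x', y'⁆ : U (slFin (k + 2))) = toU x' * toU y' - toU y' * toU x' :=
      LieHom.map_lie (UniversalEnvelopingAlgebra.ι ℂ) x' y'
    rw [T.act_toLim (LieHom.map_lie _ x' y'), h1, sub_smul, mul_smul, mul_smul, map_sub]
    change _ = T.act (inclInf (k + 2) x') (T.act (inclInf (k + 2) y') (T.toLim k w)) -
      T.act (inclInf (k + 2) y') (T.act (inclInf (k + 2) x') (T.toLim k w))
    rw [T.act_toLim rfl, T.act_toLim rfl, T.act_toLim rfl, T.act_toLim rfl]

/-- The direct limit of a tower. -/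
def lim : Rep.{u} slInf := repOf T.rho

/-- The maps to the direct limit. -/
def incl (k : ℕ) : T.obj k →ₗ[ℂ] T.lim :=
  show T.obj k →ₗ[ℂ] repOf T.rho from toRepOf T.rho ∘ₗ T.toLim k

lemma incl_apply (k : ℕ) (v : T.obj k) : T.incl k v = toRepOf T.rho (T.toLim k v) := rfl

lemma incl_toU {k : ℕ} (x : slFin (k + 2)) (v : T.obj k) :
    T.incl k (toU x • v) = toU (inclInf (k + 2) x) • T.incl k v := by
  rw [incl_apply, incl_apply, ← T.act_toLim rfl]
  exact (toU_toRepOf T.rho (inclInf (k + 2) x) (T.toLim k v)).symm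

lemma incl_succ (k : ℕ) (v : T.obj k) : T.incl (k + 1) (T.map k v) = T.incl k v := by
  have h := T.trans_succ (le_refl k) v
  rw [T.trans_self] at h
  rw [incl_apply, incl_apply, ← h, T.toLim_trans]

lemma exists_incl (v : T.lim) : ∃ N, ∀ k ≥ N, ∃ w, T.incl k w = v := by
  obtain ⟨v, rfl⟩ := (toRepOf_bijective T.rho).2 v
  obtain ⟨N, hN⟩ := T.exists_toLim v
  refine ⟨N, fun k hk => ?_⟩
  obtain ⟨w, rfl⟩ := hN k hk
  exact ⟨w, rfl⟩

lemma incl_injective (h : ∀ k, Function.Injective (T.map k)) (k : ℕ) :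
    Function.Injective (T.incl k) := by
  have htr {l : ℕ} (hl : k ≤ l) : Function.Injective (T.trans hl) := by
    induction l, hl using Nat.le_induction with
    | base => exact fun v w hvw => by rwa [trans_self, trans_self] at hvw
    | succ l hl ih => exact fun v w hvw => ih (h l (by rwa [trans_succ, trans_succ] at hvw))
  intro v w hvw
  obtain ⟨l, hl, hvw⟩ := Module.DirectLimit.exists_eq_of_of_eq ((toRepOf_bijective T.rho).1 hvw)
  exact htr hl hvw

end Tower

end DirectLimits

/-! ### Essential surjectivity -/

section EssentialSurjectivity

open scoped ModuleCat

/-- An isomorphism in an inverse limit of categories. -/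
def InverseLimit.isoMk {D : ℕ → Type w} [∀ k, Category.{v} (D k)] {F : ∀ k, D (k + 1) ⥤ D k}
    {X Y : InverseLimit F} (e : ∀ k, X.obj k ≅ Y.obj k)
    (h : ∀ k, (F k).map (e (k + 1)).hom ≫ (Y.iso k).hom = (X.iso k).hom ≫ (e k).hom) : X ≅ Y where
  hom := InverseLimit.Hom.mk (fun k => (e k).hom) h
  inv := InverseLimit.Hom.mk (fun k => (e k).inv) fun k => by
    rw [Iso.eq_comp_inv, Category.assoc, ← h, ← Category.assoc, ← Functor.map_comp,
      Iso.inv_hom_id, (F k).map_id, Category.id_comp]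
  hom_inv_id := InverseLimit.Hom.ext (funext fun k => (e k).hom_inv_id)
  inv_hom_id := InverseLimit.Hom.ext (funext fun k => (e k).inv_hom_id)

lemma catO₀_of_iso {n : ℕ} {M N : Rep.{u} (slFin n)} (e : M ≅ N) (h : catO₀ n M) : catO₀ n N := by
  refine ⟨(blockData_catO n).of_surjective e.hom
    (fun y => ⟨e.inv.hom y, by rw [← ModuleCat.comp_apply, e.inv_hom_id]; rfl⟩) h.1, fun A B hAB hA => ?_⟩
  have := hAB.left_iso
  exact A.prop_of_iso e (h.2 A B hAB hA)

lemma elt_truncVal_mem_weightSpace {n : ℕ} {N : Rep.{u} (slFin (n + 1))}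
    {χ : Module.Dual ℂ (cartan n)} {y : (trunc n).obj N}
    (hy : y ∈ weightSpace (cartan n) ((trunc n).obj N) χ) :
    (finStep n).elt (truncVal_mem y) ∈ weightSpace (cartan n) ((finStep n).obj N) χ := by
  intro h
  apply (finStep n).val_injective
  have h2 := truncVal_toU (h : slFin n) y
  rw [hy h, map_smul] at h2
  have h3 := (finStep n).val_toU (h : slFin n) ((finStep n).elt (truncVal_mem y))
  rw [Level.val_elt] at h3
  rw [h3, map_smul, Level.val_elt]
  exact h2.symm

lemma truncVal_mem_weightSpace {n : ℕ} {N : Rep.{u} (slFin (n + 1))} {a : ℕ →₀ ℤ}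
    (ha : ∀ i, n ≤ i → a i = 0) (ht : tot a = 0) {y : (trunc n).obj N}
    (hy : y ∈ weightSpace (cartan n) ((trunc n).obj N) ((slFinData n).wt a)) :
    truncVal n N y ∈ weightSpace (cartan (n + 1)) N ((slFinData (n + 1)).wt a) := by
  have h := ((finStep n).val_mem_weightSpace ha ht).mpr (elt_truncVal_mem_weightSpace hy)
  rwa [Level.val_elt] at h

/-- The tower of an object of the inverse limit. -/
abbrev tower (X : LimRep.{u}) : Tower.{u} where
  obj := X.obj
  map k := truncVal (k + 2) (X.obj (k + 1)) ∘ₗ (X.iso k).inv.hom.restrictScalars ℂ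
  map_toU k x v := by
    rw [LinearMap.comp_apply, LinearMap.comp_apply, ← truncVal_toU]
    exact congrArg _ (map_smul (X.iso k).inv.hom _ _)

variable (X : LimRep.{u})

lemma tower_map (k : ℕ) (v : X.obj k) :
    (tower X).map k v = truncVal (k + 2) (X.obj (k + 1)) ((X.iso k).inv.hom v) := rfl

lemma tower_map_iso (k : ℕ) (y : (trunc (k + 2)).obj (X.obj (k + 1))) :
    (tower X).map k ((X.iso k).hom.hom y) = truncVal (k + 2) (X.obj (k + 1)) y := by
  rw [tower_map, ← ModuleCat.comp_apply, Iso.hom_inv_id]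
  rfl

lemma tower_map_injective (k : ℕ) : Function.Injective ((tower X).map k) := fun _ _ h =>
  (X.iso k).symm.toLinearEquiv.injective (truncVal_injective _ h)

lemma tower_map_mem_weightSpace {k : ℕ} {a : ℕ →₀ ℤ} (ha : ∀ i, k + 2 ≤ i → a i = 0) (ht : tot a = 0)
    {v : X.obj k} (hv : v ∈ weightSpace (cartan (k + 2)) (X.obj k) ((slFinData (k + 2)).wt a)) :
    (tower X).map k v ∈ weightSpace (cartan (k + 3)) (X.obj (k + 1)) ((slFinData (k + 3)).wt a) :=
  truncVal_mem_weightSpace ha ht (map_mem_weightSpace (X.iso k).inv hv)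

lemma exists_tower_map {k : ℕ} {v : X.obj (k + 1)} (hv : v ∈ (finStep (k + 2)).space (X.obj (k + 1))) :
    ∃ w, (tower X).map k w = v := by
  obtain ⟨y, rfl⟩ := exists_truncVal hv
  exact ⟨_, tower_map_iso X k y⟩

lemma tower_trans_mem_weightSpace {k l : ℕ} (h : k ≤ l) {a : ℕ →₀ ℤ}
    (ha : ∀ i, k + 2 ≤ i → a i = 0) (ht : tot a = 0) {v : X.obj k}
    (hv : v ∈ weightSpace (cartan (k + 2)) (X.obj k) ((slFinData (k + 2)).wt a)) :
    (tower X).trans h v ∈ weightSpace (cartan (l + 2)) (X.obj l) ((slFinData (l + 2)).wt a) := by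
  induction l, h using Nat.le_induction with
  | base => rwa [Tower.trans_self]
  | succ l h ih =>
    rw [Tower.trans_succ _ h]
    exact tower_map_mem_weightSpace X (fun i hi => ha i (by omega)) ht ih

lemma wt_inclInf {n : ℕ} (a : ℕ →₀ ℤ) (y : cartan n) {h : slInfData.H}
    (hy : inclInf n (y : slFin n) = h) : (slFinData n).wt a y = slInfData.wt a h := by
  rw [← (infLevel n).pull_wt]
  exact congrArg (slInfData.wt a) (Subtype.ext hy)

/-- For a given diagonal element of `sl_∞` the vector is moved up to a level containing it. The
transition maps preserve weights with support below `k + 2`, since these lie in all later root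
lattices. -/
lemma incl_mem_weightSpace_iff {k : ℕ} {a : ℕ →₀ ℤ} (ha : ∀ i, k + 2 ≤ i → a i = 0)
    (ht : tot a = 0) {v : X.obj k} :
    (tower X).incl k v ∈ weightSpace slInfData.H (tower X).lim (slInfData.wt a) ↔
      v ∈ weightSpace (cartan (k + 2)) (X.obj k) ((slFinData (k + 2)).wt a) := by
  constructor
  · intro hv y
    apply (tower X).incl_injective (tower_map_injective X) k
    refine ((tower X).incl_toU (y : slFin (k + 2)) v).trans
      ((hv ⟨_, inclInf_mem_cartanInf y.2⟩).trans ?_)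
    rw [← wt_inclInf a y (h := ⟨_, inclInf_mem_cartanInf y.2⟩) rfl]
    exact (map_smul ((tower X).incl k) _ v).symm
  · intro hv h
    obtain ⟨n, hn⟩ := exists_inclInf_eq h
    obtain ⟨y, hy⟩ := hn (max k n + 2) (by omega)
    have hyc : y ∈ cartan (max k n + 2) := fun i j hij => by
      rw [← inclInf_entry, hy]
      exact h.2 i j fun hij' => hij (Fin.ext hij')
    have hw := tower_trans_mem_weightSpace X (le_max_left k n) ha ht hv ⟨y, hyc⟩
    have h1 : (tower X).incl k v = (tower X).incl (max k n) ((tower X).trans (le_max_left k n) v) := by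
      rw [Tower.incl_apply, Tower.incl_apply, Tower.toLim_trans]
    have h2 := (tower X).incl_toU y ((tower X).trans (le_max_left k n) v)
    rw [hy] at h2
    rw [h1, ← h2]
    refine (congrArg ((tower X).incl (max k n)) hw).trans ?_
    exact (map_smul ((tower X).incl (max k n)) _ _).trans
      (congrArg (fun c : ℂ => c • (tower X).incl (max k n) _) (wt_inclInf a ⟨y, hyc⟩ hy))

variable {X}

lemma incl_mem_space (hX : catC X) (k : ℕ) (v : X.obj k) :
    (tower X).incl k v ∈ (infLevel (k + 2)).space (tower X).lim := by
  have hle : (slFinData (k + 2)).partOf (X.obj k) (slFinData (k + 2)).negWt ≤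
      ((infLevel (k + 2)).space (tower X).lim).comap ((tower X).incl k) := by
    refine iSup₂_le fun χ hχ z hz => ?_
    obtain ⟨a, ha, ht, -, rfl⟩ := hχ
    exact (infLevel (k + 2)).weightSpace_le_space ⟨a, fin_out_iff.mp ha, ht, rfl⟩
      ((incl_mem_weightSpace_iff X (fin_out_iff.mp ha) ht).mpr hz)
  have hv : v ∈ (slFinData (k + 2)).partOf (X.obj k) (slFinData (k + 2)).negWt := by
    rw [partOf_of_catO₀ (hX k)]
    trivial
  exact hle hv

/-- Descent by one level at a time: a vector of level `l + 1` whose weight lies in the smaller root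
lattice belongs to the truncation of that member, which is the member of level `l`. -/
lemma exists_incl_of_weight {k : ℕ} {a : ℕ →₀ ℤ} (ha : ∀ i, k + 2 ≤ i → a i = 0) (ht : tot a = 0)
    {v : (tower X).lim} (hv : v ∈ weightSpace slInfData.H (tower X).lim (slInfData.wt a)) {l : ℕ}
    (h : k ≤ l) (hl : ∃ w, (tower X).incl l w = v) : ∃ w, (tower X).incl k w = v := by
  induction l, h using Nat.le_induction with
  | base => exact hl
  | succ l h ih =>
    obtain ⟨w, rfl⟩ := hl
    have hw := (incl_mem_weightSpace_iff X (fun i hi => ha i (by omega)) ht).mp hv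
    obtain ⟨w', hw'⟩ := exists_tower_map X
      ((finStep (l + 2)).weightSpace_le_space ⟨a, fun i hi => ha i (by omega), ht, rfl⟩ hw)
    exact ih ⟨w', ((tower X).incl_succ l w').symm.trans (congrArg ((tower X).incl (l + 1)) hw')⟩

lemma exists_incl_of_mem_space {k : ℕ} {v : (tower X).lim}
    (hv : v ∈ (infLevel (k + 2)).space (tower X).lim) : ∃ w, (tower X).incl k w = v :=
  (infLevel (k + 2)).space_induction (V := LinearMap.range ((tower X).incl k)) (fun a ha ht v hv => by
    obtain ⟨N, hN⟩ := (tower X).exists_incl v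
    exact exists_incl_of_weight ha ht hv (le_max_left k N) (hN _ (le_max_right k N))) hv

/-- The members of the tower are the truncations of its direct limit. -/
def limHom (hX : catC X) (k : ℕ) : X.obj k ⟶ (infLevel (k + 2)).obj (tower X).lim :=
  (infLevel (k + 2)).lift ((tower X).incl k) (incl_mem_space hX k) fun x y => (tower X).incl_toU x y

lemma val_limHom (hX : catC X) (k : ℕ) (v : X.obj k) :
    (infLevel (k + 2)).val _ ((limHom hX k).hom v) = (tower X).incl k v :=
  Level.val_lift (infLevel (k + 2)) _ _ _ v

lemma limHom_bijective (hX : catC X) (k : ℕ) : Function.Bijective (limHom hX k).hom := by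
  constructor
  · intro v w h
    have := congrArg ((infLevel (k + 2)).val _) h
    rw [val_limHom, val_limHom] at this
    exact (tower X).incl_injective (tower_map_injective X) k this
  · intro y
    obtain ⟨w, hw⟩ := exists_incl_of_mem_space ((infLevel (k + 2)).val_mem y)
    refine ⟨w, (infLevel (k + 2)).val_injective ?_⟩
    rw [val_limHom, hw]

lemma limHom_comm (hX : catC X) (k : ℕ) :
    (trunc (k + 2)).map (limHom hX (k + 1)) ≫ truncHom (tower X).lim (k + 2) =
      (X.iso k).hom ≫ limHom hX k := by
  apply ModuleCat.hom_ext
  ext y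
  apply (infLevel (k + 2)).val_injective
  rw [ModuleCat.comp_apply, ModuleCat.comp_apply, val_limHom, val_truncHom, truncVal_map]
  refine (val_limHom hX (k + 1) _).trans ?_
  rw [← tower_map_iso X k y]
  exact (tower X).incl_succ k _

/-- An object of the inverse limit of the principal blocks consists of the truncations of the
direct limit of its tower. -/
def limIso (hX : catC X) : X ≅ truncations (tower X).lim :=
  InverseLimit.isoMk (fun k => isoOfBijective (limHom hX k) (limHom_bijective hX k)) fun k => by
    change _ ≫ (truncIso (tower X).lim (k + 2)).hom = _
    rw [truncIso_hom]
    exact limHom_comm hX k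

/-- The direct limit is the union of its truncations, and these are the given modules, so
`catOInf₀_of_obj` applies with the given bound on the lengths. -/
lemma catOInf₀_lim (hX : catCRes X) : catOInf₀ (tower X).lim := by
  obtain ⟨hC, l, N, hl⟩ := hX
  refine catOInf₀_of_obj (l := l) (N := N + 2) (fun v => ?_) (fun n hn => ?_) fun n hn => ?_
  · obtain ⟨k, hk⟩ := (tower X).exists_incl v
    obtain ⟨w, rfl⟩ := hk k le_rfl
    exact ⟨k + 2, incl_mem_space hC k w⟩
  · obtain ⟨k, rfl⟩ : ∃ k, n = k + 2 := ⟨n - 2, by omega⟩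
    exact catO₀_of_iso (isoOfBijective (limHom hC k) (limHom_bijective hC k)) (hC k)
  · obtain ⟨k, rfl⟩ : ∃ k, n = k + 2 := ⟨n - 2, by omega⟩
    rw [← hl k (by omega)]
    exact (LinearEquiv.ofBijective (limHom hC k).hom (limHom_bijective hC k)).length_eq.symm

instance : truncationFunctor.{u}.EssSurj where
  mem_essImage X := ⟨⟨_, catOInf₀_lim X.property⟩,
    ⟨ObjectProperty.isoMk _ (limIso X.property.1).symm⟩⟩

instance : truncationFunctor.{u}.IsEquivalence where

end EssentialSurjectivity

end SlInfty

end

/-- The restricted limit of the principal blocks of category `𝒪` for `sl_2, sl_3, …` is equivalent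
to the principal block of the category of finite length weight `sl_∞`-modules with simple highest
weight subquotients. -/
theorem theorem4p4 :
    Nonempty (SlInfty.catCRes.{u}.FullSubcategory ≌ SlInfty.catOInf₀.{u}.FullSubcategory) := by
  exact ⟨SlInfty.truncationFunctor.asEquivalence.symm⟩
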